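/- Let $n\ge 1$, $1<p<\infty$, $0<\lambda<n$, and let $f\colon\mathbb R^n\to\mathbb C$ belong to the class $$\mathcal M_{\sqrt\Delta,p}=\Big\{f\in L^p_{\rm loc}(\mathbb R^n):\ \int_{\mathbb R^n}\frac{|f(x)|^p}{1+|x|^{n+1}}\,dx<\infty\Big\}.$$ For $t>0$ let $$e^{-t\sqrt\Delta}f(x)=\int_{\mathbb R^n}\frac{c_n\,t}{(t^2+|x-y|^2)^{(n+1)/2}}\,f(y)\,dy,\qquad c_n=\frac{\Gamma(\frac{n+1}2)}{\pi^{(n+1)/2}},$$ be the Poisson integral of $f$. For an open ball $B\subset\mathbb R^n$ write $r_B$ for its radius and $f_B=|B|^{-1}\int_B f(x)\,dx$ for the mean value of $f$ over $B$. Then the following two conditions are equivalent: (i) $f$ belongs to the Morrey space $L^{p,\lambda}(\mathbb R^n)$, that is, $f\in L^p_{\rm loc}(\mathbb R^n)$ and $$\sup_{B}\Big[r_B^{-\lambda}\int_B|f(x)-f_B|^p\,dx\Big]^{1/p}<\infty;$$ (ii) $$\sup_{B}\ r_B^{-\lambda/p}\,\Big\|\Big(\int_0^{r_B}\Big|t\frac{\partial}{\partial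 t}e^{-t\sqrt\Delta}f(x)\Big|^2\frac{dt}{t}\Big)^{1/2}\Big\|_{L^p(B)}<\infty.$$ Both suprema are taken over all Euclidean open balls $B\subset\mathbb R^n$. -/

import Mathlib

open MeasureTheory Set

open scoped ENNReal

noncomputable section

namespace MorreyLP

/-- `f ∈ L^p_loc(ℝⁿ)`: `f` is in `L^p` of every compact set. -/
def IsLpLoc {n : ℕ} (p : ℝ) (f : EuclideanSpace ℝ (Fin n) → ℂ) : Prop :=
  ∀ K : Set (EuclideanSpace ℝ (Fin n)), IsCompact K →
    MemLp f (ENNReal.ofReal p) (volume.restrict K)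

/-- The class `M_{√Δ,p}`: the `f ∈ L^p_loc(ℝⁿ)` with `|f(x)|^p (1 + |x|^{n+1})⁻¹ ∈ L¹(ℝⁿ)`. -/
def PoissonClass {n : ℕ} (p : ℝ) (f : EuclideanSpace ℝ (Fin n) → ℂ) : Prop :=
  IsLpLoc p f ∧
    Integrable (fun x : EuclideanSpace ℝ (Fin n) => ‖f x‖ ^ p * (1 + ‖x‖ ^ (n + 1))⁻¹) volume

/-- The Morrey seminorm
`sup_B [ r_B^{-λ} ∫_B |f(x) - f_B|^p dx ]^{1/p}`, with values in `[0,∞]`; the supremum is over all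
open balls `B`, and `f_B` is the mean value of `f` over `B`. -/
def morreySeminorm {n : ℕ} (p lam : ℝ) (f : EuclideanSpace ℝ (Fin n) → ℂ) : ℝ≥0∞ :=
  ⨆ (x₀ : EuclideanSpace ℝ (Fin n)) (r : ℝ) (_ : 0 < r),
    (ENNReal.ofReal (r ^ (-lam)) *
      ∫⁻ x in Metric.ball x₀ r, ‖f x - ⨍ y in Metric.ball x₀ r, f y‖ₑ ^ p) ^ (1 / p)

/-- The Morrey space `L^{p,λ}(ℝⁿ)`. -/
def InMorrey {n : ℕ} (p lam : ℝ) (f : EuclideanSpace ℝ (Fin n) → ℂ) : Prop :=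
  IsLpLoc p f ∧ morreySeminorm p lam f < ∞

/-- The Poisson kernel of the upper half space,
`p_t(x) = c_n t / (t² + |x|²)^{(n+1)/2}` with `c_n = Γ((n+1)/2) / π^{(n+1)/2}`. -/
def poissonKernel {n : ℕ} (t : ℝ) (x : EuclideanSpace ℝ (Fin n)) : ℝ :=
  Real.Gamma (((n : ℝ) + 1) / 2) / Real.pi ^ (((n : ℝ) + 1) / 2) * t /
    (t ^ 2 + ‖x‖ ^ 2) ^ (((n : ℝ) + 1) / 2)

/-- The Poisson semigroup `e^{-t√Δ} f(x) = ∫ p_t(x - y) f(y) dy`. -/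
def poissonSemigroup {n : ℕ} (t : ℝ) (f : EuclideanSpace ℝ (Fin n) → ℂ)
    (x : EuclideanSpace ℝ (Fin n)) : ℂ :=
  ∫ y, (poissonKernel t (x - y) : ℂ) * f y

/-- The truncated Littlewood-Paley function
`( ∫_0^r |t ∂_t e^{-t√Δ} f(x)|² dt/t )^{1/2}`, with values in `[0,∞]`. -/
def squareFunction {n : ℕ} (f : EuclideanSpace ℝ (Fin n) → ℂ) (r : ℝ)
    (x : EuclideanSpace ℝ (Fin n)) : ℝ≥0∞ :=
  (∫⁻ t in Ioo (0 : ℝ) r,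
    ‖(t : ℂ) * deriv (fun s : ℝ => poissonSemigroup s f x) t‖ₑ ^ 2 / ENNReal.ofReal t)
      ^ (1 / 2 : ℝ)

/-- `I(f,p) = sup_B r_B^{-λ/p} ‖ ( ∫_0^{r_B} |t ∂_t e^{-t√Δ} f|² dt/t )^{1/2} ‖_{L^p(B)}`, with
values in `[0,∞]`; the supremum is over all open balls `B`. -/
def littlewoodPaleyMorrey {n : ℕ} (p lam : ℝ) (f : EuclideanSpace ℝ (Fin n) → ℂ) : ℝ≥0∞ :=
  ⨆ (x₀ : EuclideanSpace ℝ (Fin n)) (r : ℝ) (_ : 0 < r),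
    ENNReal.ofReal (r ^ (-(lam / p))) *
      eLpNorm (squareFunction f r) (ENNReal.ofReal p) (volume.restrict (Metric.ball x₀ r))

end MorreyLP

end

/-!
After removal of the normalising constant, the objects are the kernel `kern t x`, the extensions
`u(t, x) = kext (kern t) f x`, which are harmonic in the upper half space, and the square
`gsq S f x = ∫_S t |∂ₜu(t, x)|² dt` of the vertical square function. Membership of `f` in the
Poisson class enters only through `WInt f`, the integrability of `f` against the kernel, and
through local `L^p` integrability.

Both implications rest on the boundedness of the vertical square function on `L^p`, `1 < p < ∞`
(`exists_lintegral_gsq_rpow_le`). It reduces to nonnegative `f`, where `u > 0`, and is then proved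
by Green's formula for powers of positive harmonic functions (`integral_lapMon_le`) with the
Hardy-Littlewood maximal function `M f` as a majorant of `u`.
* For `p ≤ 2`, the identity `Δ(u^p) = p (p - 1) u^{p-2} |∇u|²` bounds `t |∂ₜu|²` by
  `(M f)^{2-p} t Δ(u^p)`, and the integral of `t Δ(u^p)` over the half space is controlled by that
  of `(M f)^p` (`lintegral_gsq_rpow_le_of_le_two`).
* For `p > 2`, the square function is tested against a weight `h`. The semigroup law moves the
  Poisson kernel onto `h`, and the extension of `h` is at most a multiple of `v²`, where `v` is
  the extension of `(M h)^{1/2}` (`lext_le_sq`). The function `u² v² + A u^p + B v^r` with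
  `2 / p + 2 / r = 1` has a Laplacian at least `v² |∂ₜu|²` (`sq_mul_sq_le_hess`), so Green's
  formula applies again. The weight is a small multiple of a power of the square function itself,
  and its contribution is absorbed (`lintegral_gsq_rpow_le_of_two_lt`).

The oscillation condition implies the square function condition (`OscBound.squareBound`): since
`∂ₜ` annihilates constants, the mean of `f` over the ball `B(x₀, 2r)` may be subtracted. The part
of `f` inside that ball is handled by the bound on `L^p`. For the part outside, the means of
`|f - c|` over dyadic balls grow at most linearly in the number of doublings
(`OscBound.avgE_dyadic_le`), because `λ < n`, and the kernel decays geometrically.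

Conversely, let `g` have mean zero and be supported in `B(x₀, r)`. Twofold integration by parts in
the height gives the reproducing formula `∫ f g = c ∫∫ t ∂ₜ(ext f) ∂ₜ(ext g) dx dt`, here in the
form of an estimate (`MeanZeroIn.enorm_integral_mul_le`). The half space is split into the box of
size `2r` over the ball and dyadic boxes. On the first, Hölder's inequality applies, with the
square function condition for `f` and the bound on `L^q` for `g`; on the others the mean zero of
`g` improves the decay of its extension by one power, and the sum converges because `λ < n`
(`SquareBound.exists_pairing_le`). The choice of `g` as the dual function of `f - f_B`, corrected
to have mean zero, bounds the oscillation (`SquareBound.oscBound`).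
-/

noncomputable section

namespace MorreyLP

open Filter Topology

/-- Euclidean `n`-space. -/
abbrev Sp (n : ℕ) := EuclideanSpace ℝ (Fin n)

/-! ### The Poisson kernel and its derivatives -/

/-- The Poisson kernel `t (t² + |x|²)^{-(n+1)/2}` without its normalising constant. -/
def kern {n : ℕ} (t : ℝ) (x : Sp n) : ℝ := t * (t ^ 2 + ‖x‖ ^ 2) ^ (-(((n : ℝ) + 1) / 2))

/-- The derivative `∂_t` of `kern`. -/
def kernT {n : ℕ} (t : ℝ) (x : Sp n) : ℝ :=
  (t ^ 2 + ‖x‖ ^ 2) ^ (-(((n : ℝ) + 1) / 2)) -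
    (n + 1) * t ^ 2 * (t ^ 2 + ‖x‖ ^ 2) ^ (-(((n : ℝ) + 1) / 2) - 1)

/-- The second derivative `∂_t²` of `kern`. -/
def kernTT {n : ℕ} (t : ℝ) (x : Sp n) : ℝ :=
  -(3 * (n + 1)) * t * (t ^ 2 + ‖x‖ ^ 2) ^ (-(((n : ℝ) + 1) / 2) - 1) +
    (n + 1) * (n + 3) * t ^ 3 * (t ^ 2 + ‖x‖ ^ 2) ^ (-(((n : ℝ) + 1) / 2) - 2)

/-- The derivative `∂_i` of `kern t`. -/
def kernX {n : ℕ} (i : Fin n) (t : ℝ) (x : Sp n) : ℝ :=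
  -(n + 1) * t * x i * (t ^ 2 + ‖x‖ ^ 2) ^ (-(((n : ℝ) + 1) / 2) - 1)

/-- The second derivative `∂_i²` of `kern t`. -/
def kernXX {n : ℕ} (i : Fin n) (t : ℝ) (x : Sp n) : ℝ :=
  -(n + 1) * t * (t ^ 2 + ‖x‖ ^ 2) ^ (-(((n : ℝ) + 1) / 2) - 1) +
    (n + 1) * (n + 3) * t * x i ^ 2 * (t ^ 2 + ‖x‖ ^ 2) ^ (-(((n : ℝ) + 1) / 2) - 2)

section Kernel

variable {n : ℕ}

theorem sq_add_norm_sq_pos {t : ℝ} (ht : 0 < t) (x : Sp n) : 0 < t ^ 2 + ‖x‖ ^ 2 := by positivity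

theorem kern_pos {t : ℝ} (ht : 0 < t) (x : Sp n) : 0 < kern t x := by
  unfold kern
  have := sq_add_norm_sq_pos ht x
  positivity

theorem rpow_sub_one_eq {ρ : ℝ} (h : 0 < ρ) (a : ℝ) : ρ ^ (a - 1) = ρ ^ a / ρ := by
  rw [Real.rpow_sub h, Real.rpow_one]

theorem rpow_sub_two_eq {ρ : ℝ} (h : 0 < ρ) (a : ℝ) : ρ ^ (a - 2) = ρ ^ a / ρ ^ 2 := by
  rw [Real.rpow_sub h, Real.rpow_two]

theorem kern_neg (t : ℝ) (x : Sp n) : kern t (-x) = kern t x := by simp [kern]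

theorem kernT_neg (t : ℝ) (x : Sp n) : kernT t (-x) = kernT t x := by simp [kernT]

theorem hasDerivAt_kern {t : ℝ} (ht : 0 < t) (x : Sp n) :
    HasDerivAt (fun s => kern s x) (kernT t x) t := by
  have hρ := sq_add_norm_sq_pos ht x
  have h1 : HasDerivAt (fun s : ℝ => s ^ 2 + ‖x‖ ^ 2) (2 * t) t := by
    simpa using ((hasDerivAt_id t).pow 2).add_const (‖x‖ ^ 2)
  have h2 := h1.rpow_const (p := -(((n : ℝ) + 1) / 2)) (Or.inl hρ.ne')
  refine ((hasDerivAt_id t).mul h2).congr_deriv ?_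
  simp only [kernT, id]
  ring

theorem hasDerivAt_kernT {t : ℝ} (ht : 0 < t) (x : Sp n) :
    HasDerivAt (fun s => kernT s x) (kernTT t x) t := by
  have hρ := sq_add_norm_sq_pos ht x
  have h1 : HasDerivAt (fun s : ℝ => s ^ 2 + ‖x‖ ^ 2) (2 * t) t := by
    simpa using ((hasDerivAt_id t).pow 2).add_const (‖x‖ ^ 2)
  have h2 := h1.rpow_const (p := -(((n : ℝ) + 1) / 2)) (Or.inl hρ.ne')
  have h3 := h1.rpow_const (p := -(((n : ℝ) + 1) / 2) - 1) (Or.inl hρ.ne')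
  have h4 := ((hasDerivAt_id t).pow 2).const_mul ((n : ℝ) + 1)
  refine (h2.sub (h4.mul h3)).congr_deriv ?_
  rw [show (-(((n : ℝ) + 1) / 2) - 1 - 1) = -(((n : ℝ) + 1) / 2) - 2 by ring]
  simp only [kernTT, id, Pi.pow_apply]
  push_cast
  ring

/-- The `i`-th standard basis vector. -/
abbrev basisVec (i : Fin n) : Sp n := EuclideanSpace.single i (1 : ℝ)

theorem hasDerivAt_coord (i : Fin n) (x : Sp n) (h : ℝ) :
    HasDerivAt (fun s : ℝ => (x + s • basisVec i) i) 1 h := by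
  simpa using (hasDerivAt_id h).const_add (x i)

theorem hasDerivAt_norm_sq_line (i : Fin n) (x : Sp n) (h : ℝ) :
    HasDerivAt (fun s : ℝ => ‖x + s • basisVec i‖ ^ 2) (2 * (x + h • basisVec i) i) h := by
  have h1 : HasDerivAt (fun s : ℝ => x + s • basisVec i) (basisVec i) h := by
    simpa using ((hasDerivAt_id h).smul_const (basisVec i)).const_add x
  have h2 := h1.norm_sq
  refine h2.congr_deriv ?_
  rw [EuclideanSpace.inner_single_right]
  simp

theorem hasDerivAt_kern_line {t : ℝ} (ht : 0 < t) (i : Fin n) (x : Sp n) (h : ℝ) :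
    HasDerivAt (fun s : ℝ => kern t (x + s • basisVec i)) (kernX i t (x + h • basisVec i)) h := by
  have hρ := sq_add_norm_sq_pos ht (x + h • basisVec i)
  have h1 := (hasDerivAt_norm_sq_line i x h).const_add (t ^ 2)
  have h2 := (h1.rpow_const (p := -(((n : ℝ) + 1) / 2)) (Or.inl hρ.ne')).const_mul t
  refine h2.congr_deriv ?_
  simp only [kernX]
  ring

theorem hasDerivAt_kernX_line {t : ℝ} (ht : 0 < t) (i : Fin n) (x : Sp n) (h : ℝ) :
    HasDerivAt (fun s : ℝ => kernX i t (x + s • basisVec i))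
      (kernXX i t (x + h • basisVec i)) h := by
  have hρ := sq_add_norm_sq_pos ht (x + h • basisVec i)
  have h1 := (hasDerivAt_norm_sq_line i x h).const_add (t ^ 2)
  have h2 := h1.rpow_const (p := -(((n : ℝ) + 1) / 2) - 1) (Or.inl hρ.ne')
  have h3 := (hasDerivAt_coord i x h).const_mul (-((n : ℝ) + 1) * t)
  refine (h3.mul h2).congr_deriv ?_
  rw [show (-(((n : ℝ) + 1) / 2) - 1 - 1) = -(((n : ℝ) + 1) / 2) - 2 by ring]
  simp only [kernXX]
  ring

/-- The kernel is harmonic in the upper half space. -/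
theorem kernTT_add_sum_kernXX {t : ℝ} (ht : 0 < t) (x : Sp n) :
    kernTT t x + ∑ i, kernXX i t x = 0 := by
  have hρ := sq_add_norm_sq_pos ht x
  simp only [kernTT, kernXX, Finset.sum_add_distrib, Finset.sum_const, Finset.card_univ,
    Fintype.card_fin, nsmul_eq_mul]
  have h1 : ∑ i, (n + 1) * (n + 3) * t * x i ^ 2 *
      (t ^ 2 + ‖x‖ ^ 2) ^ (-(((n : ℝ) + 1) / 2) - 2) =
      (n + 1) * (n + 3) * t * ‖x‖ ^ 2 * (t ^ 2 + ‖x‖ ^ 2) ^ (-(((n : ℝ) + 1) / 2) - 2) := by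
    rw [EuclideanSpace.real_norm_sq_eq, Finset.mul_sum, Finset.sum_mul]
  rw [h1, rpow_sub_one_eq hρ, rpow_sub_two_eq hρ]
  field_simp
  ring

/-- A constant dominating all the derivative bounds of the kernel. -/
def kernC (n : ℕ) : ℝ := ((n : ℝ) + 6) ^ 2

theorem kernC_pos (n : ℕ) : 0 < kernC n := by unfold kernC; positivity

theorem abs_coord_le (x : Sp n) (i : Fin n) : |x i| ≤ ‖x‖ := by
  simpa using PiLp.norm_apply_le x i

/-- Each derivative of the kernel costs one factor `t⁻¹` and is otherwise dominated by the kernel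
itself; the same holds for `kernTT`, `kernX` and `kernXX` below. -/
theorem abs_kernT_le {t : ℝ} (ht : 0 < t) (x : Sp n) : |kernT t x| ≤ kernC n / t * kern t x := by
  have hρ := sq_add_norm_sq_pos ht x
  have hn : (0 : ℝ) ≤ n := n.cast_nonneg
  simp only [kernT, kern]
  rw [rpow_sub_one_eq hρ]
  set q := (t ^ 2 + ‖x‖ ^ 2) ^ (-(((n : ℝ) + 1) / 2)) with hq
  have hq0 : 0 < q := Real.rpow_pos_of_pos hρ _
  have h1 : q - (n + 1) * t ^ 2 * (q / (t ^ 2 + ‖x‖ ^ 2)) =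
      q * (1 - (n + 1) * (t ^ 2 / (t ^ 2 + ‖x‖ ^ 2))) := by ring
  have h2 : t ^ 2 / (t ^ 2 + ‖x‖ ^ 2) ≤ 1 := by
    rw [div_le_one hρ]; nlinarith [sq_nonneg ‖x‖]
  have h3 : 0 ≤ t ^ 2 / (t ^ 2 + ‖x‖ ^ 2) := by positivity
  have h4 : kernC n / t * (t * q) = q * kernC n := by field_simp
  rw [h1, h4, abs_mul, abs_of_pos hq0]
  gcongr
  unfold kernC
  rw [abs_le]
  constructor <;> nlinarith

theorem abs_kernTT_le {t : ℝ} (ht : 0 < t) (x : Sp n) :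
    |kernTT t x| ≤ kernC n / t ^ 2 * kern t x := by
  have hρ := sq_add_norm_sq_pos ht x
  have hn : (0 : ℝ) ≤ n := n.cast_nonneg
  simp only [kernTT, kern]
  rw [rpow_sub_one_eq hρ, rpow_sub_two_eq hρ]
  set q := (t ^ 2 + ‖x‖ ^ 2) ^ (-(((n : ℝ) + 1) / 2)) with hq
  have hq0 : 0 < q := Real.rpow_pos_of_pos hρ _
  set r := t ^ 2 / (t ^ 2 + ‖x‖ ^ 2) with hr
  have h1 : -(3 * ((n : ℝ) + 1)) * t * (q / (t ^ 2 + ‖x‖ ^ 2)) +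
      (n + 1) * (n + 3) * t ^ 3 * (q / (t ^ 2 + ‖x‖ ^ 2) ^ 2) =
      (q / t) * (-(3 * (n + 1)) * r + (n + 1) * (n + 3) * r ^ 2) := by
    rw [hr]; field_simp
  have h2 : r ≤ 1 := by
    rw [hr, div_le_one hρ]; nlinarith [sq_nonneg ‖x‖]
  have h3 : 0 ≤ r := by positivity
  have h4 : kernC n / t ^ 2 * (t * q) = (q / t) * kernC n := by field_simp
  have hr2 : r ^ 2 ≤ 1 := by nlinarith
  rw [h1, h4, abs_mul, abs_of_pos (by positivity : 0 < q / t)]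
  gcongr
  unfold kernC
  have ha : 0 ≤ (n : ℝ) * r := by positivity
  have hb : (n : ℝ) * r ≤ n := by nlinarith
  have hc : ((n : ℝ) + 1) * (n + 3) * r ^ 2 ≤ (n + 1) * (n + 3) * 1 := by gcongr
  have hd : 0 ≤ ((n : ℝ) + 1) * (n + 3) * r ^ 2 := by positivity
  rw [abs_le]
  constructor <;> nlinarith

theorem abs_kernX_le {t : ℝ} (ht : 0 < t) (i : Fin n) (x : Sp n) :
    |kernX i t x| ≤ kernC n / t * kern t x := by
  have hρ := sq_add_norm_sq_pos ht x
  have hn : (0 : ℝ) ≤ n := n.cast_nonneg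
  simp only [kernX, kern]
  rw [rpow_sub_one_eq hρ]
  set q := (t ^ 2 + ‖x‖ ^ 2) ^ (-(((n : ℝ) + 1) / 2)) with hq
  have hq0 : 0 < q := Real.rpow_pos_of_pos hρ _
  have h1 : -((n : ℝ) + 1) * t * x i * (q / (t ^ 2 + ‖x‖ ^ 2)) =
      q * (-(n + 1) * (t * x i / (t ^ 2 + ‖x‖ ^ 2))) := by ring
  have h2 : |t * x i / (t ^ 2 + ‖x‖ ^ 2)| ≤ 1 := by
    rw [abs_div, abs_mul, abs_of_pos ht, abs_of_pos hρ, div_le_one hρ]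
    nlinarith [abs_coord_le x i, sq_nonneg (t - ‖x‖), norm_nonneg x]
  have h4 : kernC n / t * (t * q) = q * kernC n := by field_simp
  rw [h1, h4, abs_mul, abs_of_pos hq0, abs_mul, abs_neg, abs_of_pos (by positivity : (0:ℝ) < n + 1)]
  gcongr
  unfold kernC
  nlinarith [abs_nonneg (t * x i / (t ^ 2 + ‖x‖ ^ 2))]

theorem abs_kernXX_le {t : ℝ} (ht : 0 < t) (i : Fin n) (x : Sp n) :
    |kernXX i t x| ≤ kernC n / t ^ 2 * kern t x := by
  have hρ := sq_add_norm_sq_pos ht x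
  have hn : (0 : ℝ) ≤ n := n.cast_nonneg
  simp only [kernXX, kern]
  rw [rpow_sub_one_eq hρ, rpow_sub_two_eq hρ]
  set q := (t ^ 2 + ‖x‖ ^ 2) ^ (-(((n : ℝ) + 1) / 2)) with hq
  have hq0 : 0 < q := Real.rpow_pos_of_pos hρ _
  set r := t ^ 2 / (t ^ 2 + ‖x‖ ^ 2) with hr
  set w := x i ^ 2 / (t ^ 2 + ‖x‖ ^ 2) with hw
  have h1 : -((n : ℝ) + 1) * t * (q / (t ^ 2 + ‖x‖ ^ 2)) +
      (n + 1) * (n + 3) * t * x i ^ 2 * (q / (t ^ 2 + ‖x‖ ^ 2) ^ 2) =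
      (q / t) * (-(n + 1) * r + (n + 1) * (n + 3) * (r * w)) := by
    rw [hr, hw]; field_simp
  have h2 : r ≤ 1 := by
    rw [hr, div_le_one hρ]; nlinarith [sq_nonneg ‖x‖]
  have h3 : 0 ≤ r := by positivity
  have h2' : w ≤ 1 := by
    rw [hw, div_le_one hρ]
    nlinarith [abs_coord_le x i, abs_nonneg (x i), sq_abs (x i), sq_nonneg t]
  have h3' : 0 ≤ w := by positivity
  have h4 : kernC n / t ^ 2 * (t * q) = (q / t) * kernC n := by field_simp
  have hr2 : r * w ≤ 1 := by nlinarith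
  rw [h1, h4, abs_mul, abs_of_pos (by positivity : 0 < q / t)]
  gcongr
  unfold kernC
  have ha : 0 ≤ (n : ℝ) * r := by positivity
  have hb : (n : ℝ) * r ≤ n := by nlinarith
  have hc : ((n : ℝ) + 1) * (n + 3) * (r * w) ≤ (n + 1) * (n + 3) * 1 := by gcongr
  have hd : 0 ≤ ((n : ℝ) + 1) * (n + 3) * (r * w) := by positivity
  rw [abs_le]
  constructor <;> nlinarith

/-- Comparison of two values of the kernel from a comparison of `t² + |x|²`. -/
theorem kern_le_of_le {s t C : ℝ} (hs : 0 < s) (ht : 0 < t) (hC : 0 < C) (x y : Sp n)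
    (h : t ^ 2 + ‖y‖ ^ 2 ≤ C * (s ^ 2 + ‖x‖ ^ 2)) :
    kern s x ≤ (s / t * C ^ (((n : ℝ) + 1) / 2)) * kern t y := by
  have h1 := sq_add_norm_sq_pos hs x
  have h2 := sq_add_norm_sq_pos ht y
  simp only [kern]
  have h3 : (C * (s ^ 2 + ‖x‖ ^ 2)) ^ (-(((n : ℝ) + 1) / 2)) ≤
      (t ^ 2 + ‖y‖ ^ 2) ^ (-(((n : ℝ) + 1) / 2)) :=
    Real.rpow_le_rpow_of_nonpos h2 h (by have : (0:ℝ) ≤ n := n.cast_nonneg; linarith)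
  rw [Real.mul_rpow hC.le h1.le, Real.rpow_neg hC.le] at h3
  have hC' : 0 < C ^ (((n : ℝ) + 1) / 2) := by positivity
  rw [inv_mul_le_iff₀ hC'] at h3
  calc s * (s ^ 2 + ‖x‖ ^ 2) ^ (-(((n : ℝ) + 1) / 2))
      ≤ s * (C ^ (((n : ℝ) + 1) / 2) * (t ^ 2 + ‖y‖ ^ 2) ^ (-(((n : ℝ) + 1) / 2))) := by gcongr
    _ = _ := by field_simp

/-- The constant of `kern_harnack`. -/
def harnackC (n : ℕ) : ℝ := 2 * 6 ^ (((n : ℝ) + 1) / 2)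

theorem harnackC_pos (n : ℕ) : 0 < harnackC n := by unfold harnackC; positivity

/-- At comparable heights the values of the kernel are comparable, uniformly in the point. -/
theorem kern_harnack {s t : ℝ} (hs : 0 < s) (ht : 0 < t) (hst : s ≤ 2 * t) (hts : t ≤ 2 * s)
    (x h : Sp n) (hh : ‖h‖ ≤ s) : kern s (x + h) ≤ harnackC n * kern t x := by
  refine (kern_le_of_le hs ht (by norm_num : (0:ℝ) < 6) (x + h) x ?_).trans ?_
  · have h1 : ‖x‖ ≤ ‖x + h‖ + s := by
      calc ‖x‖ = ‖x + h - h‖ := by simp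
        _ ≤ _ := (norm_sub_le _ _).trans (by linarith)
    nlinarith [norm_nonneg x, norm_nonneg (x + h), sq_nonneg (‖x + h‖ - s)]
  · have := kern_pos ht x
    unfold harnackC
    gcongr
    rw [div_le_iff₀ ht]; exact hst

theorem kern_le_inv_pow {t : ℝ} (ht : 0 < t) (x : Sp n) : kern t x ≤ (t ^ n)⁻¹ := by
  unfold kern
  have h3 : (t ^ 2 + ‖x‖ ^ 2) ^ (-(((n : ℝ) + 1) / 2)) ≤ (t ^ 2) ^ (-(((n : ℝ) + 1) / 2)) :=
    Real.rpow_le_rpow_of_nonpos (by positivity) (by nlinarith [sq_nonneg ‖x‖])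
      (by have : (0:ℝ) ≤ n := n.cast_nonneg; linarith)
  have h4 : (t ^ 2) ^ (-(((n : ℝ) + 1) / 2)) = (t ^ (n + 1))⁻¹ := by
    rw [← Real.rpow_natCast t 2, ← Real.rpow_mul ht.le, ← Real.rpow_natCast t (n+1),
      ← Real.rpow_neg ht.le]
    congr 1; push_cast; ring
  rw [h4] at h3
  calc _ ≤ t * (t ^ (n + 1))⁻¹ := by gcongr
    _ = _ := by rw [pow_succ]; field_simp

theorem kern_le_of_norm_ge {t R : ℝ} (ht : 0 < t) (hR : 0 < R) {x : Sp n} (hx : R ≤ ‖x‖) :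
    kern t x ≤ t * (R ^ (n + 1))⁻¹ := by
  unfold kern
  have h3 : (t ^ 2 + ‖x‖ ^ 2) ^ (-(((n : ℝ) + 1) / 2)) ≤ (R ^ 2) ^ (-(((n : ℝ) + 1) / 2)) :=
    Real.rpow_le_rpow_of_nonpos (by positivity) (by nlinarith [sq_nonneg t])
      (by have : (0:ℝ) ≤ n := n.cast_nonneg; linarith)
  have h4 : (R ^ 2) ^ (-(((n : ℝ) + 1) / 2)) = (R ^ (n + 1))⁻¹ := by
    rw [← Real.rpow_natCast R 2, ← Real.rpow_mul hR.le, ← Real.rpow_natCast R (n+1),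
      ← Real.rpow_neg hR.le]
    congr 1; push_cast; ring
  rw [h4] at h3
  gcongr

/-- Every translate and dilate of the kernel is comparable to `kern 1`. -/
theorem kern_sub_le_kern_one {t : ℝ} (ht : 0 < t) (x y : Sp n) :
    kern t (x - y) ≤
      (t / 1 * ((1 + 2 * ‖x‖ ^ 2) / t ^ 2 + 2) ^ (((n : ℝ) + 1) / 2)) * kern 1 y := by
  refine kern_le_of_le ht one_pos (by positivity) (x - y) y ?_
  have h1 : ‖y‖ ≤ ‖x - y‖ + ‖x‖ := by
    calc ‖y‖ = ‖x - (x - y)‖ := by simp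
      _ ≤ _ := (norm_sub_le _ _).trans (by linarith)
  have h2 : ((1 + 2 * ‖x‖ ^ 2) / t ^ 2 + 2) * (t ^ 2 + ‖x - y‖ ^ 2) =
    (1 + 2 * ‖x‖ ^ 2) + 2 * ‖x - y‖ ^ 2 + (1 + 2 * ‖x‖ ^ 2) * (‖x - y‖ ^ 2 / t ^ 2)
      + 2 * t ^ 2 := by field_simp; ring
  rw [h2]
  have h3 : 0 ≤ (1 + 2 * ‖x‖ ^ 2) * (‖x - y‖ ^ 2 / t ^ 2) := by positivity
  nlinarith [norm_nonneg x, norm_nonneg y, norm_nonneg (x - y), sq_nonneg (‖x - y‖ - ‖x‖),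
    sq_nonneg t]

theorem kern_scale {t : ℝ} (ht : 0 < t) (x : Sp n) :
    kern t (t • x) = (t ^ n)⁻¹ * kern 1 x := by
  simp only [kern, norm_smul, Real.norm_eq_abs, abs_of_pos ht]
  rw [show t ^ 2 + (t * ‖x‖) ^ 2 = t ^ 2 * (1 ^ 2 + ‖x‖ ^ 2) by ring,
    Real.mul_rpow (by positivity) (by positivity)]
  have h4 : (t ^ 2) ^ (-(((n : ℝ) + 1) / 2)) = (t ^ (n + 1))⁻¹ := by
    rw [← Real.rpow_natCast t 2, ← Real.rpow_mul ht.le, ← Real.rpow_natCast t (n+1),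
      ← Real.rpow_neg ht.le]
    congr 1; push_cast; ring
  rw [h4, pow_succ]
  field_simp

theorem measurable_kern : Measurable (fun z : ℝ × Sp n => kern z.1 z.2) := by
  unfold kern; fun_prop

theorem measurable_kernT : Measurable (fun z : ℝ × Sp n => kernT z.1 z.2) := by
  unfold kernT; fun_prop

theorem measurable_kernTT : Measurable (fun z : ℝ × Sp n => kernTT z.1 z.2) := by
  unfold kernTT; fun_prop

theorem measurable_kernX (i : Fin n) : Measurable (fun z : ℝ × Sp n => kernX i z.1 z.2) := by
  unfold kernX; fun_prop

theorem measurable_kernXX (i : Fin n) : Measurable (fun z : ℝ × Sp n => kernXX i z.1 z.2) := by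
  unfold kernXX; fun_prop

theorem integrable_kern {t : ℝ} (ht : 0 < t) : Integrable (fun x : Sp n => kern t x) := by
  have h1 : Integrable (fun x : Sp n => kern 1 x) := by
    have := integrable_rpow_neg_one_add_norm_sq (E := Sp n) (μ := volume) (r := (n : ℝ) + 1)
      (by simp)
    refine this.congr (ae_of_all _ fun x => ?_)
    simp only [kern]
    rw [one_mul, one_pow]
    congr 1; ring
  refine (h1.const_mul (t / 1 * ((1 + 2 * ‖(0 : Sp n)‖ ^ 2) / t ^ 2 + 2) ^
    (((n : ℝ) + 1) / 2))).mono' (measurable_kern.comp (by fun_prop :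
      Measurable (fun x : Sp n => (t, x)))).aestronglyMeasurable (ae_of_all _ fun x => ?_)
  rw [Real.norm_eq_abs, abs_of_pos (kern_pos ht x)]
  have := kern_sub_le_kern_one ht 0 x
  rwa [zero_sub, kern_neg] at this

end Kernel

/-! ### Poisson extensions of weighted integrable functions -/

/-- `f` is integrable against the Poisson kernel. -/
def WInt {n : ℕ} {F : Type*} [NormedAddCommGroup F] [NormedSpace ℝ F] (f : Sp n → F) : Prop :=
  Integrable (fun y => kern 1 y • f y)

/-- Convolution of `f` with the scalar kernel `K`; for `K = kern t` this is the (unnormalised)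
Poisson extension of `f` at height `t`. -/
def kext {n : ℕ} {F : Type*} [NormedAddCommGroup F] [NormedSpace ℝ F] (K : Sp n → ℝ)
    (f : Sp n → F) (x : Sp n) : F := ∫ y, K (x - y) • f y

section Ext

variable {n : ℕ} {F : Type*} [NormedAddCommGroup F] [NormedSpace ℝ F] {f : Sp n → F}

theorem measurable_kern_right (t : ℝ) : Measurable (fun x : Sp n => kern t x) :=
  measurable_kern.comp (by fun_prop : Measurable (fun x : Sp n => (t, x)))

theorem measurable_kernT_right (t : ℝ) : Measurable (fun x : Sp n => kernT t x) :=
  measurable_kernT.comp (by fun_prop : Measurable (fun x : Sp n => (t, x)))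

theorem measurable_kernTT_right (t : ℝ) : Measurable (fun x : Sp n => kernTT t x) :=
  measurable_kernTT.comp (by fun_prop : Measurable (fun x : Sp n => (t, x)))

theorem measurable_kernX_right (i : Fin n) (t : ℝ) : Measurable (fun x : Sp n => kernX i t x) :=
  (measurable_kernX i).comp (by fun_prop : Measurable (fun x : Sp n => (t, x)))

theorem measurable_kernXX_right (i : Fin n) (t : ℝ) : Measurable (fun x : Sp n => kernXX i t x) :=
  (measurable_kernXX i).comp (by fun_prop : Measurable (fun x : Sp n => (t, x)))

theorem WInt.aestronglyMeasurable (hf : WInt f) : AEStronglyMeasurable f volume := by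
  have h1 : AEStronglyMeasurable (fun y : Sp n => (kern 1 y)⁻¹) volume :=
    (measurable_kern_right 1).inv.aestronglyMeasurable
  refine (h1.smul (Integrable.aestronglyMeasurable hf)).congr (ae_of_all _ fun y => ?_)
  simp only [Pi.smul_apply']
  rw [inv_smul_smul₀ (kern_pos one_pos y).ne']

theorem WInt.norm (hf : WInt f) : WInt (fun y => ‖f y‖) := by
  refine (Integrable.norm hf).congr (ae_of_all _ fun y => ?_)
  simp [norm_smul, abs_of_pos (kern_pos one_pos y)]

theorem WInt.of_norm_le {G : Type*} [NormedAddCommGroup G] [NormedSpace ℝ G] {g : Sp n → G}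
    (hf : WInt f) (hg : AEStronglyMeasurable g volume) (h : ∀ᵐ y, ‖g y‖ ≤ ‖f y‖) : WInt g := by
  refine Integrable.mono hf ((measurable_kern_right 1).aestronglyMeasurable.smul hg) ?_
  filter_upwards [h] with y hy
  simp only [norm_smul]
  gcongr

theorem WInt.add {g : Sp n → F} (hf : WInt f) (hg : WInt g) : WInt (fun y => f y + g y) := by
  refine (Integrable.add hf hg).congr (ae_of_all _ fun y => ?_)
  simp [smul_add]

theorem WInt.const_smul {𝕜 : Type*} [NormedField 𝕜] [NormedSpace 𝕜 F] [SMulCommClass ℝ 𝕜 F]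
    (hf : WInt f) (c : 𝕜) : WInt (fun y => c • f y) := by
  refine (Integrable.smul c hf).congr (ae_of_all _ fun y => ?_)
  simp only [Pi.smul_apply, smul_comm]

theorem wInt_const (c : F) : WInt (fun _ : Sp n => c) := (integrable_kern one_pos).smul_const c

theorem WInt.integrable_kern_sub (hf : WInt f) {t : ℝ} (ht : 0 < t) (x : Sp n) :
    Integrable (fun y => kern t (x - y) • f y) := by
  refine Integrable.mono' (g := fun y => (t / 1 * ((1 + 2 * ‖x‖ ^ 2) / t ^ 2 + 2) ^
    (((n : ℝ) + 1) / 2)) * ‖kern 1 y • f y‖) ((Integrable.norm hf).const_mul _)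
    (((measurable_kern_right t).comp (by fun_prop)).aestronglyMeasurable.smul
      hf.aestronglyMeasurable) (ae_of_all _ fun y => ?_)
  rw [norm_smul, norm_smul, Real.norm_eq_abs, Real.norm_eq_abs, abs_of_pos (kern_pos ht _),
    abs_of_pos (kern_pos one_pos _), ← mul_assoc]
  gcongr
  exact kern_sub_le_kern_one ht x y

theorem WInt.integrable_of_le (hf : WInt f) {K : Sp n → ℝ} (hK : Measurable K) {t C : ℝ}
    (ht : 0 < t) (h : ∀ z, |K z| ≤ C * kern t z) (x : Sp n) :
    Integrable (fun y => K (x - y) • f y) := by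
  refine Integrable.mono' (g := fun y => C * ‖kern t (x - y) • f y‖)
    ((hf.integrable_kern_sub ht x).norm.const_mul _)
    ((hK.comp (by fun_prop)).aestronglyMeasurable.smul
      hf.aestronglyMeasurable) (ae_of_all _ fun y => ?_)
  rw [norm_smul, norm_smul, Real.norm_eq_abs, Real.norm_eq_abs, abs_of_pos (kern_pos ht _),
    ← mul_assoc]
  gcongr
  exact h _

theorem WInt.norm_kext_le (hf : WInt f) {K : Sp n → ℝ} {t C : ℝ}
    (ht : 0 < t) (h : ∀ z, |K z| ≤ C * kern t z) (x : Sp n) :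
    ‖kext K f x‖ ≤ C * kext (kern t) (fun y => ‖f y‖) x := by
  unfold kext
  rw [← integral_const_mul]
  refine norm_integral_le_of_norm_le ((hf.norm.integrable_kern_sub ht x).const_mul C)
    (ae_of_all _ fun y => ?_)
  rw [norm_smul, Real.norm_eq_abs, smul_eq_mul, ← mul_assoc]
  gcongr
  exact h _

theorem abs_kern_le {t : ℝ} (ht : 0 < t) (z : Sp n) : |kern t z| ≤ 1 * kern t z := by
  rw [abs_of_pos (kern_pos ht z), one_mul]

theorem kext_congr {g : Sp n → F} (h : f =ᵐ[volume] g) (K : Sp n → ℝ) (x : Sp n) :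
    kext K f x = kext K g x := by
  refine integral_congr_ae ?_
  filter_upwards [h] with y hy
  rw [hy]

theorem kext_add {g : Sp n → F} {K : Sp n → ℝ} {x : Sp n}
    (hf : Integrable (fun y => K (x - y) • f y)) (hg : Integrable (fun y => K (x - y) • g y)) :
    kext K (fun y => f y + g y) x = kext K f x + kext K g x := by
  unfold kext
  simp only [smul_add]
  exact integral_add hf hg

/-- Joint measurability of a kernel extension. -/
theorem stronglyMeasurable_kext (hf : AEStronglyMeasurable f volume) {K : ℝ → Sp n → ℝ}
    (hK : Measurable (fun z : ℝ × Sp n => K z.1 z.2)) :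
    StronglyMeasurable (fun z : ℝ × Sp n => kext (K z.1) f z.2) := by
  have h1 : (fun z : ℝ × Sp n => kext (K z.1) f z.2) =
      fun z => ∫ y, K z.1 (z.2 - y) • hf.mk f y := by
    funext z
    exact kext_congr hf.ae_eq_mk (K z.1) z.2
  rw [h1]
  refine StronglyMeasurable.integral_prod_right'
    (f := fun w : (ℝ × Sp n) × Sp n => K w.1.1 (w.1.2 - w.2) • hf.mk f w.2) ?_
  have h2 : Measurable (fun w : (ℝ × Sp n) × Sp n => K w.1.1 (w.1.2 - w.2)) :=
    hK.comp (by fun_prop : Measurable (fun w : (ℝ × Sp n) × Sp n => (w.1.1, w.1.2 - w.2)))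
  exact h2.stronglyMeasurable.smul (hf.stronglyMeasurable_mk.comp_measurable measurable_snd)

theorem stronglyMeasurable_kext_right (hf : AEStronglyMeasurable f volume) {K : Sp n → ℝ}
    (hK : Measurable K) : StronglyMeasurable (kext K f) := by
  have := stronglyMeasurable_kext hf (K := fun _ => K) (hK.comp measurable_snd)
  exact this.comp_measurable (measurable_prodMk_left (x := (0 : ℝ)))

/-! ### Differentiation of extensions -/

theorem kern_harnack_time {s t : ℝ} (ht : 0 < t) (hs : s ∈ Metric.ball t (t / 2)) (z : Sp n) :
    0 < s ∧ t / 2 ≤ s ∧ kern s z ≤ harnackC n * kern t z := by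
  rw [Metric.mem_ball, Real.dist_eq, abs_lt] at hs
  have h0 : 0 < s := by linarith
  refine ⟨h0, by linarith, ?_⟩
  have := kern_harnack h0 ht (by linarith) (by linarith) z 0 (by simpa using h0.le)
  simpa using this

/-- Differentiation under the integral sign, for a kernel whose derivative is dominated near `t` by
a multiple of `kern t`. -/
theorem hasDerivAt_kext_of_kernel {K K' : ℝ → Sp n → ℝ} (hf : WInt f)
    (hK : Measurable (fun z : ℝ × Sp n => K z.1 z.2))
    (hK' : Measurable (fun z : ℝ × Sp n => K' z.1 z.2))
    {t C C' : ℝ} (ht : 0 < t) (hbd : ∀ z, |K t z| ≤ C' * kern t z)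
    (hbd' : ∀ s ∈ Metric.ball t (t / 2), ∀ z, |K' s z| ≤ C * kern t z)
    (hd : ∀ s, 0 < s → ∀ z, HasDerivAt (fun s => K s z) (K' s z) s) (x : Sp n) :
    HasDerivAt (fun s => kext (K s) f x) (kext (K' t) f x) t := by
  have hm : ∀ s, Measurable (K s) := fun s =>
    hK.comp (by fun_prop : Measurable (fun x : Sp n => (s, x)))
  have hm' : Measurable (K' t) := hK'.comp (by fun_prop : Measurable (fun x : Sp n => (t, x)))
  refine (hasDerivAt_integral_of_dominated_loc_of_deriv_le
    (bound := fun y => C * ‖kern t (x - y) • f y‖) (F := fun s y => K s (x - y) • f y)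
    (F' := fun s y => K' s (x - y) • f y) (Metric.ball_mem_nhds t (half_pos ht)) ?_ ?_ ?_ ?_ ?_
    ?_).2
  · exact Eventually.of_forall fun s => ((hm s).comp (by fun_prop)).aestronglyMeasurable.smul
      hf.aestronglyMeasurable
  · exact hf.integrable_of_le (hm t) ht hbd x
  · exact (hm'.comp (by fun_prop)).aestronglyMeasurable.smul hf.aestronglyMeasurable
  · refine ae_of_all _ fun y s hs => ?_
    rw [norm_smul, norm_smul, Real.norm_eq_abs, Real.norm_eq_abs, abs_of_pos (kern_pos ht _),
      ← mul_assoc]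
    gcongr
    exact hbd' s hs _
  · exact (hf.integrable_kern_sub ht x).norm.const_mul C
  · exact ae_of_all _ fun y s hs => (hd s (kern_harnack_time ht hs (0 : Sp n)).1 _).smul_const (f y)

theorem abs_kernT_le_of_mem {s t : ℝ} (ht : 0 < t) (hs : s ∈ Metric.ball t (t / 2)) (z : Sp n) :
    |kernT s z| ≤ (kernC n / (t / 2) * harnackC n) * kern t z := by
  obtain ⟨h0, h1, h2⟩ := kern_harnack_time ht hs z
  have := kernC_pos n
  have := kern_pos h0 z
  calc |kernT s z| ≤ kernC n / s * kern s z := abs_kernT_le h0 z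
    _ ≤ kernC n / (t / 2) * (harnackC n * kern t z) := by gcongr
    _ = _ := by ring

theorem abs_kernTT_le_of_mem {s t : ℝ} (ht : 0 < t) (hs : s ∈ Metric.ball t (t / 2)) (z : Sp n) :
    |kernTT s z| ≤ (kernC n / (t / 2) ^ 2 * harnackC n) * kern t z := by
  obtain ⟨h0, h1, h2⟩ := kern_harnack_time ht hs z
  have := kernC_pos n
  have := kern_pos h0 z
  calc |kernTT s z| ≤ kernC n / s ^ 2 * kern s z := abs_kernTT_le h0 z
    _ ≤ kernC n / (t / 2) ^ 2 * (harnackC n * kern t z) := by gcongr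
    _ = _ := by ring

theorem WInt.hasDerivAt_kext_kern (hf : WInt f) {t : ℝ} (ht : 0 < t) (x : Sp n) :
    HasDerivAt (fun s => kext (kern s) f x) (kext (kernT t) f x) t :=
  hasDerivAt_kext_of_kernel hf measurable_kern measurable_kernT ht (abs_kern_le ht)
    (fun _ hs z => abs_kernT_le_of_mem ht hs z) (fun _ hs z => hasDerivAt_kern hs z) x

theorem WInt.hasDerivAt_kext_kernT (hf : WInt f) {t : ℝ} (ht : 0 < t) (x : Sp n) :
    HasDerivAt (fun s => kext (kernT s) f x) (kext (kernTT t) f x) t :=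
  hasDerivAt_kext_of_kernel hf measurable_kernT measurable_kernTT ht (abs_kernT_le ht)
    (fun _ hs z => abs_kernTT_le_of_mem ht hs z) (fun _ hs z => hasDerivAt_kernT hs z) x

theorem hasLineDerivAt_kext_of_kernel {K K' : Sp n → ℝ} (hf : WInt f) (hK : Measurable K)
    (hK' : Measurable K') {t C C' : ℝ} (ht : 0 < t) (hC : 0 ≤ C)
    (hbd : ∀ z, |K z| ≤ C' * kern t z)
    (hbd' : ∀ z, |K' z| ≤ C * kern t z) (i : Fin n)
    (hd : ∀ z h, HasDerivAt (fun s : ℝ => K (z + s • basisVec i)) (K' (z + h • basisVec i)) h)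
    (x : Sp n) : HasLineDerivAt ℝ (kext K f) (kext K' f x) x (basisVec i) := by
  have hrw : ∀ (s : ℝ) y, x + s • basisVec i - y = (x - y) + s • basisVec i := fun s y => by abel
  have key : HasDerivAt (fun s : ℝ => ∫ y, K (x + s • basisVec i - y) • f y)
      (∫ y, K' (x + (0 : ℝ) • basisVec i - y) • f y) 0 := by
    refine (hasDerivAt_integral_of_dominated_loc_of_deriv_le
      (bound := fun y => (C * harnackC n) * ‖kern t (x - y) • f y‖)
      (F := fun s y => K (x + s • basisVec i - y) • f y)
      (F' := fun (s : ℝ) y => K' (x + s • basisVec i - y) • f y)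
      (Metric.ball_mem_nhds (0 : ℝ) ht) ?_ ?_ ?_ ?_ ?_ ?_).2
    · exact Eventually.of_forall fun s => (hK.comp (by fun_prop)).aestronglyMeasurable.smul
        hf.aestronglyMeasurable
    · exact hf.integrable_of_le hK ht hbd _
    · exact (hK'.comp (by fun_prop)).aestronglyMeasurable.smul hf.aestronglyMeasurable
    · refine ae_of_all _ fun y s hs => ?_
      have hs' : ‖s • basisVec i‖ ≤ t := by
        rw [mem_ball_zero_iff] at hs
        rw [norm_smul]; simpa using hs.le
      rw [norm_smul, norm_smul, Real.norm_eq_abs, Real.norm_eq_abs, abs_of_pos (kern_pos ht _),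
        ← mul_assoc, mul_assoc C]
      gcongr
      rw [hrw]
      refine (hbd' _).trans ?_
      gcongr
      exact kern_harnack ht ht (by linarith) (by linarith) _ _ hs'
    · exact (hf.integrable_kern_sub ht x).norm.const_mul _
    · refine ae_of_all _ fun y s hs => ?_
      simp only [hrw]
      exact (hd (x - y) s).smul_const (f y)
  simpa [HasLineDerivAt, kext] using key

theorem WInt.hasLineDerivAt_kext_kern (hf : WInt f) {t : ℝ} (ht : 0 < t) (i : Fin n) (x : Sp n) :
    HasLineDerivAt ℝ (kext (kern t) f) (kext (kernX i t) f x) x (basisVec i) :=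
  hasLineDerivAt_kext_of_kernel hf (measurable_kern_right t) (measurable_kernX_right i t) ht
    (by have := kernC_pos n; positivity) (abs_kern_le ht) (abs_kernX_le ht i) i
    (fun z h => hasDerivAt_kern_line ht i z h) x

theorem WInt.hasLineDerivAt_kext_kernX (hf : WInt f) {t : ℝ} (ht : 0 < t) (i : Fin n) (x : Sp n) :
    HasLineDerivAt ℝ (kext (kernX i t) f) (kext (kernXX i t) f x) x (basisVec i) :=
  hasLineDerivAt_kext_of_kernel hf (measurable_kernX_right i t) (measurable_kernXX_right i t) ht
    (by have := kernC_pos n; positivity) (abs_kernX_le ht i) (abs_kernXX_le ht i) i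
    (fun z h => hasDerivAt_kernX_line ht i z h) x

theorem WInt.kext_harmonic (hf : WInt f) {t : ℝ} (ht : 0 < t) (x : Sp n) :
    kext (kernTT t) f x + ∑ i, kext (kernXX i t) f x = 0 := by
  unfold kext
  rw [← integral_finsetSum _ fun i _ =>
    hf.integrable_of_le (measurable_kernXX_right i t) ht (abs_kernXX_le ht i) x,
    ← integral_add (hf.integrable_of_le (measurable_kernTT_right t) ht (abs_kernTT_le ht) x)
      (integrable_finsetSum _ fun i _ =>
        hf.integrable_of_le (measurable_kernXX_right i t) ht (abs_kernXX_le ht i) x)]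
  refine integral_eq_zero_of_ae (ae_of_all _ fun y => ?_)
  simp only [← Finset.sum_smul, ← add_smul]
  rw [kernTT_add_sum_kernXX ht, zero_smul, Pi.zero_apply]

theorem WInt.kext_pos {f : Sp n → ℝ} (hf : WInt f) (h0 : ∀ y, 0 ≤ f y)
    (hne : ¬ f =ᵐ[volume] 0) {t : ℝ} (ht : 0 < t) (x : Sp n) : 0 < kext (kern t) f x := by
  have h1 : 0 ≤ fun y => kern t (x - y) • f y := fun y =>
    mul_nonneg (kern_pos ht _).le (h0 y)
  refine lt_of_le_of_ne (integral_nonneg h1) fun h => hne ?_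
  have := (integral_eq_zero_iff_of_nonneg h1 (hf.integrable_kern_sub ht x)).1 h.symm
  filter_upwards [this] with y hy
  exact (mul_eq_zero.1 hy).resolve_left (kern_pos ht _).ne'

theorem kext_nonneg {f : Sp n → ℝ} (h0 : ∀ y, 0 ≤ f y) {t : ℝ} (ht : 0 < t) (x : Sp n) :
    0 ≤ kext (kern t) f x :=
  integral_nonneg fun y => mul_nonneg (kern_pos ht _).le (h0 y)

end Ext

/-! ### The Hardy–Littlewood maximal function -/

/-- The uncentred Hardy–Littlewood maximal function, with values in `[0,∞]`. -/
def maxFn {n : ℕ} (f : Sp n → ℝ≥0∞) (x : Sp n) : ℝ≥0∞ :=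
  ⨆ (z : Sp n) (r : ℝ) (_ : 0 < r) (_ : x ∈ Metric.ball z r),
    (∫⁻ y in Metric.ball z r, f y) / volume (Metric.ball z r)

section Maximal

variable {n : ℕ}

theorem volume_ball_pos (z : Sp n) {r : ℝ} (hr : 0 < r) : 0 < volume (Metric.ball z r) :=
  Metric.measure_ball_pos _ _ hr

theorem volume_ball_lt_top (z : Sp n) (r : ℝ) : volume (Metric.ball z r) < ∞ := measure_ball_lt_top

theorem volume_ball_eq (z : Sp n) {r : ℝ} (hr : 0 < r) :
    volume (Metric.ball z r) = ENNReal.ofReal (r ^ n) * volume (Metric.ball (0 : Sp n) 1) := by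
  have := Measure.addHaar_ball_of_pos (volume : Measure (Sp n)) z hr
  simpa using this

theorem lt_maxFn_iff {f : Sp n → ℝ≥0∞} {x : Sp n} {s : ℝ≥0∞} :
    s < maxFn f x ↔ ∃ z, ∃ r : ℝ, 0 < r ∧ x ∈ Metric.ball z r ∧
      s * volume (Metric.ball z r) < ∫⁻ y in Metric.ball z r, f y := by
  unfold maxFn
  simp only [lt_iSup_iff, exists_prop]
  refine exists_congr fun z => exists_congr fun r => and_congr_right fun hr =>
    and_congr_right fun _ => ?_
  rw [ENNReal.lt_div_iff_mul_lt (Or.inl (volume_ball_pos z hr).ne')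
    (Or.inl (volume_ball_lt_top z r).ne)]

theorem lintegral_ball_le_maxFn (f : Sp n → ℝ≥0∞) {x z : Sp n} {r : ℝ} (hr : 0 < r)
    (hx : x ∈ Metric.ball z r) :
    ∫⁻ y in Metric.ball z r, f y ≤ maxFn f x * volume (Metric.ball z r) := by
  by_contra! h
  exact lt_irrefl _ (lt_maxFn_iff.2 ⟨z, r, hr, hx, h⟩)

theorem isOpen_lt_maxFn (f : Sp n → ℝ≥0∞) (s : ℝ≥0∞) : IsOpen {x | s < maxFn f x} := by
  rw [isOpen_iff_forall_mem_open]
  intro x hx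
  obtain ⟨z, r, hr, hxz, h⟩ := lt_maxFn_iff.1 hx
  exact ⟨Metric.ball z r, fun y hy => lt_maxFn_iff.2 ⟨z, r, hr, hy, h⟩, Metric.isOpen_ball, hxz⟩

theorem measurable_maxFn (f : Sp n → ℝ≥0∞) : Measurable (maxFn f) :=
  measurable_of_Ioi fun s => (isOpen_lt_maxFn f s).measurableSet

/-- The weak type `(1,1)` estimate, from the Vitali covering lemma. -/
theorem mul_volume_lt_maxFn_le [NeZero n] (f : Sp n → ℝ≥0∞) {s : ℝ≥0∞} (hs : s ≠ 0) :
    s * volume {x | s < maxFn f x} ≤ ENNReal.ofReal (5 ^ n) * ∫⁻ y, f y := by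
  rcases eq_or_ne (∫⁻ y, f y) ∞ with htop | hfin
  · rw [htop, ENNReal.mul_top (by simp)]
    exact le_top
  have hs' : ∀ x ∈ {x | s < maxFn f x}, ∃ z, ∃ r : ℝ, 0 < r ∧ x ∈ Metric.ball z r ∧
      s * volume (Metric.ball z r) < ∫⁻ y in Metric.ball z r, f y :=
    fun x hx => lt_maxFn_iff.1 hx
  choose! z r hr hxz hlt using hs'
  -- the radii are bounded because the volumes of the balls are
  obtain ⟨R, hR⟩ : ∃ R : ℝ, ∀ x ∈ {x | s < maxFn f x}, r x ≤ R := by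
    set c := volume (Metric.ball (0 : Sp n) 1) with hc
    have hc0 : c ≠ 0 := (volume_ball_pos 0 one_pos).ne'
    have hct : c ≠ ∞ := (volume_ball_lt_top 0 1).ne
    have hq : (∫⁻ y, f y) / (s * c) ≠ ∞ := ENNReal.div_ne_top hfin (mul_ne_zero hs hc0)
    refine ⟨max 1 ((∫⁻ y, f y) / (s * c)).toReal, fun x hx => ?_⟩
    by_contra! h
    obtain ⟨h1, h2⟩ := max_lt_iff.1 h
    have h3 : s * volume (Metric.ball (z x) (r x)) < ∫⁻ y, f y :=
      (hlt x hx).trans_le (setLIntegral_le_lintegral _ _)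
    rw [volume_ball_eq _ (hr x hx), ← hc, mul_left_comm] at h3
    have hst : s * c ≠ ∞ := by
      intro h
      rw [h, ENNReal.mul_top (by simpa using pow_pos (hr x hx) n)] at h3
      exact not_top_lt h3
    have h4 : ENNReal.ofReal (r x ^ n) < (∫⁻ y, f y) / (s * c) := by
      rwa [ENNReal.lt_div_iff_mul_lt (Or.inl (mul_ne_zero hs hc0)) (Or.inl hst)]
    have h5 : r x ^ n < ((∫⁻ y, f y) / (s * c)).toReal := by
      rwa [ENNReal.ofReal_lt_iff_lt_toReal (pow_pos (hr x hx) n).le hq] at h4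
    have h6 : r x ≤ r x ^ n := le_self_pow₀ h1.le (NeZero.ne n)
    linarith
  obtain ⟨u, hu, hdisj, hcov⟩ := Vitali.exists_disjoint_subfamily_covering_enlargement_closedBall
    {x | s < maxFn f x} z r R hR 5 (by norm_num)
  have hucount : u.Countable := by
    refine hdisj.countable_of_nonempty_interior fun x hx => ?_
    refine ⟨z x, ?_⟩
    exact Metric.ball_subset_interior_closedBall (Metric.mem_ball_self (hr x (hu hx)))
  have hsub : {x | s < maxFn f x} ⊆ ⋃ x ∈ u, Metric.closedBall (z x) (5 * r x) := by
    intro x hx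
    obtain ⟨b, hb, hxb⟩ := hcov x hx
    exact mem_biUnion hb (hxb (Metric.ball_subset_closedBall (hxz x hx)))
  have hball : ∀ x ∈ u, s * volume (Metric.closedBall (z x) (5 * r x)) ≤
      ENNReal.ofReal (5 ^ n) * ∫⁻ y in Metric.ball (z x) (r x), f y := by
    intro x hx
    have h0 := hr x (hu hx)
    rw [Measure.addHaar_closedBall_eq_addHaar_ball, volume_ball_eq _ (by positivity), mul_pow,
      ENNReal.ofReal_mul (by positivity), mul_assoc, ← volume_ball_eq (z x) h0, mul_left_comm]
    gcongr
    exact (hlt x (hu hx)).le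
  have := hucount.to_subtype
  calc s * volume {x | s < maxFn f x}
      ≤ s * ∑' x : u, volume (Metric.closedBall (z x) (5 * r x)) := by
        gcongr
        exact (measure_mono hsub).trans (measure_biUnion_le _ hucount _)
    _ = ∑' x : u, s * volume (Metric.closedBall (z x) (5 * r x)) := ENNReal.tsum_mul_left.symm
    _ ≤ ∑' x : u, ENNReal.ofReal (5 ^ n) * ∫⁻ y in Metric.ball (z x) (r x), f y :=
        ENNReal.tsum_le_tsum fun x => hball x x.2
    _ = ENNReal.ofReal (5 ^ n) * ∑' x : u, ∫⁻ y in Metric.ball (z x) (r x), f y :=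
        ENNReal.tsum_mul_left
    _ = ENNReal.ofReal (5 ^ n) * ∫⁻ y in ⋃ x ∈ u, Metric.ball (z x) (r x), f y := by
        rw [lintegral_biUnion hucount (fun _ _ => Metric.isOpen_ball.measurableSet)]
        exact hdisj.mono fun x => Metric.ball_subset_closedBall
    _ ≤ _ := mul_le_mul_right (setLIntegral_le_lintegral _ _) _

theorem lintegral_Ioo_rpow {p b : ℝ} (hp : 0 < p) (hb : 0 ≤ b) :
    ∫⁻ t in Ioo 0 b, ENNReal.ofReal (p * t ^ (p - 1)) = ENNReal.ofReal (b ^ p) := by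
  have h1 : IntegrableOn (fun t : ℝ => p * t ^ (p - 1)) (Ioo 0 b) := by
    have h := (intervalIntegral.intervalIntegrable_rpow' (a := 0) (b := b) (r := p - 1)
      (by linarith)).const_mul p
    rw [intervalIntegrable_iff_integrableOn_Ioo_of_le hb] at h
    exact h
  rw [← ofReal_integral_eq_lintegral_ofReal h1]
  · congr 1
    rw [← integral_Ioc_eq_integral_Ioo, ← intervalIntegral.integral_of_le hb,
      intervalIntegral.integral_const_mul, integral_rpow (Or.inl (by linarith))]
    rw [sub_add_cancel, Real.zero_rpow hp.ne', sub_zero]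
    field_simp
  · refine (ae_restrict_iff' measurableSet_Ioo).2 (ae_of_all _ fun t ht => ?_)
    have := ht.1
    positivity

/-- The layer cake formula for a number of `[0,∞]`. -/
theorem lintegral_indicator_rpow {p : ℝ} (hp : 0 < p) (a : ℝ≥0∞) :
    ∫⁻ t in Ioi (0 : ℝ), ENNReal.ofReal (p * t ^ (p - 1)) *
      (if ENNReal.ofReal t < a then 1 else 0) = a ^ p := by
  have key : ∀ s : Set ℝ, MeasurableSet s →
      ∫⁻ t in Ioi (0 : ℝ), ENNReal.ofReal (p * t ^ (p - 1)) * s.indicator 1 t =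
      ∫⁻ t in Ioi (0 : ℝ) ∩ s, ENNReal.ofReal (p * t ^ (p - 1)) := by
    intro s hs
    rw [inter_comm, ← Measure.restrict_restrict hs, ← lintegral_indicator hs]
    refine lintegral_congr fun t => ?_
    by_cases h : t ∈ s <;> simp [h]
  rcases eq_or_ne a ∞ with rfl | ha
  · rw [ENNReal.top_rpow_of_pos hp, eq_top_iff]
    refine ENNReal.le_of_forall_nnreal_lt fun N _ => ?_
    have h2 := lintegral_Ioo_rpow hp (b := (N : ℝ) ^ (1 / p)) (by positivity)
    rw [← Real.rpow_mul N.coe_nonneg, one_div_mul_cancel hp.ne', Real.rpow_one,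
      ENNReal.ofReal_coe_nnreal] at h2
    rw [← h2]
    refine (lintegral_mono_set Ioo_subset_Ioi_self).trans (lintegral_mono fun t => ?_)
    simp
  · lift a to NNReal using ha
    have h2 := lintegral_Ioo_rpow hp (b := (a : ℝ)) a.coe_nonneg
    have h3 := key (Iio (a : ℝ)) measurableSet_Iio
    rw [show Ioi (0:ℝ) ∩ Iio (a:ℝ) = Ioo 0 (a : ℝ) from rfl, h2] at h3
    rw [← ENNReal.ofReal_rpow_of_nonneg a.coe_nonneg hp.le, ENNReal.ofReal_coe_nnreal] at h3
    rw [← h3]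
    refine setLIntegral_congr_fun measurableSet_Ioi fun t ht => ?_
    have : (ENNReal.ofReal t < (a : ℝ≥0∞)) ↔ t ∈ Iio (a : ℝ) := by
      rw [ENNReal.ofReal_lt_iff_lt_toReal (le_of_lt ht) ENNReal.coe_ne_top]; rfl
    simp only [this, indicator, Pi.one_apply]

theorem lintegral_rpow_eq_layer {g : Sp n → ℝ≥0∞} (hg : Measurable g) (w : Sp n → ℝ≥0∞)
    (hw : Measurable w) {p : ℝ} (hp : 0 < p) :
    ∫⁻ x, w x * g x ^ p = ∫⁻ t in Ioi (0 : ℝ), ENNReal.ofReal (p * t ^ (p - 1)) *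
      ∫⁻ x in {x | ENNReal.ofReal t < g x}, w x := by
  have hms : ∀ t : ℝ, MeasurableSet {x | ENNReal.ofReal t < g x} :=
    fun t => measurableSet_lt measurable_const hg
  calc ∫⁻ x, w x * g x ^ p
      = ∫⁻ x, ∫⁻ t in Ioi (0 : ℝ), w x * (ENNReal.ofReal (p * t ^ (p - 1)) *
          (if ENNReal.ofReal t < g x then 1 else 0)) := by
        refine lintegral_congr fun x => ?_
        rw [lintegral_const_mul, lintegral_indicator_rpow hp]
        refine Measurable.mul (by fun_prop) ?_
        exact Measurable.ite (measurableSet_lt (by fun_prop) measurable_const)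
          measurable_const measurable_const
    _ = ∫⁻ t in Ioi (0 : ℝ), ∫⁻ x, w x * (ENNReal.ofReal (p * t ^ (p - 1)) *
          (if ENNReal.ofReal t < g x then 1 else 0)) := by
        refine lintegral_lintegral_swap ?_
        refine Measurable.aemeasurable ?_
        refine (hw.comp measurable_fst).mul (Measurable.mul (by fun_prop) ?_)
        exact Measurable.ite (measurableSet_lt (by fun_prop) (hg.comp measurable_fst))
          measurable_const measurable_const
    _ = _ := by
        refine lintegral_congr fun t => ?_
        rw [← lintegral_indicator (hms t), ← lintegral_const_mul _ (hw.indicator (hms t))]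
        refine lintegral_congr fun x => ?_
        by_cases h : ENNReal.ofReal t < g x <;> simp [h, mul_comm]

/-- The constant of the maximal inequality on `L^p`. -/
def maxC (n : ℕ) (p : ℝ) : ℝ := 2 * 5 ^ n * (p / (p - 1)) * 2 ^ (p - 1)

/-- The Hardy–Littlewood maximal inequality on `L^p`, `1 < p < ∞`. -/
theorem lintegral_maxFn_rpow_le [NeZero n] {f : Sp n → ℝ≥0∞} (hf : Measurable f) {p : ℝ}
    (hp : 1 < p) : ∫⁻ x, maxFn f x ^ p ≤ ENNReal.ofReal (maxC n p) * ∫⁻ x, f x ^ p := by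
  have hp0 : 0 < p := by linarith
  have hp1 : 0 < p - 1 := by linarith
  -- the part of `f` below half the level does not contribute to the level set
  have hweak : ∀ t : ℝ, 0 < t → ENNReal.ofReal (t / 2) * volume {x | ENNReal.ofReal t < maxFn f x} ≤
      ENNReal.ofReal (5 ^ n) * ∫⁻ x in {x | ENNReal.ofReal t < 2 * f x}, f x := by
    intro t ht
    set g : Sp n → ℝ≥0∞ := {x | ENNReal.ofReal t < 2 * f x}.indicator f with hg
    have hms : MeasurableSet {x | ENNReal.ofReal t < 2 * f x} :=
      measurableSet_lt measurable_const (hf.const_mul 2)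
    have h2 : ENNReal.ofReal t = 2 * ENNReal.ofReal (t / 2) := by
      rw [← ENNReal.ofReal_ofNat, ← ENNReal.ofReal_mul (by norm_num)]
      congr 1; ring
    have hle : ∀ y, f y ≤ g y + ENNReal.ofReal (t / 2) := by
      intro y
      by_cases h : y ∈ {x | ENNReal.ofReal t < 2 * f x}
      · rw [hg, indicator_of_mem h]; exact le_self_add
      · rw [hg, indicator_of_notMem h, zero_add]
        simp only [mem_ofPred_eq, not_lt, h2] at h
        exact (ENNReal.mul_le_mul_iff_right (by simp) (by simp)).1 h
    rw [← lintegral_indicator hms]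
    refine le_trans ?_ (mul_volume_lt_maxFn_le g (s := ENNReal.ofReal (t / 2)) (by simpa using ht))
    refine mul_le_mul_right (measure_mono fun x hx => ?_) _
    obtain ⟨z, r, hr, hxz, h⟩ := lt_maxFn_iff.1 hx
    refine lt_maxFn_iff.2 ⟨z, r, hr, hxz, ?_⟩
    have h3 : ∫⁻ y in Metric.ball z r, f y ≤
        (∫⁻ y in Metric.ball z r, g y) + ENNReal.ofReal (t / 2) * volume (Metric.ball z r) := by
      refine (lintegral_mono hle).trans ?_
      rw [lintegral_add_right _ measurable_const, lintegral_const]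
      simp
    rw [h2, two_mul, add_mul] at h
    have h4 := h.trans_le h3
    exact lt_of_add_lt_add_right h4
  have hL := lintegral_rpow_eq_layer (measurable_maxFn f) 1 measurable_one hp0
  simp only [Pi.one_apply, one_mul, lintegral_one, Measure.restrict_apply MeasurableSet.univ,
    univ_inter] at hL
  have hR := lintegral_rpow_eq_layer (hf.const_mul 2) f hf hp1
  have hR' : ∫⁻ x, f x * (2 * f x) ^ (p - 1) = ENNReal.ofReal (2 ^ (p - 1)) * ∫⁻ x, f x ^ p := by
    rw [← lintegral_const_mul _ (hf.pow_const p)]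
    refine lintegral_congr fun x => ?_
    rw [ENNReal.mul_rpow_of_nonneg _ _ hp1.le, mul_left_comm,
      ← ENNReal.ofReal_rpow_of_pos (by norm_num), ENNReal.ofReal_ofNat]
    congr 1
    nth_rewrite 1 [← ENNReal.rpow_one (f x)]
    rw [← ENNReal.rpow_add_of_nonneg _ _ zero_le_one hp1.le]
    congr 1; ring
  have hcmp : ∫⁻ x, maxFn f x ^ p ≤ ∫⁻ t in Ioi (0 : ℝ),
      ENNReal.ofReal (2 * 5 ^ n * (p / (p - 1))) * (ENNReal.ofReal ((p - 1) * t ^ (p - 1 - 1)) *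
      ∫⁻ x in {x | ENNReal.ofReal t < 2 * f x}, f x) := by
    rw [hL]
    refine setLIntegral_mono' measurableSet_Ioi fun t (ht : 0 < t) => ?_
    have e1 : p * t ^ (p - 1) = (p * (2 * t ^ (p - 1 - 1))) * (t / 2) := by
      rw [Real.rpow_sub_one ht.ne' (p - 1)]; field_simp
    have e2 : 2 * 5 ^ n * (p / (p - 1)) * ((p - 1) * t ^ (p - 1 - 1)) =
        (p * (2 * t ^ (p - 1 - 1))) * 5 ^ n := by field_simp
    have e3 : 0 ≤ p * (2 * t ^ (p - 1 - 1)) := by positivity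
    rw [e1, ← mul_assoc (ENNReal.ofReal (2 * 5 ^ n * (p / (p - 1)))),
      ← ENNReal.ofReal_mul (by positivity), e2, ENNReal.ofReal_mul e3, ENNReal.ofReal_mul e3,
      mul_assoc, mul_assoc]
    exact mul_le_mul_right (hweak t ht) _
  refine hcmp.trans ?_
  rw [lintegral_const_mul' _ _ ENNReal.ofReal_ne_top, ← hR, hR', ← mul_assoc,
    ← ENNReal.ofReal_mul (by positivity)]
  rfl

end Maximal

/-! ### Domination of the Poisson extension by averages over balls -/

section Domination

variable {n : ℕ}

/-- The kernel is at most a geometric series of normalised indicators of dyadic balls. -/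
theorem ofReal_kern_le_tsum {t : ℝ} (ht : 0 < t) (z : Sp n) :
    ENNReal.ofReal (kern t z) ≤ ∑' j : ℕ, ENNReal.ofReal (2 ^ (n + 1) * ((1 / 2) ^ j *
      ((2 ^ j * t) ^ n)⁻¹)) * (Metric.ball (0 : Sp n) (2 ^ j * t)).indicator 1 z := by
  have hex : ∃ j : ℕ, ‖z‖ < 2 ^ j * t := by
    obtain ⟨j, hj⟩ := pow_unbounded_of_one_lt (‖z‖ / t) (by norm_num : (1 : ℝ) < 2)
    exact ⟨j, by rwa [div_lt_iff₀ ht] at hj⟩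
  classical
  set j := Nat.find hex with hj
  have hjz : ‖z‖ < 2 ^ j * t := Nat.find_spec hex
  refine le_trans ?_ (ENNReal.le_tsum j)
  rw [indicator_of_mem (by simpa using hjz), Pi.one_apply, mul_one]
  apply ENNReal.ofReal_le_ofReal
  rcases Nat.eq_zero_or_pos j with h0 | h0
  · rw [h0]
    have h1 := kern_le_inv_pow ht z
    have h2 : (1 : ℝ) ≤ 2 ^ (n + 1) := one_le_pow₀ (by norm_num)
    have h3 : 0 < (t ^ n)⁻¹ := by positivity
    simp only [pow_zero, one_mul]
    nlinarith
  · obtain ⟨k, hk⟩ := Nat.exists_eq_succ_of_ne_zero h0.ne'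
    have hk' : 2 ^ k * t ≤ ‖z‖ := by
      by_contra! h
      have := Nat.find_min' hex h
      omega
    refine (kern_le_of_norm_ge ht (by positivity) hk').trans (le_of_eq ?_)
    rw [hk, Nat.succ_eq_add_one, one_div_pow]
    field_simp
    ring

theorem lintegral_kern_le_tsum {t : ℝ} (ht : 0 < t) (x : Sp n) {g : Sp n → ℝ≥0∞}
    (hg : AEMeasurable g volume) :
    ∫⁻ y, ENNReal.ofReal (kern t (x - y)) * g y ≤
      ENNReal.ofReal (2 ^ (n + 1)) * volume (Metric.ball (0 : Sp n) 1) *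
        ∑' j : ℕ, ENNReal.ofReal ((1 / 2) ^ j) * ((∫⁻ y in Metric.ball x (2 ^ j * t), g y) /
          volume (Metric.ball x (2 ^ j * t))) := by
  have hmem : ∀ (r : ℝ) y, (Metric.ball (0 : Sp n) r).indicator (1 : Sp n → ℝ≥0∞) (x - y) * g y =
      (Metric.ball x r).indicator g y := by
    intro r y
    by_cases h : y ∈ Metric.ball x r
    · rw [indicator_of_mem h, indicator_of_mem, Pi.one_apply, one_mul]
      rw [mem_ball_zero_iff, ← dist_eq_norm, dist_comm]; exact h
    · rw [indicator_of_notMem h, indicator_of_notMem, zero_mul]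
      rw [mem_ball_zero_iff, ← dist_eq_norm, dist_comm]; exact h
  calc ∫⁻ y, ENNReal.ofReal (kern t (x - y)) * g y
      ≤ ∫⁻ y, ∑' j : ℕ, ENNReal.ofReal (2 ^ (n + 1) * ((1 / 2) ^ j * ((2 ^ j * t) ^ n)⁻¹)) *
          (Metric.ball x (2 ^ j * t)).indicator g y := by
        refine lintegral_mono fun y => ?_
        refine (mul_le_mul_left (ofReal_kern_le_tsum ht (x - y)) _).trans (le_of_eq ?_)
        rw [← ENNReal.tsum_mul_right]
        simp only [mul_assoc, hmem]
    _ = ∑' j : ℕ, ENNReal.ofReal (2 ^ (n + 1) * ((1 / 2) ^ j * ((2 ^ j * t) ^ n)⁻¹)) *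
          ∫⁻ y in Metric.ball x (2 ^ j * t), g y := by
        rw [lintegral_tsum fun j => (hg.indicator measurableSet_ball).const_mul _]
        congr 1
        funext j
        rw [lintegral_const_mul'' _ (hg.indicator measurableSet_ball),
          lintegral_indicator measurableSet_ball]
    _ = _ := by
        rw [← ENNReal.tsum_mul_left]
        congr 1
        funext j
        have hr : 0 < 2 ^ j * t := by positivity
        have hw0 := (volume_ball_pos (0 : Sp n) one_pos).ne'
        have hwt := (volume_ball_lt_top (0 : Sp n) 1).ne
        rw [volume_ball_eq x hr, ENNReal.ofReal_mul (by positivity),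
          ENNReal.ofReal_mul (by positivity), ENNReal.ofReal_inv_of_pos (by positivity),
          ENNReal.div_eq_inv_mul, ENNReal.mul_inv (Or.inr hwt) (Or.inr hw0)]
        rw [show ∀ a b c d e f : ℝ≥0∞, a * b * (c * (d * e * f)) = (b * e) * (a * (c * d) * f) by
          intros; ring, ENNReal.mul_inv_cancel hw0 hwt, one_mul]

theorem tsum_ofReal_half_pow : ∑' j : ℕ, ENNReal.ofReal ((1 / 2) ^ j) = 2 := by
  rw [← ENNReal.ofReal_tsum_of_nonneg (fun j => by positivity) summable_geometric_two,
    tsum_geometric_two, ENNReal.ofReal_ofNat]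

/-- The constant of the domination of extensions by the maximal function. -/
def domC (n : ℕ) : ℝ := 2 ^ (n + 1) * (volume (Metric.ball (0 : Sp n) 1)).toReal * 2

theorem domC_nonneg (n : ℕ) : 0 ≤ domC n := by unfold domC; positivity

theorem ofReal_domC (n : ℕ) : ENNReal.ofReal (domC n) =
    ENNReal.ofReal (2 ^ (n + 1)) * volume (Metric.ball (0 : Sp n) 1) * 2 := by
  unfold domC
  rw [ENNReal.ofReal_mul (by positivity), ENNReal.ofReal_mul (by positivity),
    ENNReal.ofReal_toReal (volume_ball_lt_top _ _).ne, ENNReal.ofReal_ofNat]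

/-- A bound for the extension in terms of a common bound of all the averages over the centred
balls of radius at least `t`. -/
theorem lintegral_kern_le_of_average_le {t : ℝ} (ht : 0 < t) (x : Sp n) {g : Sp n → ℝ≥0∞}
    (hg : AEMeasurable g volume) {M : ℝ≥0∞}
    (hM : ∀ r, t ≤ r → ∫⁻ y in Metric.ball x r, g y ≤ M * volume (Metric.ball x r)) :
    ∫⁻ y, ENNReal.ofReal (kern t (x - y)) * g y ≤ ENNReal.ofReal (domC n) * M := by
  refine (lintegral_kern_le_tsum ht x hg).trans ?_
  rw [ofReal_domC, mul_assoc _ 2 M]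
  gcongr
  have h2 : ∑' j : ℕ, ENNReal.ofReal ((1 / 2) ^ j) * M = 2 * M := by
    rw [ENNReal.tsum_mul_right, tsum_ofReal_half_pow]
  rw [← h2]
  refine ENNReal.tsum_le_tsum fun j => ?_
  gcongr
  refine ENNReal.div_le_of_le_mul (hM _ ?_)
  have : (1 : ℝ) ≤ 2 ^ j := one_le_pow₀ (by norm_num)
  nlinarith

theorem lintegral_kern_le_maxFn {t : ℝ} (ht : 0 < t) {x y : Sp n} (hy : y ∈ Metric.ball x t)
    {g : Sp n → ℝ≥0∞} (hg : AEMeasurable g volume) :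
    ∫⁻ z, ENNReal.ofReal (kern t (x - z)) * g z ≤ ENNReal.ofReal (domC n) * maxFn g y :=
  lintegral_kern_le_of_average_le ht x hg fun _ hr =>
    lintegral_ball_le_maxFn g (ht.trans_le hr) (Metric.ball_subset_ball hr hy)

theorem WInt.ofReal_kext {f : Sp n → ℝ} (hf : WInt f) (h0 : ∀ y, 0 ≤ f y) {t : ℝ} (ht : 0 < t)
    (x : Sp n) : ENNReal.ofReal (kext (kern t) f x) =
      ∫⁻ y, ENNReal.ofReal (kern t (x - y)) * ENNReal.ofReal (f y) := by
  unfold kext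
  rw [ofReal_integral_eq_lintegral_ofReal (hf.integrable_kern_sub ht x)
    (ae_of_all _ fun y => mul_nonneg (kern_pos ht _).le (h0 y))]
  refine lintegral_congr fun y => ?_
  rw [smul_eq_mul, ENNReal.ofReal_mul (kern_pos ht _).le]

theorem WInt.ofReal_kext_norm {F : Type*} [NormedAddCommGroup F] [NormedSpace ℝ F] {f : Sp n → F}
    (hf : WInt f) {t : ℝ} (ht : 0 < t) (x : Sp n) :
    ENNReal.ofReal (kext (kern t) (fun y => ‖f y‖) x) =
      ∫⁻ y, ENNReal.ofReal (kern t (x - y)) * ‖f y‖ₑ := by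
  rw [hf.norm.ofReal_kext (fun y => norm_nonneg _) ht]
  simp only [ofReal_norm]

theorem WInt.ofReal_kext_norm_le_maxFn {F : Type*} [NormedAddCommGroup F] [NormedSpace ℝ F]
    {f : Sp n → F} (hf : WInt f) {t : ℝ} (ht : 0 < t) {x y : Sp n} (hy : y ∈ Metric.ball x t) :
    ENNReal.ofReal (kext (kern t) (fun y => ‖f y‖) x) ≤
      ENNReal.ofReal (domC n) * maxFn (fun z => ‖f z‖ₑ) y := by
  rw [hf.ofReal_kext_norm ht]
  exact lintegral_kern_le_maxFn ht hy hf.aestronglyMeasurable.enorm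

/-! ### Membership in the weighted class -/

theorem kern_one_le_one (x : Sp n) : kern 1 x ≤ 1 := by
  simpa using kern_le_inv_pow one_pos x

variable {F : Type*} [NormedAddCommGroup F] [NormedSpace ℝ F] {f : Sp n → F}

theorem wInt_of_integrable (hf : Integrable f) : WInt f := by
  refine hf.norm.mono' ((measurable_kern_right 1).aestronglyMeasurable.smul
    hf.aestronglyMeasurable) (ae_of_all _ fun y => ?_)
  rw [norm_smul, Real.norm_eq_abs, abs_of_pos (kern_pos one_pos y)]
  exact mul_le_of_le_one_left (norm_nonneg _) (kern_one_le_one y)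

theorem le_one_add_rpow {a p : ℝ} (ha : 0 ≤ a) (hp : 1 ≤ p) : a ≤ 1 + a ^ p := by
  rcases le_total a 1 with h | h
  · have := Real.rpow_nonneg ha p; linarith
  · have := Real.rpow_le_rpow_of_exponent_le h hp
    rw [Real.rpow_one] at this; linarith

theorem wInt_of_rpow {p : ℝ} (hp : 1 ≤ p) (hm : AEStronglyMeasurable f volume)
    (hf : WInt (fun y => ‖f y‖ ^ p)) : WInt f := by
  refine ((wInt_const (1 : ℝ)).add hf).of_norm_le hm (ae_of_all _ fun y => ?_)
  rw [Real.norm_of_nonneg (by positivity)]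
  exact le_one_add_rpow (norm_nonneg _) hp

theorem wInt_of_lintegral_rpow {p : ℝ} (hp : 1 ≤ p) (hm : AEStronglyMeasurable f volume)
    (hf : ∫⁻ y, ‖f y‖ₑ ^ p < ∞) : WInt f := by
  refine wInt_of_rpow hp hm (wInt_of_integrable ⟨?_, ?_⟩)
  · exact (hm.norm.aemeasurable.pow_const p).aestronglyMeasurable
  · rw [HasFiniteIntegral]
    refine lt_of_eq_of_lt (lintegral_congr fun y => ?_) hf
    rw [← ofReal_norm, ← ofReal_norm, Real.norm_of_nonneg (by positivity),
      ENNReal.ofReal_rpow_of_nonneg (norm_nonneg _) (by linarith)]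

theorem WInt.locallyIntegrable (hf : WInt f) : LocallyIntegrable f volume := by
  rw [locallyIntegrable_iff]
  intro k hk
  obtain ⟨R, hR⟩ := hk.isBounded.exists_norm_le
  set C := (1 / 1 * (1 + R ^ 2) ^ (((n : ℝ) + 1) / 2)) with hC
  refine Integrable.mono' (g := fun y => C * ‖kern 1 y • f y‖) ?_
    hf.aestronglyMeasurable.restrict ?_
  · exact ((Integrable.norm hf).const_mul C).integrableOn
  · refine (ae_restrict_iff' hk.measurableSet).2 (ae_of_all _ fun y hy => ?_)
    rw [norm_smul, Real.norm_eq_abs, abs_of_pos (kern_pos one_pos y), ← mul_assoc]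
    refine le_mul_of_one_le_left (norm_nonneg _) ?_
    have h1 : kern 1 (0 : Sp n) = 1 := by simp [kern]
    have h2 : kern 1 (0 : Sp n) ≤ C * kern 1 y := by
      refine kern_le_of_le one_pos one_pos (show (0 : ℝ) < 1 + R ^ 2 by positivity) 0 y ?_
      have := hR y hy
      have := norm_nonneg y
      simp only [norm_zero]
      nlinarith
    rwa [h1] at h2

end Domination

/-! ### Normalisation and approximation of the identity -/

section Normalisation

variable {n : ℕ}

/-- The total mass of the unnormalised kernel. -/
def kernMass (n : ℕ) : ℝ := ∫ x : Sp n, kern 1 x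

theorem kernMass_pos (n : ℕ) : 0 < kernMass n := by
  unfold kernMass
  rw [integral_pos_iff_support_of_nonneg (fun x => (kern_pos one_pos x).le)
    (integrable_kern one_pos)]
  have : Function.support (fun x : Sp n => kern 1 x) = univ :=
    eq_univ_of_forall fun x => (kern_pos one_pos x).ne'
  rw [this]
  exact (volume_ball_pos (0 : Sp n) one_pos).trans_le (measure_mono (subset_univ _))

theorem integral_kern {t : ℝ} (ht : 0 < t) : ∫ x : Sp n, kern t x = kernMass n := by
  have h1 := Measure.integral_comp_smul (volume : Measure (Sp n)) (fun x => kern t x) t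
  simp only [kern_scale ht, finrank_euclideanSpace, Fintype.card_fin, integral_const_mul] at h1
  rw [abs_of_pos (by positivity), smul_eq_mul] at h1
  exact (mul_left_cancel₀ (by positivity) h1).symm

theorem integral_kern_sub {t : ℝ} (ht : 0 < t) (x : Sp n) :
    ∫ y, kern t (x - y) = kernMass n := by
  rw [integral_sub_left_eq_self (fun y => kern t y) volume x, integral_kern ht]

theorem lintegral_kern_sub {t : ℝ} (ht : 0 < t) (x : Sp n) :
    ∫⁻ y, ENNReal.ofReal (kern t (x - y)) = ENNReal.ofReal (kernMass n) := by
  rw [← integral_kern_sub ht x, ofReal_integral_eq_lintegral_ofReal]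
  · exact ((integrable_kern ht).comp_sub_left x)
  · exact ae_of_all _ fun y => (kern_pos ht _).le

variable {F : Type*} [NormedAddCommGroup F] [NormedSpace ℝ F] {f : Sp n → F}

theorem integral_kernT_sub {t : ℝ} (ht : 0 < t) (x : Sp n) : ∫ y, kernT t (x - y) = 0 := by
  have h1 := (wInt_const (n := n) (1 : ℝ)).hasDerivAt_kext_kern ht x
  have h2 : (fun s => kext (kern s) (fun _ : Sp n => (1 : ℝ)) x) =ᶠ[𝓝 t] fun _ => kernMass n := by
    filter_upwards [lt_mem_nhds ht] with s hs
    simp [kext, integral_kern_sub hs]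
  have h3 := (h1.congr_of_eventuallyEq h2.symm).unique (hasDerivAt_const t (kernMass n))
  simpa [kext] using h3

theorem kext_sub_const [CompleteSpace F] (hf : WInt f) {K : Sp n → ℝ} (hK : Measurable K)
    {t C : ℝ} (ht : 0 < t) (h : ∀ z, |K z| ≤ C * kern t z) (c : F) (x : Sp n) :
    kext K f x = kext K (fun y => f y - c) x + (∫ y, K (x - y)) • c := by
  have h1 := hf.integrable_of_le hK ht h x
  have h2 := (wInt_const c).integrable_of_le hK ht h x
  have h3 : (∫ y, K (x - y)) • c = ∫ y, K (x - y) • c := (integral_smul_const _ _).symm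
  unfold kext
  rw [h3, ← integral_add _ h2]
  · simp [smul_sub]
  · simp only [smul_sub]; exact h1.sub h2

theorem WInt.sub_const (hf : WInt f) (c : F) : WInt (fun y => f y - c) := by
  simpa [sub_eq_add_neg] using hf.add (wInt_const (-c))

/-- Approximation of (a multiple of) the identity at Lebesgue points. -/
theorem WInt.ae_tendsto_kext [NeZero n] [CompleteSpace F] (hf : WInt f) {K : ℝ → Sp n → ℝ}
    (hK : ∀ s, Measurable (K s)) {C a : ℝ}
    (hb : ∀ s, 0 < s → ∀ z, |K s z| ≤ C * kern s z)
    (ha : ∀ s, 0 < s → ∀ x, ∫ y, K s (x - y) = a) :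
    ∀ᵐ x, Tendsto (fun s => kext (K s) f x) (𝓝[>] 0) (𝓝 (a • f x)) := by
  filter_upwards [IsUnifLocDoublingMeasure.ae_tendsto_average_norm_sub (volume : Measure (Sp n))
    hf.locallyIntegrable 1] with x hx
  rw [tendsto_iff_norm_sub_tendsto_zero]
  set g : Sp n → F := fun y => f y - f x with hg
  have hgW : WInt g := hf.sub_const _
  have hlim := hx (l := 𝓝[>] (0 : ℝ)) (fun _ => x) id tendsto_id
    (by
      filter_upwards [self_mem_nhdsWithin] with s hs
      simpa using (le_of_lt hs))
  have hzero : ∀ s, 0 < s → ‖kext (K s) f x - a • f x‖ ≤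
      C * kext (kern s) (fun y => ‖g y‖) x := by
    intro s hs
    rw [kext_sub_const hf (hK s) hs (hb s hs) (f x) x, ha s hs, add_sub_cancel_right]
    exact hgW.norm_kext_le hs (hb s hs) x
  suffices h : Tendsto (fun s => kext (kern s) (fun y => ‖g y‖) x) (𝓝[>] 0) (𝓝 0) by
    refine squeeze_zero' (Eventually.of_forall fun s => norm_nonneg _) ?_
      (by simpa using h.const_mul C)
    filter_upwards [self_mem_nhdsWithin] with s hs
    exact hzero s hs
  rw [Metric.tendsto_nhds]
  intro ε hε
  obtain ⟨η, hη, hηb⟩ : ∃ η > 0, ∀ r, 0 < r → r ≤ η →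
      ∫⁻ y in Metric.ball x r, ‖g y‖ₑ ≤
        ENNReal.ofReal (ε / 4 / (domC n + 1)) * volume (Metric.ball x r) := by
    have hε' : 0 < ε / 4 / (domC n + 1) := by have := domC_nonneg n; positivity
    have h1 := hlim (Iio_mem_nhds hε')
    rw [mem_map, mem_nhdsGT_iff_exists_Ioc_subset] at h1
    obtain ⟨η, hη, h2⟩ := h1
    refine ⟨η, hη, fun r hr hrη => ?_⟩
    have h3 : (⨍ y in Metric.closedBall x r, ‖f y - f x‖) < ε / 4 / (domC n + 1) :=
      h2 (show r ∈ Ioc 0 η from ⟨hr, hrη⟩)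
    have hvol : volume (Metric.closedBall x r) = volume (Metric.ball x r) :=
      Measure.addHaar_closedBall_eq_addHaar_ball _ _ _
    have hint : IntegrableOn g (Metric.closedBall x r) :=
      (hgW.locallyIntegrable.integrableOn_isCompact (isCompact_closedBall x r))
    rw [setAverage_eq, smul_eq_mul, measureReal_def, hvol,
      inv_mul_lt_iff₀ (ENNReal.toReal_pos (volume_ball_pos x hr).ne'
        (volume_ball_lt_top x r).ne)] at h3
    calc ∫⁻ y in Metric.ball x r, ‖g y‖ₑ ≤ ∫⁻ y in Metric.closedBall x r, ‖g y‖ₑ :=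
          lintegral_mono_set Metric.ball_subset_closedBall
      _ = ENNReal.ofReal (∫ y in Metric.closedBall x r, ‖g y‖) :=
          (ofReal_integral_norm_eq_lintegral_enorm hint).symm
      _ ≤ ENNReal.ofReal ((volume (Metric.ball x r)).toReal * (ε / 4 / (domC n + 1))) :=
          ENNReal.ofReal_le_ofReal h3.le
      _ = _ := by
          rw [ENNReal.ofReal_mul (by positivity), mul_comm,
            ENNReal.ofReal_toReal (volume_ball_lt_top x r).ne]
  set A := kext (kern η) (fun y => ‖g y‖) x with hA
  have hA0 : 0 ≤ A := kext_nonneg (fun y => norm_nonneg _) hη x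
  -- the part of the integral over the complement of `ball x η` is `O(s)`
  set D := (1 / η * 2 ^ (((n : ℝ) + 1) / 2)) * A with hD
  have hD0 : 0 ≤ D := by positivity
  filter_upwards [Ioo_mem_nhdsGT (show (0 : ℝ) < min η (ε / 2 / (D + 1)) by positivity)] with s hs
  have hs0 : 0 < s := hs.1
  have hsD : s * D < ε / 2 := by
    have h1 : s < ε / 2 / (D + 1) := hs.2.trans_le (min_le_right _ _)
    rw [lt_div_iff₀ (by positivity)] at h1
    nlinarith
  rw [Real.dist_eq, sub_zero, abs_of_nonneg (kext_nonneg (fun y => norm_nonneg _) hs0 x)]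
  set gi : Sp n → ℝ≥0∞ := (Metric.ball x η).indicator fun y => ‖g y‖ₑ with hgi
  have hgm : AEMeasurable (fun y => ‖g y‖ₑ) volume := hgW.aestronglyMeasurable.enorm
  have hnear : ∫⁻ y, ENNReal.ofReal (kern s (x - y)) * gi y ≤
      ENNReal.ofReal (domC n) * ENNReal.ofReal (ε / 4 / (domC n + 1)) := by
    refine lintegral_kern_le_of_average_le hs0 x (hgm.indicator measurableSet_ball) fun r hr => ?_
    have hr0 := hs0.trans_le hr
    rw [lintegral_indicator measurableSet_ball, Measure.restrict_restrict measurableSet_ball]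
    rcases le_total r η with h | h
    · exact (lintegral_mono_set inter_subset_right).trans (hηb r hr0 h)
    · refine ((lintegral_mono_set inter_subset_left).trans (hηb η hη le_rfl)).trans ?_
      gcongr
  have hfar : ∀ y, ENNReal.ofReal (kern s (x - y)) * ‖g y‖ₑ ≤
      ENNReal.ofReal (kern s (x - y)) * gi y +
        ENNReal.ofReal (s * (1 / η * 2 ^ (((n : ℝ) + 1) / 2))) *
          (ENNReal.ofReal (kern η (x - y)) * ‖g y‖ₑ) := by
    intro y
    by_cases hy : y ∈ Metric.ball x η
    · rw [hgi, indicator_of_mem hy]; exact le_self_add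
    · rw [hgi, indicator_of_notMem hy, mul_zero, zero_add, ← mul_assoc,
        ← ENNReal.ofReal_mul (by positivity)]
      gcongr
      refine (kern_le_of_le hs0 hη (by norm_num : (0:ℝ) < 2) (x - y) (x - y) ?_).trans
        (le_of_eq (by ring))
      rw [Metric.mem_ball, not_lt, dist_comm, dist_eq_norm] at hy
      nlinarith [sq_nonneg s]
  have hfin : ENNReal.ofReal (kext (kern s) (fun y => ‖g y‖) x) ≤
      ENNReal.ofReal (ε / 4 + s * D) := by
    rw [hgW.ofReal_kext_norm hs0]
    refine (lintegral_mono hfar).trans ?_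
    rw [lintegral_add_left', lintegral_const_mul' _ _ ENNReal.ofReal_ne_top,
      ← hgW.ofReal_kext_norm hη, ← ENNReal.ofReal_mul (by positivity), ENNReal.ofReal_add
      (by positivity) (by positivity)]
    · refine add_le_add (hnear.trans ?_) (ENNReal.ofReal_le_ofReal (le_of_eq ?_))
      · rw [← ENNReal.ofReal_mul (domC_nonneg n)]
        refine ENNReal.ofReal_le_ofReal ?_
        have := domC_nonneg n
        rw [mul_div_assoc', div_le_iff₀ (by positivity)]
        nlinarith
      · rw [hD, ← hA]; ring
    · exact (((measurable_kern_right s).comp (by fun_prop)).ennreal_ofReal.aemeasurable).mul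
        (hgm.indicator measurableSet_ball)
  rw [ENNReal.ofReal_le_ofReal_iff (by positivity)] at hfin
  linarith

end Normalisation

/-! ### The semigroup property -/

section Semigroup

variable {n : ℕ}

theorem wInt_kern {t : ℝ} (ht : 0 < t) : WInt (fun x : Sp n => kern t x) :=
  wInt_of_integrable (integrable_kern ht)

theorem wInt_of_abs_le {L : Sp n → ℝ} (hL : Measurable L) {t C : ℝ} (ht : 0 < t)
    (h : ∀ z, |L z| ≤ C * kern t z) : WInt L := by
  refine ((wInt_kern ht).const_smul C).of_norm_le hL.aestronglyMeasurable (ae_of_all _ fun y => ?_)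
  rw [Real.norm_eq_abs, Real.norm_eq_abs, smul_eq_mul]
  exact (h y).trans (le_abs_self _)

/-- Differentiation of a convolution of two kernels that both depend on the parameter. -/
theorem hasDerivAt_integral_mul_kern {A A' B B' : ℝ → Sp n → ℝ} (hA : ∀ τ, Measurable (A τ))
    (hA' : ∀ τ, Measurable (A' τ)) (hB : ∀ τ, Measurable (B τ)) (hB' : ∀ τ, Measurable (B' τ))
    {s t C δ : ℝ} (hs : 0 < s) (ht : 0 < t) (hC : 0 ≤ C) (hδ : 0 < δ)
    (bA : ∀ τ ∈ Metric.ball 0 δ, ∀ z, |A τ z| ≤ C * kern s z)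
    (bA' : ∀ τ ∈ Metric.ball 0 δ, ∀ z, |A' τ z| ≤ C * kern s z)
    (bB : ∀ τ ∈ Metric.ball 0 δ, ∀ z, |B τ z| ≤ C * kern t z)
    (bB' : ∀ τ ∈ Metric.ball 0 δ, ∀ z, |B' τ z| ≤ C * kern t z)
    (dA : ∀ τ ∈ Metric.ball 0 δ, ∀ z, HasDerivAt (fun τ => A τ z) (A' τ z) τ)
    (dB : ∀ τ ∈ Metric.ball 0 δ, ∀ z, HasDerivAt (fun τ => B τ z) (B' τ z) τ) (x : Sp n) :
    HasDerivAt (fun τ => ∫ y, A τ (x - y) * B τ y)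
      (∫ y, (A' 0 (x - y) * B 0 y + A 0 (x - y) * B' 0 y)) 0 := by
  have h0 : (0 : ℝ) ∈ Metric.ball (0 : ℝ) δ := Metric.mem_ball_self hδ
  have hk : Integrable (fun y => kern s (x - y) * kern t y) :=
    (wInt_kern ht).integrable_kern_sub hs x
  have hmul : ∀ {a b : ℝ} {y : Sp n}, |a| ≤ C * kern s (x - y) → |b| ≤ C * kern t y →
      |a * b| ≤ C ^ 2 * (kern s (x - y) * kern t y) := by
    intro a b y ha hb
    rw [abs_mul]
    have := kern_pos hs (x - y)
    calc |a| * |b| ≤ (C * kern s (x - y)) * (C * kern t y) := by gcongr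
      _ = _ := by ring
  refine (hasDerivAt_integral_of_dominated_loc_of_deriv_le
    (bound := fun y => 2 * C ^ 2 * (kern s (x - y) * kern t y))
    (F := fun τ y => A τ (x - y) * B τ y)
    (F' := fun τ y => A' τ (x - y) * B τ y + A τ (x - y) * B' τ y)
    (Metric.ball_mem_nhds 0 hδ) ?_ ?_ ?_ ?_ ?_ ?_).2
  · exact Eventually.of_forall fun τ =>
      (((hA τ).comp (by fun_prop)).mul (hB τ)).aestronglyMeasurable
  · refine (hk.const_mul (C ^ 2)).mono'
      (((hA 0).comp (by fun_prop)).mul (hB 0)).aestronglyMeasurable (ae_of_all _ fun y => ?_)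
    exact hmul (bA 0 h0 _) (bB 0 h0 _)
  · exact ((((hA' 0).comp (by fun_prop)).mul (hB 0)).add
      (((hA 0).comp (by fun_prop)).mul (hB' 0))).aestronglyMeasurable
  · refine ae_of_all _ fun y τ hτ => (norm_add_le _ _).trans ?_
    have e1 := hmul (y := y) (bA' τ hτ _) (bB τ hτ _)
    have e2 := hmul (y := y) (bA τ hτ _) (bB' τ hτ _)
    rw [Real.norm_eq_abs, Real.norm_eq_abs]
    linarith
  · exact hk.const_mul _
  · exact ae_of_all _ fun y τ hτ => (dA τ hτ _).mul (dB τ hτ _)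

theorem add_mem_ball {s τ δ : ℝ} (hδ : δ ≤ s / 2) (hτ : τ ∈ Metric.ball 0 δ) :
    s + τ ∈ Metric.ball s (s / 2) ∧ s - τ ∈ Metric.ball s (s / 2) := by
  rw [Metric.mem_ball, Real.dist_eq, sub_zero] at hτ
  constructor <;> rw [Metric.mem_ball, Real.dist_eq, abs_lt] <;> rw [abs_lt] at hτ <;>
    constructor <;> linarith

/-- A common constant for the local bounds of the kernel and its derivatives at height `t`. -/
def localC (n : ℕ) (t : ℝ) : ℝ :=
  harnackC n + kernC n / (t / 2) * harnackC n + kernC n / (t / 2) ^ 2 * harnackC n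

theorem local_bounds {s t : ℝ} (ht : 0 < t) (hs : s ∈ Metric.ball t (t / 2)) (z : Sp n) :
    |kern s z| ≤ localC n t * kern t z ∧ |kernT s z| ≤ localC n t * kern t z ∧
      |kernTT s z| ≤ localC n t * kern t z := by
  have h1 := harnackC_pos n
  have h2 := kernC_pos n
  have h3 := kern_pos ht z
  obtain ⟨h4, h5, h6⟩ := kern_harnack_time ht hs z
  have e1 : 0 < kernC n / (t / 2) * harnackC n := by positivity
  have e2 : 0 < kernC n / (t / 2) ^ 2 * harnackC n := by positivity
  refine ⟨?_, (abs_kernT_le_of_mem ht hs z).trans ?_, (abs_kernTT_le_of_mem ht hs z).trans ?_⟩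
  · rw [abs_of_pos (kern_pos h4 z)]
    refine h6.trans ?_
    gcongr
    unfold localC; linarith
  · gcongr
    unfold localC; linarith
  · gcongr
    unfold localC; linarith

theorem localC_pos (n : ℕ) {t : ℝ} (ht : 0 < t) : 0 < localC n t := by
  have h1 := harnackC_pos n
  have h2 := kernC_pos n
  unfold localC; positivity

theorem integrable_mul_of_bounds {K L : Sp n → ℝ} (hK : Measurable K) (hL : Measurable L)
    {s t C D : ℝ} (hs : 0 < s) (ht : 0 < t) (bK : ∀ z, |K z| ≤ C * kern s z)
    (bL : ∀ z, |L z| ≤ D * kern t z) (x : Sp n) : Integrable (fun y => K (x - y) * L y) :=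
  (wInt_of_abs_le hL ht bL).integrable_of_le hK hs bK x

/-- The second spatial derivative can be moved across a convolution of kernels. -/
theorem integral_kernXX_mul_kern {s t : ℝ} (hs : 0 < s) (ht : 0 < t) (i : Fin n) (x : Sp n) :
    ∫ y, kernXX i s (x - y) * kern t y = ∫ y, kern s (x - y) * kernXX i t y := by
  have mk := fun u => measurable_kern_right (n := n) u
  have mX := fun u => measurable_kernX_right (n := n) i u
  have mXX := fun u => measurable_kernXX_right (n := n) i u
  have hflip : ∀ {g g' : Sp n → ℝ}, (∀ z (h : ℝ),
      HasDerivAt (fun r : ℝ => g (z + r • basisVec i)) (g' (z + h • basisVec i)) h) →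
      ∀ y, HasLineDerivAt ℝ (fun y => g (x - y)) (-g' (x - y)) y (basisVec i) := by
    intro g g' h y
    have h1 := h (x - y) (-0)
    have h2 := HasDerivAt.scomp (0 : ℝ) h1 (hasDerivAt_neg (0 : ℝ))
    simp only [HasLineDerivAt]
    refine (h2.congr_deriv (by simp)).congr_of_eventuallyEq (Eventually.of_forall fun r => ?_)
    simp only [Function.comp]
    congr 1
    rw [neg_smul]; abel
  have hline : ∀ {g g' : Sp n → ℝ}, (∀ z (h : ℝ),
      HasDerivAt (fun r : ℝ => g (z + r • basisVec i)) (g' (z + h • basisVec i)) h) →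
      ∀ y, HasLineDerivAt ℝ g (g' y) y (basisVec i) := by
    intro g g' h y
    simpa [HasLineDerivAt] using h y 0
  have h1 := integral_bilinear_hasLineDerivAt_right_eq_neg_left_of_integrable
    (B := ContinuousLinearMap.mul ℝ ℝ) (μ := volume) (v := basisVec i)
    (f := fun y => kernX i s (x - y)) (f' := fun y => -kernXX i s (x - y))
    (g := fun y => kern t y) (g' := fun y => kernX i t y)
    (by
      simpa using (integrable_mul_of_bounds (mXX s) (mk t) hs ht (abs_kernXX_le hs i)
        (abs_kern_le ht) x).neg)
    (integrable_mul_of_bounds (mX s) (mX t) hs ht (abs_kernX_le hs i) (abs_kernX_le ht i) x)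
    (integrable_mul_of_bounds (mX s) (mk t) hs ht (abs_kernX_le hs i) (abs_kern_le ht) x)
    (fun y _ => hflip (hasDerivAt_kernX_line hs i) y)
    (fun y _ => hline (hasDerivAt_kern_line ht i) y)
  have h2 := integral_bilinear_hasLineDerivAt_right_eq_neg_left_of_integrable
    (B := ContinuousLinearMap.mul ℝ ℝ) (μ := volume) (v := basisVec i)
    (f := fun y => kern s (x - y)) (f' := fun y => -kernX i s (x - y))
    (g := fun y => kernX i t y) (g' := fun y => kernXX i t y)
    (by
      simpa using (integrable_mul_of_bounds (mX s) (mX t) hs ht (abs_kernX_le hs i)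
        (abs_kernX_le ht i) x).neg)
    (integrable_mul_of_bounds (mk s) (mXX t) hs ht (abs_kern_le hs) (abs_kernXX_le ht i) x)
    (integrable_mul_of_bounds (mk s) (mX t) hs ht (abs_kern_le hs) (abs_kernX_le ht i) x)
    (fun y _ => hflip (hasDerivAt_kern_line hs i) y)
    (fun y _ => hline (hasDerivAt_kernX_line ht i) y)
  simp only [ContinuousLinearMap.mul_apply', neg_mul, integral_neg, neg_neg] at h1 h2
  rw [← h1, h2]

theorem kernTT_eq_neg_sum {t : ℝ} (ht : 0 < t) (x : Sp n) :
    kernTT t x = -∑ i, kernXX i t x := by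
  linarith [kernTT_add_sum_kernXX ht x]

theorem integral_kernTT_mul_kern {s t : ℝ} (hs : 0 < s) (ht : 0 < t) (x : Sp n) :
    ∫ y, kernTT s (x - y) * kern t y = ∫ y, kern s (x - y) * kernTT t y := by
  simp only [kernTT_eq_neg_sum hs, kernTT_eq_neg_sum ht, neg_mul, mul_neg, integral_neg,
    Finset.sum_mul, Finset.mul_sum]
  rw [integral_finsetSum _ fun i _ => integrable_mul_of_bounds (measurable_kernXX_right i s)
      (measurable_kern_right t) hs ht (abs_kernXX_le hs i) (abs_kern_le ht) x,
    integral_finsetSum _ fun i _ => integrable_mul_of_bounds (measurable_kern_right s)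
      (measurable_kernXX_right i t) hs ht (abs_kern_le hs) (abs_kernXX_le ht i) x]
  simp only [integral_kernXX_mul_kern hs ht]

theorem hasDerivAt_comp_const_add {g : ℝ → ℝ} {g' s τ : ℝ} (h : HasDerivAt g g' (s + τ)) :
    HasDerivAt (fun τ => g (s + τ)) g' τ := h.comp_const_add s τ

/-- The difference `k_s' * k_t - k_s * k_t'` does not change when both times move by the same
amount. -/
theorem hasDerivAt_wronskian {s t : ℝ} (hs : 0 < s) (ht : 0 < t) (x : Sp n) :
    HasDerivAt (fun τ => (∫ y, kernT (s + τ) (x - y) * kern (t + τ) y) -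
      ∫ y, kern (s + τ) (x - y) * kernT (t + τ) y) 0 0 := by
  have hδ : 0 < min (s / 2) (t / 2) := by positivity
  set C := localC n s + localC n t with hC
  have hCs := localC_pos n hs
  have hCt := localC_pos n ht
  have ms : ∀ τ ∈ Metric.ball (0 : ℝ) (min (s / 2) (t / 2)), s + τ ∈ Metric.ball s (s / 2) :=
    fun τ hτ => (add_mem_ball (min_le_left _ _) hτ).1
  have mt : ∀ τ ∈ Metric.ball (0 : ℝ) (min (s / 2) (t / 2)), t + τ ∈ Metric.ball t (t / 2) :=
    fun τ hτ => (add_mem_ball (min_le_right _ _) hτ).1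
  have bs : ∀ τ ∈ Metric.ball (0 : ℝ) (min (s / 2) (t / 2)), ∀ z : Sp n,
      |kern (s + τ) z| ≤ C * kern s z ∧ |kernT (s + τ) z| ≤ C * kern s z ∧
        |kernTT (s + τ) z| ≤ C * kern s z := by
    intro τ hτ z
    obtain ⟨h1, h2, h3⟩ := local_bounds hs (ms τ hτ) z
    have := kern_pos hs z
    have h4 : localC n s * kern s z ≤ C * kern s z := by gcongr; linarith
    exact ⟨h1.trans h4, h2.trans h4, h3.trans h4⟩
  have bt : ∀ τ ∈ Metric.ball (0 : ℝ) (min (s / 2) (t / 2)), ∀ z : Sp n,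
      |kern (t + τ) z| ≤ C * kern t z ∧ |kernT (t + τ) z| ≤ C * kern t z ∧
        |kernTT (t + τ) z| ≤ C * kern t z := by
    intro τ hτ z
    obtain ⟨h1, h2, h3⟩ := local_bounds ht (mt τ hτ) z
    have := kern_pos ht z
    have h4 : localC n t * kern t z ≤ C * kern t z := by gcongr; linarith
    exact ⟨h1.trans h4, h2.trans h4, h3.trans h4⟩
  have ps := fun τ hτ => (kern_harnack_time hs (ms τ hτ) (0 : Sp n)).1
  have pt := fun τ hτ => (kern_harnack_time ht (mt τ hτ) (0 : Sp n)).1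
  have h1 := hasDerivAt_integral_mul_kern (A := fun τ => kernT (s + τ))
    (A' := fun τ => kernTT (s + τ)) (B := fun τ => kern (t + τ)) (B' := fun τ => kernT (t + τ))
    (fun _ => measurable_kernT_right _) (fun _ => measurable_kernTT_right _)
    (fun _ => measurable_kern_right _) (fun _ => measurable_kernT_right _) hs ht
    (show 0 ≤ C by positivity) hδ
    (fun τ hτ z => (bs τ hτ z).2.1) (fun τ hτ z => (bs τ hτ z).2.2)
    (fun τ hτ z => (bt τ hτ z).1) (fun τ hτ z => (bt τ hτ z).2.1)
    (fun τ hτ z => hasDerivAt_comp_const_add (hasDerivAt_kernT (ps τ hτ) z))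
    (fun τ hτ z => hasDerivAt_comp_const_add (hasDerivAt_kern (pt τ hτ) z)) x
  have h2 := hasDerivAt_integral_mul_kern (A := fun τ => kern (s + τ))
    (A' := fun τ => kernT (s + τ)) (B := fun τ => kernT (t + τ)) (B' := fun τ => kernTT (t + τ))
    (fun _ => measurable_kern_right _) (fun _ => measurable_kernT_right _)
    (fun _ => measurable_kernT_right _) (fun _ => measurable_kernTT_right _) hs ht
    (show 0 ≤ C by positivity) hδ
    (fun τ hτ z => (bs τ hτ z).1) (fun τ hτ z => (bs τ hτ z).2.1)
    (fun τ hτ z => (bt τ hτ z).2.1) (fun τ hτ z => (bt τ hτ z).2.2)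
    (fun τ hτ z => hasDerivAt_comp_const_add (hasDerivAt_kern (ps τ hτ) z))
    (fun τ hτ z => hasDerivAt_comp_const_add (hasDerivAt_kernT (pt τ hτ) z)) x
  refine (h1.sub h2).congr_deriv ?_
  simp only [add_zero]
  rw [integral_add, integral_add, integral_kernTT_mul_kern hs ht]
  · ring
  · exact integrable_mul_of_bounds (measurable_kernT_right s) (measurable_kernT_right t) hs ht
      (abs_kernT_le hs) (abs_kernT_le ht) x
  · exact integrable_mul_of_bounds (measurable_kern_right s) (measurable_kernTT_right t) hs ht
      (abs_kern_le hs) (abs_kernTT_le ht) x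
  · exact integrable_mul_of_bounds (measurable_kernTT_right s) (measurable_kern_right t) hs ht
      (abs_kernTT_le hs) (abs_kern_le ht) x
  · exact integrable_mul_of_bounds (measurable_kernT_right s) (measurable_kernT_right t) hs ht
      (abs_kernT_le hs) (abs_kernT_le ht) x

theorem integral_kern_mul_kern_le {s t : ℝ} (hs : 0 < s) (ht : 0 < t) (x : Sp n) :
    ∫ y, kern s (x - y) * kern t y ≤ (s ^ n)⁻¹ * kernMass n := by
  rw [← integral_kern ht, ← integral_const_mul]
  refine integral_mono ((wInt_kern ht).integrable_kern_sub hs x)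
    ((integrable_kern ht).const_mul _) fun y => ?_
  have := kern_pos ht y
  have h := kern_le_inv_pow hs (x - y)
  show kern s (x - y) * kern t y ≤ (s ^ n)⁻¹ * kern t y
  gcongr

theorem abs_integral_mul_le {K L : Sp n → ℝ} {s t C D : ℝ} (hs : 0 < s) (ht : 0 < t)
    (bK : ∀ z, |K z| ≤ C * kern s z) (bL : ∀ z, |L z| ≤ D * kern t z) (x : Sp n) :
    |∫ y, K (x - y) * L y| ≤ C * D * ((s ^ n)⁻¹ * kernMass n) := by
  have hCn : 0 ≤ C := by
    have := (abs_nonneg _).trans (bK 0)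
    exact nonneg_of_mul_nonneg_left this (kern_pos hs _)
  have hDn : 0 ≤ D := by
    have := (abs_nonneg _).trans (bL 0)
    exact nonneg_of_mul_nonneg_left this (kern_pos ht _)
  calc |∫ y, K (x - y) * L y| ≤ ∫ y, C * D * (kern s (x - y) * kern t y) := by
        rw [← Real.norm_eq_abs]
        refine norm_integral_le_of_norm_le
          (((wInt_kern ht).integrable_kern_sub hs x).const_mul _) (ae_of_all _ fun y => ?_)
        rw [Real.norm_eq_abs, abs_mul]
        have := kern_pos hs (x - y)
        calc |K (x - y)| * |L y| ≤ (C * kern s (x - y)) * (D * kern t y) := by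
              gcongr
              · exact bK _
              · exact bL _
          _ = _ := by ring
    _ = C * D * ∫ y, kern s (x - y) * kern t y := integral_const_mul _ _
    _ ≤ _ := by
        gcongr
        exact integral_kern_mul_kern_le hs ht x

/-- The identity `k_s' * k_t = k_s * k_t'`. -/
theorem integral_kernT_mul_kern {s t : ℝ} (hs : 0 < s) (ht : 0 < t) (x : Sp n) :
    ∫ y, kernT s (x - y) * kern t y = ∫ y, kern s (x - y) * kernT t y := by
  set W : ℝ → ℝ := fun τ => (∫ y, kernT (s + τ) (x - y) * kern (t + τ) y) -
      ∫ y, kern (s + τ) (x - y) * kernT (t + τ) y with hW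
  have hd : ∀ τ, 0 ≤ τ → HasDerivAt W 0 τ := by
    intro τ hτ
    have h := hasDerivAt_wronskian (show 0 < s + τ by linarith) (show 0 < t + τ by linarith) x
    have h2 : HasDerivAt (fun r => W (τ + r)) 0 0 := by
      refine h.congr_of_eventuallyEq (Eventually.of_forall fun r => ?_)
      simp only [hW, add_assoc]
    have h3 := HasDerivAt.comp_const_add (-τ) τ (f := fun r => W (τ + r)) (f' := 0)
      (by rw [neg_add_cancel]; exact h2)
    simpa using h3
  have hconst : ∀ τ, 0 ≤ τ → W τ = W 0 := by
    intro τ hτ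
    refine constant_of_derivWithin_zero (a := 0) (b := τ) (f := W) ?_ ?_ τ ⟨hτ, le_rfl⟩
    · exact fun r hr => (hd r hr.1).differentiableAt.differentiableWithinAt
    · intro r hr
      exact (hd r hr.1).hasDerivWithinAt.derivWithin
        (uniqueDiffOn_Icc (hr.1.trans_lt hr.2) r ⟨hr.1, hr.2.le⟩)
  have hM := kernMass_pos n
  have hK := kernC_pos n
  have hbound : ∀ τ, 0 ≤ τ → |W 0| ≤
      2 * kernC n * ((s ^ n)⁻¹ * kernMass n) * (1 / (s + τ) + 1 / (t + τ)) := by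
    intro τ hτ
    rw [← hconst τ hτ]
    have hs' : 0 < s + τ := by linarith
    have ht' : 0 < t + τ := by linarith
    have h1 := abs_integral_mul_le hs' ht' (abs_kernT_le hs') (abs_kern_le ht') x
    have h2 := abs_integral_mul_le hs' ht' (abs_kern_le hs') (abs_kernT_le ht') x
    have h3 : ((s + τ) ^ n)⁻¹ ≤ (s ^ n)⁻¹ := by gcongr; linarith
    have h5 : ((s + τ) ^ n)⁻¹ * kernMass n ≤ (s ^ n)⁻¹ * kernMass n := by gcongr
    have h4 : |W τ| ≤ kernC n / (s + τ) * 1 * (((s + τ) ^ n)⁻¹ * kernMass n) +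
        1 * (kernC n / (t + τ)) * (((s + τ) ^ n)⁻¹ * kernMass n) :=
      (abs_sub _ _).trans (add_le_add h1 h2)
    refine h4.trans ?_
    have h6 : 0 < ((s + τ) ^ n)⁻¹ * kernMass n := by positivity
    have h7 : 0 < (s ^ n)⁻¹ * kernMass n := by positivity
    calc _ = kernC n * (((s + τ) ^ n)⁻¹ * kernMass n) * (1 / (s + τ) + 1 / (t + τ)) := by ring
      _ ≤ kernC n * ((s ^ n)⁻¹ * kernMass n) * (1 / (s + τ) + 1 / (t + τ)) := by gcongr
      _ ≤ _ := by
        have h8 : 0 < kernC n * ((s ^ n)⁻¹ * kernMass n) * (1 / (s + τ) + 1 / (t + τ)) := by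
          positivity
        linarith
  have hlim : Tendsto (fun τ : ℝ => 2 * kernC n * ((s ^ n)⁻¹ * kernMass n) *
      (1 / (s + τ) + 1 / (t + τ))) atTop (𝓝 0) := by
    have e : ∀ a : ℝ, Tendsto (fun τ : ℝ => 1 / (a + τ)) atTop (𝓝 0) := fun a => by
      simp only [one_div]
      exact tendsto_inv_atTop_zero.comp (tendsto_atTop_add_const_left _ _ tendsto_id)
    simpa using ((e s).add (e t)).const_mul (2 * kernC n * ((s ^ n)⁻¹ * kernMass n))
  have h0 : |W 0| ≤ 0 := ge_of_tendsto hlim ((eventually_ge_atTop 0).mono hbound)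
  have h1 : W 0 = 0 := abs_nonpos_iff.1 h0
  simp only [hW, add_zero] at h1
  linarith

/-- `k_s * k_t` depends only on `s + t`. -/
theorem integral_kern_mul_kern_const {s t τ : ℝ} (hs : 0 < s) (hτ : 0 ≤ τ) (hτt : τ < t)
    (x : Sp n) : ∫ y, kern s (x - y) * kern t y = ∫ y, kern (s + τ) (x - y) * kern (t - τ) y := by
  set W : ℝ → ℝ := fun τ => ∫ y, kern (s + τ) (x - y) * kern (t - τ) y with hW
  have hd : ∀ r, 0 ≤ r → r ≤ τ → HasDerivAt W 0 r := by
    intro r hr hrτ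
    have hs' : 0 < s + r := by linarith
    have ht' : 0 < t - r := by linarith
    set C := localC n (s + r) + localC n (t - r) with hC
    have hCs := localC_pos n hs'
    have hCt := localC_pos n ht'
    set δ := min ((s + r) / 2) ((t - r) / 2) with hδd
    have hδ : 0 < δ := by positivity
    have ms : ∀ τ ∈ Metric.ball (0 : ℝ) δ, s + r + τ ∈ Metric.ball (s + r) ((s + r) / 2) :=
      fun τ hτ => (add_mem_ball (min_le_left _ _) hτ).1
    have mt : ∀ τ ∈ Metric.ball (0 : ℝ) δ, t - r - τ ∈ Metric.ball (t - r) ((t - r) / 2) :=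
      fun τ hτ => (add_mem_ball (min_le_right _ _) hτ).2
    have bs : ∀ τ ∈ Metric.ball (0 : ℝ) δ, ∀ z : Sp n,
        |kern (s + r + τ) z| ≤ C * kern (s + r) z ∧ |kernT (s + r + τ) z| ≤ C * kern (s + r) z := by
      intro τ hτ z
      obtain ⟨h1, h2, -⟩ := local_bounds hs' (ms τ hτ) z
      have := kern_pos hs' z
      have h4 : localC n (s + r) * kern (s + r) z ≤ C * kern (s + r) z := by gcongr; linarith
      exact ⟨h1.trans h4, h2.trans h4⟩
    have bt : ∀ τ ∈ Metric.ball (0 : ℝ) δ, ∀ z : Sp n,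
        |kern (t - r - τ) z| ≤ C * kern (t - r) z ∧
          |-kernT (t - r - τ) z| ≤ C * kern (t - r) z := by
      intro τ hτ z
      obtain ⟨h1, h2, -⟩ := local_bounds ht' (mt τ hτ) z
      have := kern_pos ht' z
      have h4 : localC n (t - r) * kern (t - r) z ≤ C * kern (t - r) z := by gcongr; linarith
      exact ⟨h1.trans h4, by rw [abs_neg]; exact h2.trans h4⟩
    have h1 := hasDerivAt_integral_mul_kern (A := fun τ => kern (s + r + τ))
      (A' := fun τ => kernT (s + r + τ)) (B := fun τ => kern (t - r - τ))
      (B' := fun τ z => -kernT (t - r - τ) z)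
      (fun _ => measurable_kern_right _) (fun _ => measurable_kernT_right _)
      (fun _ => measurable_kern_right _) (fun _ => (measurable_kernT_right _).neg) hs' ht'
      (show 0 ≤ C by positivity) hδ
      (fun τ hτ z => (bs τ hτ z).1) (fun τ hτ z => (bs τ hτ z).2)
      (fun τ hτ z => (bt τ hτ z).1) (fun τ hτ z => (bt τ hτ z).2)
      (fun τ hτ z => hasDerivAt_comp_const_add
        (hasDerivAt_kern (kern_harnack_time hs' (ms τ hτ) (0 : Sp n)).1 z))
      (fun τ hτ z => (hasDerivAt_kern
        (kern_harnack_time ht' (mt τ hτ) (0 : Sp n)).1 z).comp_const_sub (t - r) τ) x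
    have h2 : HasDerivAt (fun u => W (r + u)) 0 0 := by
      refine (h1.congr_deriv ?_).congr_of_eventuallyEq (Eventually.of_forall fun u => ?_)
      · simp only [add_zero, sub_zero, mul_neg]
        rw [integral_add, integral_neg, integral_kernT_mul_kern hs' ht', add_neg_cancel]
        · exact integrable_mul_of_bounds (measurable_kernT_right _) (measurable_kern_right _) hs'
            ht' (abs_kernT_le hs') (abs_kern_le ht') x
        · exact (integrable_mul_of_bounds (measurable_kern_right _) (measurable_kernT_right _) hs'
            ht' (abs_kern_le hs') (abs_kernT_le ht') x).neg
      · simp only [hW, add_assoc, sub_sub]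
    have h3 := HasDerivAt.comp_const_add (-r) r (f := fun u => W (r + u)) (f' := 0)
      (by rw [neg_add_cancel]; exact h2)
    simpa using h3
  have hc : W τ = W 0 := by
    refine constant_of_derivWithin_zero (a := 0) (b := τ) (f := W) ?_ ?_ τ ⟨hτ, le_rfl⟩
    · exact fun r hr => (hd r hr.1 hr.2).differentiableAt.differentiableWithinAt
    · intro r hr
      exact (hd r hr.1 hr.2.le).hasDerivWithinAt.derivWithin
        (uniqueDiffOn_Icc (hr.1.trans_lt hr.2) r ⟨hr.1, hr.2.le⟩)
  have h0 : W 0 = ∫ y, kern s (x - y) * kern t y := by simp [hW]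
  rw [← h0, ← hc]

theorem integral_kern_mul_comp {ε : ℝ} (hε : 0 < ε) (g : Sp n → ℝ) :
    ∫ y, g y * kern ε y = ∫ w, g (ε • w) * kern 1 w := by
  have h1 := Measure.integral_comp_smul (volume : Measure (Sp n)) (fun y => g y * kern ε y) ε
  simp only [kern_scale hε, finrank_euclideanSpace, Fintype.card_fin] at h1
  rw [abs_of_pos (by positivity), smul_eq_mul] at h1
  have h2 : ∀ w, g (ε • w) * ((ε ^ n)⁻¹ * kern 1 w) = (ε ^ n)⁻¹ * (g (ε • w) * kern 1 w) :=
    fun w => by ring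
  simp only [h2, integral_const_mul] at h1
  exact (mul_left_cancel₀ (by positivity) h1).symm

/-- The semigroup property of the unnormalised kernels. -/
theorem integral_kern_mul_kern {s t : ℝ} (hs : 0 < s) (ht : 0 < t) (x : Sp n) :
    ∫ y, kern s (x - y) * kern t y = kernMass n * kern (s + t) x := by
  have hev : ∀ᶠ ε in 𝓝[>] (0 : ℝ), ∫ y, kern s (x - y) * kern t y =
      ∫ w, kern (s + t - ε) (x - ε • w) * kern 1 w := by
    filter_upwards [Ioo_mem_nhdsGT ht] with ε hε
    rw [integral_kern_mul_kern_const hs (show 0 ≤ t - ε by linarith [hε.2])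
      (show t - ε < t by linarith [hε.1]) x, sub_sub_cancel,
      integral_kern_mul_comp hε.1 (fun y => kern (s + (t - ε)) (x - y)), ← add_sub_assoc]
  have hlim : Tendsto (fun ε : ℝ => ∫ w, kern (s + t - ε) (x - ε • w) * kern 1 w) (𝓝[>] 0)
      (𝓝 (∫ w : Sp n, kern (s + t) x * kern 1 w)) := by
    refine tendsto_integral_filter_of_dominated_convergence (fun w => (s ^ n)⁻¹ * kern 1 w)
      (Eventually.of_forall fun ε => ?_) ?_ ((integrable_kern one_pos).const_mul _)
      (ae_of_all _ fun w => ?_)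
    · exact (((measurable_kern_right _).comp (by fun_prop)).mul
        (measurable_kern_right 1)).aestronglyMeasurable
    · filter_upwards [Ioo_mem_nhdsGT ht] with ε hε
      refine ae_of_all _ fun w => ?_
      have h0 : 0 < s + t - ε := by linarith [hε.2]
      have h1 := kern_pos (one_pos) w
      rw [Real.norm_eq_abs, abs_mul, abs_of_pos (kern_pos h0 _), abs_of_pos h1]
      gcongr
      refine (kern_le_inv_pow h0 _).trans ?_
      gcongr
      linarith [hε.2]
    · refine Tendsto.mul_const _ ?_
      have hpos : 0 < (s + t - 0) ^ 2 + ‖x - (0 : ℝ) • w‖ ^ 2 := by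
        have : 0 < s + t - 0 := by linarith
        positivity
      have hc : ContinuousAt (fun ε : ℝ => kern (s + t - ε) (x - ε • w)) 0 := by
        unfold kern
        refine ContinuousAt.mul (by fun_prop) ?_
        exact ContinuousAt.rpow_const (by fun_prop) (Or.inl hpos.ne')
      have := hc.tendsto
      simp only [sub_zero, zero_smul] at this
      exact this.mono_left nhdsWithin_le_nhds
  have h := tendsto_nhds_unique (tendsto_const_nhds.congr' hev) hlim
  rw [h, integral_const_mul, mul_comm]
  rfl

theorem kext_kern_kern {s t : ℝ} (hs : 0 < s) (ht : 0 < t) (x : Sp n) :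
    kext (kern s) (kern t) x = kernMass n * kern (s + t) x := integral_kern_mul_kern hs ht x

theorem kext_kernT_kern {s t : ℝ} (hs : 0 < s) (ht : 0 < t) (x : Sp n) :
    kext (kernT s) (kern t) x = kernMass n * kernT (s + t) x := by
  have h1 := (wInt_kern ht).hasDerivAt_kext_kern hs x
  have h2 : HasDerivAt (fun s => kernMass n * kern (s + t) x)
      (kernMass n * kernT (s + t) x) s :=
    ((hasDerivAt_kern (add_pos hs ht) x).comp_add_const s t).const_mul _
  refine h1.unique (h2.congr_of_eventuallyEq ?_)
  filter_upwards [lt_mem_nhds hs] with r hr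
  exact kext_kern_kern hr ht x

theorem kext_kern_kernT {s t : ℝ} (hs : 0 < s) (ht : 0 < t) (x : Sp n) :
    kext (kern s) (kernT t) x = kernMass n * kernT (s + t) x := by
  rw [← kext_kernT_kern hs ht]
  exact (integral_kernT_mul_kern hs ht x).symm

theorem kext_kernT_kernT {s t : ℝ} (hs : 0 < s) (ht : 0 < t) (x : Sp n) :
    kext (kernT s) (kernT t) x = kernMass n * kernTT (s + t) x := by
  have h1 := (wInt_of_abs_le (measurable_kernT_right (n := n) t) ht
    (abs_kernT_le ht)).hasDerivAt_kext_kern hs x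
  have h2 : HasDerivAt (fun s => kernMass n * kernT (s + t) x)
      (kernMass n * kernTT (s + t) x) s :=
    ((hasDerivAt_kernT (add_pos hs ht) x).comp_add_const s t).const_mul _
  refine h1.unique (h2.congr_of_eventuallyEq ?_)
  filter_upwards [lt_mem_nhds hs] with r hr
  exact kext_kern_kernT hr ht x

end Semigroup

/-! ### Composition of extensions -/

section Composition

variable {n : ℕ} {F : Type*} [NormedAddCommGroup F] [NormedSpace ℝ F] {f : Sp n → F}

theorem WInt.integrable_prod_kern (hf : WInt f) {s t : ℝ} (hs : 0 < s) (ht : 0 < t) (x : Sp n) :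
    Integrable (fun w : Sp n × Sp n => (kern s (x - w.2) * kern t (w.2 - w.1)) • f w.1)
      (volume.prod volume) := by
  have hk : ∀ y : Sp n, ∫ z, kern s (x - z) * kern t (z - y) =
      kernMass n * kern (s + t) (x - y) := by
    intro y
    rw [← integral_kern_mul_kern hs ht, ← integral_add_right_eq_self _ y]
    simp only [add_sub_cancel_right, sub_add_eq_sub_sub, sub_right_comm x y]
  have hki : ∀ y : Sp n, Integrable (fun z => kern s (x - z) * kern t (z - y)) := by
    intro y
    have := (integrable_mul_of_bounds (measurable_kern_right s) (measurable_kern_right t) hs ht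
      (abs_kern_le hs) (abs_kern_le ht) (x - y)).comp_sub_right y
    refine this.congr (ae_of_all _ fun z => ?_)
    show kern s (x - y - (z - y)) * _ = _
    rw [sub_sub_sub_cancel_right]
  have hm : AEStronglyMeasurable (fun w : Sp n × Sp n =>
      (kern s (x - w.2) * kern t (w.2 - w.1)) • f w.1) (volume.prod volume) := by
    refine AEStronglyMeasurable.smul ?_ hf.aestronglyMeasurable.comp_fst
    exact (((measurable_kern_right s).comp (by fun_prop)).mul
      ((measurable_kern_right t).comp (by fun_prop))).aestronglyMeasurable
  rw [integrable_prod_iff hm]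
  refine ⟨ae_of_all _ fun y => (hki y).smul_const (f y), ?_⟩
  have hn : ∀ y, ∫ z, ‖(kern s (x - z) * kern t (z - y)) • f y‖ =
      kernMass n * ‖kern (s + t) (x - y) • f y‖ := by
    intro y
    rw [norm_smul, Real.norm_eq_abs, abs_of_pos (kern_pos (add_pos hs ht) _), ← mul_assoc, ← hk y,
      ← integral_mul_const]
    refine integral_congr_ae (ae_of_all _ fun z => ?_)
    simp only [norm_smul, Real.norm_eq_abs]
    rw [abs_of_pos (mul_pos (kern_pos hs _) (kern_pos ht _))]
  simp only [hn]
  exact (hf.integrable_kern_sub (add_pos hs ht) x).norm.const_mul _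

theorem WInt.integrable_prod_of_bounds (hf : WInt f) {K L : Sp n → ℝ} (hK : Measurable K)
    (hL : Measurable L) {s t C D : ℝ} (hs : 0 < s) (ht : 0 < t) (bK : ∀ z, |K z| ≤ C * kern s z)
    (bL : ∀ z, |L z| ≤ D * kern t z) (x : Sp n) :
    Integrable (fun w : Sp n × Sp n => (K (x - w.2) * L (w.2 - w.1)) • f w.1)
      (volume.prod volume) := by
  refine Integrable.mono' (g := fun w : Sp n × Sp n => (C * D) *
    ‖(kern s (x - w.2) * kern t (w.2 - w.1)) • f w.1‖)
    ((hf.integrable_prod_kern hs ht x).norm.const_mul _) ?_ (ae_of_all _ fun w => ?_)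
  · refine AEStronglyMeasurable.smul ?_ hf.aestronglyMeasurable.comp_fst
    exact ((hK.comp (by fun_prop)).mul (hL.comp (by fun_prop))).aestronglyMeasurable
  · have h1 := kern_pos hs (x - w.2)
    have h2 := kern_pos ht (w.2 - w.1)
    rw [norm_smul, norm_smul, Real.norm_eq_abs, Real.norm_eq_abs, abs_mul, abs_mul, abs_of_pos h1,
      abs_of_pos h2]
    calc |K (x - w.2)| * |L (w.2 - w.1)| * ‖f w.1‖
        ≤ (C * kern s (x - w.2)) * (D * kern t (w.2 - w.1)) * ‖f w.1‖ := by
          have := (abs_nonneg _).trans (bK (x - w.2))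
          gcongr
          · exact bK _
          · exact bL _
      _ = _ := by ring

theorem WInt.kext_kext [CompleteSpace F] (hf : WInt f) {K L : Sp n → ℝ} (hK : Measurable K)
    (hL : Measurable L) {s t C D : ℝ} (hs : 0 < s) (ht : 0 < t) (bK : ∀ z, |K z| ≤ C * kern s z)
    (bL : ∀ z, |L z| ≤ D * kern t z) (x : Sp n) :
    kext K (kext L f) x = kext (kext K L) f x := by
  have h := integral_integral_swap (μ := volume) (ν := volume)
    (f := fun y z => (K (x - z) * L (z - y)) • f y)
    (hf.integrable_prod_of_bounds hK hL hs ht bK bL x)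
  unfold kext
  calc ∫ y, K (x - y) • ∫ z, L (y - z) • f z
      = ∫ z, ∫ y, (K (x - z) * L (z - y)) • f y := by
        refine integral_congr_ae (ae_of_all _ fun z => ?_)
        simp only [← integral_smul, mul_smul]
    _ = ∫ y, ∫ z, (K (x - z) * L (z - y)) • f y := h.symm
    _ = _ := by
        refine integral_congr_ae (ae_of_all _ fun y => ?_)
        simp only
        rw [integral_smul_const]
        congr 1
        rw [← integral_add_right_eq_self _ y]
        simp only [add_sub_cancel_right, sub_add_eq_sub_sub, sub_right_comm x y, smul_eq_mul]

theorem kext_const_mul (c : ℝ) (K : Sp n → ℝ) (f : Sp n → F) (x : Sp n) :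
    kext (fun z => c * K z) f x = c • kext K f x := by
  unfold kext
  simp only [mul_smul]
  rw [integral_smul]

theorem WInt.kext_kern_kernT [CompleteSpace F] (hf : WInt f) {s t : ℝ} (hs : 0 < s)
    (ht : 0 < t) (x : Sp n) :
    kext (kern s) (kext (kernT t) f) x = kernMass n • kext (kernT (s + t)) f x := by
  rw [hf.kext_kext (measurable_kern_right s) (measurable_kernT_right t) hs ht (abs_kern_le hs)
    (abs_kernT_le ht), ← kext_const_mul]
  congr 1
  funext z
  exact MorreyLP.kext_kern_kernT hs ht z

theorem WInt.kext_kernT_kernT [CompleteSpace F] (hf : WInt f) {s t : ℝ} (hs : 0 < s)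
    (ht : 0 < t) (x : Sp n) :
    kext (kernT s) (kext (kernT t) f) x = kernMass n • kext (kernTT (s + t)) f x := by
  rw [hf.kext_kext (measurable_kernT_right s) (measurable_kernT_right t) hs ht (abs_kernT_le hs)
    (abs_kernT_le ht), ← kext_const_mul]
  congr 1
  funext z
  exact MorreyLP.kext_kernT_kernT hs ht z

/-- Extensions at positive height are again integrable against the kernel. -/
theorem WInt.wInt_kext (hf : WInt f) {L : Sp n → ℝ} (hL : Measurable L) {t D : ℝ} (ht : 0 < t)
    (bL : ∀ z, |L z| ≤ D * kern t z) : WInt (kext L f) := by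
  have h := (hf.integrable_prod_of_bounds (measurable_kern_right 1) hL one_pos ht
    (abs_kern_le one_pos) bL 0).integral_prod_right
  refine h.congr (ae_of_all _ fun z => ?_)
  simp only [zero_sub, kern_neg, mul_smul, integral_smul]
  rfl

end Composition

/-! ### Green's formula for monomials in two positive harmonic functions -/

/-- The second-order part of the second derivative of `u ^ a * v ^ b` along a curve with first
derivatives `ξ` and `η`. -/
def hessMon (a b u v ξ η : ℝ) : ℝ :=
  u ^ a * v ^ b * (a * (a - 1) * (ξ / u) ^ 2 + 2 * a * b * (ξ / u) * (η / v) +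
    b * (b - 1) * (η / v) ^ 2)

/-- The derivative of `u ^ a * v ^ b` along a curve with first derivatives `ξ` and `η`. -/
def gradMon (a b u v ξ η : ℝ) : ℝ := u ^ a * v ^ b * (a * (ξ / u) + b * (η / v))

theorem hasDerivAt_mon {U V : ℝ → ℝ} {U' V' s : ℝ} (a b : ℝ) (hU : HasDerivAt U U' s)
    (hV : HasDerivAt V V' s) (pU : 0 < U s) (pV : 0 < V s) :
    HasDerivAt (fun s => U s ^ a * V s ^ b) (gradMon a b (U s) (V s) U' V') s := by
  refine ((hU.rpow_const (p := a) (Or.inl pU.ne')).mul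
    (hV.rpow_const (p := b) (Or.inl pV.ne'))).congr_deriv ?_
  rw [gradMon, rpow_sub_one_eq pU, rpow_sub_one_eq pV]
  field_simp

theorem hasDerivAt_gradMon {U V U₁ V₁ : ℝ → ℝ} {U₂ V₂ s : ℝ} (a b : ℝ)
    (hU : HasDerivAt U (U₁ s) s) (hV : HasDerivAt V (V₁ s) s) (hU₁ : HasDerivAt U₁ U₂ s)
    (hV₁ : HasDerivAt V₁ V₂ s) (pU : 0 < U s) (pV : 0 < V s) :
    HasDerivAt (fun s => gradMon a b (U s) (V s) (U₁ s) (V₁ s))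
      (hessMon a b (U s) (V s) (U₁ s) (V₁ s) + gradMon a b (U s) (V s) U₂ V₂) s := by
  have h1 := hasDerivAt_mon a b hU hV pU pV
  have h2 := ((hU₁.div hU pU.ne').const_mul a).add ((hV₁.div hV pV.ne').const_mul b)
  refine (h1.mul h2).congr_deriv ?_
  simp only [hessMon, gradMon, Pi.add_apply, Pi.div_apply]
  have := pU.ne'
  have := pV.ne'
  field_simp
  ring

/-- A constant for the bounds of `gradMon` and `hessMon`. -/
def monC (a b C : ℝ) : ℝ :=
  (|a| + |b|) * C + (|a * (a - 1)| + 2 * |a * b| + |b * (b - 1)|) * C ^ 2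

theorem monC_nonneg (a b : ℝ) {C : ℝ} (hC : 0 ≤ C) : 0 ≤ monC a b C := by
  unfold monC; positivity

theorem abs_div_le_of {ξ u c : ℝ} (hu : 0 < u) (h : |ξ| ≤ c * u) : |ξ / u| ≤ c := by
  rw [abs_div, abs_of_pos hu, div_le_iff₀ hu]; exact h

theorem abs_gradMon_le {a b u v ξ η C t : ℝ} (hu : 0 < u) (hv : 0 < v) (ht : 0 < t)
    (hξ : |ξ| ≤ C / t * u) (hη : |η| ≤ C / t * v) :
    |gradMon a b u v ξ η| ≤ monC a b C / t * (u ^ a * v ^ b) := by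
  have h1 := abs_div_le_of hu hξ
  have h2 := abs_div_le_of hv hη
  have hp : 0 < u ^ a * v ^ b := by positivity
  rw [gradMon, abs_mul, abs_of_pos hp, mul_comm]
  gcongr
  calc |a * (ξ / u) + b * (η / v)| ≤ |a| * |ξ / u| + |b| * |η / v| := by
        rw [← abs_mul, ← abs_mul]; exact abs_add_le _ _
    _ ≤ |a| * (C / t) + |b| * (C / t) := by gcongr
    _ = (|a| + |b|) * C / t := by ring
    _ ≤ _ := by
      gcongr
      unfold monC
      have : 0 ≤ (|a * (a - 1)| + 2 * |a * b| + |b * (b - 1)|) * C ^ 2 := by positivity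
      linarith

theorem abs_hessMon_le {a b u v ξ η C t : ℝ} (hu : 0 < u) (hv : 0 < v) (ht : 0 < t) (hC : 0 ≤ C)
    (hξ : |ξ| ≤ C / t * u) (hη : |η| ≤ C / t * v) :
    |hessMon a b u v ξ η| ≤ monC a b C / t ^ 2 * (u ^ a * v ^ b) := by
  have h1 := abs_div_le_of hu hξ
  have h2 := abs_div_le_of hv hη
  have hp : 0 < u ^ a * v ^ b := by positivity
  rw [hessMon, abs_mul, abs_of_pos hp, mul_comm]
  gcongr
  calc |a * (a - 1) * (ξ / u) ^ 2 + 2 * a * b * (ξ / u) * (η / v) + b * (b - 1) * (η / v) ^ 2|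
      ≤ |a * (a - 1)| * |ξ / u| ^ 2 + 2 * |a * b| * |ξ / u| * |η / v| +
          |b * (b - 1)| * |η / v| ^ 2 := by
        refine (abs_add_le _ _).trans (add_le_add ((abs_add_le _ _).trans (add_le_add ?_ ?_)) ?_)
        · rw [abs_mul, abs_pow]
        · rw [abs_mul, abs_mul, mul_assoc 2 a b, abs_mul 2, abs_two]
        · rw [abs_mul, abs_pow]
    _ ≤ |a * (a - 1)| * (C / t) ^ 2 + 2 * |a * b| * (C / t) * (C / t) +
          |b * (b - 1)| * (C / t) ^ 2 := by gcongr
    _ = (|a * (a - 1)| + 2 * |a * b| + |b * (b - 1)|) * C ^ 2 / t ^ 2 := by ring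
    _ ≤ _ := by
      gcongr
      unfold monC
      have : 0 ≤ (|a| + |b|) * C := by positivity
      linarith

/-- The integral of `t g''` for `g = U ^ a * V ^ b`, computed by the fundamental theorem of
calculus; the boundary terms `t g' - g` are bounded by the values of `g`. -/
theorem integral_second_deriv_mon_le {U V U₁ V₁ U₂ V₂ : ℝ → ℝ} {a b C θ ε T : ℝ} (hC : 0 ≤ C)
    (dU : ∀ t, 0 < t → HasDerivAt U (U₁ t) t) (dV : ∀ t, 0 < t → HasDerivAt V (V₁ t) t)
    (dU₁ : ∀ t, 0 < t → HasDerivAt U₁ (U₂ t) t) (dV₁ : ∀ t, 0 < t → HasDerivAt V₁ (V₂ t) t)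
    (pU : ∀ t, 0 < t → 0 < U t) (pV : ∀ t, 0 < t → 0 < V t)
    (bU₁ : ∀ t, 0 < t → |U₁ t| ≤ C / t * U t) (bV₁ : ∀ t, 0 < t → |V₁ t| ≤ C / t * V t)
    (bU₂ : ∀ t, 0 < t → |U₂ t| ≤ C / t ^ 2 * U t) (bV₂ : ∀ t, 0 < t → |V₂ t| ≤ C / t ^ 2 * V t)
    (hle : ∀ t, 0 < t → U t ^ a * V t ^ b ≤ θ)
    (mH : Measurable fun t => hessMon a b (U t) (V t) (U₁ t) (V₁ t))
    (mG : Measurable fun t => gradMon a b (U t) (V t) (U₂ t) (V₂ t)) (hε : 0 < ε) (hεT : ε ≤ T) :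
    ∫ t in Ioc ε T, t * (hessMon a b (U t) (V t) (U₁ t) (V₁ t) +
      gradMon a b (U t) (V t) (U₂ t) (V₂ t)) ≤ 2 * (monC a b C + 1) * θ := by
  have hM := monC_nonneg a b hC
  have hθ : 0 ≤ θ := le_trans
    (by have := pU ε hε; have := pV ε hε; positivity) (hle ε hε)
  have bH : ∀ t, 0 < t → |hessMon a b (U t) (V t) (U₁ t) (V₁ t)| ≤ monC a b C / t ^ 2 * θ :=
    fun t ht => (abs_hessMon_le (pU t ht) (pV t ht) ht hC (bU₁ t ht) (bV₁ t ht)).trans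
      (mul_le_mul_of_nonneg_left (hle t ht) (by positivity))
  have bG : ∀ t, 0 < t → |gradMon a b (U t) (V t) (U₂ t) (V₂ t)| ≤ monC a b C / t ^ 2 * θ :=
    fun t ht => (abs_gradMon_le (pU t ht) (pV t ht) (pow_pos ht 2) (bU₂ t ht) (bV₂ t ht)).trans
      (mul_le_mul_of_nonneg_left (hle t ht) (by positivity))
  set W : ℝ → ℝ := fun t => t * gradMon a b (U t) (V t) (U₁ t) (V₁ t) - U t ^ a * V t ^ b with hW
  have hder : ∀ t ∈ uIcc ε T, HasDerivAt W (t * (hessMon a b (U t) (V t) (U₁ t) (V₁ t) +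
      gradMon a b (U t) (V t) (U₂ t) (V₂ t))) t := by
    intro t ht
    rw [uIcc_of_le hεT] at ht
    have ht0 : 0 < t := hε.trans_le ht.1
    have h5 := hasDerivAt_gradMon a b (dU t ht0) (dV t ht0) (dU₁ t ht0) (dV₁ t ht0) (pU t ht0)
      (pV t ht0)
    have h6 := hasDerivAt_mon a b (dU t ht0) (dV t ht0) (pU t ht0) (pV t ht0)
    refine (((hasDerivAt_id t).mul h5).sub h6).congr_deriv ?_
    simp only [id]
    ring
  have hint : IntervalIntegrable (fun t => t * (hessMon a b (U t) (V t) (U₁ t) (V₁ t) +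
      gradMon a b (U t) (V t) (U₂ t) (V₂ t))) volume ε T := by
    rw [intervalIntegrable_iff_integrableOn_Ioc_of_le hεT]
    refine Integrable.mono' (g := fun _ => 2 * (monC a b C / ε) * θ)
      (integrable_const _) (measurable_id.mul (mH.add mG)).aestronglyMeasurable ?_
    refine (ae_restrict_iff' measurableSet_Ioc).2 (ae_of_all _ fun t ht => ?_)
    have ht0 : 0 < t := hε.trans ht.1
    rw [Real.norm_eq_abs, abs_mul, abs_of_pos ht0]
    calc t * |hessMon a b (U t) (V t) (U₁ t) (V₁ t) + gradMon a b (U t) (V t) (U₂ t) (V₂ t)|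
        ≤ t * (monC a b C / t ^ 2 * θ + monC a b C / t ^ 2 * θ) := by
          gcongr
          exact (abs_add_le _ _).trans (add_le_add (bH t ht0) (bG t ht0))
      _ = 2 * (monC a b C / t) * θ := by field_simp; ring
      _ ≤ _ := by
          gcongr
          exact ht.1.le
  have hWb : ∀ t, 0 < t → |W t| ≤ (monC a b C + 1) * θ := by
    intro t ht
    have hpos : 0 ≤ U t ^ a * V t ^ b := by
      have := pU t ht; have := pV t ht; positivity
    have h1 := abs_gradMon_le (a := a) (b := b) (pU t ht) (pV t ht) ht (bU₁ t ht) (bV₁ t ht)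
    have h2 : |t * gradMon a b (U t) (V t) (U₁ t) (V₁ t)| ≤ monC a b C * θ := by
      rw [abs_mul, abs_of_pos ht]
      calc _ ≤ t * (monC a b C / t * (U t ^ a * V t ^ b)) := by gcongr
        _ = monC a b C * (U t ^ a * V t ^ b) := by
          rw [← mul_assoc, mul_div_cancel₀ _ ht.ne']
        _ ≤ _ := by gcongr; exact hle t ht
    have h3 : |U t ^ a * V t ^ b| ≤ θ := by rw [abs_of_nonneg hpos]; exact hle t ht
    have h4 := abs_sub (t * gradMon a b (U t) (V t) (U₁ t) (V₁ t)) (U t ^ a * V t ^ b)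
    simp only [hW]
    linarith
  have hFTC := intervalIntegral.integral_eq_sub_of_hasDerivAt hder hint
  rw [intervalIntegral.integral_of_le hεT] at hFTC
  rw [hFTC]
  have h1 := hWb ε hε
  have h2 := hWb T (hε.trans_le hεT)
  have h3 := le_abs_self (W T)
  have h4 := neg_abs_le (W ε)
  linarith

section Green

variable {n : ℕ} {f h : Sp n → ℝ}

/-- The Laplacian in `n + 1` variables of `u ^ a * v ^ b`, where `u` and `v` are the extensions of
`f` and `h`. -/
def lapMon (a b : ℝ) (f h : Sp n → ℝ) (t : ℝ) (x : Sp n) : ℝ :=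
  hessMon a b (kext (kern t) f x) (kext (kern t) h x) (kext (kernT t) f x) (kext (kernT t) h x) +
    ∑ i, hessMon a b (kext (kern t) f x) (kext (kern t) h x) (kext (kernX i t) f x)
      (kext (kernX i t) h x)

/-- `f` is a nonnegative function with a positive extension. -/
structure PosExt (f : Sp n → ℝ) : Prop where
  wInt : WInt f
  nonneg : ∀ y, 0 ≤ f y
  pos : ∀ {t : ℝ}, 0 < t → ∀ x, 0 < kext (kern t) f x

theorem PosExt.abs_kext_le (hf : PosExt f) {K : Sp n → ℝ} {t C : ℝ} (ht : 0 < t)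
    (h : ∀ z, |K z| ≤ C * kern t z) (x : Sp n) : |kext K f x| ≤ C * kext (kern t) f x := by
  have h1 := hf.wInt.norm_kext_le ht h x
  simpa only [Real.norm_of_nonneg (hf.nonneg _), Real.norm_eq_abs] using h1

theorem measurable_kext_joint (hf : WInt f) {K : ℝ → Sp n → ℝ}
    (hK : Measurable (fun z : ℝ × Sp n => K z.1 z.2)) :
    Measurable (fun z : ℝ × Sp n => kext (K z.1) f z.2) :=
  (stronglyMeasurable_kext hf.aestronglyMeasurable hK).measurable

theorem measurable_hessMon_joint (hf : WInt f) (hh : WInt h) (a b : ℝ) {K : ℝ → Sp n → ℝ}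
    (hK : Measurable (fun z : ℝ × Sp n => K z.1 z.2)) :
    Measurable (fun z : ℝ × Sp n => hessMon a b (kext (kern z.1) f z.2) (kext (kern z.1) h z.2)
      (kext (K z.1) f z.2) (kext (K z.1) h z.2)) := by
  have h1 := measurable_kext_joint hf measurable_kern
  have h2 := measurable_kext_joint hh measurable_kern
  have h3 := measurable_kext_joint hf hK
  have h4 := measurable_kext_joint hh hK
  unfold hessMon
  fun_prop

theorem measurable_gradMon_joint (hf : WInt f) (hh : WInt h) (a b : ℝ) {K : ℝ → Sp n → ℝ}
    (hK : Measurable (fun z : ℝ × Sp n => K z.1 z.2)) :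
    Measurable (fun z : ℝ × Sp n => gradMon a b (kext (kern z.1) f z.2) (kext (kern z.1) h z.2)
      (kext (K z.1) f z.2) (kext (K z.1) h z.2)) := by
  have h1 := measurable_kext_joint hf measurable_kern
  have h2 := measurable_kext_joint hh measurable_kern
  have h3 := measurable_kext_joint hf hK
  have h4 := measurable_kext_joint hh hK
  unfold gradMon
  fun_prop

/-- The integral of the derivative of an integrable function vanishes. -/
theorem integral_lineDeriv_eq_zero {Φ Φ' : Sp n → ℝ} {v : Sp n} (hΦ : Integrable Φ)
    (hΦ' : Integrable Φ') (hd : ∀ x, HasLineDerivAt ℝ Φ (Φ' x) x v) : ∫ x, Φ' x = 0 := by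
  have h := integral_bilinear_hasLineDerivAt_right_eq_neg_left_of_integrable
    (B := ContinuousLinearMap.mul ℝ ℝ) (μ := volume) (v := v) (f := Φ) (f' := Φ')
    (g := fun _ => (1 : ℝ)) (g' := fun _ => 0) (by simpa using hΦ') (by simp)
    (by simpa using hΦ) (fun x _ => hd x)
    (fun x _ => by simpa [HasLineDerivAt] using hasDerivAt_const (0 : ℝ) (1 : ℝ))
  simpa using h.symm

variable {a b : ℝ} {Θ : Sp n → ℝ}

theorem integrable_of_le_mon (hΘ : Integrable Θ)
    (hle : ∀ᵐ x, ∀ t, 0 < t → kext (kern t) f x ^ a * kext (kern t) h x ^ b ≤ Θ x)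
    {Φ : Sp n → ℝ} (hΦ : Measurable Φ) {t c : ℝ} (hc : 0 ≤ c) (ht : 0 < t)
    (hb : ∀ x, |Φ x| ≤ c * (kext (kern t) f x ^ a * kext (kern t) h x ^ b)) : Integrable Φ := by
  refine (hΘ.const_mul c).mono' hΦ.aestronglyMeasurable ?_
  filter_upwards [hle] with x hx
  refine (hb x).trans ?_
  gcongr
  exact hx t ht

/-- Integration by parts in the space variables. -/
theorem integral_gradMon_kernTT (hf : PosExt f) (hh : PosExt h) (hΘ : Integrable Θ)
    (hle : ∀ᵐ x, ∀ t, 0 < t → kext (kern t) f x ^ a * kext (kern t) h x ^ b ≤ Θ x)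
    {t : ℝ} (ht : 0 < t) :
    ∫ x, gradMon a b (kext (kern t) f x) (kext (kern t) h x) (kext (kernTT t) f x)
        (kext (kernTT t) h x) =
      ∑ i, ∫ x, hessMon a b (kext (kern t) f x) (kext (kern t) h x) (kext (kernX i t) f x)
        (kext (kernX i t) h x) := by
  have hC := (kernC_pos n).le
  have mkt : Measurable (fun x : Sp n => (t, x)) := by fun_prop
  have iHess : ∀ i, Integrable (fun x => hessMon a b (kext (kern t) f x) (kext (kern t) h x)
      (kext (kernX i t) f x) (kext (kernX i t) h x)) := fun i =>
    integrable_of_le_mon hΘ hle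
      ((measurable_hessMon_joint hf.wInt hh.wInt a b (measurable_kernX i)).comp mkt)
      (div_nonneg (monC_nonneg a b hC) (sq_nonneg t)) ht
      (fun x => abs_hessMon_le (hf.pos ht x) (hh.pos ht x) ht hC
        (hf.abs_kext_le ht (abs_kernX_le ht i) x) (hh.abs_kext_le ht (abs_kernX_le ht i) x))
  have iGradX : ∀ i, Integrable (fun x => gradMon a b (kext (kern t) f x) (kext (kern t) h x)
      (kext (kernX i t) f x) (kext (kernX i t) h x)) := fun i =>
    integrable_of_le_mon hΘ hle
      ((measurable_gradMon_joint hf.wInt hh.wInt a b (measurable_kernX i)).comp mkt)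
      (div_nonneg (monC_nonneg a b hC) ht.le) ht
      (fun x => abs_gradMon_le (hf.pos ht x) (hh.pos ht x) ht
        (hf.abs_kext_le ht (abs_kernX_le ht i) x) (hh.abs_kext_le ht (abs_kernX_le ht i) x))
  have iGradXX : ∀ i, Integrable (fun x => gradMon a b (kext (kern t) f x) (kext (kern t) h x)
      (kext (kernXX i t) f x) (kext (kernXX i t) h x)) := fun i =>
    integrable_of_le_mon hΘ hle
      ((measurable_gradMon_joint hf.wInt hh.wInt a b (measurable_kernXX i)).comp mkt)
      (div_nonneg (monC_nonneg a b hC) (sq_nonneg t)) ht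
      (fun x => abs_gradMon_le (hf.pos ht x) (hh.pos ht x) (pow_pos ht 2)
        (hf.abs_kext_le ht (abs_kernXX_le ht i) x) (hh.abs_kext_le ht (abs_kernXX_le ht i) x))
  have key : ∀ i, ∫ x, gradMon a b (kext (kern t) f x) (kext (kern t) h x) (kext (kernXX i t) f x)
      (kext (kernXX i t) h x) = -∫ x, hessMon a b (kext (kern t) f x) (kext (kern t) h x)
        (kext (kernX i t) f x) (kext (kernX i t) h x) := by
    intro i
    have hz := integral_lineDeriv_eq_zero (v := basisVec i) (iGradX i)
      ((iHess i).add (iGradXX i)) (fun x => by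
        have h1 := hf.wInt.hasLineDerivAt_kext_kern ht i x
        have h2 := hh.wInt.hasLineDerivAt_kext_kern ht i x
        have h3 := hf.wInt.hasLineDerivAt_kext_kernX ht i x
        have h4 := hh.wInt.hasLineDerivAt_kext_kernX ht i x
        have h5 := hasDerivAt_gradMon (s := 0)
          (U := fun r : ℝ => kext (kern t) f (x + r • basisVec i))
          (V := fun r : ℝ => kext (kern t) h (x + r • basisVec i))
          (U₁ := fun r : ℝ => kext (kernX i t) f (x + r • basisVec i))
          (V₁ := fun r : ℝ => kext (kernX i t) h (x + r • basisVec i)) a b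
          (by simpa [HasLineDerivAt] using h1) (by simpa [HasLineDerivAt] using h2)
          h3 h4 (hf.pos ht _) (hh.pos ht _)
        simpa [HasLineDerivAt] using h5)
    simp only [Pi.add_apply] at hz
    rw [integral_add (iHess i) (iGradXX i)] at hz
    linarith
  have hlin : ∀ x, gradMon a b (kext (kern t) f x) (kext (kern t) h x) (kext (kernTT t) f x)
      (kext (kernTT t) h x) = -∑ i, gradMon a b (kext (kern t) f x) (kext (kern t) h x)
        (kext (kernXX i t) f x) (kext (kernXX i t) h x) := by
    intro x
    have e1 : kext (kernTT t) f x = -∑ i, kext (kernXX i t) f x := by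
      linarith [hf.wInt.kext_harmonic ht x]
    have e2 : kext (kernTT t) h x = -∑ i, kext (kernXX i t) h x := by
      linarith [hh.wInt.kext_harmonic ht x]
    simp only [gradMon, e1, e2, ← Finset.mul_sum, Finset.sum_add_distrib, ← Finset.sum_div]
    ring
  simp only [hlin, integral_neg]
  rw [integral_finsetSum _ fun i _ => iGradXX i, ← Finset.sum_neg_distrib]
  refine Finset.sum_congr rfl fun i _ => ?_
  rw [key, neg_neg]

/-- Products of the time variable with second-order terms are integrable over slabs. -/
theorem integrable_prod_of_le_mon (hf : PosExt f) (hh : PosExt h) (hΘ : Integrable Θ)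
    (hle : ∀ᵐ x, ∀ t, 0 < t → kext (kern t) f x ^ a * kext (kern t) h x ^ b ≤ Θ x)
    {Φ : ℝ → Sp n → ℝ}
    (hΦ : Measurable (fun z : ℝ × Sp n => Φ z.1 z.2)) {ε T c : ℝ} (hε : 0 < ε) (hc : 0 ≤ c)
    (hb : ∀ t x, 0 < t → |Φ t x| ≤ c / t ^ 2 * (kext (kern t) f x ^ a * kext (kern t) h x ^ b)) :
    Integrable (fun z : ℝ × Sp n => z.1 * Φ z.1 z.2)
      ((volume.restrict (Ioc ε T)).prod volume) := by
  have hdom : Integrable (fun z : ℝ × Sp n => (c / ε) * Θ z.2)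
      ((volume.restrict (Ioc ε T)).prod volume) := by
    have h1 : Integrable (fun _ : ℝ => c / ε) (volume.restrict (Ioc ε T)) :=
      integrable_const _
    exact h1.mul_prod hΘ
  refine hdom.mono' (measurable_fst.mul hΦ).aestronglyMeasurable ?_
  have hae : ∀ᵐ z ∂((volume.restrict (Ioc ε T)).prod (volume : Measure (Sp n))),
      z.1 ∈ Ioc ε T := by
    have h2 : ∀ᵐ t ∂(volume.restrict (Ioc ε T)), t ∈ Ioc ε T := ae_restrict_mem measurableSet_Ioc
    exact Measure.quasiMeasurePreserving_fst.ae h2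
  filter_upwards [hae, Measure.quasiMeasurePreserving_snd.ae hle] with z hz hle
  have ht : 0 < z.1 := hε.trans hz.1
  have hΘ0 : 0 ≤ Θ z.2 := le_trans
    (by have := hf.pos ht z.2; have := hh.pos ht z.2; positivity) (hle z.1 ht)
  rw [Real.norm_eq_abs, abs_mul, abs_of_pos ht]
  calc z.1 * |Φ z.1 z.2| ≤ z.1 * (c / z.1 ^ 2 * Θ z.2) := by
        gcongr
        refine (hb z.1 z.2 ht).trans ?_
        gcongr
        exact hle z.1 ht
    _ = c / z.1 * Θ z.2 := by field_simp
    _ ≤ c / ε * Θ z.2 := by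
        gcongr
        exact hz.1.le

theorem integrable_prod_lapMon (hf : PosExt f) (hh : PosExt h) (hΘ : Integrable Θ)
    (hle : ∀ᵐ x, ∀ t, 0 < t → kext (kern t) f x ^ a * kext (kern t) h x ^ b ≤ Θ x)
    {ε T : ℝ} (hε : 0 < ε) :
    Integrable (fun z : ℝ × Sp n => z.1 * lapMon a b f h z.1 z.2)
      ((volume.restrict (Ioc ε T)).prod volume) := by
  have hC := (kernC_pos n).le
  unfold lapMon
  simp only [mul_add, Finset.mul_sum]
  refine Integrable.add ?_ (integrable_finsetSum _ fun i _ => ?_)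
  · exact integrable_prod_of_le_mon hf hh hΘ hle
      (measurable_hessMon_joint hf.wInt hh.wInt a b measurable_kernT) hε (monC_nonneg a b hC)
      (fun t x ht => abs_hessMon_le (hf.pos ht x) (hh.pos ht x) ht hC
        (hf.abs_kext_le ht (abs_kernT_le ht) x) (hh.abs_kext_le ht (abs_kernT_le ht) x))
  · exact integrable_prod_of_le_mon hf hh hΘ hle
      (measurable_hessMon_joint hf.wInt hh.wInt a b (measurable_kernX i)) hε (monC_nonneg a b hC)
      (fun t x ht => abs_hessMon_le (hf.pos ht x) (hh.pos ht x) ht hC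
        (hf.abs_kext_le ht (abs_kernX_le ht i) x) (hh.abs_kext_le ht (abs_kernX_le ht i) x))

set_option maxHeartbeats 1000000 in
/-- Green's formula on the slab `ε < t ≤ T`, with the boundary terms estimated by `Θ`. -/
theorem integral_lapMon_le (hf : PosExt f) (hh : PosExt h) (hΘ : Integrable Θ)
    (hle : ∀ᵐ x, ∀ t, 0 < t → kext (kern t) f x ^ a * kext (kern t) h x ^ b ≤ Θ x)
    {ε T : ℝ} (hε : 0 < ε) (hεT : ε ≤ T) :
    ∫ z, z.1 * lapMon a b f h z.1 z.2 ∂((volume.restrict (Ioc ε T)).prod volume) ≤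
      2 * (monC a b (kernC n) + 1) * ∫ x, Θ x := by
  have hC := (kernC_pos n).le
  set μ := volume.restrict (Ioc ε T) with hμ
  set H : ℝ → Sp n → ℝ := fun t x => hessMon a b (kext (kern t) f x) (kext (kern t) h x)
    (kext (kernT t) f x) (kext (kernT t) h x) with hH
  set G : ℝ → Sp n → ℝ := fun t x => gradMon a b (kext (kern t) f x) (kext (kern t) h x)
    (kext (kernTT t) f x) (kext (kernTT t) h x) with hG
  have mH : Measurable (fun z : ℝ × Sp n => H z.1 z.2) :=
    measurable_hessMon_joint hf.wInt hh.wInt a b measurable_kernT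
  have mG : Measurable (fun z : ℝ × Sp n => G z.1 z.2) :=
    measurable_gradMon_joint hf.wInt hh.wInt a b measurable_kernTT
  have bH : ∀ t x, 0 < t → |H t x| ≤ monC a b (kernC n) / t ^ 2 *
      (kext (kern t) f x ^ a * kext (kern t) h x ^ b) := fun t x ht =>
    abs_hessMon_le (hf.pos ht x) (hh.pos ht x) ht hC
      (hf.abs_kext_le ht (abs_kernT_le ht) x) (hh.abs_kext_le ht (abs_kernT_le ht) x)
  have bG : ∀ t x, 0 < t → |G t x| ≤ monC a b (kernC n) / t ^ 2 *
      (kext (kern t) f x ^ a * kext (kern t) h x ^ b) := fun t x ht =>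
    abs_gradMon_le (hf.pos ht x) (hh.pos ht x) (pow_pos ht 2)
      (hf.abs_kext_le ht (abs_kernTT_le ht) x) (hh.abs_kext_le ht (abs_kernTT_le ht) x)
  have iHess : ∀ {t : ℝ} (ht : 0 < t) (i : Fin n), Integrable (fun x =>
      hessMon a b (kext (kern t) f x) (kext (kern t) h x)
      (kext (kernX i t) f x) (kext (kernX i t) h x)) := fun {t} ht i =>
    integrable_of_le_mon hΘ hle
      ((measurable_hessMon_joint hf.wInt hh.wInt a b (measurable_kernX i)).comp
        (by fun_prop : Measurable (fun x : Sp n => (t, x))))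
      (div_nonneg (monC_nonneg a b hC) (sq_nonneg t)) ht
      (fun x => abs_hessMon_le (hf.pos ht x) (hh.pos ht x) ht hC
        (hf.abs_kext_le ht (abs_kernX_le ht i) x) (hh.abs_kext_le ht (abs_kernX_le ht i) x))
  have iH : ∀ {t : ℝ}, 0 < t → Integrable (H t) := fun {t} ht =>
    integrable_of_le_mon hΘ hle
      (mH.comp (by fun_prop : Measurable (fun x : Sp n => (t, x))))
      (div_nonneg (monC_nonneg a b hC) (sq_nonneg t)) ht (fun x => bH t x ht)
  have iG : ∀ {t : ℝ}, 0 < t → Integrable (G t) := fun {t} ht =>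
    integrable_of_le_mon hΘ hle
      (mG.comp (by fun_prop : Measurable (fun x : Sp n => (t, x))))
      (div_nonneg (monC_nonneg a b hC) (sq_nonneg t)) ht (fun x => bG t x ht)
  have hprod : Integrable (fun z : ℝ × Sp n => z.1 * (H z.1 z.2 + G z.1 z.2))
      (μ.prod volume) := by
    simp only [mul_add]
    exact (integrable_prod_of_le_mon hf hh hΘ hle mH hε (monC_nonneg a b hC) bH).add
      (integrable_prod_of_le_mon hf hh hΘ hle mG hε (monC_nonneg a b hC) bG)
  have hstep : ∫ z, z.1 * lapMon a b f h z.1 z.2 ∂(μ.prod volume) =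
      ∫ z, z.1 * (H z.1 z.2 + G z.1 z.2) ∂(μ.prod volume) := by
    rw [integral_prod _ (integrable_prod_lapMon hf hh hΘ hle hε), integral_prod _ hprod]
    refine setIntegral_congr_fun measurableSet_Ioc fun t ht => ?_
    have ht0 : 0 < t := hε.trans ht.1
    simp only [integral_const_mul]
    congr 1
    unfold lapMon
    rw [integral_add (iH ht0) (iG ht0), integral_add (iH ht0)
      (integrable_finsetSum _ fun i _ => iHess ht0 i), integral_finsetSum _ fun i _ => iHess ht0 i,
      integral_gradMon_kernTT hf hh hΘ hle ht0]
  rw [hstep, integral_prod_symm _ hprod, ← integral_const_mul]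
  refine integral_mono_ae hprod.integral_prod_right (hΘ.const_mul _) ?_
  filter_upwards [hle] with x hle
  exact integral_second_deriv_mon_le hC (fun t ht => hf.wInt.hasDerivAt_kext_kern ht x)
    (fun t ht => hh.wInt.hasDerivAt_kext_kern ht x)
    (fun t ht => hf.wInt.hasDerivAt_kext_kernT ht x)
    (fun t ht => hh.wInt.hasDerivAt_kext_kernT ht x) (fun t ht => hf.pos ht x)
    (fun t ht => hh.pos ht x) (fun t ht => hf.abs_kext_le ht (abs_kernT_le ht) x)
    (fun t ht => hh.abs_kext_le ht (abs_kernT_le ht) x)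
    (fun t ht => hf.abs_kext_le ht (abs_kernTT_le ht) x)
    (fun t ht => hh.abs_kext_le ht (abs_kernTT_le ht) x) hle
    (mH.comp (by fun_prop : Measurable (fun t : ℝ => (t, x))))
    (mG.comp (by fun_prop : Measurable (fun t : ℝ => (t, x)))) hε hεT

end Green

/-! ### The vertical square function on `L^p`, `1 < p ≤ 2` -/

section SquareFunction

variable {n : ℕ}

/-- The square of the vertical square function, restricted to the heights in `S`. -/
def gsq {F : Type*} [NormedAddCommGroup F] [NormedSpace ℝ F] (S : Set ℝ) (f : Sp n → F)
    (x : Sp n) : ℝ≥0∞ :=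
  ∫⁻ t in S, ENNReal.ofReal t * ‖kext (kernT t) f x‖ₑ ^ 2

theorem measurable_gsq_integrand {F : Type*} [NormedAddCommGroup F] [NormedSpace ℝ F]
    {f : Sp n → F} (hf : AEStronglyMeasurable f volume) :
    Measurable (fun z : ℝ × Sp n => ENNReal.ofReal z.1 * ‖kext (kernT z.1) f z.2‖ₑ ^ 2) := by
  have := (stronglyMeasurable_kext hf measurable_kernT).enorm
  fun_prop

theorem measurable_gsq {F : Type*} [NormedAddCommGroup F] [NormedSpace ℝ F] {f : Sp n → F}
    (hf : AEStronglyMeasurable f volume) (S : Set ℝ) : Measurable (gsq S f) :=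
  Measurable.lintegral_prod_left' (measurable_gsq_integrand hf)

theorem gsq_mono {F : Type*} [NormedAddCommGroup F] [NormedSpace ℝ F] {S S' : Set ℝ} (h : S ⊆ S')
    (f : Sp n → F) (x : Sp n) : gsq S f x ≤ gsq S' f x :=
  lintegral_mono_set h

/-- A real-valued multiple of the maximal function that dominates all extensions. -/
def maxR {F : Type*} [NormedAddCommGroup F] (f : Sp n → F) (x : Sp n) : ℝ :=
  domC n * (maxFn (fun y => ‖f y‖ₑ) x).toReal

theorem maxFn_congr {f g : Sp n → ℝ≥0∞} (h : f =ᵐ[volume] g) : maxFn f = maxFn g := by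
  funext x
  unfold maxFn
  have h1 : ∀ (z : Sp n) (r : ℝ), ∫⁻ y in Metric.ball z r, f y = ∫⁻ y in Metric.ball z r, g y :=
    fun z r => lintegral_congr_ae (ae_restrict_of_ae h)
  simp only [h1]

theorem lintegral_maxFn_rpow_le' [NeZero n] {f : Sp n → ℝ≥0∞} (hf : AEMeasurable f volume) {p : ℝ}
    (hp : 1 < p) : ∫⁻ x, maxFn f x ^ p ≤ ENNReal.ofReal (maxC n p) * ∫⁻ x, f x ^ p := by
  have h1 := lintegral_maxFn_rpow_le hf.measurable_mk hp
  rw [← maxFn_congr hf.ae_eq_mk] at h1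
  refine h1.trans (le_of_eq ?_)
  congr 1
  refine lintegral_congr_ae ?_
  filter_upwards [hf.ae_eq_mk] with x hx
  rw [hx]

theorem ae_maxFn_lt_top [NeZero n] {f : Sp n → ℝ≥0∞} (hf : AEMeasurable f volume) {p : ℝ}
    (hp : 1 < p) (hfin : ∫⁻ x, f x ^ p < ∞) : ∀ᵐ x, maxFn f x < ∞ := by
  have h1 : ∫⁻ x, maxFn f x ^ p ≠ ∞ :=
    ((lintegral_maxFn_rpow_le' hf hp).trans_lt
      (ENNReal.mul_lt_top ENNReal.ofReal_lt_top hfin)).ne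
  filter_upwards [ae_lt_top ((measurable_maxFn f).pow_const p) h1] with x hx
  exact (ENNReal.rpow_lt_top_iff_of_pos (by linarith)).1 hx

section maxR

variable {F : Type*} [NormedAddCommGroup F] {f : Sp n → F} {p : ℝ}

theorem maxR_nonneg (f : Sp n → F) (x : Sp n) : 0 ≤ maxR f x :=
  mul_nonneg (domC_nonneg n) ENNReal.toReal_nonneg

theorem ae_kext_le_maxR [NeZero n] [NormedSpace ℝ F] (hp : 1 < p) (hf : WInt f)
    (hfin : ∫⁻ x, ‖f x‖ₑ ^ p < ∞) :
    ∀ᵐ x, ∀ t, 0 < t → kext (kern t) (fun y => ‖f y‖) x ≤ maxR f x := by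
  filter_upwards [ae_maxFn_lt_top hf.aestronglyMeasurable.enorm hp hfin] with x hx t ht
  have h1 := hf.ofReal_kext_norm_le_maxFn ht (Metric.mem_ball_self ht (x := x))
  rw [← ENNReal.ofReal_toReal hx.ne, ← ENNReal.ofReal_mul (domC_nonneg n),
    ENNReal.ofReal_le_ofReal_iff (mul_nonneg (domC_nonneg n) ENNReal.toReal_nonneg)] at h1
  exact h1

theorem measurable_maxR (f : Sp n → F) : Measurable (maxR f) :=
  (measurable_maxFn _).ennreal_toReal.const_mul _

/-- The constant in the `L^p` bound of `maxR`. -/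
def maxRC (n : ℕ) (p : ℝ) : ℝ := domC n ^ p * maxC n p

theorem maxC_nonneg (n : ℕ) {p : ℝ} (hp : 1 < p) : 0 ≤ maxC n p := by
  have : 0 < p - 1 := by linarith
  unfold maxC
  positivity

theorem maxRC_nonneg (n : ℕ) {p : ℝ} (hp : 1 < p) : 0 ≤ maxRC n p :=
  mul_nonneg (Real.rpow_nonneg (domC_nonneg n) _) (maxC_nonneg n hp)

theorem lintegral_maxR_rpow_le [NeZero n] (hp : 1 < p) (hf : AEStronglyMeasurable f volume) :
    ∫⁻ x, ENNReal.ofReal (maxR f x ^ p) ≤ ENNReal.ofReal (maxRC n p) * ∫⁻ x, ‖f x‖ₑ ^ p := by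
  have hp0 : 0 < p := by linarith
  have h1 : ∀ x, ENNReal.ofReal (maxR f x ^ p) ≤
      ENNReal.ofReal (domC n ^ p) * maxFn (fun y => ‖f y‖ₑ) x ^ p := by
    intro x
    rw [maxR, Real.mul_rpow (domC_nonneg n) ENNReal.toReal_nonneg,
      ENNReal.ofReal_mul (Real.rpow_nonneg (domC_nonneg n) _),
      ← ENNReal.ofReal_rpow_of_nonneg ENNReal.toReal_nonneg hp0.le]
    gcongr
    exact ENNReal.ofReal_toReal_le
  refine (lintegral_mono h1).trans ?_
  rw [lintegral_const_mul _ ((measurable_maxFn _).pow_const p), maxRC,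
    ENNReal.ofReal_mul (Real.rpow_nonneg (domC_nonneg n) _), mul_assoc]
  gcongr
  exact lintegral_maxFn_rpow_le' hf.enorm hp

theorem integrable_maxR_rpow [NeZero n] (hp : 1 < p) (hf : AEStronglyMeasurable f volume)
    (hfin : ∫⁻ x, ‖f x‖ₑ ^ p < ∞) : Integrable (fun x => maxR f x ^ p) := by
  refine ⟨((measurable_maxR f).pow_const p).aestronglyMeasurable, ?_⟩
  rw [hasFiniteIntegral_iff_ofReal (ae_of_all _ fun x => Real.rpow_nonneg (maxR_nonneg f x) _)]
  exact (lintegral_maxR_rpow_le hp hf).trans_lt (ENNReal.mul_lt_top ENNReal.ofReal_lt_top hfin)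

theorem ofReal_integral_maxR_rpow_le [NeZero n] (hp : 1 < p) (hf : AEStronglyMeasurable f volume)
    (hfin : ∫⁻ x, ‖f x‖ₑ ^ p < ∞) :
    ENNReal.ofReal (∫ x, maxR f x ^ p) ≤ ENNReal.ofReal (maxRC n p) * ∫⁻ x, ‖f x‖ₑ ^ p := by
  rw [ofReal_integral_eq_lintegral_ofReal (integrable_maxR_rpow hp hf hfin)
    (ae_of_all _ fun x => Real.rpow_nonneg (maxR_nonneg f x) _)]
  exact lintegral_maxR_rpow_le hp hf

end maxR

theorem PosExt.ae_le_maxR [NeZero n] {f : Sp n → ℝ} (hf : PosExt f) {p : ℝ} (hp : 1 < p)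
    (hfin : ∫⁻ x, ‖f x‖ₑ ^ p < ∞) : ∀ᵐ x, ∀ t, 0 < t → kext (kern t) f x ≤ maxR f x := by
  have := ae_kext_le_maxR hp hf.wInt hfin
  simpa only [Real.norm_of_nonneg (hf.nonneg _)] using this

theorem enorm_sq_eq_ofReal (a : ℝ) : ‖a‖ₑ ^ 2 = ENNReal.ofReal (a ^ 2) := by
  rw [← ofReal_norm, ← ENNReal.ofReal_pow (norm_nonneg _), Real.norm_eq_abs, sq_abs]

theorem rpow_mul_rpow_le_add {a b : ℝ≥0∞} {θ : ℝ} (h0 : 0 ≤ θ) (h1 : θ ≤ 1) :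
    a ^ (1 - θ) * b ^ θ ≤ a + b := by
  calc a ^ (1 - θ) * b ^ θ ≤ (max a b) ^ (1 - θ) * (max a b) ^ θ := by
        have : 0 ≤ 1 - θ := by linarith
        gcongr
        · exact le_max_left _ _
        · exact le_max_right _ _
    _ = max a b := by
        rw [← ENNReal.rpow_add_of_nonneg _ _ (by linarith) h0, sub_add_cancel, ENNReal.rpow_one]
    _ ≤ a + b := max_le le_self_add le_add_self

/-- The Lebesgue integral over `x` and `t` of a nonnegative function dominated by an integrable
one. -/
theorem lintegral_lintegral_le_of_integral_le {Ψ : ℝ × Sp n → ℝ} {μ : Measure ℝ} [SFinite μ]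
    {c : ℝ} (hΨ : Integrable Ψ (μ.prod volume)) (h0 : 0 ≤ᵐ[μ.prod volume] Ψ)
    (hle : ∫ z, Ψ z ∂(μ.prod volume) ≤ c) :
    ∫⁻ x, ∫⁻ t, ENNReal.ofReal (Ψ (t, x)) ∂μ ≤ ENNReal.ofReal c := by
  rw [← lintegral_prod_symm _ hΨ.aestronglyMeasurable.aemeasurable.ennreal_ofReal,
    ← ofReal_integral_eq_lintegral_ofReal hΨ h0]
  exact ENNReal.ofReal_le_ofReal hle

theorem ae_prod_mem_Ioc (ε T : ℝ) :
    ∀ᵐ z ∂((volume.restrict (Ioc ε T)).prod (volume : Measure (Sp n))), z.1 ∈ Ioc ε T := by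
  have h2 : ∀ᵐ t ∂(volume.restrict (Ioc ε T)), t ∈ Ioc ε T := ae_restrict_mem measurableSet_Ioc
  exact Measure.quasiMeasurePreserving_fst.ae h2

theorem hessMon_zero_right (p u v ξ η : ℝ) :
    hessMon p 0 u v ξ η = u ^ p * (p * (p - 1) * (ξ / u) ^ 2) := by
  simp [hessMon]

/-- The constant of `lintegral_gsq_rpow_le_of_le_two`. -/
def smallExpC (n : ℕ) (p : ℝ) : ℝ :=
  (1 + (1 / (p * (p - 1))) ) * (1 + 2 * (monC p 0 (kernC n) + 1)) * maxRC n p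

/-- The `L^p` bound of the square function of a nonnegative function for `1 < p ≤ 2`. It rests on
the identity `Δ(u^p) = p (p - 1) u^{p-2} |∇u|²`. -/
theorem lintegral_gsq_rpow_le_of_le_two [NeZero n] {f : Sp n → ℝ} (hf : PosExt f) {p : ℝ}
    (hp : 1 < p) (hp2 : p ≤ 2) (hfin : ∫⁻ x, ‖f x‖ₑ ^ p < ∞) {ε T : ℝ} (hε : 0 < ε) (hεT : ε ≤ T) :
    ∫⁻ x, gsq (Ioc ε T) f x ^ (p / 2) ≤ ENNReal.ofReal (smallExpC n p) * ∫⁻ x, ‖f x‖ₑ ^ p := by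
  have hp0 : 0 < p := by linarith
  have hp1 : 0 < p - 1 := by linarith
  have hm := hf.wInt.aestronglyMeasurable
  have hΘ := integrable_maxR_rpow hp hm hfin
  have hmax := hf.ae_le_maxR hp hfin
  have hle : ∀ᵐ x, ∀ t, 0 < t →
      kext (kern t) f x ^ p * kext (kern t) f x ^ (0 : ℝ) ≤ maxR f x ^ p := by
    filter_upwards [hmax] with x hx t ht
    rw [Real.rpow_zero, mul_one]
    exact Real.rpow_le_rpow (hf.pos ht x).le (hx t ht) hp0.le
  have hlap : ∀ t x, 0 < t → kext (kern t) f x ^ p * (p * (p - 1) *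
      (kext (kernT t) f x / kext (kern t) f x) ^ 2) ≤ lapMon p 0 f f t x := by
    intro t x ht
    simp only [lapMon, hessMon_zero_right]
    refine le_add_of_nonneg_right (Finset.sum_nonneg fun i _ => ?_)
    have := hf.pos ht x
    positivity
  have hlap0 : ∀ t x, 0 < t → 0 ≤ lapMon p 0 f f t x := fun t x ht =>
    le_trans (by have := hf.pos ht x; positivity) (hlap t x ht)
  set J : Sp n → ℝ≥0∞ := fun x => ∫⁻ t in Ioc ε T, ENNReal.ofReal (t * lapMon p 0 f f t x) with hJ
  have hJint : ∫⁻ x, J x ≤ ENNReal.ofReal (2 * (monC p 0 (kernC n) + 1) * ∫ x, maxR f x ^ p) := by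
    refine lintegral_lintegral_le_of_integral_le (integrable_prod_lapMon hf hf hΘ hle hε) ?_
      (integral_lapMon_le hf hf hΘ hle hε hεT)
    filter_upwards [ae_prod_mem_Ioc ε T] with z hz
    exact mul_nonneg (hε.trans hz.1).le (hlap0 _ _ (hε.trans hz.1))
  have hJm : AEMeasurable J volume :=
    (integrable_prod_lapMon (T := T) hf hf hΘ hle
      hε).aestronglyMeasurable.aemeasurable.ennreal_ofReal.lintegral_prod_left'
  -- `|∂ₜu|²` is `u^{2-p}` times a part of `Δ(u^p)`, and `u ≤ M` with a nonnegative exponent `2 - p`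
  have hpt : ∀ᵐ x, gsq (Ioc ε T) f x ^ (p / 2) ≤
      ENNReal.ofReal (1 + 1 / (p * (p - 1))) * (ENNReal.ofReal (maxR f x ^ p) + J x) := by
    filter_upwards [hmax] with x hx
    have hM0 := maxR_nonneg f x
    have h1 : gsq (Ioc ε T) f x ≤
        ENNReal.ofReal (1 / (p * (p - 1))) * (ENNReal.ofReal (maxR f x ^ (2 - p)) * J x) := by
      rw [gsq, hJ, ← mul_assoc, ← ENNReal.ofReal_mul (by positivity),
        ← lintegral_const_mul' _ _ ENNReal.ofReal_ne_top]
      refine setLIntegral_mono' measurableSet_Ioc fun t ht => ?_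
      have ht0 : 0 < t := hε.trans ht.1
      rw [enorm_sq_eq_ofReal, ← ENNReal.ofReal_mul ht0.le, ← ENNReal.ofReal_mul (by positivity)]
      refine ENNReal.ofReal_le_ofReal ?_
      have hu := hf.pos ht0 x
      set u := kext (kern t) f x with hu'
      set ξ := kext (kernT t) f x with hξ'
      have e1 : ξ ^ 2 = (1 / (p * (p - 1))) * u ^ (2 - p) *
          (u ^ p * (p * (p - 1) * (ξ / u) ^ 2)) := by
        have e2 : u ^ (2 - p) * u ^ p = u ^ 2 := by
          rw [← Real.rpow_add hu, sub_add_cancel, Real.rpow_two]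
        calc ξ ^ 2 = (u ^ 2) * (ξ / u) ^ 2 := by field_simp
          _ = _ := by rw [← e2]; field_simp
      calc t * ξ ^ 2 = t * ((1 / (p * (p - 1))) * u ^ (2 - p) *
          (u ^ p * (p * (p - 1) * (ξ / u) ^ 2))) := by rw [← e1]
        _ ≤ t * ((1 / (p * (p - 1))) * maxR f x ^ (2 - p) * lapMon p 0 f f t x) := by
          have e3 : u ^ (2 - p) ≤ maxR f x ^ (2 - p) :=
            Real.rpow_le_rpow hu.le (hx t ht0) (by linarith)
          have e4 := hlap t x ht0
          gcongr
        _ = _ := by ring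
    have h2 : (ENNReal.ofReal (maxR f x ^ (2 - p)) * J x) ^ (p / 2) ≤
        ENNReal.ofReal (maxR f x ^ p) + J x := by
      rw [ENNReal.mul_rpow_of_nonneg _ _ (by positivity)]
      refine le_trans (le_of_eq ?_) (rpow_mul_rpow_le_add (θ := p / 2) (by positivity)
        (by linarith))
      congr 1
      rw [ENNReal.ofReal_rpow_of_nonneg (by positivity) (by positivity),
        ENNReal.ofReal_rpow_of_nonneg (by positivity) (by linarith), ← Real.rpow_mul hM0,
        ← Real.rpow_mul hM0]
      congr 2; ring
    calc gsq (Ioc ε T) f x ^ (p / 2)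
        ≤ (ENNReal.ofReal (1 / (p * (p - 1))) *
            (ENNReal.ofReal (maxR f x ^ (2 - p)) * J x)) ^ (p / 2) := by gcongr
      _ = ENNReal.ofReal (1 / (p * (p - 1))) ^ (p / 2) *
            (ENNReal.ofReal (maxR f x ^ (2 - p)) * J x) ^ (p / 2) :=
          ENNReal.mul_rpow_of_nonneg _ _ (by positivity)
      _ ≤ _ := by
          gcongr
          rw [ENNReal.ofReal_rpow_of_nonneg (by positivity) (by positivity)]
          refine ENNReal.ofReal_le_ofReal ?_
          rcases le_total (1 / (p * (p - 1))) 1 with h | h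
          · refine (Real.rpow_le_one (by positivity) h (by positivity)).trans ?_
            have : 0 < 1 / (p * (p - 1)) := by positivity
            linarith
          · refine (Real.rpow_le_rpow_of_exponent_le h (show p / 2 ≤ 1 by linarith)).trans ?_
            rw [Real.rpow_one]; linarith
  have hM1 := monC_nonneg p 0 (kernC_pos n).le
  have hI0 : 0 ≤ ∫ x, maxR f x ^ p :=
    integral_nonneg fun x => Real.rpow_nonneg (maxR_nonneg f x) _
  refine (lintegral_mono_ae hpt).trans ?_
  rw [lintegral_const_mul' _ _ ENNReal.ofReal_ne_top, lintegral_add_right' _ hJm,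
    ← ofReal_integral_eq_lintegral_ofReal hΘ
      (ae_of_all _ fun x => Real.rpow_nonneg (maxR_nonneg f x) _)]
  calc _ ≤ ENNReal.ofReal (1 + 1 / (p * (p - 1))) * (ENNReal.ofReal (∫ x, maxR f x ^ p) +
        ENNReal.ofReal (2 * (monC p 0 (kernC n) + 1) * ∫ x, maxR f x ^ p)) := by gcongr
    _ = ENNReal.ofReal ((1 + 1 / (p * (p - 1))) * (1 + 2 * (monC p 0 (kernC n) + 1))) *
        ENNReal.ofReal (∫ x, maxR f x ^ p) := by
        rw [← ENNReal.ofReal_add hI0 (by positivity), ← ENNReal.ofReal_mul (by positivity),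
          ← ENNReal.ofReal_mul (by positivity)]
        congr 1; ring
    _ ≤ ENNReal.ofReal ((1 + 1 / (p * (p - 1))) * (1 + 2 * (monC p 0 (kernC n) + 1))) *
        (ENNReal.ofReal (maxRC n p) * ∫⁻ x, ‖f x‖ₑ ^ p) := by
        gcongr
        exact ofReal_integral_maxR_rpow_le hp hm hfin
    _ = _ := by
        rw [← mul_assoc, ← ENNReal.ofReal_mul (by positivity)]
        rfl

end SquareFunction

/-! ### The vertical square function on `L^p`, `2 < p < ∞` -/

section Large

variable {n : ℕ}

theorem rpow_two_mul_le_max {u v p r : ℝ} (hu : 0 < u) (hv : 0 < v) (hp : 2 < p)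
    (hr : r = 2 * p / (p - 2)) : u ^ (2 : ℝ) * v ^ (2 : ℝ) ≤ max (u ^ p) (v ^ r) := by
  have hp2 : 0 < p - 2 := by linarith
  have hr0 : 0 < r := by rw [hr]; positivity
  have hpr : 2 / p + 2 / r = 1 := by rw [hr]; field_simp; ring
  have hm : 0 < max (u ^ p) (v ^ r) := lt_max_of_lt_left (by positivity)
  calc u ^ (2 : ℝ) * v ^ (2 : ℝ) = (u ^ p) ^ (2 / p) * (v ^ r) ^ (2 / r) := by
        rw [← Real.rpow_mul hu.le, ← Real.rpow_mul hv.le]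
        congr 2 <;> field_simp
    _ ≤ max (u ^ p) (v ^ r) ^ (2 / p) * max (u ^ p) (v ^ r) ^ (2 / r) := by
        gcongr
        · exact le_max_left _ _
        · exact le_max_right _ _
    _ = max (u ^ p) (v ^ r) := by rw [← Real.rpow_add hm, hpr, Real.rpow_one]

/-- The Hessian of `F(u, v) = u² v² + A u^p + B v^r`, `2 / p + 2 / r = 1`, controls `v² ξ²` when
`A` and `B` are large: the mixed term of `u² v²` is absorbed by one of the two powers. -/
theorem sq_mul_sq_le_hess {u v p r ξ η : ℝ} (hu : 0 < u) (hv : 0 < v) (hp : 2 < p)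
    (hr : r = 2 * p / (p - 2)) : v ^ 2 * ξ ^ 2 ≤ hessMon 2 2 u v ξ η +
      16 / (p * (p - 1)) * hessMon p 0 u v ξ η + 16 / (r * (r - 1)) * hessMon 0 r u v ξ η := by
  have hp2 : 0 < p - 2 := by linarith
  have hr2 : 2 < r := by
    rw [hr, lt_div_iff₀ hp2]; linarith
  have hp1 : 0 < p - 1 := by linarith
  have hr1 : 0 < r - 1 := by linarith
  have hmax := rpow_two_mul_le_max hu hv hp hr
  set G := u ^ (2 : ℝ) * v ^ (2 : ℝ) with hG
  have hG0 : 0 < G := by positivity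
  set α := ξ / u with hα
  set β := η / v with hβ
  have e0 : v ^ 2 * ξ ^ 2 = G * α ^ 2 := by
    rw [hG, hα, Real.rpow_two, Real.rpow_two]; field_simp
  have e1 : hessMon 2 2 u v ξ η = G * (2 * α ^ 2 + 8 * α * β + 2 * β ^ 2) := by
    simp only [hessMon, ← hG, ← hα, ← hβ]; ring
  have e2 : 16 / (p * (p - 1)) * hessMon p 0 u v ξ η = 16 * (u ^ p * α ^ 2) := by
    rw [hessMon_zero_right, ← hα]; field_simp
  have e3 : 16 / (r * (r - 1)) * hessMon 0 r u v ξ η = 16 * (v ^ r * β ^ 2) := by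
    simp only [hessMon, Real.rpow_zero, ← hβ]; field_simp; ring
  rw [e0, e1, e2, e3]
  have hup : 0 < u ^ p := by positivity
  have hvr : 0 < v ^ r := by positivity
  rcases le_max_iff.1 hmax with h | h
  · have h1 : G * α ^ 2 ≤ u ^ p * α ^ 2 := by gcongr
    have h2 : 0 ≤ v ^ r * β ^ 2 := by positivity
    have h3 : 0 ≤ G * (17 * α ^ 2 + 8 * α * β + 2 * β ^ 2) :=
      mul_nonneg hG0.le (by nlinarith [sq_nonneg (2 * α + β), sq_nonneg α, sq_nonneg β])
    nlinarith
  · have h1 : G * β ^ 2 ≤ v ^ r * β ^ 2 := by gcongr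
    have h2 : 0 ≤ u ^ p * α ^ 2 := by positivity
    have h3 : 0 ≤ G * (α ^ 2 + 8 * α * β + 18 * β ^ 2) :=
      mul_nonneg hG0.le (by nlinarith [sq_nonneg (α + 4 * β), sq_nonneg α, sq_nonneg β])
    nlinarith

/-- The constant of `lintegral_sq_mul_sq_le`. -/
def trilinearC (n : ℕ) (p r : ℝ) : ℝ :=
  (2 * (monC 2 2 (kernC n) + 1) + 16 / (p * (p - 1)) * (2 * (monC p 0 (kernC n) + 1)) +
    16 / (r * (r - 1)) * (2 * (monC 0 r (kernC n) + 1)))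

/-- The trilinear estimate behind the square function bound for `p > 2`. -/
theorem lintegral_sq_mul_sq_le [NeZero n] {f h : Sp n → ℝ} (hf : PosExt f) (hh : PosExt h)
    {p r : ℝ} (hp : 2 < p) (hr : r = 2 * p / (p - 2)) (hfin : ∫⁻ x, ‖f x‖ₑ ^ p < ∞)
    (hhfin : ∫⁻ x, ‖h x‖ₑ ^ r < ∞) {ε T : ℝ} (hε : 0 < ε) (hεT : ε ≤ T) :
    ∫⁻ x, ∫⁻ t in Ioc ε T, ENNReal.ofReal (t * (kext (kern t) h x ^ 2 * kext (kernT t) f x ^ 2)) ≤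
      ENNReal.ofReal (trilinearC n p r) * (ENNReal.ofReal (maxRC n p) * (∫⁻ x, ‖f x‖ₑ ^ p) +
        ENNReal.ofReal (maxRC n r) * ∫⁻ x, ‖h x‖ₑ ^ r) := by
  have hp2 : 0 < p - 2 := by linarith
  have hr2 : 2 < r := by
    rw [hr, lt_div_iff₀ hp2]; linarith
  have hp1 : 0 < p - 1 := by linarith
  have hr1 : 0 < r - 1 := by linarith
  have hp0 : 0 < p := by linarith
  have hr0 : 0 < r := by linarith
  have hC := (kernC_pos n).le
  have hm := hf.wInt.aestronglyMeasurable
  have hhm := hh.wInt.aestronglyMeasurable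
  have hΘ₁ := integrable_maxR_rpow (by linarith : 1 < p) hm hfin
  have hΘ₂ := integrable_maxR_rpow (by linarith : 1 < r) hhm hhfin
  set Θ : Sp n → ℝ := fun x => maxR f x ^ p + maxR h x ^ r with hΘd
  have hΘ : Integrable Θ := hΘ₁.add hΘ₂
  have hmax : ∀ᵐ x, ∀ t, 0 < t → kext (kern t) f x ^ p ≤ maxR f x ^ p ∧
      kext (kern t) h x ^ r ≤ maxR h x ^ r ∧ 0 ≤ maxR f x ^ p ∧ 0 ≤ maxR h x ^ r := by
    filter_upwards [hf.ae_le_maxR (by linarith) hfin, hh.ae_le_maxR (by linarith) hhfin] with x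
      h1 h2 t ht
    have := maxR_nonneg f x
    have := maxR_nonneg h x
    exact ⟨Real.rpow_le_rpow (hf.pos ht x).le (h1 t ht) hp0.le,
      Real.rpow_le_rpow (hh.pos ht x).le (h2 t ht) hr0.le, by positivity, by positivity⟩
  have hle₁ : ∀ᵐ x, ∀ t, 0 < t →
      kext (kern t) f x ^ (2 : ℝ) * kext (kern t) h x ^ (2 : ℝ) ≤ Θ x := by
    filter_upwards [hmax] with x hx t ht
    obtain ⟨h1, h2, h3, h4⟩ := hx t ht
    refine (rpow_two_mul_le_max (hf.pos ht x) (hh.pos ht x) hp hr).trans (max_le ?_ ?_) <;>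
      simp only [hΘd] <;> linarith
  have hle₂ : ∀ᵐ x, ∀ t, 0 < t →
      kext (kern t) f x ^ p * kext (kern t) h x ^ (0 : ℝ) ≤ Θ x := by
    filter_upwards [hmax] with x hx t ht
    obtain ⟨h1, h2, h3, h4⟩ := hx t ht
    rw [Real.rpow_zero, mul_one]
    simp only [hΘd]; linarith
  have hle₃ : ∀ᵐ x, ∀ t, 0 < t →
      kext (kern t) f x ^ (0 : ℝ) * kext (kern t) h x ^ r ≤ Θ x := by
    filter_upwards [hmax] with x hx t ht
    obtain ⟨h1, h2, h3, h4⟩ := hx t ht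
    rw [Real.rpow_zero, one_mul]
    simp only [hΘd]; linarith
  have i₁ := integrable_prod_lapMon (T := T) hf hh hΘ hle₁ hε
  have i₂ := (integrable_prod_lapMon (T := T) hf hh hΘ hle₂ hε).const_mul (16 / (p * (p - 1)))
  have i₃ := (integrable_prod_lapMon (T := T) hf hh hΘ hle₃ hε).const_mul (16 / (r * (r - 1)))
  have b₁ := integral_lapMon_le hf hh hΘ hle₁ hε hεT
  have b₂ := integral_lapMon_le hf hh hΘ hle₂ hε hεT
  have b₃ := integral_lapMon_le hf hh hΘ hle₃ hε hεT
  set Ψ : ℝ × Sp n → ℝ := fun z => z.1 * lapMon 2 2 f h z.1 z.2 +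
    16 / (p * (p - 1)) * (z.1 * lapMon p 0 f h z.1 z.2) +
    16 / (r * (r - 1)) * (z.1 * lapMon 0 r f h z.1 z.2) with hΨ
  have hpt : ∀ t x, 0 < t →
      t * (kext (kern t) h x ^ 2 * kext (kernT t) f x ^ 2) ≤ Ψ (t, x) := by
    intro t x ht
    have e : Ψ (t, x) = t * (lapMon 2 2 f h t x + 16 / (p * (p - 1)) * lapMon p 0 f h t x +
        16 / (r * (r - 1)) * lapMon 0 r f h t x) := by simp only [hΨ]; ring
    rw [e]
    gcongr
    have hu := hf.pos ht x
    have hv := hh.pos ht x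
    have h1 := sq_mul_sq_le_hess (ξ := kext (kernT t) f x) (η := kext (kernT t) h x) hu hv hp hr
    have h2 : ∀ i : Fin n, 0 ≤ hessMon 2 2 (kext (kern t) f x) (kext (kern t) h x)
        (kext (kernX i t) f x) (kext (kernX i t) h x) +
        16 / (p * (p - 1)) * hessMon p 0 (kext (kern t) f x) (kext (kern t) h x)
        (kext (kernX i t) f x) (kext (kernX i t) h x) +
        16 / (r * (r - 1)) * hessMon 0 r (kext (kern t) f x) (kext (kern t) h x)
        (kext (kernX i t) f x) (kext (kernX i t) h x) := fun i =>
      le_trans (by positivity) (sq_mul_sq_le_hess hu hv hp hr)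
    have h3 := Finset.sum_nonneg fun i (_ : i ∈ Finset.univ) => h2 i
    simp only [Finset.sum_add_distrib, ← Finset.mul_sum] at h3
    simp only [lapMon]
    linarith
  have hΨi : Integrable Ψ ((volume.restrict (Ioc ε T)).prod volume) := (i₁.add i₂).add i₃
  have hΨle : ∫ z, Ψ z ∂((volume.restrict (Ioc ε T)).prod volume) ≤ trilinearC n p r * ∫ x, Θ x := by
    have e := integral_add (i₁.add i₂) i₃
    have e' := integral_add i₁ i₂
    simp only [Pi.add_apply] at e e'
    rw [hΨ, e, e', integral_const_mul, integral_const_mul]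
    have c₂ : 0 ≤ 16 / (p * (p - 1)) := by positivity
    have c₃ : 0 ≤ 16 / (r * (r - 1)) := by positivity
    have d₂ := mul_le_mul_of_nonneg_left b₂ c₂
    have d₃ := mul_le_mul_of_nonneg_left b₃ c₃
    unfold trilinearC
    linarith
  have hΨ0 : 0 ≤ᵐ[(volume.restrict (Ioc ε T)).prod volume] Ψ := by
    filter_upwards [ae_prod_mem_Ioc ε T] with z hz
    have ht : 0 < z.1 := hε.trans hz.1
    exact le_trans (by positivity) (hpt z.1 z.2 ht)
  have hgC : 0 ≤ trilinearC n p r := by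
    have h1 := monC_nonneg 2 2 hC
    have h2 := monC_nonneg p 0 hC
    have h3 := monC_nonneg 0 r hC
    unfold trilinearC; positivity
  calc _ ≤ ∫⁻ x, ∫⁻ t in Ioc ε T, ENNReal.ofReal (Ψ (t, x)) :=
        lintegral_mono fun x => setLIntegral_mono' measurableSet_Ioc fun t ht =>
          ENNReal.ofReal_le_ofReal (hpt t x (hε.trans ht.1))
    _ ≤ ENNReal.ofReal (trilinearC n p r * ∫ x, Θ x) :=
        lintegral_lintegral_le_of_integral_le hΨi hΨ0 hΨle
    _ = ENNReal.ofReal (trilinearC n p r) * (ENNReal.ofReal (∫ x, maxR f x ^ p) +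
        ENNReal.ofReal (∫ x, maxR h x ^ r)) := by
        rw [ENNReal.ofReal_mul hgC, hΘd, integral_add hΘ₁ hΘ₂, ENNReal.ofReal_add
          (integral_nonneg fun x => Real.rpow_nonneg (maxR_nonneg f x) _)
          (integral_nonneg fun x => Real.rpow_nonneg (maxR_nonneg h x) _)]
    _ ≤ _ := by
        gcongr
        · exact ofReal_integral_maxR_rpow_le (by linarith) hm hfin
        · exact ofReal_integral_maxR_rpow_le (by linarith) hhm hhfin

/-! ### Replacing a weight by the square of an extension -/

/-- The extension of a function with values in `[0,∞]`. -/
def lext (t : ℝ) (h : Sp n → ℝ≥0∞) (y : Sp n) : ℝ≥0∞ :=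
  ∫⁻ z, ENNReal.ofReal (kern t (y - z)) * h z

/-- The square root of the maximal function. -/
def sqrtMax (h : Sp n → ℝ≥0∞) (x : Sp n) : ℝ := (maxFn h x ^ (1 / 2 : ℝ)).toReal

theorem measurable_sqrtMax (h : Sp n → ℝ≥0∞) : Measurable (sqrtMax h) :=
  ((measurable_maxFn h).pow_const _).ennreal_toReal

theorem enorm_sqrtMax_le (h : Sp n → ℝ≥0∞) (x : Sp n) :
    ‖sqrtMax h x‖ₑ ≤ maxFn h x ^ (1 / 2 : ℝ) := by
  rw [sqrtMax, ← ofReal_norm, Real.norm_of_nonneg ENNReal.toReal_nonneg]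
  exact ENNReal.ofReal_toReal_le

theorem lintegral_sqrtMax_rpow_le [NeZero n] {h : Sp n → ℝ≥0∞} (hh : AEMeasurable h volume) {q : ℝ}
    (hq : 1 < q) :
    ∫⁻ x, ‖sqrtMax h x‖ₑ ^ (2 * q) ≤ ENNReal.ofReal (maxC n q) * ∫⁻ x, h x ^ q := by
  refine le_trans (lintegral_mono fun x => ?_) (lintegral_maxFn_rpow_le' hh hq)
  calc ‖sqrtMax h x‖ₑ ^ (2 * q) ≤ (maxFn h x ^ (1 / 2 : ℝ)) ^ (2 * q) := by
        gcongr
        exact enorm_sqrtMax_le h x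
    _ = maxFn h x ^ q := by
        rw [← ENNReal.rpow_mul]
        congr 1; ring

theorem wInt_sqrtMax [NeZero n] {h : Sp n → ℝ≥0∞} (hh : AEMeasurable h volume) {q : ℝ}
    (hq : 1 < q) (hfin : ∫⁻ x, h x ^ q < ∞) : WInt (sqrtMax h) :=
  wInt_of_lintegral_rpow (p := 2 * q) (by linarith)
    (measurable_sqrtMax h).aestronglyMeasurable
    ((lintegral_sqrtMax_rpow_le hh hq).trans_lt (ENNReal.mul_lt_top ENNReal.ofReal_lt_top hfin))

theorem maxFn_ne_zero {h : Sp n → ℝ≥0∞} (hh : AEMeasurable h volume) (hne : ¬ h =ᵐ[volume] 0)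
    (x : Sp n) : maxFn h x ≠ 0 := by
  intro h0
  apply hne
  have h1 : ∀ k : ℕ, ∀ᵐ y, y ∈ Metric.ball x (k + 1) → h y = 0 := by
    intro k
    have h2 := lintegral_ball_le_maxFn h (x := x) (z := x) (r := k + 1) (by positivity)
      (Metric.mem_ball_self (by positivity))
    rw [h0, zero_mul, nonpos_iff_eq_zero, lintegral_eq_zero_iff' hh.restrict] at h2
    exact (ae_restrict_iff' measurableSet_ball).1 h2
  filter_upwards [ae_all_iff.2 h1] with y hy
  obtain ⟨k, hk⟩ := exists_nat_gt (dist y x)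
  exact hy k (by rw [Metric.mem_ball]; linarith)

theorem posExt_sqrtMax [NeZero n] {h : Sp n → ℝ≥0∞} (hh : AEMeasurable h volume) {q : ℝ}
    (hq : 1 < q) (hfin : ∫⁻ x, h x ^ q < ∞) (hne : ¬ h =ᵐ[volume] 0) : PosExt (sqrtMax h) where
  wInt := wInt_sqrtMax hh hq hfin
  nonneg _ := ENNReal.toReal_nonneg
  pos ht x := by
    refine (wInt_sqrtMax hh hq hfin).kext_pos (fun _ => ENNReal.toReal_nonneg) ?_ ht x
    intro h0
    have h1 : ∀ᵐ y : Sp n, False := by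
      filter_upwards [h0, ae_maxFn_lt_top hh hq hfin] with y hy hlt
      have h2 : 0 < maxFn h y ^ (1 / 2 : ℝ) :=
        ENNReal.rpow_pos (pos_iff_ne_zero.2 (maxFn_ne_zero hh hne y)) hlt.ne
      have h3 : maxFn h y ^ (1 / 2 : ℝ) ≠ ∞ := by simp [hlt.ne]
      exact (ENNReal.toReal_pos h2.ne' h3).ne' hy
    have h4 := (volume_ball_pos (0 : Sp n) one_pos).trans_le (measure_mono (subset_univ _))
    rw [ae_iff] at h1
    simp only [not_false_eq_true] at h1
    exact h4.ne' h1

/-- A lower bound of the mass of the kernel in the ball of radius `t`. -/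
def coneC (n : ℕ) : ℝ :=
  2⁻¹ ^ (((n : ℝ) + 1) / 2) * (volume (Metric.ball (0 : Sp n) 1)).toReal

theorem coneC_pos (n : ℕ) : 0 < coneC n := by
  have := ENNReal.toReal_pos (volume_ball_pos (0 : Sp n) one_pos).ne' (volume_ball_lt_top _ _).ne
  unfold coneC; positivity

theorem coneC_le_lintegral {t : ℝ} (ht : 0 < t) (y : Sp n) :
    ENNReal.ofReal (coneC n) ≤ ∫⁻ z in Metric.ball y t, ENNReal.ofReal (kern t (y - z)) := by
  have h1 : ∀ z ∈ Metric.ball y t, (t ^ n)⁻¹ * 2⁻¹ ^ (((n : ℝ) + 1) / 2) ≤ kern t (y - z) := by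
    intro z hz
    rw [Metric.mem_ball, dist_comm, dist_eq_norm] at hz
    have h2 := kern_le_of_le (n := n) ht ht (by norm_num : (0 : ℝ) < 2) 0 (y - z)
      (by rw [norm_zero]; nlinarith [norm_nonneg (y - z)])
    have h3 : kern t (0 : Sp n) = (t ^ n)⁻¹ := by
      have := kern_scale (n := n) ht 0
      simpa [kern] using this
    rw [h3, div_self ht.ne', one_mul] at h2
    rw [Real.inv_rpow (by norm_num)]
    rw [← div_eq_mul_inv, div_le_iff₀ (by positivity)]
    linarith
  calc ENNReal.ofReal (coneC n)
      = ENNReal.ofReal ((t ^ n)⁻¹ * 2⁻¹ ^ (((n : ℝ) + 1) / 2)) * volume (Metric.ball y t) := by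
        rw [volume_ball_eq y ht, coneC,
          ← ENNReal.ofReal_toReal (volume_ball_lt_top (0 : Sp n) 1).ne,
          ← ENNReal.ofReal_mul (by positivity), ← ENNReal.ofReal_mul (by positivity)]
        congr 1
        rw [ENNReal.ofReal_toReal (volume_ball_lt_top (0 : Sp n) 1).ne]
        field_simp
    _ = ∫⁻ z in Metric.ball y t, ENNReal.ofReal ((t ^ n)⁻¹ * 2⁻¹ ^ (((n : ℝ) + 1) / 2)) := by
        rw [setLIntegral_const]
    _ ≤ _ := setLIntegral_mono' measurableSet_ball fun z hz => ENNReal.ofReal_le_ofReal (h1 z hz)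

/-- The extension of `h` is dominated by the square of the extension of the square root of its
maximal function, because the maximal function is at least the extension on a whole ball. -/
theorem lext_le_sq [NeZero n] {h : Sp n → ℝ≥0∞} (hh : AEMeasurable h volume) {q : ℝ}
    (hq : 1 < q) (hfin : ∫⁻ x, h x ^ q < ∞) {t : ℝ} (ht : 0 < t) (y : Sp n) :
    lext t h y ≤ ENNReal.ofReal (domC n / coneC n ^ 2) *
      ENNReal.ofReal (kext (kern t) (sqrtMax h) y ^ 2) := by
  have hW := wInt_sqrtMax hh hq hfin
  have hcone := coneC_pos n
  set S := lext t h y with hS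
  have h1 : ∀ z ∈ Metric.ball y t, S ^ (1 / 2 : ℝ) ≤
      ENNReal.ofReal (domC n) ^ (1 / 2 : ℝ) * maxFn h z ^ (1 / 2 : ℝ) := by
    intro z hz
    rw [← ENNReal.mul_rpow_of_nonneg _ _ (by norm_num)]
    gcongr
    exact lintegral_kern_le_maxFn ht hz hh
  have h2 : ∀ᵐ z, maxFn h z ^ (1 / 2 : ℝ) = ENNReal.ofReal (sqrtMax h z) := by
    filter_upwards [ae_maxFn_lt_top hh hq hfin] with z hz
    rw [sqrtMax, ENNReal.ofReal_toReal]
    simp [hz.ne]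
  have h3 : ENNReal.ofReal (coneC n) * S ^ (1 / 2 : ℝ) ≤
      ENNReal.ofReal (domC n) ^ (1 / 2 : ℝ) * ENNReal.ofReal (kext (kern t) (sqrtMax h) y) := by
    rw [hW.ofReal_kext (fun _ => ENNReal.toReal_nonneg) ht]
    have mk : Measurable fun z => ENNReal.ofReal (kern t (y - z)) :=
      ((measurable_kern_right t).comp (by fun_prop)).ennreal_ofReal
    calc ENNReal.ofReal (coneC n) * S ^ (1 / 2 : ℝ)
        ≤ (∫⁻ z in Metric.ball y t, ENNReal.ofReal (kern t (y - z))) * S ^ (1 / 2 : ℝ) := by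
          gcongr
          exact coneC_le_lintegral ht y
      _ = ∫⁻ z in Metric.ball y t, ENNReal.ofReal (kern t (y - z)) * S ^ (1 / 2 : ℝ) :=
          (lintegral_mul_const _ mk).symm
      _ ≤ ∫⁻ z in Metric.ball y t, ENNReal.ofReal (domC n) ^ (1 / 2 : ℝ) *
            (ENNReal.ofReal (kern t (y - z)) * maxFn h z ^ (1 / 2 : ℝ)) := by
          refine setLIntegral_mono' measurableSet_ball fun z hz => ?_
          rw [mul_left_comm]
          gcongr
          exact h1 z hz
      _ ≤ ∫⁻ z, ENNReal.ofReal (domC n) ^ (1 / 2 : ℝ) *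
            (ENNReal.ofReal (kern t (y - z)) * maxFn h z ^ (1 / 2 : ℝ)) :=
          setLIntegral_le_lintegral _ _
      _ = ENNReal.ofReal (domC n) ^ (1 / 2 : ℝ) *
            ∫⁻ z, ENNReal.ofReal (kern t (y - z)) * maxFn h z ^ (1 / 2 : ℝ) :=
          lintegral_const_mul' _ _ (by simp)
      _ = _ := by
          congr 1
          refine lintegral_congr_ae ?_
          filter_upwards [h2] with z hz
          rw [hz]
  have hk0 : 0 ≤ kext (kern t) (sqrtMax h) y := kext_nonneg (fun _ => ENNReal.toReal_nonneg) ht y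
  have h4 := ENNReal.rpow_le_rpow h3 (by norm_num : (0 : ℝ) ≤ 2)
  rw [ENNReal.mul_rpow_of_nonneg _ _ (by norm_num), ENNReal.mul_rpow_of_nonneg _ _ (by norm_num),
    ← ENNReal.rpow_mul, ← ENNReal.rpow_mul, one_div_mul_cancel (by norm_num), ENNReal.rpow_one,
    ENNReal.rpow_one, ENNReal.rpow_two, ENNReal.rpow_two, ← ENNReal.ofReal_pow hcone.le,
    ← ENNReal.ofReal_pow hk0] at h4
  rw [ENNReal.ofReal_div_of_pos (by positivity), mul_comm, ← mul_div_assoc,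
    ENNReal.le_div_iff_mul_le (Or.inl (ENNReal.ofReal_pos.2 (by positivity)).ne')
      (Or.inl ENNReal.ofReal_ne_top)]
  exact (mul_comm _ _).trans_le (h4.trans_eq (mul_comm _ _))

end Large

/-! ### Duality and absorption for `p > 2` -/

section Duality

variable {n : ℕ}

theorem setLIntegral_Ioc_two_mul (φ : ℝ → ℝ≥0∞) (a b : ℝ) :
    ∫⁻ t in Ioc (2 * a) (2 * b), φ t = 2 * ∫⁻ s in Ioc a b, φ (2 * s) := by
  rw [← image_mul_left_Ioc (zero_lt_two' ℝ), lintegral_image_eq_lintegral_abs_deriv_mul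
    (f' := fun _ => 2) measurableSet_Ioc
    (fun x _ => ((hasDerivAt_mul_const (2 : ℝ)).hasDerivWithinAt.congr_deriv rfl).congr
      (fun y _ => mul_comm 2 y) (mul_comm 2 x))
    (fun x _ y _ h => by simpa using h), ← lintegral_const_mul' _ _ (by simp)]
  simp

theorem sq_lintegral_mul_le {α : Type*} [MeasurableSpace α] {μ : Measure α} {w g : α → ℝ≥0∞}
    (hw : AEMeasurable w μ) (hg : AEMeasurable g μ) :
    (∫⁻ a, w a * g a ∂μ) ^ 2 ≤ (∫⁻ a, w a ∂μ) * ∫⁻ a, w a * g a ^ 2 ∂μ := by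
  have hs : ∀ c : ℝ≥0∞, (c ^ (1 / 2 : ℝ)) ^ (2 : ℝ) = c := fun c => by
    rw [← ENNReal.rpow_mul]; norm_num
  have h1 := ENNReal.lintegral_mul_le_Lp_mul_Lq μ (Real.HolderConjugate.two_two)
    (hw.pow_const (1 / 2 : ℝ)) ((hw.pow_const (1 / 2 : ℝ)).mul hg)
  have e1 : ∀ a, ((fun a => w a ^ (1 / 2 : ℝ)) * fun a => w a ^ (1 / 2 : ℝ) * g a) a =
      w a * g a := by
    intro a
    rw [Pi.mul_apply, ← mul_assoc, ← sq, ← ENNReal.rpow_two, hs]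
  have e2 : ∀ a, (w a ^ (1 / 2 : ℝ) * g a) ^ (2 : ℝ) = w a * g a ^ 2 := by
    intro a
    rw [ENNReal.mul_rpow_of_nonneg _ _ (by norm_num), hs, ENNReal.rpow_two]
  simp only [Pi.mul_apply] at e1
  simp only [Pi.mul_apply, e1, e2, hs] at h1
  calc (∫⁻ a, w a * g a ∂μ) ^ 2 = (∫⁻ a, w a * g a ∂μ) ^ (2 : ℝ) := (ENNReal.rpow_two _).symm
    _ ≤ ((∫⁻ a, w a ∂μ) ^ (1 / 2 : ℝ) * (∫⁻ a, w a * g a ^ 2 ∂μ) ^ (1 / 2 : ℝ)) ^ (2 : ℝ) := by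
        gcongr
    _ = _ := by rw [ENNReal.mul_rpow_of_nonneg _ _ (by norm_num), hs, hs]

section

variable {F : Type*} [NormedAddCommGroup F] [NormedSpace ℝ F] [CompleteSpace F]

/-- By the semigroup law, `∂ₜu` at height `2s` is an average of `∂ₜu` at height `s`. -/
theorem WInt.enorm_kextT_two_mul_sq_le {f : Sp n → F} (hf : WInt f) {s : ℝ} (hs : 0 < s)
    (x : Sp n) : ‖kext (kernT (2 * s)) f x‖ₑ ^ 2 ≤ ENNReal.ofReal (kernMass n)⁻¹ *
      ∫⁻ y, ENNReal.ofReal (kern s (x - y)) * ‖kext (kernT s) f y‖ₑ ^ 2 := by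
  have hZ := kernMass_pos n
  have h1 := hf.kext_kern_kernT hs hs x
  rw [← two_mul] at h1
  have h2 : ENNReal.ofReal (kernMass n) * ‖kext (kernT (2 * s)) f x‖ₑ ≤
      ∫⁻ y, ENNReal.ofReal (kern s (x - y)) * ‖kext (kernT s) f y‖ₑ := by
    calc ENNReal.ofReal (kernMass n) * ‖kext (kernT (2 * s)) f x‖ₑ
        = ‖kernMass n • kext (kernT (2 * s)) f x‖ₑ := by
          rw [enorm_smul, Real.enorm_of_nonneg hZ.le]
      _ = ‖kext (kern s) (kext (kernT s) f) x‖ₑ := by rw [h1]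
      _ ≤ ∫⁻ y, ‖kern s (x - y) • kext (kernT s) f y‖ₑ := enorm_integral_le_lintegral_enorm _
      _ = _ := by
          refine lintegral_congr fun y => ?_
          rw [enorm_smul, Real.enorm_of_nonneg (kern_pos hs _).le]
  have mk : Measurable fun y => ENNReal.ofReal (kern s (x - y)) :=
    ((measurable_kern_right s).comp (by fun_prop)).ennreal_ofReal
  have h3 := sq_lintegral_mul_le (μ := volume) mk.aemeasurable
    (stronglyMeasurable_kext_right hf.aestronglyMeasurable
      (measurable_kernT_right s)).enorm.aemeasurable
  rw [lintegral_kern_sub hs] at h3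
  have h4 := (pow_le_pow_left' h2 2).trans h3
  set S := ∫⁻ y, ENNReal.ofReal (kern s (x - y)) * ‖kext (kernT s) f y‖ₑ ^ 2
  set a := ‖kext (kernT (2 * s)) f x‖ₑ
  have hZ0 : ENNReal.ofReal (kernMass n) ≠ 0 := by simpa using hZ
  rw [mul_pow, sq (ENNReal.ofReal _), mul_assoc,
    ENNReal.mul_le_mul_iff_right hZ0 ENNReal.ofReal_ne_top] at h4
  rw [ENNReal.ofReal_inv_of_pos hZ, ← ENNReal.div_eq_inv_mul,
    ENNReal.le_div_iff_mul_le (Or.inl hZ0) (Or.inl ENNReal.ofReal_ne_top), mul_comm]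
  exact h4

end

theorem measurable_kern_sub_prod (t : ℝ) :
    Measurable fun z : Sp n × Sp n => ENNReal.ofReal (kern t (z.1 - z.2)) :=
  ((measurable_kern_right t).comp (measurable_fst.sub measurable_snd)).ennreal_ofReal

/-- Testing the square function against a weight. -/
theorem lintegral_gsq_mul_le [NeZero n] {f : Sp n → ℝ} (hf : WInt f) {h : Sp n → ℝ≥0∞}
    (hh : Measurable h) {q : ℝ} (hq : 1 < q) (hfin : ∫⁻ x, h x ^ q < ∞) {ε T : ℝ} (hε : 0 < ε) :
    ∫⁻ x, gsq (Ioc (2 * ε) (2 * T)) f x * h x ≤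
      ENNReal.ofReal (4 * (kernMass n)⁻¹ * (domC n / coneC n ^ 2)) *
      ∫⁻ x, ∫⁻ t in Ioc ε T,
        ENNReal.ofReal (t * (kext (kern t) (sqrtMax h) x ^ 2 * kext (kernT t) f x ^ 2)) := by
  have hZ := kernMass_pos n
  have hcone := coneC_pos n
  have hdom := domC_nonneg n
  have hm := hf.aestronglyMeasurable
  have hW := (wInt_sqrtMax hh.aemeasurable hq hfin).aestronglyMeasurable
  have m1 : Measurable fun z : ℝ × Sp n => kext (kernT z.1) f z.2 :=
    (stronglyMeasurable_kext hm measurable_kernT).measurable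
  have m2 : Measurable fun z : ℝ × Sp n => kext (kern z.1) (sqrtMax h) z.2 :=
    (stronglyMeasurable_kext hW measurable_kern).measurable
  have m3 : Measurable fun z : ℝ × Sp n => kext (kernT (2 * z.1)) f z.2 :=
    m1.comp (f := fun z : ℝ × Sp n => (2 * z.1, z.2)) (by fun_prop)
  -- for a fixed height, Tonelli's theorem moves the kernel onto the weight
  have hs : ∀ s, 0 < s → ∫⁻ x, ‖kext (kernT (2 * s)) f x‖ₑ ^ 2 * h x ≤
      ENNReal.ofReal ((kernMass n)⁻¹ * (domC n / coneC n ^ 2)) * ∫⁻ y,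
        ENNReal.ofReal (kext (kern s) (sqrtMax h) y ^ 2 * kext (kernT s) f y ^ 2) := by
    intro s hs0
    have mG : Measurable fun y => ‖kext (kernT s) f y‖ₑ ^ 2 :=
      (stronglyMeasurable_kext_right hm (measurable_kernT_right s)).enorm.pow_const 2
    calc ∫⁻ x, ‖kext (kernT (2 * s)) f x‖ₑ ^ 2 * h x
        ≤ ∫⁻ x, ENNReal.ofReal (kernMass n)⁻¹ *
          (∫⁻ y, ENNReal.ofReal (kern s (x - y)) * ‖kext (kernT s) f y‖ₑ ^ 2) * h x := by
          gcongr with x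
          exact hf.enorm_kextT_two_mul_sq_le hs0 x
      _ = ENNReal.ofReal (kernMass n)⁻¹ * ∫⁻ x, ∫⁻ y, ENNReal.ofReal (kern s (x - y)) *
            ‖kext (kernT s) f y‖ₑ ^ 2 * h x := by
          rw [← lintegral_const_mul' _ _ ENNReal.ofReal_ne_top]
          refine lintegral_congr fun x => ?_
          rw [mul_assoc, lintegral_mul_const]
          exact ((measurable_kern_sub_prod s).comp measurable_prodMk_left).mul mG
      _ = ENNReal.ofReal (kernMass n)⁻¹ * ∫⁻ y, ∫⁻ x, ENNReal.ofReal (kern s (x - y)) *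
            ‖kext (kernT s) f y‖ₑ ^ 2 * h x := by
          rw [lintegral_lintegral_swap]
          exact (((measurable_kern_sub_prod s).mul (mG.comp measurable_snd)).mul
            (hh.comp measurable_fst)).aemeasurable
      _ = ENNReal.ofReal (kernMass n)⁻¹ * ∫⁻ y, ‖kext (kernT s) f y‖ₑ ^ 2 * lext s h y := by
          congr 1
          refine lintegral_congr fun y => ?_
          rw [lext, ← lintegral_const_mul]
          · refine lintegral_congr fun x => ?_
            rw [← kern_neg, neg_sub]; ring
          · exact ((measurable_kern_sub_prod s).comp measurable_prodMk_left).mul hh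
      _ ≤ ENNReal.ofReal (kernMass n)⁻¹ * ∫⁻ y, ENNReal.ofReal (domC n / coneC n ^ 2) *
            ENNReal.ofReal (kext (kern s) (sqrtMax h) y ^ 2 * kext (kernT s) f y ^ 2) := by
          refine mul_le_mul_right (lintegral_mono fun y => ?_) _
          rw [ENNReal.ofReal_mul (sq_nonneg _), ← mul_assoc, enorm_sq_eq_ofReal, mul_comm]
          refine mul_le_mul_left ?_ _
          exact lext_le_sq hh.aemeasurable hq hfin hs0 y
      _ = _ := by
          rw [lintegral_const_mul' _ _ ENNReal.ofReal_ne_top, ← mul_assoc,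
            ← ENNReal.ofReal_mul (inv_nonneg.2 hZ.le)]
  calc ∫⁻ x, gsq (Ioc (2 * ε) (2 * T)) f x * h x
      = ∫⁻ x, ∫⁻ s in Ioc ε T, 4 * (ENNReal.ofReal s *
          (‖kext (kernT (2 * s)) f x‖ₑ ^ 2 * h x)) := by
        refine lintegral_congr fun x => ?_
        have m4 : Measurable fun s => ‖kext (kernT (2 * s)) f x‖ₑ ^ 2 :=
          (m3.comp measurable_prodMk_right).enorm.pow_const 2
        rw [gsq, setLIntegral_Ioc_two_mul, ← lintegral_const_mul' _ _ (by simp),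
          ← lintegral_mul_const]
        · refine lintegral_congr fun s => ?_
          rw [ENNReal.ofReal_mul (by norm_num), ENNReal.ofReal_ofNat]
          ring
        · fun_prop
    _ = ∫⁻ s in Ioc ε T, ∫⁻ x, 4 * (ENNReal.ofReal s *
          (‖kext (kernT (2 * s)) f x‖ₑ ^ 2 * h x)) := by
        rw [lintegral_lintegral_swap]
        have m5 : Measurable fun z : Sp n × ℝ => ‖kext (kernT (2 * z.2)) f z.1‖ₑ ^ 2 :=
          (m3.comp measurable_swap).enorm.pow_const 2
        refine Measurable.aemeasurable ?_
        exact ((measurable_snd.ennreal_ofReal.mul (m5.mul (hh.comp measurable_fst)))).const_mul 4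
    _ ≤ ∫⁻ s in Ioc ε T, ENNReal.ofReal (4 * (kernMass n)⁻¹ * (domC n / coneC n ^ 2)) * ∫⁻ x,
          ENNReal.ofReal (s * (kext (kern s) (sqrtMax h) x ^ 2 * kext (kernT s) f x ^ 2)) := by
        refine setLIntegral_mono' measurableSet_Ioc fun s hsI => ?_
        have hs0 : 0 < s := hε.trans hsI.1
        rw [lintegral_const_mul' _ _ (by simp), lintegral_const_mul' _ _ ENNReal.ofReal_ne_top]
        simp only [ENNReal.ofReal_mul hs0.le]
        rw [lintegral_const_mul' _ _ ENNReal.ofReal_ne_top]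
        calc _ ≤ 4 * (ENNReal.ofReal s *
              (ENNReal.ofReal ((kernMass n)⁻¹ * (domC n / coneC n ^ 2)) * ∫⁻ y,
              ENNReal.ofReal (kext (kern s) (sqrtMax h) y ^ 2 * kext (kernT s) f y ^ 2))) := by
              gcongr
              exact hs s hs0
          _ = _ := by
              rw [mul_assoc (4 : ℝ), ENNReal.ofReal_mul (by norm_num : (0 : ℝ) ≤ 4),
                ENNReal.ofReal_ofNat]
              ring
    _ = _ := by
        rw [lintegral_const_mul' _ _ ENNReal.ofReal_ne_top]
        congr 1
        rw [lintegral_lintegral_swap]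
        have : Measurable fun z : ℝ × Sp n => z.1 *
          (kext (kern z.1) (sqrtMax h) z.2 ^ 2 * kext (kernT z.1) f z.2 ^ 2) := by fun_prop
        exact this.ennreal_ofReal.aemeasurable

/-- The constant of `lintegral_gsq_mul_le_add`. -/
def weightedC (n : ℕ) (p : ℝ) : ℝ :=
  4 * (kernMass n)⁻¹ * (domC n / coneC n ^ 2) * trilinearC n p (2 * p / (p - 2)) *
    (maxRC n p + maxRC n (2 * p / (p - 2)) * maxC n (p / (p - 2)))

theorem trilinearC_nonneg (n : ℕ) {p r : ℝ} (hp : 1 < p) (hr : 1 < r) : 0 ≤ trilinearC n p r := by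
  have hC := (kernC_pos n).le
  have h1 := monC_nonneg 2 2 hC
  have h2 := monC_nonneg p 0 hC
  have h3 := monC_nonneg 0 r hC
  have hp1 : 0 < p - 1 := by linarith
  have hr1 : 0 < r - 1 := by linarith
  unfold trilinearC; positivity

theorem weightedC_nonneg (n : ℕ) {p : ℝ} (hp : 2 < p) : 0 ≤ weightedC n p := by
  have hp2 : 0 < p - 2 := by linarith
  have hr : 1 < 2 * p / (p - 2) := by rw [lt_div_iff₀ hp2]; linarith
  have hq : 1 < p / (p - 2) := by rw [lt_div_iff₀ hp2]; linarith
  have h1 := kernMass_pos n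
  have h2 := domC_nonneg n
  have h3 := coneC_pos n
  have h4 := trilinearC_nonneg n (by linarith : 1 < p) hr
  have h5 := maxRC_nonneg n (by linarith : 1 < p)
  have h6 := maxRC_nonneg n hr
  have h7 := maxC_nonneg n hq
  unfold weightedC; positivity

/-- A weight `h` is replaced by the square of the extension `v` of `sqrtMax h`, to which the
trilinear estimate applies. The exponents of `h` and `v` are `p / (p - 2)` and `2 p / (p - 2)`. -/
theorem lintegral_gsq_mul_le_add [NeZero n] {f : Sp n → ℝ} (hf : PosExt f) {p : ℝ} (hp : 2 < p)
    (hpfin : ∫⁻ x, ‖f x‖ₑ ^ p < ∞) {h : Sp n → ℝ≥0∞} (hh : Measurable h)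
    (hfin : ∫⁻ x, h x ^ (p / (p - 2)) < ∞) {ε T : ℝ} (hε : 0 < ε) (hεT : ε ≤ T) :
    ∫⁻ x, gsq (Ioc (2 * ε) (2 * T)) f x * h x ≤
      ENNReal.ofReal (weightedC n p) * ((∫⁻ x, ‖f x‖ₑ ^ p) + ∫⁻ x, h x ^ (p / (p - 2))) := by
  by_cases hne : h =ᵐ[volume] 0
  · have : ∫⁻ x, gsq (Ioc (2 * ε) (2 * T)) f x * h x = 0 := by
      rw [← lintegral_zero (μ := (volume : Measure (Sp n)))]
      refine lintegral_congr_ae ?_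
      filter_upwards [hne] with x hx
      simp [hx]
    rw [this]
    exact zero_le
  have hp2 : 0 < p - 2 := by linarith
  have hr : 1 < 2 * p / (p - 2) := by rw [lt_div_iff₀ hp2]; linarith
  have hq : 1 < p / (p - 2) := by rw [lt_div_iff₀ hp2]; linarith
  have er : 2 * (p / (p - 2)) = 2 * p / (p - 2) := by ring
  have hs := lintegral_sqrtMax_rpow_le hh.aemeasurable hq
  rw [er] at hs
  have h1 := kernMass_pos n
  have h2 := domC_nonneg n
  have h3 := coneC_pos n
  have h4 := trilinearC_nonneg n (by linarith : 1 < p) hr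
  have h5 := maxRC_nonneg n (by linarith : 1 < p)
  have h6 := maxRC_nonneg n hr
  have h7 := maxC_nonneg n hq
  refine (lintegral_gsq_mul_le hf.wInt hh hq hfin hε).trans ?_
  have key := lintegral_sq_mul_sq_le hf (posExt_sqrtMax hh.aemeasurable hq hfin hne) hp rfl hpfin
    (hs.trans_lt (ENNReal.mul_lt_top ENNReal.ofReal_lt_top hfin)) hε hεT
  set A := ∫⁻ x, ‖f x‖ₑ ^ p
  set B := ∫⁻ x, h x ^ (p / (p - 2))
  calc _ ≤ ENNReal.ofReal (4 * (kernMass n)⁻¹ * (domC n / coneC n ^ 2)) *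
        (ENNReal.ofReal (trilinearC n p (2 * p / (p - 2))) * (ENNReal.ofReal (maxRC n p +
          maxRC n (2 * p / (p - 2)) * maxC n (p / (p - 2))) * (A + B))) := by
        refine mul_le_mul_right (key.trans (mul_le_mul_right ?_ _)) _
        rw [mul_add]
        refine add_le_add ?_ ?_
        · gcongr
          exact le_add_of_nonneg_right (by positivity)
        · refine (mul_le_mul_right hs _).trans ?_
          rw [← mul_assoc, ← ENNReal.ofReal_mul h6]
          gcongr
          exact le_add_of_nonneg_left h5
    _ = _ := by
        rw [← mul_assoc, ← mul_assoc, ← ENNReal.ofReal_mul (by positivity),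
          ← ENNReal.ofReal_mul (by positivity), weightedC]

/-- A truncated square function has a finite `L^p` norm, with no uniformity in the truncation; this
finiteness is what allows absorption. -/
theorem lintegral_gsq_rpow_lt_top [NeZero n] {F : Type*} [NormedAddCommGroup F] [NormedSpace ℝ F]
    {f : Sp n → F} (hf : WInt f) {p : ℝ} (hp : 1 < p)
    (hfin : ∫⁻ x, ‖f x‖ₑ ^ p < ∞) {a b : ℝ} (ha : 0 < a) :
    ∫⁻ x, gsq (Ioc a b) f x ^ (p / 2) < ∞ := by
  have hp0 : 0 < p := by linarith
  have hC := kernC_pos n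
  set c : ℝ≥0∞ := ENNReal.ofReal (kernC n ^ 2 / a) * ENNReal.ofReal (b - a) with hc
  have hctop : c ≠ ∞ := ENNReal.mul_ne_top ENNReal.ofReal_ne_top ENNReal.ofReal_ne_top
  have h1 : ∀ᵐ x, gsq (Ioc a b) f x ^ (p / 2) ≤ c ^ (p / 2) * ENNReal.ofReal (maxR f x ^ p) := by
    filter_upwards [ae_kext_le_maxR hp hf hfin] with x hx
    have hM := maxR_nonneg f x
    have h2 : gsq (Ioc a b) f x ≤ c * ENNReal.ofReal (maxR f x ^ 2) := by
      calc gsq (Ioc a b) f x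
        ≤ ∫⁻ _ in Ioc a b, ENNReal.ofReal (kernC n ^ 2 / a * maxR f x ^ 2) := by
            refine setLIntegral_mono' measurableSet_Ioc fun t ht => ?_
            have ht0 : 0 < t := ha.trans ht.1
            rw [← ofReal_norm, ← ENNReal.ofReal_pow (norm_nonneg _), ← ENNReal.ofReal_mul ht0.le]
            refine ENNReal.ofReal_le_ofReal ?_
            calc t * ‖kext (kernT t) f x‖ ^ 2 ≤ t * (kernC n / t * maxR f x) ^ 2 := by
                  gcongr
                  refine (hf.norm_kext_le ht0 (abs_kernT_le ht0) x).trans ?_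
                  gcongr
                  exact hx t ht0
              _ = kernC n ^ 2 / t * maxR f x ^ 2 := by field_simp
              _ ≤ _ := by
                  gcongr
                  exact ht.1.le
        _ = _ := by
            rw [setLIntegral_const, Real.volume_Ioc, ENNReal.ofReal_mul (by positivity), hc]
            ring
    calc gsq (Ioc a b) f x ^ (p / 2) ≤ (c * ENNReal.ofReal (maxR f x ^ 2)) ^ (p / 2) := by gcongr
      _ = _ := by
          rw [ENNReal.mul_rpow_of_nonneg _ _ (by positivity),
            ENNReal.ofReal_rpow_of_nonneg (by positivity) (by positivity), ← Real.rpow_two,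
            ← Real.rpow_mul hM]
          congr 3; ring
  refine (lintegral_mono_ae h1).trans_lt ?_
  rw [lintegral_const_mul' _ _ (ENNReal.rpow_ne_top_of_nonneg (by positivity) hctop)]
  exact ENNReal.mul_lt_top (ENNReal.rpow_ne_top_of_nonneg (by positivity) hctop).lt_top
    ((lintegral_maxR_rpow_le hp hf.aestronglyMeasurable).trans_lt
      (ENNReal.mul_lt_top ENNReal.ofReal_lt_top hfin))

/-- The size of the weight in the absorption argument. -/
def absorbC (n : ℕ) (p : ℝ) : ℝ := (2 * (weightedC n p + 1)) ^ (-((p - 2) / 2))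

/-- The `L^p` bound of the square function of a nonnegative function for `p > 2`. The square
function `G` is tested against the small multiple `h = l G^(p/2 - 1)` of its own power, which is the
extremal weight; since `h^(p/(p-2))` is a multiple of `G^(p/2)`, the term in `h` is absorbed. -/
theorem lintegral_gsq_rpow_le_of_two_lt [NeZero n] {f : Sp n → ℝ} (hf : PosExt f) {p : ℝ}
    (hp : 2 < p) (hfin : ∫⁻ x, ‖f x‖ₑ ^ p < ∞) {ε T : ℝ} (hε : 0 < ε) (hεT : ε ≤ T) :
    ∫⁻ x, gsq (Ioc (2 * ε) (2 * T)) f x ^ (p / 2) ≤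
      ENNReal.ofReal (2 * weightedC n p / absorbC n p) * ∫⁻ x, ‖f x‖ₑ ^ p := by
  have hp2 : 0 < p - 2 := by linarith
  have hC := weightedC_nonneg n hp
  have hb : 0 < 2 * (weightedC n p + 1) := by positivity
  set l := absorbC n p with hl
  have hl0 : 0 < l := Real.rpow_pos_of_pos hb _
  have hlq : weightedC n p * l ^ (p / (p - 2)) ≤ l / 2 := by
    have e1 : l ^ (p / (p - 2)) = l * (2 * (weightedC n p + 1))⁻¹ := by
      have e2 : p / (p - 2) = 1 + 2 / (p - 2) := by field_simp; ring
      rw [e2, Real.rpow_add hl0, Real.rpow_one]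
      congr 1
      rw [hl, absorbC, ← Real.rpow_mul hb.le, ← Real.rpow_neg_one]
      congr 1
      field_simp
    rw [e1]
    calc weightedC n p * (l * (2 * (weightedC n p + 1))⁻¹) = l / 2 * (weightedC n p / (weightedC n p + 1)) := by
          field_simp
      _ ≤ l / 2 * 1 := by
          gcongr
          rw [div_le_one (by linarith)]; linarith
      _ = l / 2 := mul_one _
  set G := gsq (Ioc (2 * ε) (2 * T)) f with hG
  have hGm : Measurable G := measurable_gsq hf.wInt.aestronglyMeasurable _
  set I := ∫⁻ x, G x ^ (p / 2) with hI
  have hItop : I < ∞ := lintegral_gsq_rpow_lt_top hf.wInt (by linarith) hfin (by positivity)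
  have e1 : ∀ x, G x * (ENNReal.ofReal l * G x ^ (p / 2 - 1)) =
      ENNReal.ofReal l * G x ^ (p / 2) := by
    intro x
    have : G x ^ (p / 2) = G x * G x ^ (p / 2 - 1) := by
      conv_rhs => rw [← ENNReal.rpow_one (G x), ← ENNReal.rpow_mul, one_mul,
        ← ENNReal.rpow_add_of_nonneg _ _ zero_le_one (by linarith)]
      congr 1; ring
    rw [this]; ring
  have e2 : ∀ x, (ENNReal.ofReal l * G x ^ (p / 2 - 1)) ^ (p / (p - 2)) =
      ENNReal.ofReal (l ^ (p / (p - 2))) * G x ^ (p / 2) := by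
    intro x
    rw [ENNReal.mul_rpow_of_nonneg _ _ (by positivity),
      ENNReal.ofReal_rpow_of_nonneg hl0.le (by positivity), ← ENNReal.rpow_mul]
    congr 2
    field_simp
  have key := lintegral_gsq_mul_le_add hf hp hfin
    (h := fun x => ENNReal.ofReal l * G x ^ (p / 2 - 1)) ((hGm.pow_const _).const_mul _) (by
      simp only [e2]
      rw [lintegral_const_mul' _ _ ENNReal.ofReal_ne_top]
      exact ENNReal.mul_lt_top ENNReal.ofReal_lt_top hItop) hε hεT
  simp only [e2, ← hG, e1] at key
  rw [lintegral_const_mul' _ _ ENNReal.ofReal_ne_top,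
    lintegral_const_mul' _ _ ENNReal.ofReal_ne_top, ← hI] at key
  set A := ∫⁻ x, ‖f x‖ₑ ^ p
  rw [← ENNReal.ofReal_toReal hItop.ne, ← ENNReal.ofReal_toReal hfin.ne] at key ⊢
  have hI0 := ENNReal.toReal_nonneg (a := I)
  have hA0 := ENNReal.toReal_nonneg (a := A)
  rw [← ENNReal.ofReal_mul (by positivity), ← ENNReal.ofReal_mul (by positivity),
    ← ENNReal.ofReal_add (by positivity) (by positivity), ← ENNReal.ofReal_mul (by positivity),
    ENNReal.ofReal_le_ofReal_iff (by positivity)] at key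
  rw [← ENNReal.ofReal_mul (by positivity)]
  refine ENNReal.ofReal_le_ofReal ?_
  have h1 := mul_le_mul_of_nonneg_right hlq hI0
  rw [div_mul_eq_mul_div, le_div_iff₀ hl0]
  nlinarith

end Duality

/-! ### The vertical square function on `L^p`, `1 < p < ∞` -/

section All

variable {n : ℕ}

theorem iUnion_Ioc_inv_two_mul :
    ⋃ k : ℕ, Ioc (2 * ((k : ℝ) + 1)⁻¹) (2 * ((k : ℝ) + 1)) = Ioi 0 := by
  ext t
  simp only [mem_iUnion, mem_Ioc, mem_Ioi]
  constructor
  · rintro ⟨k, h, -⟩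
    exact lt_trans (by positivity) h
  · intro ht
    obtain ⟨k, hk⟩ := exists_nat_gt (max (2 / t) t)
    have h1 := (le_max_left _ _).trans_lt hk
    have h2 := (le_max_right _ _).trans_lt hk
    refine ⟨k, ?_, by linarith⟩
    rw [← div_eq_mul_inv, div_lt_iff₀ (by positivity)]
    rw [div_lt_iff₀ ht] at h1
    nlinarith

theorem monotone_Ioc_inv_two_mul :
    Monotone fun k : ℕ => Ioc (2 * ((k : ℝ) + 1)⁻¹) (2 * ((k : ℝ) + 1)) := by
  intro i j hij
  have : (i : ℝ) ≤ j := by exact_mod_cast hij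
  refine Ioc_subset_Ioc ?_ (by linarith)
  gcongr

theorem lintegral_gsq_Ioi_rpow_le {F : Type*} [NormedAddCommGroup F] [NormedSpace ℝ F]
    {f : Sp n → F} (hf : AEStronglyMeasurable f volume) {q : ℝ} {C : ℝ≥0∞}
    (h : ∀ ε T, 0 < ε → ε ≤ T → ∫⁻ x, gsq (Ioc (2 * ε) (2 * T)) f x ^ q ≤ C) :
    ∫⁻ x, gsq (Ioi 0) f x ^ q ≤ C := by
  have h1 : ∀ x, Tendsto (fun k : ℕ =>
      gsq (Ioc (2 * ((k : ℝ) + 1)⁻¹) (2 * ((k : ℝ) + 1))) f x ^ q) atTop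
      (𝓝 (gsq (Ioi 0) f x ^ q)) := by
    intro x
    refine ((ENNReal.continuous_rpow_const (y := q)).tendsto _).comp ?_
    have h2 := tendsto_measure_iUnion_atTop (μ := volume.withDensity fun t : ℝ =>
      ENNReal.ofReal t * ‖kext (kernT t) f x‖ₑ ^ 2) monotone_Ioc_inv_two_mul
    rw [iUnion_Ioc_inv_two_mul, withDensity_apply _ measurableSet_Ioi] at h2
    refine h2.congr fun k => ?_
    rw [Function.comp_apply, withDensity_apply _ measurableSet_Ioc, gsq]
  calc ∫⁻ x, gsq (Ioi 0) f x ^ q = ∫⁻ x, liminf (fun k : ℕ =>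
        gsq (Ioc (2 * ((k : ℝ) + 1)⁻¹) (2 * ((k : ℝ) + 1))) f x ^ q) atTop :=
        lintegral_congr fun x => (h1 x).liminf_eq.symm
    _ ≤ liminf (fun k : ℕ => ∫⁻ x,
        gsq (Ioc (2 * ((k : ℝ) + 1)⁻¹) (2 * ((k : ℝ) + 1))) f x ^ q) atTop :=
        lintegral_liminf_le fun k => (measurable_gsq hf _).pow_const q
    _ ≤ liminf (fun _ : ℕ => C) atTop := by
        refine liminf_le_liminf (Eventually.of_forall fun k => h _ _ (by positivity) ?_)
        have : (0 : ℝ) ≤ k := k.cast_nonneg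
        exact (inv_le_one_of_one_le₀ (by linarith)).trans (by linarith)
    _ = C := by simp

theorem PosExt.exists_lintegral_gsq_rpow_le (n : ℕ) [NeZero n] {p : ℝ} (hp : 1 < p) :
    ∃ C : ℝ, 0 ≤ C ∧ ∀ f : Sp n → ℝ, PosExt f → ∫⁻ x, ‖f x‖ₑ ^ p < ∞ →
      ∫⁻ x, gsq (Ioi 0) f x ^ (p / 2) ≤ ENNReal.ofReal C * ∫⁻ x, ‖f x‖ₑ ^ p := by
  have hp1 : 0 < p - 1 := by linarith
  rcases le_or_gt p 2 with h | h
  · refine ⟨smallExpC n p, ?_, fun f hf hfin => lintegral_gsq_Ioi_rpow_le hf.wInt.aestronglyMeasurable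
      fun ε T hε hεT => lintegral_gsq_rpow_le_of_le_two hf hp h hfin (by linarith)
        (by linarith)⟩
    have h1 := monC_nonneg p 0 (kernC_pos n).le
    have h2 := maxRC_nonneg n hp
    unfold smallExpC; positivity
  · refine ⟨2 * weightedC n p / absorbC n p, ?_, fun f hf hfin =>
      lintegral_gsq_Ioi_rpow_le hf.wInt.aestronglyMeasurable fun ε T hε hεT =>
        lintegral_gsq_rpow_le_of_two_lt hf h hfin hε hεT⟩
    have h1 := weightedC_nonneg n h
    have : 0 ≤ absorbC n p := Real.rpow_nonneg (by positivity) _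
    positivity

theorem add_rpow_le_two_rpow_mul {a b : ℝ≥0∞} {q : ℝ} (hq : 0 ≤ q) :
    (a + b) ^ q ≤ ENNReal.ofReal (2 ^ q) * (a ^ q + b ^ q) := by
  have h2 : (2 : ℝ≥0∞) ^ q = ENNReal.ofReal (2 ^ q) := by
    rw [← ENNReal.ofReal_rpow_of_nonneg (by norm_num) hq, ENNReal.ofReal_ofNat]
  rw [← h2]
  rcases le_total a b with h | h
  · calc (a + b) ^ q ≤ (2 * b) ^ q := by
          gcongr
          rw [two_mul]; gcongr
      _ = 2 ^ q * b ^ q := ENNReal.mul_rpow_of_nonneg _ _ hq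
      _ ≤ _ := by gcongr; exact le_add_self
  · calc (a + b) ^ q ≤ (2 * a) ^ q := by
          gcongr
          rw [two_mul]; gcongr
      _ = 2 ^ q * a ^ q := ENNReal.mul_rpow_of_nonneg _ _ hq
      _ ≤ _ := by gcongr; exact le_self_add

theorem add_sq_le_two_mul_add_sq (a b : ℝ≥0∞) : (a + b) ^ 2 ≤ 2 * (a ^ 2 + b ^ 2) := by
  rcases le_total a b with h | h
  · obtain ⟨c, rfl⟩ := le_iff_exists_add.1 h
    ring_nf
    gcongr
    exact le_mul_of_one_le_right zero_le one_le_two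
  · obtain ⟨c, rfl⟩ := le_iff_exists_add.1 h
    ring_nf
    gcongr
    exact le_mul_of_one_le_right zero_le one_le_two

/-- If `‖f‖` is controlled by two functions for which the `L^p` bound holds, and the extension is
correspondingly dominated, then the bound holds for `f`. -/
theorem lintegral_gsq_rpow_le_of_dominated {F G : Type*} [NormedAddCommGroup F] [NormedSpace ℝ F]
    [NormedAddCommGroup G] [NormedSpace ℝ G] {f : Sp n → F} {g h : Sp n → G} {p C : ℝ}
    (hp : 0 < p) (hgm : AEStronglyMeasurable g volume)
    (hfg : ∀ x, ‖g x‖ ≤ ‖f x‖) (hfh : ∀ x, ‖h x‖ ≤ ‖f x‖)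
    (hk : ∀ t, 0 < t → ∀ x,
      ‖kext (kernT t) f x‖ₑ ≤ ‖kext (kernT t) g x‖ₑ + ‖kext (kernT t) h x‖ₑ)
    (hg : ∫⁻ x, gsq (Ioi 0) g x ^ (p / 2) ≤ ENNReal.ofReal C * ∫⁻ x, ‖g x‖ₑ ^ p)
    (hh : ∫⁻ x, gsq (Ioi 0) h x ^ (p / 2) ≤ ENNReal.ofReal C * ∫⁻ x, ‖h x‖ₑ ^ p) :
    ∫⁻ x, gsq (Ioi 0) f x ^ (p / 2) ≤
      ENNReal.ofReal (2 ^ (p / 2) * 2 ^ (p / 2) * 2 * C) * ∫⁻ x, ‖f x‖ₑ ^ p := by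
  have h1 : ∀ x, gsq (Ioi 0) f x ≤ 2 * (gsq (Ioi 0) g x + gsq (Ioi 0) h x) := by
    intro x
    have mg : Measurable fun t => ENNReal.ofReal t * ‖kext (kernT t) g x‖ₑ ^ 2 :=
      (measurable_gsq_integrand hgm).comp measurable_prodMk_right
    rw [gsq, gsq, gsq, ← lintegral_add_left mg, ← lintegral_const_mul' _ _ (by simp)]
    refine setLIntegral_mono' measurableSet_Ioi fun t ht => ?_
    rw [← mul_add, mul_left_comm]
    gcongr
    exact (pow_le_pow_left' (hk t ht x) 2).trans (add_sq_le_two_mul_add_sq _ _)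
  have hgf : ∫⁻ x, ‖g x‖ₑ ^ p ≤ ∫⁻ x, ‖f x‖ₑ ^ p := by
    gcongr with x
    exact enorm_le_iff_norm_le.2 (hfg x)
  have hhf : ∫⁻ x, ‖h x‖ₑ ^ p ≤ ∫⁻ x, ‖f x‖ₑ ^ p := by
    gcongr with x
    exact enorm_le_iff_norm_le.2 (hfh x)
  have h2 : (2 : ℝ≥0∞) ^ (p / 2) = ENNReal.ofReal (2 ^ (p / 2)) := by
    rw [← ENNReal.ofReal_rpow_of_nonneg (by norm_num) (by positivity), ENNReal.ofReal_ofNat]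
  calc ∫⁻ x, gsq (Ioi 0) f x ^ (p / 2)
      ≤ ∫⁻ x, ENNReal.ofReal (2 ^ (p / 2)) * (ENNReal.ofReal (2 ^ (p / 2)) *
        (gsq (Ioi 0) g x ^ (p / 2) + gsq (Ioi 0) h x ^ (p / 2))) := by
        refine lintegral_mono fun x => ?_
        calc gsq (Ioi 0) f x ^ (p / 2) ≤ (2 * (gsq (Ioi 0) g x + gsq (Ioi 0) h x)) ^ (p / 2) := by
              gcongr
              exact h1 x
          _ ≤ _ := by
              rw [ENNReal.mul_rpow_of_nonneg _ _ (by positivity), h2]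
              gcongr
              exact add_rpow_le_two_rpow_mul (by positivity)
    _ = ENNReal.ofReal (2 ^ (p / 2)) * (ENNReal.ofReal (2 ^ (p / 2)) *
        ((∫⁻ x, gsq (Ioi 0) g x ^ (p / 2)) + ∫⁻ x, gsq (Ioi 0) h x ^ (p / 2))) := by
        rw [lintegral_const_mul' _ _ ENNReal.ofReal_ne_top,
          lintegral_const_mul' _ _ ENNReal.ofReal_ne_top, lintegral_add_left]
        exact (measurable_gsq hgm _).pow_const _
    _ ≤ ENNReal.ofReal (2 ^ (p / 2)) * (ENNReal.ofReal (2 ^ (p / 2)) *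
        (ENNReal.ofReal C * (∫⁻ x, ‖f x‖ₑ ^ p) + ENNReal.ofReal C * (∫⁻ x, ‖f x‖ₑ ^ p))) := by
        gcongr
        · exact hg.trans (by gcongr)
        · exact hh.trans (by gcongr)
    _ = _ := by
        rw [ENNReal.ofReal_mul (by positivity), ENNReal.ofReal_mul (by positivity),
          ENNReal.ofReal_mul (by positivity), ENNReal.ofReal_ofNat]
        ring

/-- A nonnegative function has a positive extension unless it vanishes almost everywhere. -/
theorem lintegral_gsq_rpow_le_of_nonneg {p C : ℝ} (hp : 1 < p)
    (hCb : ∀ f : Sp n → ℝ, PosExt f → ∫⁻ x, ‖f x‖ₑ ^ p < ∞ →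
      ∫⁻ x, gsq (Ioi 0) f x ^ (p / 2) ≤ ENNReal.ofReal C * ∫⁻ x, ‖f x‖ₑ ^ p)
    {f : Sp n → ℝ} (hf : WInt f) (h0 : ∀ x, 0 ≤ f x) (hfin : ∫⁻ x, ‖f x‖ₑ ^ p < ∞) :
    ∫⁻ x, gsq (Ioi 0) f x ^ (p / 2) ≤ ENNReal.ofReal C * ∫⁻ x, ‖f x‖ₑ ^ p := by
  by_cases hne : f =ᵐ[volume] 0
  · have h1 : ∀ x, gsq (Ioi 0) f x = 0 := by
      intro x
      have : ∀ t, kext (kernT t) f x = 0 := fun t => by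
        rw [kext_congr hne]; simp [kext]
      simp [gsq, this]
    have : (0 : ℝ≥0∞) ^ (p / 2) = 0 := ENNReal.zero_rpow_of_pos (by linarith)
    simp [h1, this]
  · exact hCb f ⟨hf, h0, fun ht x => hf.kext_pos h0 hne ht x⟩ hfin

/-- **The vertical Littlewood-Paley square function is bounded on `L^p`**, `1 < p < ∞`. -/
theorem exists_lintegral_gsq_rpow_le (n : ℕ) [NeZero n] {p : ℝ} (hp : 1 < p) :
    ∃ C : ℝ, 0 ≤ C ∧ ∀ f : Sp n → ℂ, AEStronglyMeasurable f volume → ∫⁻ x, ‖f x‖ₑ ^ p < ∞ →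
      ∫⁻ x, gsq (Ioi 0) f x ^ (p / 2) ≤ ENNReal.ofReal C * ∫⁻ x, ‖f x‖ₑ ^ p := by
  obtain ⟨C, hC, hCb⟩ := PosExt.exists_lintegral_gsq_rpow_le n hp
  set c : ℝ := 2 ^ (p / 2) * 2 ^ (p / 2) * 2 with hc
  have hp0 : 0 < p := by linarith
  have hc0 : 0 ≤ c := by positivity
  refine ⟨c * (c * C), by positivity, fun f hm hfin => ?_⟩
  have hf : WInt f := wInt_of_lintegral_rpow hp.le hm hfin
  have hreal : ∀ g : Sp n → ℝ, AEStronglyMeasurable g volume → (∀ x, ‖g x‖ ≤ ‖f x‖) →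
      ∫⁻ x, gsq (Ioi 0) g x ^ (p / 2) ≤ ENNReal.ofReal (c * C) * ∫⁻ x, ‖g x‖ₑ ^ p := by
    intro g hgm hgf
    have hg : WInt g := hf.of_norm_le hgm (ae_of_all _ hgf)
    have hgfin : ∫⁻ x, ‖g x‖ₑ ^ p < ∞ := by
      refine lt_of_le_of_lt (lintegral_mono fun x => ?_) hfin
      have := enorm_le_iff_norm_le.2 (hgf x)
      gcongr
    have h1 : ∀ x, ‖max (g x) 0‖ ≤ ‖g x‖ := fun x => by
      rw [Real.norm_of_nonneg (le_max_right _ _), Real.norm_eq_abs]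
      exact max_le (le_abs_self _) (abs_nonneg _)
    have h2 : ∀ x, ‖max (-g x) 0‖ ≤ ‖g x‖ := fun x => by
      rw [Real.norm_of_nonneg (le_max_right _ _), Real.norm_eq_abs]
      exact max_le (neg_le_abs _) (abs_nonneg _)
    have m1 : AEStronglyMeasurable (fun x => max (g x) 0) volume :=
      hgm.sup aestronglyMeasurable_const
    have m2 : AEStronglyMeasurable (fun x => max (-g x) 0) volume :=
      hgm.neg.sup aestronglyMeasurable_const
    have w1 : WInt fun x => max (g x) 0 := hg.of_norm_le m1 (ae_of_all _ h1)
    have w2 : WInt fun x => max (-g x) 0 := hg.of_norm_le m2 (ae_of_all _ h2)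
    refine lintegral_gsq_rpow_le_of_dominated hp0 m1 h1 h2 ?_
      (lintegral_gsq_rpow_le_of_nonneg hp hCb w1 (fun x => le_max_right _ _) ?_)
      (lintegral_gsq_rpow_le_of_nonneg hp hCb w2 (fun x => le_max_right _ _) ?_)
    · intro t ht x
      have e : kext (kernT t) g x = kext (kernT t) (fun x => max (g x) 0) x -
          kext (kernT t) (fun x => max (-g x) 0) x := by
        unfold kext
        rw [← integral_sub (w1.integrable_of_le (measurable_kernT_right t) ht (abs_kernT_le ht) x)
          (w2.integrable_of_le (measurable_kernT_right t) ht (abs_kernT_le ht) x)]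
        congr 1
        funext y
        rw [← smul_sub]
        congr 1
        rcases le_total 0 (g y) with h | h
        · rw [max_eq_left h, max_eq_right (by linarith), sub_zero]
        · rw [max_eq_right h, max_eq_left (by linarith), zero_sub, neg_neg]
      rw [e]
      exact enorm_sub_le
    · refine lt_of_le_of_lt (lintegral_mono fun x => ?_) hgfin
      have := enorm_le_iff_norm_le.2 (h1 x)
      gcongr
    · refine lt_of_le_of_lt (lintegral_mono fun x => ?_) hgfin
      have := enorm_le_iff_norm_le.2 (h2 x)
      gcongr
  have hre : ∀ x, ‖(f x).re‖ ≤ ‖f x‖ := fun x => Complex.abs_re_le_norm _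
  have him : ∀ x, ‖(f x).im‖ ≤ ‖f x‖ := fun x => Complex.abs_im_le_norm _
  have m1 : AEStronglyMeasurable (fun x => (f x).re) volume :=
    Complex.continuous_re.comp_aestronglyMeasurable hm
  have m2 : AEStronglyMeasurable (fun x => (f x).im) volume :=
    Complex.continuous_im.comp_aestronglyMeasurable hm
  refine lintegral_gsq_rpow_le_of_dominated hp0 m1 hre him ?_
    (hreal _ m1 hre) (hreal _ m2 him)
  intro t ht x
  have hi := hf.integrable_of_le (measurable_kernT_right t) ht (abs_kernT_le ht) x
  have e1 : (kext (kernT t) f x).re = kext (kernT t) (fun y => (f y).re) x := by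
    have := Complex.reCLM.integral_comp_comm hi
    simp only [Complex.reCLM_apply, Complex.real_smul, Complex.re_ofReal_mul] at this
    simpa [kext] using this.symm
  have e2 : (kext (kernT t) f x).im = kext (kernT t) (fun y => (f y).im) x := by
    have := Complex.imCLM.integral_comp_comm hi
    simp only [Complex.imCLM_apply, Complex.real_smul, Complex.im_ofReal_mul] at this
    simpa [kext] using this.symm
  rw [← e1, ← e2, ← ofReal_norm, ← ofReal_norm, ← ofReal_norm,
    ← ENNReal.ofReal_add (norm_nonneg _) (norm_nonneg _)]
  exact ENNReal.ofReal_le_ofReal (Complex.norm_le_abs_re_add_abs_im _)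

end All

/-! ### Means over balls -/

section Means

variable {n : ℕ}

theorem lintegral_div_le_rpow_lintegral_div {α F : Type*} [MeasurableSpace α]
    [NormedAddCommGroup F] {μ : Measure α} {g : α → F} (hg : AEStronglyMeasurable g μ)
    {p : ℝ} (hp : 1 ≤ p) (h0 : μ univ ≠ 0) (htop : μ univ ≠ ∞) :
    (∫⁻ x, ‖g x‖ₑ ∂μ) / μ univ ≤ ((∫⁻ x, ‖g x‖ₑ ^ p ∂μ) / μ univ) ^ (1 / p) := by
  have h1 := eLpNorm'_le_eLpNorm'_mul_rpow_measure_univ one_pos hp hg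
  simp only [eLpNorm', ENNReal.rpow_one, div_one] at h1
  rw [ENNReal.div_rpow_of_nonneg _ _ (by positivity)]
  calc (∫⁻ x, ‖g x‖ₑ ∂μ) / μ univ
      ≤ ((∫⁻ x, ‖g x‖ₑ ^ p ∂μ) ^ (1 / p) * μ univ ^ (1 - 1 / p)) / μ univ := by gcongr
    _ = (∫⁻ x, ‖g x‖ₑ ^ p ∂μ) ^ (1 / p) / μ univ ^ (1 / p) := by
        rw [ENNReal.rpow_sub _ _ h0 htop, ENNReal.rpow_one, div_eq_mul_inv, div_eq_mul_inv,
          div_eq_mul_inv, mul_assoc]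
        congr 1
        rw [mul_right_comm, ENNReal.mul_inv_cancel h0 htop, one_mul]

theorem lintegral_enorm_indicator_rpow {α F : Type*} [MeasurableSpace α]
    [NormedAddCommGroup F] {μ : Measure α} {s : Set α} (hs : MeasurableSet s) (g : α → F)
    {p : ℝ} (hp : 0 < p) : ∫⁻ x, ‖s.indicator g x‖ₑ ^ p ∂μ = ∫⁻ x in s, ‖g x‖ₑ ^ p ∂μ := by
  rw [← lintegral_indicator hs]
  refine lintegral_congr fun x => ?_
  by_cases hx : x ∈ s <;> simp [hx, hp]

/-- The average of `‖g‖` over a ball. -/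
def avgE {F : Type*} [NormedAddCommGroup F] (g : Sp n → F) (x : Sp n) (r : ℝ) : ℝ≥0∞ :=
  (∫⁻ y in Metric.ball x r, ‖g y‖ₑ) / volume (Metric.ball x r)

theorem avgE_le_rpow {F : Type*} [NormedAddCommGroup F] {g : Sp n → F}
    (hg : AEStronglyMeasurable g volume) {p : ℝ} (hp : 1 ≤ p) (x : Sp n) {r : ℝ} (hr : 0 < r) :
    avgE g x r ≤ ((∫⁻ y in Metric.ball x r, ‖g y‖ₑ ^ p) / volume (Metric.ball x r)) ^ (1 / p) := by
  have h1 := lintegral_div_le_rpow_lintegral_div (hg.restrict (s := Metric.ball x r)) hp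
    (by simpa using (volume_ball_pos x hr).ne') (by simpa using (volume_ball_lt_top x r).ne)
  rwa [Measure.restrict_apply_univ] at h1

theorem avgE_two_mul (g : Sp n → ℂ) (x : Sp n) {r : ℝ} (hr : 0 < r) :
    avgE g x r ≤ ENNReal.ofReal (2 ^ n) * avgE g x (2 * r) := by
  have h0 := (volume_ball_pos x hr).ne'
  have ht := (volume_ball_lt_top x r).ne
  have e : volume (Metric.ball x (2 * r)) = ENNReal.ofReal (2 ^ n) * volume (Metric.ball x r) := by
    rw [volume_ball_eq x hr, volume_ball_eq x (by positivity : 0 < 2 * r), mul_pow,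
      ENNReal.ofReal_mul (by positivity), mul_assoc]
  have hc : ENNReal.ofReal (2 ^ n) ≠ 0 := by
    rw [Ne, ENNReal.ofReal_eq_zero, not_le]; positivity
  rw [avgE, avgE, e, ← mul_div_assoc, ENNReal.mul_div_mul_left _ _ hc ENNReal.ofReal_ne_top]
  gcongr
  linarith

theorem WInt.enorm_setAverage_sub_le {f : Sp n → ℂ} (hf : WInt f) (c : ℂ) (x : Sp n) {r : ℝ}
    (hr : 0 < r) : ‖(⨍ y in Metric.ball x r, f y) - c‖ₑ ≤ avgE (fun y => f y - c) x r := by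
  have h0 := (volume_ball_pos x hr).ne'
  have ht := (volume_ball_lt_top x r).ne
  have hi : IntegrableOn f (Metric.ball x r) :=
    (hf.locallyIntegrable.integrableOn_isCompact (isCompact_closedBall x r)).mono_set
      Metric.ball_subset_closedBall
  have hv : 0 < volume.real (Metric.ball x r) := ENNReal.toReal_pos h0 ht
  have e : (⨍ y in Metric.ball x r, f y) - c =
      (volume.real (Metric.ball x r))⁻¹ • ∫ y in Metric.ball x r, (f y - c) := by
    rw [integral_sub hi (integrableOn_const ht), setAverage_eq, smul_sub, setIntegral_const,
      inv_smul_smul₀ hv.ne']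
  rw [e, enorm_smul, avgE, ENNReal.div_eq_inv_mul, Real.enorm_of_nonneg (by positivity),
    ENNReal.ofReal_inv_of_pos hv, measureReal_def, ENNReal.ofReal_toReal ht]
  gcongr
  exact enorm_integral_le_lintegral_enorm _

/-- The Morrey condition on the oscillation of `f` over all balls, with constant `C`. -/
def OscBound (p lam : ℝ) (C : ℝ≥0∞) (f : Sp n → ℂ) : Prop :=
  ∀ (x : Sp n) (r : ℝ), 0 < r → ∫⁻ y in Metric.ball x r,
    ‖f y - ⨍ z in Metric.ball x r, f z‖ₑ ^ p ≤ C * ENNReal.ofReal (r ^ lam)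

/-- The Morrey condition on the square function of `f` over all balls, with constant `C`. -/
def SquareBound (p lam : ℝ) (C : ℝ≥0∞) (f : Sp n → ℂ) : Prop :=
  ∀ (x : Sp n) (r : ℝ), 0 < r → ∫⁻ y in Metric.ball x r, gsq (Ioo 0 r) f y ^ (p / 2) ≤
    C * ENNReal.ofReal (r ^ lam)

/-- The bound of the mean oscillation over balls of radius at least `r`. -/
def oscMean (n : ℕ) (p lam : ℝ) (C : ℝ≥0∞) (r : ℝ) : ℝ≥0∞ :=
  (C * ENNReal.ofReal (r ^ lam) / (ENNReal.ofReal (r ^ n) *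
    volume (Metric.ball (0 : Sp n) 1))) ^ (1 / p)

theorem OscBound.avgE_le {p lam : ℝ} {C : ℝ≥0∞} {f : Sp n → ℂ} (h : OscBound p lam C f)
    (hf : WInt f) (hp : 1 < p) (hlam : lam < n) (x : Sp n) {r s : ℝ} (hr : 0 < r) (hrs : r ≤ s) :
    avgE (fun y => f y - ⨍ z in Metric.ball x s, f z) x s ≤ oscMean n p lam C r := by
  have hs : 0 < s := hr.trans_le hrs
  have hm : AEStronglyMeasurable (fun y => f y - ⨍ z in Metric.ball x s, f z) volume :=
    hf.aestronglyMeasurable.sub aestronglyMeasurable_const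
  refine (avgE_le_rpow hm hp.le x hs).trans ?_
  refine ENNReal.rpow_le_rpow ?_ (by positivity)
  have e : ∀ ρ : ℝ, 0 < ρ → C * ENNReal.ofReal (ρ ^ lam) / (ENNReal.ofReal (ρ ^ n) *
      volume (Metric.ball (0 : Sp n) 1)) =
      C * ENNReal.ofReal (ρ ^ (lam - n)) / volume (Metric.ball (0 : Sp n) 1) := by
    intro ρ hρ
    have h1 : ENNReal.ofReal (ρ ^ lam) =
        ENNReal.ofReal (ρ ^ n) * ENNReal.ofReal (ρ ^ (lam - n)) := by
      rw [← ENNReal.ofReal_mul (by positivity), Real.rpow_sub hρ, Real.rpow_natCast]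
      congr 1; field_simp
    rw [h1, mul_left_comm, ENNReal.mul_div_mul_left _ _ _ ENNReal.ofReal_ne_top]
    rw [Ne, ENNReal.ofReal_eq_zero, not_le]; positivity
  rw [e r hr]
  calc _ ≤ C * ENNReal.ofReal (s ^ lam) / (ENNReal.ofReal (s ^ n) *
        volume (Metric.ball (0 : Sp n) 1)) := by
        rw [volume_ball_eq x hs]
        gcongr
        exact h x s hs
    _ ≤ _ := by
        rw [e s hs]
        exact ENNReal.div_le_div_right (mul_le_mul_right (ENNReal.ofReal_le_ofReal
          (Real.rpow_le_rpow_of_nonpos hr hrs (by linarith))) _) _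

theorem oscMean_rpow (n : ℕ) {p lam : ℝ} (hp : 1 < p) (C : ℝ≥0∞) {r : ℝ} (hr : 0 < r) (x : Sp n) :
    oscMean n p lam C r ^ p * volume (Metric.ball x r) = C * ENNReal.ofReal (r ^ lam) := by
  have hp0 : p ≠ 0 := by linarith
  rw [oscMean, ← volume_ball_eq x hr, ← ENNReal.rpow_mul, one_div_mul_cancel hp0, ENNReal.rpow_one,
    ENNReal.div_mul_cancel (volume_ball_pos x hr).ne' (volume_ball_lt_top x r).ne]

/-- The means over the balls `B(x, 2^j r)` grow at most linearly in `j`. -/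
theorem OscBound.avgE_dyadic_le {p lam : ℝ} {C : ℝ≥0∞} {f : Sp n → ℂ} (h : OscBound p lam C f)
    (hf : WInt f) (hp : 1 < p) (hlam : lam < n) (x : Sp n) {r : ℝ} (hr : 0 < r) (j : ℕ) :
    avgE (fun y => f y - ⨍ z in Metric.ball x (2 * r), f z) x (2 ^ j * r) ≤
      ENNReal.ofReal (1 + (j + 1) * 2 ^ n) * oscMean n p lam C r := by
  set A := oscMean n p lam C r
  set a : ℕ → ℂ := fun j => ⨍ z in Metric.ball x (2 ^ j * r), f z with ha
  have hA : ∀ j, avgE (fun y => f y - a j) x (2 ^ j * r) ≤ A := fun j =>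
    h.avgE_le hf hp hlam x hr (le_mul_of_one_le_left hr.le (one_le_pow₀ one_le_two))
  have hstep : ∀ j, edist (a j) (a (j + 1)) ≤ ENNReal.ofReal (2 ^ n) * A := by
    intro j
    rw [edist_eq_enorm_sub]
    refine (hf.enorm_setAverage_sub_le (a (j + 1)) x (by positivity)).trans ?_
    refine (avgE_two_mul _ x (by positivity)).trans ?_
    gcongr
    rw [← mul_assoc, ← pow_succ']
    exact hA (j + 1)
  have hdist : edist (a j) (a 1) ≤ ENNReal.ofReal ((j + 1) * 2 ^ n) * A := by
    calc edist (a j) (a 1) ≤ edist (a j) (a 0) + edist (a 0) (a 1) := edist_triangle _ _ _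
      _ ≤ (∑ i ∈ Finset.range j, ENNReal.ofReal (2 ^ n) * A) + ENNReal.ofReal (2 ^ n) * A := by
          rw [edist_comm (a j)]
          gcongr
          · exact (edist_le_range_sum_edist a j).trans (Finset.sum_le_sum fun i _ => hstep i)
          · exact hstep 0
      _ = _ := by
          rw [Finset.sum_const, Finset.card_range, nsmul_eq_mul, ← add_one_mul, ← mul_assoc,
            ENNReal.ofReal_mul (by positivity), ENNReal.ofReal_add (by positivity) zero_le_one,
            ENNReal.ofReal_natCast, ENNReal.ofReal_one]
  have e1 : (⨍ z in Metric.ball x (2 * r), f z) = a 1 := by simp [ha]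
  have hB0 := (volume_ball_pos x (by positivity : 0 < 2 ^ j * r)).ne'
  have hBt := (volume_ball_lt_top x (2 ^ j * r)).ne
  rw [e1]
  calc avgE (fun y => f y - a 1) x (2 ^ j * r)
      ≤ (∫⁻ y in Metric.ball x (2 ^ j * r), (‖f y - a j‖ₑ + edist (a j) (a 1))) /
          volume (Metric.ball x (2 ^ j * r)) := by
        rw [avgE]
        gcongr with y
        rw [edist_eq_enorm_sub, ← sub_add_sub_cancel (f y) (a j) (a 1)]
        exact enorm_add_le _ _
    _ = avgE (fun y => f y - a j) x (2 ^ j * r) + edist (a j) (a 1) := by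
        rw [lintegral_add_right _ measurable_const, ENNReal.add_div, setLIntegral_const,
          ENNReal.mul_div_cancel_right hB0 hBt, avgE]
    _ ≤ A + ENNReal.ofReal ((j + 1) * 2 ^ n) * A := add_le_add (hA j) hdist
    _ = _ := by
        rw [ENNReal.ofReal_add zero_le_one (by positivity), ENNReal.ofReal_one]
        ring

/-- The constant in the bound of the extension of the oscillation. -/
def oscC (n : ℕ) : ℝ≥0∞ :=
  ENNReal.ofReal (2 ^ (n + 1)) * volume (Metric.ball (0 : Sp n) 1) *
    ∑' j : ℕ, ENNReal.ofReal ((1 / 2) ^ j * (1 + (j + 1) * 2 ^ n))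

theorem oscC_ne_top (n : ℕ) : oscC n ≠ ∞ := by
  refine ENNReal.mul_ne_top
    (ENNReal.mul_ne_top ENNReal.ofReal_ne_top (volume_ball_lt_top _ _).ne) ?_
  have h1 : Summable fun j : ℕ => (1 / 2 : ℝ) ^ j * (1 + ((j : ℝ) + 1) * 2 ^ n) := by
    have s1 := summable_pow_mul_geometric_of_norm_lt_one 1 (r := (1 / 2 : ℝ)) (by norm_num)
    have s0 := summable_geometric_of_lt_one (r := (1 / 2 : ℝ)) (by norm_num) (by norm_num)
    refine ((s1.mul_right (2 ^ n)).add (s0.mul_right (1 + 2 ^ n))).congr fun j => ?_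
    ring
  rw [← ENNReal.ofReal_tsum_of_nonneg (fun j => by positivity) h1]
  exact ENNReal.ofReal_ne_top

theorem OscBound.lintegral_kern_le {p lam : ℝ} {C : ℝ≥0∞} {f : Sp n → ℂ} (h : OscBound p lam C f)
    (hf : WInt f) (hp : 1 < p) (hlam : lam < n) (x : Sp n) {r : ℝ} (hr : 0 < r) :
    ∫⁻ y, ENNReal.ofReal (kern r (x - y)) * ‖f y - ⨍ z in Metric.ball x (2 * r), f z‖ₑ ≤
      oscC n * oscMean n p lam C r := by
  have hm := (hf.sub_const (⨍ z in Metric.ball x (2 * r), f z)).aestronglyMeasurable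
  refine (lintegral_kern_le_tsum hr x hm.enorm).trans ?_
  rw [oscC, mul_assoc _ (∑' _, _), ← ENNReal.tsum_mul_right]
  refine mul_le_mul_right (ENNReal.tsum_le_tsum fun j => ?_) _
  rw [ENNReal.ofReal_mul (by positivity), mul_assoc]
  gcongr
  exact h.avgE_dyadic_le hf hp hlam x hr j

end Means

/-! ### The oscillation controls the square function -/

section Forward

variable {n : ℕ}

theorem WInt.kext_kernT_sub_const {f : Sp n → ℂ} (hf : WInt f) {t : ℝ} (ht : 0 < t) (c : ℂ)
    (x : Sp n) : kext (kernT t) f x = kext (kernT t) (fun y => f y - c) x := by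
  rw [MorreyLP.kext_sub_const hf (measurable_kernT_right t) ht (abs_kernT_le ht) c,
    integral_kernT_sub ht,
    zero_smul, add_zero]

theorem gsq_add_le {f g h : Sp n → ℂ} (hgm : AEStronglyMeasurable g volume) {S : Set ℝ}
    (hS : MeasurableSet S) {x : Sp n}
    (hk : ∀ t ∈ S, ‖kext (kernT t) f x‖ₑ ≤ ‖kext (kernT t) g x‖ₑ + ‖kext (kernT t) h x‖ₑ) :
    gsq S f x ≤ 2 * (gsq S g x + gsq S h x) := by
  have mg : Measurable fun t => ENNReal.ofReal t * ‖kext (kernT t) g x‖ₑ ^ 2 :=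
    (measurable_gsq_integrand hgm).comp measurable_prodMk_right
  rw [gsq, gsq, gsq, ← lintegral_add_left mg, ← lintegral_const_mul' _ _ (by simp)]
  refine setLIntegral_mono' hS fun t ht => ?_
  rw [← mul_add, mul_left_comm]
  gcongr
  exact (pow_le_pow_left' (hk t ht) 2).trans (add_sq_le_two_mul_add_sq _ _)

/-- Away from the ball `B(x₀, 2r)` all kernels at heights below `r` are comparable to the one at
height `r`, with a gain of `t / r`. -/
theorem kern_le_far {t r : ℝ} (ht : 0 < t) (htr : t < r) {x₀ x y : Sp n}
    (hx : x ∈ Metric.ball x₀ r) (hy : y ∉ Metric.ball x₀ (2 * r)) :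
    kern t (x - y) ≤ t / r * 5 ^ (((n : ℝ) + 1) / 2) * kern r (x₀ - y) := by
  have hr := ht.trans htr
  rw [Metric.mem_ball, dist_eq_norm] at hx
  rw [Metric.mem_ball, dist_comm, dist_eq_norm, not_lt] at hy
  have h1 : ‖x₀ - y‖ ≤ ‖x - y‖ + ‖x - x₀‖ := by
    have : x₀ - y = (x - y) - (x - x₀) := by abel
    rw [this]; exact norm_sub_le _ _
  exact kern_le_of_le (n := n) ht hr (by norm_num : (0 : ℝ) < 5) (x - y) (x₀ - y)
    (by nlinarith [norm_nonneg (x - y)])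

theorem abs_kernT_le_far {t r : ℝ} (ht : 0 < t) (htr : t < r) {x₀ x y : Sp n}
    (hx : x ∈ Metric.ball x₀ r) (hy : y ∉ Metric.ball x₀ (2 * r)) :
    |kernT t (x - y)| ≤ kernC n * 5 ^ (((n : ℝ) + 1) / 2) / r * kern r (x₀ - y) := by
  refine (abs_kernT_le ht _).trans ?_
  have hr := ht.trans htr
  have hC := kernC_pos n
  calc kernC n / t * kern t (x - y)
      ≤ kernC n / t * (t / r * 5 ^ (((n : ℝ) + 1) / 2) * kern r (x₀ - y)) := by
        gcongr
        exact kern_le_far ht htr hx hy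
    _ = _ := by field_simp

/-- The oscillation condition implies the square function condition. After subtraction of the mean
over `B(x₀, 2r)` the function is split at the boundary of that ball. -/
theorem OscBound.squareBound [NeZero n] {p lam : ℝ} {C : ℝ≥0∞} {f : Sp n → ℂ}
    (h : OscBound p lam C f) (hC : C ≠ ∞) (hf : WInt f) (hp : 1 < p)
    (hlam' : lam < n) : ∃ C' : ℝ≥0∞, C' ≠ ∞ ∧ SquareBound p lam C' f := by
  obtain ⟨D, hD, hL⟩ := exists_lintegral_gsq_rpow_le n hp
  have hp0 : 0 < p := by linarith
  set κ : ℝ≥0∞ := ENNReal.ofReal (kernC n * 5 ^ (((n : ℝ) + 1) / 2)) * oscC n with hκ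
  have hκt : κ ≠ ∞ := ENNReal.mul_ne_top ENNReal.ofReal_ne_top (oscC_ne_top n)
  have hkC := kernC_pos n
  set c₂ : ℝ≥0∞ := ENNReal.ofReal (2 ^ (p / 2)) with hc₂
  have h2p : (2 : ℝ≥0∞) ^ (p / 2) = c₂ := by
    rw [hc₂, ← ENNReal.ofReal_rpow_of_nonneg (by norm_num) (by positivity), ENNReal.ofReal_ofNat]
  refine ⟨c₂ * (c₂ * (ENNReal.ofReal D * (C * ENNReal.ofReal (2 ^ lam)) + κ ^ p * C)), ?_, ?_⟩
  · have := ENNReal.rpow_ne_top_of_nonneg hp0.le hκt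
    finiteness
  intro x₀ r hr
  set c := ⨍ z in Metric.ball x₀ (2 * r), f z with hc
  have hg : WInt fun y => f y - c := hf.sub_const c
  set B₂ := Metric.ball x₀ (2 * r) with hB₂
  set g₁ : Sp n → ℂ := B₂.indicator fun y => f y - c with hg₁
  set g₂ : Sp n → ℂ := B₂ᶜ.indicator fun y => f y - c with hg₂
  have m₁ : AEStronglyMeasurable g₁ volume := hg.aestronglyMeasurable.indicator measurableSet_ball
  have m₂ : AEStronglyMeasurable g₂ volume :=
    hg.aestronglyMeasurable.indicator measurableSet_ball.compl
  have w₁ : WInt g₁ := hg.of_norm_le m₁ (ae_of_all _ fun y => norm_indicator_le_norm_self _ _)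
  have w₂ : WInt g₂ := hg.of_norm_le m₂ (ae_of_all _ fun y => norm_indicator_le_norm_self _ _)
  -- the local part is controlled by the bound on `L^p`
  have hnear : ∫⁻ y in Metric.ball x₀ r, gsq (Ioo 0 r) g₁ y ^ (p / 2) ≤
      ENNReal.ofReal D * (C * ENNReal.ofReal (2 ^ lam)) * ENNReal.ofReal (r ^ lam) := by
    have e : ∫⁻ y, ‖g₁ y‖ₑ ^ p = ∫⁻ y in B₂, ‖f y - c‖ₑ ^ p :=
      lintegral_enorm_indicator_rpow measurableSet_ball _ hp0
    have e2 : ∫⁻ y, ‖g₁ y‖ₑ ^ p ≤ C * ENNReal.ofReal (2 ^ lam) * ENNReal.ofReal (r ^ lam) := by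
      rw [e, mul_assoc, ← ENNReal.ofReal_mul (by positivity), ← Real.mul_rpow (by norm_num) hr.le]
      exact h x₀ (2 * r) (by positivity)
    calc _ ≤ ∫⁻ y, gsq (Ioi 0) g₁ y ^ (p / 2) := by
          refine (setLIntegral_le_lintegral _ _).trans (lintegral_mono fun y => ?_)
          have := gsq_mono (Ioo_subset_Ioi_self : Ioo 0 r ⊆ Ioi 0) g₁ y
          gcongr
      _ ≤ ENNReal.ofReal D * ∫⁻ y, ‖g₁ y‖ₑ ^ p := hL g₁ m₁ (e2.trans_lt (by finiteness))
      _ ≤ _ := by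
          rw [mul_assoc]
          gcongr
  -- the far part is bounded on the ball
  have hfar : ∀ x ∈ Metric.ball x₀ r, gsq (Ioo 0 r) g₂ x ≤ (κ * oscMean n p lam C r) ^ 2 := by
    intro x hx
    have hpt : ∀ t ∈ Ioo 0 r, ‖kext (kernT t) g₂ x‖ₑ ≤
        ENNReal.ofReal r⁻¹ * (κ * oscMean n p lam C r) := by
      intro t ht
      calc ‖kext (kernT t) g₂ x‖ₑ ≤ ∫⁻ y, ‖kernT t (x - y) • g₂ y‖ₑ :=
            enorm_integral_le_lintegral_enorm _
        _ ≤ ∫⁻ y, ENNReal.ofReal (kernC n * 5 ^ (((n : ℝ) + 1) / 2) / r) *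
              (ENNReal.ofReal (kern r (x₀ - y)) * ‖f y - c‖ₑ) := by
            refine lintegral_mono fun y => ?_
            by_cases hy : y ∈ B₂
            · simp [hg₂, hy]
            · rw [hg₂, indicator_of_mem (by simpa using hy), enorm_smul, ← mul_assoc,
                ← ENNReal.ofReal_mul (by positivity), ← ofReal_norm (kernT t _), Real.norm_eq_abs]
              gcongr
              exact abs_kernT_le_far ht.1 ht.2 hx hy
        _ = ENNReal.ofReal (kernC n * 5 ^ (((n : ℝ) + 1) / 2) / r) *
              ∫⁻ y, ENNReal.ofReal (kern r (x₀ - y)) * ‖f y - c‖ₑ :=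
            lintegral_const_mul' _ _ ENNReal.ofReal_ne_top
        _ ≤ ENNReal.ofReal (kernC n * 5 ^ (((n : ℝ) + 1) / 2) / r) *
              (oscC n * oscMean n p lam C r) := by
            gcongr
            exact h.lintegral_kern_le hf hp hlam' x₀ hr
        _ = _ := by
            rw [div_eq_mul_inv, ENNReal.ofReal_mul (by positivity), hκ]
            ring
    calc gsq (Ioo 0 r) g₂ x ≤ ∫⁻ _ in Ioo 0 r, ENNReal.ofReal r *
          (ENNReal.ofReal r⁻¹ * (κ * oscMean n p lam C r)) ^ 2 := by
          refine setLIntegral_mono' measurableSet_Ioo fun t ht => ?_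
          gcongr
          · exact ht.2.le
          · exact hpt t ht
      _ = (ENNReal.ofReal r * ENNReal.ofReal r⁻¹) ^ 2 * (κ * oscMean n p lam C r) ^ 2 := by
          rw [setLIntegral_const, Real.volume_Ioo, sub_zero]
          ring
      _ = _ := by
          rw [← ENNReal.ofReal_mul hr.le, mul_inv_cancel₀ hr.ne', ENNReal.ofReal_one, one_pow,
            one_mul]
  have hfar' : ∫⁻ y in Metric.ball x₀ r, gsq (Ioo 0 r) g₂ y ^ (p / 2) ≤
      κ ^ p * C * ENNReal.ofReal (r ^ lam) := by
    calc _ ≤ ∫⁻ _ in Metric.ball x₀ r, (κ * oscMean n p lam C r) ^ p := by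
          refine setLIntegral_mono' measurableSet_ball fun x hx => ?_
          calc gsq (Ioo 0 r) g₂ x ^ (p / 2) ≤ ((κ * oscMean n p lam C r) ^ 2) ^ (p / 2) := by
                have := hfar x hx
                gcongr
            _ = _ := by
                rw [← ENNReal.rpow_two, ← ENNReal.rpow_mul]
                congr 1; ring
      _ = _ := by
          rw [setLIntegral_const, ENNReal.mul_rpow_of_nonneg _ _ hp0.le, mul_assoc,
            oscMean_rpow n hp C hr x₀, mul_assoc]
  have hsplit : ∀ x, gsq (Ioo 0 r) f x ^ (p / 2) ≤
      c₂ * (c₂ * (gsq (Ioo 0 r) g₁ x ^ (p / 2) + gsq (Ioo 0 r) g₂ x ^ (p / 2))) := by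
    intro x
    have h1 : gsq (Ioo 0 r) f x ≤ 2 * (gsq (Ioo 0 r) g₁ x + gsq (Ioo 0 r) g₂ x) := by
      refine gsq_add_le m₁ measurableSet_Ioo fun t ht => ?_
      have ht0 : 0 < t := ht.1
      have e : kext (kernT t) f x = kext (kernT t) g₁ x + kext (kernT t) g₂ x := by
        rw [hf.kext_kernT_sub_const ht0 c, ← kext_add
          (w₁.integrable_of_le (measurable_kernT_right t) ht0 (abs_kernT_le ht0) x)
          (w₂.integrable_of_le (measurable_kernT_right t) ht0 (abs_kernT_le ht0) x)]
        congr 1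
        funext y
        exact (indicator_self_add_compl_apply B₂ (fun y => f y - c) y).symm
      rw [e]
      exact enorm_add_le _ _
    calc gsq (Ioo 0 r) f x ^ (p / 2)
        ≤ (2 * (gsq (Ioo 0 r) g₁ x + gsq (Ioo 0 r) g₂ x)) ^ (p / 2) := by gcongr
      _ ≤ _ := by
          rw [ENNReal.mul_rpow_of_nonneg _ _ (by positivity), h2p]
          gcongr
          exact add_rpow_le_two_rpow_mul (by positivity)
  calc ∫⁻ y in Metric.ball x₀ r, gsq (Ioo 0 r) f y ^ (p / 2)
      ≤ ∫⁻ y in Metric.ball x₀ r,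
          c₂ * (c₂ * (gsq (Ioo 0 r) g₁ y ^ (p / 2) + gsq (Ioo 0 r) g₂ y ^ (p / 2))) :=
        lintegral_mono fun y => hsplit y
    _ = c₂ * (c₂ * ((∫⁻ y in Metric.ball x₀ r, gsq (Ioo 0 r) g₁ y ^ (p / 2)) +
          ∫⁻ y in Metric.ball x₀ r, gsq (Ioo 0 r) g₂ y ^ (p / 2))) := by
        rw [lintegral_const_mul' _ _ ENNReal.ofReal_ne_top,
          lintegral_const_mul' _ _ ENNReal.ofReal_ne_top, lintegral_add_left]
        exact (measurable_gsq m₁ _).pow_const _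
    _ ≤ c₂ * (c₂ * (ENNReal.ofReal D * (C * ENNReal.ofReal (2 ^ lam)) * ENNReal.ofReal (r ^ lam) +
          κ ^ p * C * ENNReal.ofReal (r ^ lam))) := by gcongr
    _ = _ := by ring

end Forward

/-! ### Lipschitz bounds of the kernel -/

section Lipschitz

variable {n : ℕ}

/-- The Euclidean norm of the point `(t, x)` of the half space. -/
def hnorm (t : ℝ) (x : Sp n) : ℝ := √(t ^ 2 + ‖x‖ ^ 2)

theorem hnorm_sq (t : ℝ) (x : Sp n) : hnorm t x ^ 2 = t ^ 2 + ‖x‖ ^ 2 :=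
  Real.sq_sqrt (by positivity)

theorem hnorm_pos {t : ℝ} (ht : 0 < t) (x : Sp n) : 0 < hnorm t x :=
  Real.sqrt_pos.2 (sq_add_norm_sq_pos ht x)

theorem le_hnorm_left (t : ℝ) (x : Sp n) : t ≤ hnorm t x :=
  Real.le_sqrt_of_sq_le (by nlinarith [norm_nonneg x])

theorem norm_le_hnorm (t : ℝ) (x : Sp n) : ‖x‖ ≤ hnorm t x :=
  Real.le_sqrt_of_sq_le (by nlinarith)

theorem abs_hnorm_sub_le {t : ℝ} (ht : 0 < t) (a b : Sp n) :
    |hnorm t a - hnorm t b| ≤ ‖a - b‖ := by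
  have ha := hnorm_pos ht a
  have hb := hnorm_pos ht b
  have h1 : |hnorm t a - hnorm t b| * (hnorm t a + hnorm t b) =
      |‖a‖ - ‖b‖| * (‖a‖ + ‖b‖) := by
    rw [← abs_of_pos (add_pos ha hb), ← abs_mul,
      ← abs_of_nonneg (add_nonneg (norm_nonneg a) (norm_nonneg b)), ← abs_mul]
    congr 1
    have := hnorm_sq t a
    have := hnorm_sq t b
    linarith
  have h2 : |‖a‖ - ‖b‖| ≤ ‖a - b‖ := abs_norm_sub_norm_le a b
  have h3 := norm_le_hnorm t a
  have h4 := norm_le_hnorm t b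
  refine le_of_mul_le_mul_right ?_ (add_pos ha hb)
  rw [h1]
  exact mul_le_mul h2 (by linarith) (by positivity) (norm_nonneg _)

theorem rpow_neg_half_eq (k : ℕ) {ρ : ℝ} (hρ : 0 ≤ ρ) : ρ ^ (-((k : ℝ) / 2)) = (√ρ ^ k)⁻¹ := by
  rw [Real.rpow_neg hρ, Real.sqrt_eq_rpow, ← Real.rpow_natCast, ← Real.rpow_mul hρ]
  congr 2; ring

theorem kern_eq_hnorm (t : ℝ) (x : Sp n) : kern t x = t * (hnorm t x ^ (n + 1))⁻¹ := by
  rw [kern, hnorm, ← rpow_neg_half_eq _ (by positivity)]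
  push_cast; rfl

theorem kernT_eq_hnorm (t : ℝ) (x : Sp n) : kernT t x =
    (hnorm t x ^ (n + 1))⁻¹ - (n + 1) * t ^ 2 * (hnorm t x ^ (n + 3))⁻¹ := by
  rw [kernT, hnorm, ← rpow_neg_half_eq _ (by positivity), ← rpow_neg_half_eq _ (by positivity)]
  push_cast
  congr 3; ring

theorem abs_inv_pow_sub_le {c x y : ℝ} (hc : 0 < c) (hx : c ≤ x) (hy : c ≤ y) (k : ℕ) :
    |(x ^ (k + 1))⁻¹ - (y ^ (k + 1))⁻¹| ≤ (k + 1) * (c ^ (k + 2))⁻¹ * |x - y| := by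
  have hx0 := hc.trans_le hx
  have hy0 := hc.trans_le hy
  have h1 := abs_pow_sub_pow_le x⁻¹ y⁻¹ (k + 1)
  rw [inv_pow, inv_pow, abs_of_pos (inv_pos.2 hx0), abs_of_pos (inv_pos.2 hy0)] at h1
  have h2 : |x⁻¹ - y⁻¹| ≤ (c ^ 2)⁻¹ * |x - y| := by
    rw [inv_sub_inv hx0.ne' hy0.ne', abs_div, abs_of_pos (mul_pos hx0 hy0), abs_sub_comm y x,
      div_eq_inv_mul]
    gcongr
    nlinarith
  have h3 : max x⁻¹ y⁻¹ ≤ c⁻¹ := max_le (inv_anti₀ hc hx) (inv_anti₀ hc hy)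
  have h4 : 0 ≤ max x⁻¹ y⁻¹ := le_max_of_le_left (inv_nonneg.2 hx0.le)
  calc _ ≤ |x⁻¹ - y⁻¹| * ((k + 1 : ℕ) : ℝ) * max x⁻¹ y⁻¹ ^ k := by simpa using h1
    _ ≤ ((c ^ 2)⁻¹ * |x - y|) * ((k + 1 : ℕ) : ℝ) * c⁻¹ ^ k := by gcongr
    _ = _ := by
        push_cast
        rw [pow_add, mul_inv, inv_pow]; ring

theorem abs_inv_hnorm_pow_sub_le {t : ℝ} (ht : 0 < t) {a b : Sp n}
    (h : 2 * ‖a - b‖ ≤ hnorm t b) (k : ℕ) :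
    |(hnorm t a ^ (k + 1))⁻¹ - (hnorm t b ^ (k + 1))⁻¹| ≤
      (k + 1) * 2 ^ (k + 2) * ‖a - b‖ * (hnorm t b ^ (k + 2))⁻¹ := by
  have hb := hnorm_pos ht b
  have h1 := abs_hnorm_sub_le ht a b
  have h2 : hnorm t b / 2 ≤ hnorm t a := by
    have := (abs_le.1 h1).1
    linarith
  refine (abs_inv_pow_sub_le (half_pos hb) h2 (half_le_self hb.le) k).trans ?_
  rw [div_pow, inv_div, div_eq_mul_inv]
  calc _ ≤ ((k : ℝ) + 1) * (2 ^ (k + 2) * (hnorm t b ^ (k + 2))⁻¹) * ‖a - b‖ := by gcongr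
    _ = _ := by ring

/-- The constant in the Lipschitz bounds of the kernel and of its derivative. -/
def lipC (n : ℕ) : ℝ := (n + 1) * 2 ^ (n + 2) + (n + 1) * ((n + 3) * 2 ^ (n + 4))

theorem lipC_pos (n : ℕ) : 0 < lipC n := by unfold lipC; positivity

/-- A displacement small relative to the distance from the origin of the half space gains the factor
`‖a - b‖ / hnorm t b`. -/
theorem abs_kern_sub_le {t : ℝ} (ht : 0 < t) {a b : Sp n} (h : 2 * ‖a - b‖ ≤ hnorm t b) :
    |kern t a - kern t b| ≤ lipC n * (t * ‖a - b‖ * (hnorm t b ^ (n + 2))⁻¹) := by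
  have hb := hnorm_pos ht b
  rw [kern_eq_hnorm, kern_eq_hnorm, ← mul_sub, abs_mul, abs_of_pos ht]
  calc _ ≤ t * ((n + 1) * 2 ^ (n + 2) * ‖a - b‖ * (hnorm t b ^ (n + 2))⁻¹) := by
        gcongr
        exact abs_inv_hnorm_pow_sub_le ht h n
    _ = ((n + 1) * 2 ^ (n + 2)) * (t * ‖a - b‖ * (hnorm t b ^ (n + 2))⁻¹) := by ring
    _ ≤ _ := by
        gcongr
        exact le_add_of_nonneg_right (by positivity)

theorem abs_kernT_sub_le {t : ℝ} (ht : 0 < t) {a b : Sp n} (h : 2 * ‖a - b‖ ≤ hnorm t b) :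
    |kernT t a - kernT t b| ≤ lipC n * (‖a - b‖ * (hnorm t b ^ (n + 2))⁻¹) := by
  have hb := hnorm_pos ht b
  have h1 := abs_inv_hnorm_pow_sub_le ht h n
  have h2 := abs_inv_hnorm_pow_sub_le ht h (n + 2)
  push_cast at h2
  have h3 : t ^ 2 * (hnorm t b ^ (n + 4))⁻¹ ≤ (hnorm t b ^ (n + 2))⁻¹ := by
    rw [← div_eq_mul_inv, div_le_iff₀ (by positivity)]
    have : hnorm t b ^ (n + 4) = hnorm t b ^ (n + 2) * hnorm t b ^ 2 := by ring
    rw [this, ← mul_assoc, inv_mul_cancel₀ (by positivity), one_mul]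
    exact pow_le_pow_left₀ ht.le (le_hnorm_left t b) 2
  rw [kernT_eq_hnorm, kernT_eq_hnorm, sub_sub_sub_comm, ← mul_sub]
  refine (abs_sub _ _).trans ?_
  rw [abs_mul, abs_of_nonneg (by positivity : 0 ≤ ((n : ℝ) + 1) * t ^ 2)]
  calc _ ≤ (n + 1) * 2 ^ (n + 2) * ‖a - b‖ * (hnorm t b ^ (n + 2))⁻¹ +
        (n + 1) * t ^ 2 * ((n + 2 + 1) * 2 ^ (n + 2 + 2) * ‖a - b‖ *
          (hnorm t b ^ (n + 2 + 2))⁻¹) := by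
        gcongr
    _ = (n + 1) * 2 ^ (n + 2) * ‖a - b‖ * (hnorm t b ^ (n + 2))⁻¹ +
        (n + 1) * ((n + 3) * 2 ^ (n + 4)) * ‖a - b‖ * (t ^ 2 * (hnorm t b ^ (n + 4))⁻¹) := by ring
    _ ≤ (n + 1) * 2 ^ (n + 2) * ‖a - b‖ * (hnorm t b ^ (n + 2))⁻¹ +
        (n + 1) * ((n + 3) * 2 ^ (n + 4)) * ‖a - b‖ * (hnorm t b ^ (n + 2))⁻¹ := by gcongr
    _ = _ := by rw [lipC]; ring

/-! ### The kernel `t ∂ₜk - k` -/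

/-- The kernel `t ∂ₜk - k`, whose derivative in `t` is `t ∂ₜ²k`. -/
def kernO (t : ℝ) (x : Sp n) : ℝ := t * kernT t x - kern t x

theorem measurable_kernO_right (t : ℝ) : Measurable (fun x : Sp n => kernO t x) :=
  ((measurable_kernT_right t).const_mul t).sub (measurable_kern_right t)

theorem abs_kernO_le {t : ℝ} (ht : 0 < t) (x : Sp n) :
    |kernO t x| ≤ (kernC n + 1) * kern t x := by
  have h1 := abs_kernT_le ht x
  have h2 := kern_pos ht x
  refine (abs_sub _ _).trans ?_
  rw [abs_mul, abs_of_pos ht, abs_of_pos h2, add_mul, one_mul]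
  refine add_le_add_left ?_ _
  calc t * |kernT t x| ≤ t * (kernC n / t * kern t x) := by gcongr
    _ = _ := by field_simp

theorem abs_kernO_sub_le {t : ℝ} (ht : 0 < t) {a b : Sp n} (h : 2 * ‖a - b‖ ≤ t) :
    |kernO t a - kernO t b| ≤ 2 * lipC n * ‖a - b‖ / t * kern t b := by
  have hb := hnorm_pos ht b
  have h' := h.trans (le_hnorm_left t b)
  have hL := lipC_pos n
  have h1 : (hnorm t b ^ (n + 2))⁻¹ ≤ (hnorm t b ^ (n + 1))⁻¹ / t := by
    rw [pow_succ, mul_inv, div_eq_mul_inv]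
    gcongr
    exact le_hnorm_left t b
  rw [kernO, kernO, sub_sub_sub_comm, ← mul_sub]
  refine (abs_sub _ _).trans ?_
  rw [abs_mul, abs_of_pos ht]
  calc _ ≤ t * (lipC n * (‖a - b‖ * (hnorm t b ^ (n + 2))⁻¹)) +
        lipC n * (t * ‖a - b‖ * (hnorm t b ^ (n + 2))⁻¹) := by
        gcongr
        · exact abs_kernT_sub_le ht h'
        · exact abs_kern_sub_le ht h'
    _ = 2 * lipC n * ‖a - b‖ * t * (hnorm t b ^ (n + 2))⁻¹ := by ring
    _ ≤ 2 * lipC n * ‖a - b‖ * t * ((hnorm t b ^ (n + 1))⁻¹ / t) := by gcongr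
    _ = _ := by rw [kern_eq_hnorm]; field_simp

theorem integral_kernO_sub {t : ℝ} (ht : 0 < t) (x : Sp n) :
    ∫ y, kernO t (x - y) = -kernMass n := by
  have i1 : Integrable fun y : Sp n => kern t (x - y) := (integrable_kern ht).comp_sub_left x
  have i2 : Integrable fun y : Sp n => t * kernT t (x - y) := by
    refine ((i1.const_mul (kernC n / t)).mono'
      ((measurable_kernT_right t).comp (by fun_prop)).aestronglyMeasurable
      (ae_of_all _ fun y => abs_kernT_le ht _)).const_mul t
  unfold kernO
  rw [integral_sub i2 i1, integral_const_mul, integral_kernT_sub ht, integral_kern_sub ht]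
  ring

variable {F : Type*} [NormedAddCommGroup F] [NormedSpace ℝ F] {f : Sp n → F}

theorem WInt.kext_kernO (hf : WInt f) {t : ℝ} (ht : 0 < t) (x : Sp n) :
    kext (kernO t) f x = t • kext (kernT t) f x - kext (kern t) f x := by
  unfold kext
  rw [← integral_smul, ← integral_sub]
  · refine integral_congr_ae (ae_of_all _ fun y => ?_)
    simp only [kernO, sub_smul, mul_smul]
  · exact (hf.integrable_of_le (measurable_kernT_right t) ht (abs_kernT_le ht) x).smul t
  · exact hf.integrable_kern_sub ht x

theorem WInt.hasDerivAt_kext_kernO (hf : WInt f) {t : ℝ} (ht : 0 < t) (x : Sp n) :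
    HasDerivAt (fun s => kext (kernO s) f x) (t • kext (kernTT t) f x) t := by
  have h1 := ((hasDerivAt_id t).smul (hf.hasDerivAt_kext_kernT ht x)).sub
    (hf.hasDerivAt_kext_kern ht x)
  refine (h1.congr_of_eventuallyEq ?_).congr_deriv ?_
  · filter_upwards [lt_mem_nhds ht] with s hs
    simpa using hf.kext_kernO hs x
  · simp

theorem WInt.norm_kext_kernO_sub_le (hf : WInt f) {t : ℝ} (ht : 0 < t) {x x₀ : Sp n}
    (h : 2 * ‖x - x₀‖ ≤ t) : ‖kext (kernO t) f x - kext (kernO t) f x₀‖ ≤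
      2 * lipC n * ‖x - x₀‖ * (t⁻¹ * kext (kern t) (fun y => ‖f y‖) x₀) := by
  have hi := fun x => hf.integrable_of_le (measurable_kernO_right t) ht (abs_kernO_le ht) x
  have e : kext (kernO t) f x - kext (kernO t) f x₀ =
      ∫ y, (kernO t (x - y) - kernO t (x₀ - y)) • f y := by
    unfold kext
    rw [← integral_sub (hi x) (hi x₀)]
    simp only [sub_smul]
  rw [e, ← mul_assoc, ← div_eq_mul_inv]
  unfold kext
  rw [← integral_const_mul]
  refine norm_integral_le_of_norm_le ((hf.norm.integrable_kern_sub ht x₀).const_mul _)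
    (ae_of_all _ fun y => ?_)
  rw [norm_smul, smul_eq_mul, ← mul_assoc]
  gcongr
  have e2 : (x - y) - (x₀ - y) = x - x₀ := by abel
  have := abs_kernO_sub_le ht (a := x - y) (b := x₀ - y) (by rwa [e2])
  rwa [e2] at this

/-- Extensions grow slower than linearly in the height. -/
theorem WInt.tendsto_inv_mul_kext {f : Sp n → ℝ} (hf : WInt f) (x : Sp n) :
    Tendsto (fun t => t⁻¹ * kext (kern t) f x) atTop (𝓝 0) := by
  have h1 : Tendsto (fun t : ℝ => ∫ y, t⁻¹ * (kern t (x - y) • f y)) atTop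
      (𝓝 (∫ _ : Sp n, (0 : ℝ))) := by
    refine tendsto_integral_filter_of_dominated_convergence
      (fun y => ‖kern 1 (x - y) • f y‖) ?_ ?_ (hf.integrable_kern_sub one_pos x).norm ?_
    · filter_upwards [eventually_gt_atTop 0] with t ht
      exact (hf.integrable_kern_sub ht x).aestronglyMeasurable.const_mul _
    · filter_upwards [eventually_ge_atTop 1] with t ht
      have ht0 : 0 < t := by linarith
      refine ae_of_all _ fun y => ?_
      have h2 := kern_le_of_le (n := n) ht0 one_pos one_pos (x - y) (x - y) (by nlinarith)
      rw [Real.one_rpow, mul_one, div_one] at h2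
      rw [norm_mul, norm_smul, norm_smul, ← mul_assoc]
      gcongr
      rw [Real.norm_of_nonneg (by positivity), Real.norm_of_nonneg (kern_pos ht0 _).le,
        Real.norm_of_nonneg (kern_pos one_pos _).le, inv_mul_le_iff₀ ht0]
      exact h2
    · refine ae_of_all _ fun y => ?_
      have h3 : Tendsto (fun t : ℝ => t⁻¹ * kern t (x - y)) atTop (𝓝 0) := by
        refine squeeze_zero' (g := fun t : ℝ => t⁻¹) ?_ ?_ tendsto_inv_atTop_zero
        · filter_upwards [eventually_gt_atTop 0] with t ht
          have := kern_pos ht (x - y)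
          positivity
        · filter_upwards [eventually_ge_atTop 1] with t ht
          have ht0 : 0 < t := by linarith
          have h4 := kern_le_inv_pow ht0 (x - y)
          have h5 : (t ^ n)⁻¹ ≤ 1 := inv_le_one_of_one_le₀ (one_le_pow₀ ht)
          calc t⁻¹ * kern t (x - y) ≤ t⁻¹ * 1 := by
                gcongr
                exact h4.trans h5
            _ = t⁻¹ := mul_one _
      simpa [mul_assoc] using h3.mul_const (f y)
  simpa [integral_const_mul, kext] using h1

end Lipschitz

/-! ### Functions with mean zero in a ball -/

section MeanZero

variable {n : ℕ}

/-- A function in `L^q` that vanishes outside the ball `B(x₀, r)` and has integral zero. -/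
structure MeanZeroIn (q : ℝ) (x₀ : Sp n) (r : ℝ) (g : Sp n → ℂ) : Prop where
  meas : AEStronglyMeasurable g volume
  supp : ∀ x, x ∉ Metric.ball x₀ r → g x = 0
  fin : ∫⁻ x, ‖g x‖ₑ ^ q < ∞
  mean : ∫ x, g x = 0

theorem MeanZeroIn.wInt {q : ℝ} {x₀ : Sp n} {r : ℝ} {g : Sp n → ℂ} (hg : MeanZeroIn q x₀ r g)
    (hq : 1 ≤ q) : WInt g :=
  wInt_of_lintegral_rpow hq hg.meas hg.fin

theorem MeanZeroIn.integrable {q : ℝ} {x₀ : Sp n} {r : ℝ} {g : Sp n → ℂ}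
    (hg : MeanZeroIn q x₀ r g) (hq : 1 ≤ q) : Integrable g := by
  have h1 := (hg.wInt hq).locallyIntegrable.integrableOn_isCompact (isCompact_closedBall x₀ r)
  refine (integrableOn_iff_integrable_of_support_subset fun x hx => ?_).1 h1
  by_contra h
  exact hx (hg.supp x fun h' => h (Metric.ball_subset_closedBall h'))

/-- Over a bounded box away from the boundary, the kernels are dominated by a single one. -/
theorem kern_sub_le_of_mem_ball {ε T r s : ℝ} (hε : 0 < ε) (hs : s ∈ Icc ε T) {x₀ x : Sp n}
    (hx : x ∈ Metric.ball x₀ r) (y : Sp n) : kern s (x - y) ≤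
      T * ((1 + 2 * r ^ 2) / ε ^ 2 + 2) ^ (((n : ℝ) + 1) / 2) * kern 1 (x₀ - y) := by
  have hs0 : 0 < s := hε.trans_le hs.1
  rw [Metric.mem_ball, dist_eq_norm] at hx
  have h1 : ‖x₀ - y‖ ≤ ‖x - y‖ + ‖x - x₀‖ := by
    have : x₀ - y = (x - y) - (x - x₀) := by abel
    rw [this]; exact norm_sub_le _ _
  have h2 : ‖x₀ - y‖ ^ 2 ≤ 2 * ‖x - y‖ ^ 2 + 2 * r ^ 2 := by
    nlinarith [norm_nonneg (x - y), norm_nonneg (x₀ - y), norm_nonneg (x - x₀),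
      sq_nonneg (‖x - y‖ - ‖x - x₀‖)]
  have h3 : ε ^ 2 ≤ s ^ 2 := pow_le_pow_left₀ hε.le hs.1 2
  have h4 : 1 + 2 * r ^ 2 ≤ (1 + 2 * r ^ 2) / ε ^ 2 * s ^ 2 := by
    rw [div_mul_eq_mul_div, le_div_iff₀ (by positivity)]
    gcongr
  have h5 : 0 ≤ (1 + 2 * r ^ 2) / ε ^ 2 := by positivity
  have h6 := kern_pos one_pos (x₀ - y)
  have h7 : 1 ^ 2 + ‖x₀ - y‖ ^ 2 ≤ ((1 + 2 * r ^ 2) / ε ^ 2 + 2) * (s ^ 2 + ‖x - y‖ ^ 2) := by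
    have := mul_nonneg h5 (sq_nonneg ‖x - y‖)
    nlinarith [sq_nonneg s]
  refine (kern_le_of_le hs0 one_pos (by positivity) (x - y) (x₀ - y) h7).trans ?_
  gcongr
  rw [div_one]; exact hs.2

variable {F : Type*} [NormedAddCommGroup F] [NormedSpace ℝ F] {f : Sp n → F}

theorem WInt.exists_kext_norm_le (hf : WInt f) {ε T : ℝ} (hε : 0 < ε) (x₀ : Sp n) (r : ℝ) :
    ∃ K : ℝ, ∀ s ∈ Icc ε T, ∀ x ∈ Metric.ball x₀ r, kext (kern s) (fun y => ‖f y‖) x ≤ K := by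
  refine ⟨T * ((1 + 2 * r ^ 2) / ε ^ 2 + 2) ^ (((n : ℝ) + 1) / 2) *
    kext (kern 1) (fun y => ‖f y‖) x₀, fun s hs x hx => ?_⟩
  have hs0 : 0 < s := hε.trans_le hs.1
  unfold kext
  rw [← integral_const_mul]
  refine integral_mono (hf.norm.integrable_kern_sub hs0 x)
    ((hf.norm.integrable_kern_sub one_pos x₀).const_mul _) fun y => ?_
  simp only [smul_eq_mul, ← mul_assoc]
  gcongr
  exact kern_sub_le_of_mem_ball hε hs hx y

end MeanZero

/-! ### A reproducing formula -/

section Reproducing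

variable {n : ℕ} {f g : Sp n → ℂ} {q : ℝ} {x₀ : Sp n} {r : ℝ}

theorem MeanZeroIn.integrable_prod_kext (hg : MeanZeroIn q x₀ r g) (hq : 1 ≤ q) {w : Sp n → ℂ}
    (hw : WInt w) {K : Sp n → ℝ} (hK : Measurable K) {t C : ℝ} (ht : 0 < t)
    (h : ∀ z, |K z| ≤ C * kern t z) :
    Integrable (fun z : Sp n × Sp n => K (z.1 - z.2) • (w z.2 * g z.1))
      (volume.prod volume) := by
  set c := C * (t * ((1 + 2 * r ^ 2) / t ^ 2 + 2) ^ (((n : ℝ) + 1) / 2)) with hc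
  have hC : 0 ≤ C := by
    have h1 := (abs_nonneg _).trans (h 0)
    exact nonneg_of_mul_nonneg_left h1 (kern_pos ht _)
  have i1 : Integrable (fun z : Sp n × Sp n => c * (‖g z.1‖ * ‖kern 1 (x₀ - z.2) • w z.2‖))
      (volume.prod volume) :=
    ((hg.integrable hq).norm.mul_prod (hw.integrable_kern_sub one_pos x₀).norm).const_mul c
  refine i1.mono' ?_ (ae_of_all _ fun z => ?_)
  · exact (hK.comp (measurable_fst.sub measurable_snd)).aestronglyMeasurable.smul
      (hw.aestronglyMeasurable.comp_snd.mul hg.meas.comp_fst)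
  · by_cases hz : z.1 ∈ Metric.ball x₀ r
    · have h1 := kern_sub_le_of_mem_ball ht ⟨le_rfl, le_rfl⟩ hz z.2
      have h2 := kern_pos one_pos (x₀ - z.2)
      rw [norm_smul, norm_smul, norm_mul, Real.norm_eq_abs, Real.norm_of_nonneg h2.le]
      calc |K (z.1 - z.2)| * (‖w z.2‖ * ‖g z.1‖)
          ≤ (C * (t * ((1 + 2 * r ^ 2) / t ^ 2 + 2) ^ (((n : ℝ) + 1) / 2) * kern 1 (x₀ - z.2))) *
            (‖w z.2‖ * ‖g z.1‖) := by
            gcongr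
            exact (h _).trans (by gcongr)
        _ = _ := by rw [hc]; ring
    · simp [hg.supp _ hz]

/-- Extending is self-adjoint. -/
theorem MeanZeroIn.integral_kext_mul (hg : MeanZeroIn q x₀ r g) (hq : 1 ≤ q) {w : Sp n → ℂ}
    (hw : WInt w) {K : Sp n → ℝ} (hK : Measurable K) {t C : ℝ} (ht : 0 < t)
    (h : ∀ z, |K z| ≤ C * kern t z) (hev : ∀ z, K (-z) = K z) :
    ∫ x, kext K w x * g x = ∫ y, w y * kext K g y := by
  have h1 := integral_integral_swap (f := fun x y => K (x - y) • (w y * g x))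
    (hg.integrable_prod_kext hq hw hK ht h)
  calc ∫ x, kext K w x * g x = ∫ x, ∫ y, K (x - y) • (w y * g x) := by
        refine integral_congr_ae (ae_of_all _ fun x => ?_)
        simp only [kext, ← integral_mul_const, smul_mul_assoc]
    _ = ∫ y, ∫ x, K (x - y) • (w y * g x) := h1
    _ = _ := by
        refine integral_congr_ae (ae_of_all _ fun y => ?_)
        simp only [kext, ← integral_const_mul]
        refine integral_congr_ae (ae_of_all _ fun x => ?_)
        simp only [mul_smul_comm]
        rw [← hev, neg_sub]

theorem MeanZeroIn.integrable_kext_mul (hg : MeanZeroIn q x₀ r g) (hq : 1 ≤ q) {w : Sp n → ℂ}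
    (hw : WInt w) {K : Sp n → ℝ} (hK : Measurable K) {t C : ℝ} (ht : 0 < t)
    (h : ∀ z, |K z| ≤ C * kern t z) : Integrable (fun x => kext K w x * g x) := by
  refine (hg.integrable_prod_kext hq hw hK ht h).integral_prod_left.congr
    (ae_of_all _ fun x => ?_)
  simp only [kext, ← integral_mul_const, smul_mul_assoc]

theorem MeanZeroIn.integrable_prod_kernTT (hg : MeanZeroIn q x₀ r g) (hq : 1 ≤ q) (hf : WInt f)
    {ε T : ℝ} (hε : 0 < ε) :
    Integrable (fun z : ℝ × Sp n => (z.1 • kext (kernTT z.1) f z.2) * g z.2)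
      ((volume.restrict (Ioc ε T)).prod volume) := by
  obtain ⟨K, hK⟩ := hf.exists_kext_norm_le (T := T) hε x₀ r
  have hC := kernC_pos n
  have i1 : Integrable (fun z : ℝ × Sp n => kernC n / ε * K * ‖g z.2‖)
      ((volume.restrict (Ioc ε T)).prod volume) :=
    ((hg.integrable hq).norm.comp_snd (volume.restrict (Ioc ε T))).const_mul _
  refine i1.mono' ?_ ?_
  · exact (measurable_fst.aestronglyMeasurable.smul (stronglyMeasurable_kext
      hf.aestronglyMeasurable measurable_kernTT).aestronglyMeasurable).mul hg.meas.comp_snd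
  · filter_upwards [ae_prod_mem_Ioc ε T] with z hz
    have hz0 : 0 < z.1 := hε.trans hz.1
    by_cases hx : z.2 ∈ Metric.ball x₀ r
    · rw [norm_mul, norm_smul, Real.norm_of_nonneg hz0.le]
      refine mul_le_mul_of_nonneg_right ?_ (norm_nonneg _)
      have h1 := hK z.1 ⟨hz.1.le, hz.2⟩ z.2 hx
      have h0 : 0 ≤ kext (kern z.1) (fun y => ‖f y‖) z.2 :=
        kext_nonneg (fun y => norm_nonneg _) hz0 _
      calc z.1 * ‖kext (kernTT z.1) f z.2‖
          ≤ z.1 * (kernC n / z.1 ^ 2 * kext (kern z.1) (fun y => ‖f y‖) z.2) := by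
            gcongr
            exact hf.norm_kext_le hz0 (abs_kernTT_le hz0) z.2
        _ = kernC n / z.1 * kext (kern z.1) (fun y => ‖f y‖) z.2 := by field_simp
        _ ≤ kernC n / ε * K := by
            gcongr
            exact hz.1.le
    · simp [hg.supp _ hx]

/-- Integration by parts in the height against a test function. -/
theorem MeanZeroIn.integral_kernO_sub_eq (hg : MeanZeroIn q x₀ r g) (hq : 1 ≤ q) (hf : WInt f)
    {ε T : ℝ} (hε : 0 < ε) (hεT : ε ≤ T) :
    (∫ x, kext (kernO T) f x * g x) - ∫ x, kext (kernO ε) f x * g x =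
      ∫ s in Ioc ε T, s • ∫ x, kext (kernTT s) f x * g x := by
  have hT : 0 < T := hε.trans_le hεT
  have h1 := hg.integrable_kext_mul hq hf (measurable_kernO_right T) hT (abs_kernO_le hT)
  have h2 := hg.integrable_kext_mul hq hf (measurable_kernO_right ε) hε (abs_kernO_le hε)
  have i1 := hg.integrable_prod_kernTT hq hf (T := T) hε
  have h3 : ∀ x, ∫ s in Ioc ε T, s • kext (kernTT s) f x =
      kext (kernO T) f x - kext (kernO ε) f x := by
    intro x
    rw [← intervalIntegral.integral_of_le hεT]
    refine intervalIntegral.integral_eq_sub_of_hasDerivAt (f := fun s => kext (kernO s) f x)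
      (fun s hs => ?_) ?_
    · rw [uIcc_of_le hεT] at hs
      exact hf.hasDerivAt_kext_kernO (hε.trans_le hs.1) x
    · obtain ⟨K, hK⟩ := hf.exists_kext_norm_le (T := T) hε x 1
      have hC := kernC_pos n
      rw [intervalIntegrable_iff_integrableOn_Ioc_of_le hεT]
      have mm : StronglyMeasurable fun s : ℝ => kext (kernTT s) f x :=
        (stronglyMeasurable_kext hf.aestronglyMeasurable measurable_kernTT).comp_measurable
          measurable_prodMk_right
      refine Measure.integrableOn_of_bounded (M := kernC n / ε * K) (by simp)
        (stronglyMeasurable_id.smul mm).aestronglyMeasurable ?_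
      filter_upwards [ae_restrict_mem measurableSet_Ioc] with s hs
      have hs0 : 0 < s := hε.trans hs.1
      have h4 := hK s ⟨hs.1.le, hs.2⟩ x (Metric.mem_ball_self one_pos)
      have h0 : 0 ≤ kext (kern s) (fun y => ‖f y‖) x :=
        kext_nonneg (fun y => norm_nonneg _) hs0 _
      change ‖s • kext (kernTT s) f x‖ ≤ _
      rw [norm_smul, Real.norm_of_nonneg hs0.le]
      calc s * ‖kext (kernTT s) f x‖
          ≤ s * (kernC n / s ^ 2 * kext (kern s) (fun y => ‖f y‖) x) := by
            gcongr
            exact hf.norm_kext_le hs0 (abs_kernTT_le hs0) x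
        _ = kernC n / s * kext (kern s) (fun y => ‖f y‖) x := by field_simp
        _ ≤ kernC n / ε * K := by
            gcongr
            exact hs.1.le
  calc _ = ∫ x, ∫ s in Ioc ε T, (s • kext (kernTT s) f x) * g x := by
        rw [← integral_sub h1 h2]
        refine integral_congr_ae (ae_of_all _ fun x => ?_)
        simp only [integral_mul_const, h3, sub_mul]
    _ = ∫ s in Ioc ε T, ∫ x, (s • kext (kernTT s) f x) * g x :=
        (integral_integral_swap i1).symm
    _ = _ := by
        refine integral_congr_ae (ae_of_all _ fun s => ?_)
        simp only [smul_mul_assoc, integral_smul]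

theorem MeanZeroIn.enorm_integral_kernTT_le (hg : MeanZeroIn q x₀ r g) (hq : 1 ≤ q) (hf : WInt f)
    {t : ℝ} (ht : 0 < t) : ‖∫ x, kext (kernTT (2 * t)) f x * g x‖ₑ ≤
      ENNReal.ofReal (kernMass n)⁻¹ *
        ∫⁻ x, ‖kext (kernT t) f x‖ₑ * ‖kext (kernT t) g x‖ₑ := by
  have hZ := kernMass_pos n
  have e : ∫ x, kext (kernTT (2 * t)) f x * g x =
      (kernMass n)⁻¹ • ∫ x, kext (kernT t) f x * kext (kernT t) g x := by
    rw [← hg.integral_kext_mul hq (hf.wInt_kext (measurable_kernT_right t) ht (abs_kernT_le ht))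
      (measurable_kernT_right t) ht (abs_kernT_le ht) (kernT_neg t), ← integral_smul]
    refine integral_congr_ae (ae_of_all _ fun x => ?_)
    simp only
    rw [hf.kext_kernT_kernT ht ht, ← two_mul, smul_mul_assoc, inv_smul_smul₀ hZ.ne']
  rw [e, enorm_smul, Real.enorm_of_nonneg (inv_nonneg.2 hZ.le)]
  gcongr
  refine (enorm_integral_le_lintegral_enorm _).trans (le_of_eq ?_)
  simp only [enorm_mul]

/-- The pairing of the derivatives of two extensions over the half space. -/
def pairing (f g : Sp n → ℂ) : ℝ≥0∞ :=
  ∫⁻ t in Ioi (0 : ℝ), ENNReal.ofReal t *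
    ∫⁻ x, ‖kext (kernT t) f x‖ₑ * ‖kext (kernT t) g x‖ₑ

/-- By the semigroup law, `∂ₜ²` at height `2t` is a composition of two copies of `∂ₜ` at height `t`,
one of which is moved to `g`. -/
theorem MeanZeroIn.enorm_integral_kernO_sub_le (hg : MeanZeroIn q x₀ r g) (hq : 1 ≤ q)
    (hf : WInt f) {ε T : ℝ} (hε : 0 < ε) (hεT : ε ≤ T) :
    ‖(∫ x, kext (kernO T) f x * g x) - ∫ x, kext (kernO ε) f x * g x‖ₑ ≤
      ENNReal.ofReal (4 * (kernMass n)⁻¹) * pairing f g := by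
  have hZ := kernMass_pos n
  rw [hg.integral_kernO_sub_eq hq hf hε hεT]
  refine (enorm_integral_le_lintegral_enorm _).trans ?_
  have e1 : Ioc ε T = Ioc (2 * (ε / 2)) (2 * (T / 2)) := by congr 1 <;> ring
  rw [e1, setLIntegral_Ioc_two_mul, ← lintegral_const_mul' _ _ (by simp)]
  calc _ ≤ ∫⁻ t in Ioc (ε / 2) (T / 2), ENNReal.ofReal (4 * (kernMass n)⁻¹) *
        (ENNReal.ofReal t * ∫⁻ x, ‖kext (kernT t) f x‖ₑ * ‖kext (kernT t) g x‖ₑ) := by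
        refine setLIntegral_mono' measurableSet_Ioc fun t ht => ?_
        have ht0 : 0 < t := (half_pos hε).trans ht.1
        rw [enorm_smul, Real.enorm_of_nonneg (by positivity : 0 ≤ 2 * t)]
        calc _ ≤ 2 * (ENNReal.ofReal (2 * t) * (ENNReal.ofReal (kernMass n)⁻¹ *
              ∫⁻ x, ‖kext (kernT t) f x‖ₑ * ‖kext (kernT t) g x‖ₑ)) := by
              gcongr
              exact hg.enorm_integral_kernTT_le hq hf ht0
          _ = _ := by
              have h4 : ENNReal.ofReal 4 = 2 * 2 := by
                rw [ENNReal.ofReal_ofNat]; norm_num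
              rw [ENNReal.ofReal_mul (by norm_num), ENNReal.ofReal_mul (by norm_num), h4,
                ENNReal.ofReal_ofNat]
              ring
    _ = ENNReal.ofReal (4 * (kernMass n)⁻¹) * ∫⁻ t in Ioc (ε / 2) (T / 2),
        (ENNReal.ofReal t * ∫⁻ x, ‖kext (kernT t) f x‖ₑ * ‖kext (kernT t) g x‖ₑ) :=
        lintegral_const_mul' _ _ ENNReal.ofReal_ne_top
    _ ≤ _ := by
        unfold pairing
        gcongr
        exact fun t ht => (half_pos hε).trans ht.1

/-- Because of the mean zero, the boundary term at infinity vanishes. -/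
theorem MeanZeroIn.tendsto_integral_kernO_atTop (hg : MeanZeroIn q x₀ r g) (hq : 1 ≤ q)
    (hf : WInt f) (hr : 0 < r) :
    Tendsto (fun T => ∫ x, kext (kernO T) f x * g x) atTop (𝓝 0) := by
  have hi := hg.integrable hq
  have hL := lipC_pos n
  have h1 : Tendsto (fun T => (2 * lipC n * r * ∫ x, ‖g x‖) *
      (T⁻¹ * kext (kern T) (fun y => ‖f y‖) x₀)) atTop (𝓝 0) := by
    simpa using (hf.norm.tendsto_inv_mul_kext x₀).const_mul (2 * lipC n * r * ∫ x, ‖g x‖)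
  refine squeeze_zero_norm' ?_ h1
  filter_upwards [eventually_ge_atTop (2 * r)] with T hT
  have hT0 : 0 < T := by linarith
  have i1 := hg.integrable_kext_mul hq hf (measurable_kernO_right T) hT0 (abs_kernO_le hT0)
  have e1 : ∫ x, kext (kernO T) f x * g x =
      ∫ x, (kext (kernO T) f x - kext (kernO T) f x₀) * g x := by
    simp only [sub_mul]
    rw [integral_sub i1 (hi.const_mul _), integral_const_mul, hg.mean, mul_zero, sub_zero]
  have h0 : 0 ≤ kext (kern T) (fun y => ‖f y‖) x₀ := kext_nonneg (fun y => norm_nonneg _) hT0 _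
  rw [e1, mul_right_comm, ← integral_const_mul]
  refine norm_integral_le_of_norm_le (hi.norm.const_mul _) (ae_of_all _ fun x => ?_)
  by_cases hx : x ∈ Metric.ball x₀ r
  · rw [Metric.mem_ball, dist_eq_norm] at hx
    rw [norm_mul]
    gcongr
    refine (hf.norm_kext_kernO_sub_le hT0 (by linarith)).trans ?_
    gcongr
  · simp [hg.supp _ hx]

/-- The extensions of a function in `L^p_loc` at small heights are dominated on a ball. -/
theorem WInt.ae_kext_norm_le_maxR_add [NeZero n] (hf : WInt f) {p : ℝ} (hp : 1 < p)
    (x₀ : Sp n) {r : ℝ} (hr : 0 < r) (hfin : ∫⁻ x in Metric.ball x₀ (2 * r), ‖f x‖ₑ ^ p < ∞) :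
    ∀ᵐ x, x ∈ Metric.ball x₀ r → ∀ t ∈ Ioo 0 r, kext (kern t) (fun y => ‖f y‖) x ≤
      maxR ((Metric.ball x₀ (2 * r)).indicator f) x +
        5 ^ (((n : ℝ) + 1) / 2) * kext (kern r) (fun y => ‖f y‖) x₀ := by
  set B₂ := Metric.ball x₀ (2 * r) with hB₂
  have m₁ : AEStronglyMeasurable (B₂.indicator f) volume :=
    hf.aestronglyMeasurable.indicator measurableSet_ball
  have w₁ : WInt (B₂.indicator f) :=
    hf.of_norm_le m₁ (ae_of_all _ fun y => norm_indicator_le_norm_self _ _)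
  have e : ∫⁻ x, ‖B₂.indicator f x‖ₑ ^ p < ∞ := by
    rw [lintegral_enorm_indicator_rpow measurableSet_ball _ (by linarith)]
    exact hfin
  filter_upwards [ae_kext_le_maxR hp w₁ e] with x hx hxB t ht
  have h1 := hx t ht.1
  have i1 := w₁.norm.integrable_kern_sub ht.1 x
  have i2 := (hf.norm.integrable_kern_sub hr x₀).const_mul (5 ^ (((n : ℝ) + 1) / 2))
  have h2 : kext (kern t) (fun y => ‖f y‖) x ≤
      kext (kern t) (fun y => ‖B₂.indicator f y‖) x +
        5 ^ (((n : ℝ) + 1) / 2) * kext (kern r) (fun y => ‖f y‖) x₀ := by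
    unfold kext
    rw [← integral_const_mul, ← integral_add i1 i2]
    refine integral_mono (hf.norm.integrable_kern_sub ht.1 x) (i1.add i2) fun y => ?_
    have k1 := kern_pos hr (x₀ - y)
    have k2 := kern_pos ht.1 (x - y)
    simp only [smul_eq_mul]
    by_cases hy : y ∈ B₂
    · rw [indicator_of_mem hy]
      exact le_add_of_nonneg_right (by positivity)
    · rw [indicator_of_notMem hy, norm_zero, mul_zero, zero_add, ← mul_assoc]
      gcongr
      have hk := kern_pos hr (x₀ - y)
      refine (kern_le_far ht.1 ht.2 hxB hy).trans ?_
      gcongr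
      exact mul_le_of_le_one_left (by positivity) ((div_le_one hr).2 ht.2.le)
  linarith

/-- The boundary term at height zero is the pairing of the two functions. -/
theorem MeanZeroIn.tendsto_integral_kernO_zero [NeZero n] {p : ℝ} (hpq : p.HolderConjugate q)
    (hg : MeanZeroIn q x₀ r g) (hf : WInt f) (hr : 0 < r)
    (hfin : ∫⁻ x in Metric.ball x₀ (2 * r), ‖f x‖ₑ ^ p < ∞) :
    Tendsto (fun t => ∫ x, kext (kernO t) f x * g x) (𝓝[>] 0)
      (𝓝 (∫ x, (-kernMass n) • (f x * g x))) := by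
  have hp : 1 < p := hpq.lt
  have hq : 1 ≤ q := hpq.symm.lt.le
  have hi := hg.integrable hq
  set B₂ := Metric.ball x₀ (2 * r) with hB₂
  have hC := kernC_pos n
  set K := 5 ^ (((n : ℝ) + 1) / 2) * kext (kern r) (fun y => ‖f y‖) x₀ with hK
  have hM := integrable_maxR_rpow (f := B₂.indicator f) hp
    (hf.aestronglyMeasurable.indicator measurableSet_ball) (by
      rw [lintegral_enorm_indicator_rpow measurableSet_ball _ (by linarith)]; exact hfin)
  have hgq : Integrable fun x => ‖g x‖ ^ q := by
    refine ⟨(hg.meas.norm.aemeasurable.pow_const q).aestronglyMeasurable, ?_⟩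
    rw [HasFiniteIntegral]
    refine lt_of_eq_of_lt (lintegral_congr fun y => ?_) hg.fin
    rw [Real.enorm_of_nonneg (by positivity), ← ENNReal.ofReal_rpow_of_nonneg (norm_nonneg _)
      (by linarith), ofReal_norm]
  refine tendsto_integral_filter_of_dominated_convergence (fun x => (kernC n + 1) *
    ((maxR (B₂.indicator f) x ^ p / p + ‖g x‖ ^ q / q) + K * ‖g x‖)) ?_ ?_
    ((((hM.div_const p).add (hgq.div_const q)).add (hi.norm.const_mul K)).const_mul _) ?_
  · filter_upwards [self_mem_nhdsWithin] with t ht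
    exact (hg.integrable_kext_mul hq hf (measurable_kernO_right t) ht
      (abs_kernO_le ht)).aestronglyMeasurable
  · filter_upwards [Ioo_mem_nhdsGT hr] with t ht
    filter_upwards [hf.ae_kext_norm_le_maxR_add hp x₀ hr hfin] with x hx
    by_cases hxB : x ∈ Metric.ball x₀ r
    · have h1 := hx hxB t ht
      have h2 := hf.norm_kext_le ht.1 (abs_kernO_le ht.1) x
      have h3 := Real.young_inequality_of_nonneg (maxR_nonneg (B₂.indicator f) x)
        (norm_nonneg (g x)) hpq
      rw [norm_mul]
      calc ‖kext (kernO t) f x‖ * ‖g x‖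
          ≤ ((kernC n + 1) * (maxR (B₂.indicator f) x + K)) * ‖g x‖ := by
            gcongr
            exact h2.trans (by gcongr)
        _ = (kernC n + 1) * (maxR (B₂.indicator f) x * ‖g x‖ + K * ‖g x‖) := by ring
        _ ≤ _ := by gcongr
    · have h0 : 0 ≤ maxR (B₂.indicator f) x := maxR_nonneg _ _
      have hq0 : 0 < q := by linarith
      have : (0 : ℝ) ^ q = 0 := Real.zero_rpow hq0.ne'
      simp only [hg.supp _ hxB, mul_zero, norm_zero, this, zero_div, add_zero]
      positivity
  · filter_upwards [hf.ae_tendsto_kext (K := kernO) measurable_kernO_right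
      (fun s hs z => abs_kernO_le hs z) (fun s hs x => integral_kernO_sub hs x)] with x hx
    rw [← smul_mul_assoc]
    exact hx.mul_const (g x)

/-- **Reproducing estimate**: the integral of a product is controlled by the pairing of the
derivatives of the two extensions. -/
theorem MeanZeroIn.enorm_integral_mul_le [NeZero n] {p : ℝ} (hpq : p.HolderConjugate q)
    (hg : MeanZeroIn q x₀ r g) (hf : WInt f) (hr : 0 < r)
    (hfin : ∫⁻ x in Metric.ball x₀ (2 * r), ‖f x‖ₑ ^ p < ∞) :
    ‖∫ x, f x * g x‖ₑ ≤ ENNReal.ofReal (4 * (kernMass n)⁻¹ ^ 2) * pairing f g := by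
  have hZ := kernMass_pos n
  have hq : 1 ≤ q := hpq.symm.lt.le
  set R := ENNReal.ofReal (4 * (kernMass n)⁻¹) * pairing f g with hR
  have h1 : ∀ T, 0 < T → ‖(∫ x, kext (kernO T) f x * g x) -
      ∫ x, (-kernMass n) • (f x * g x)‖ₑ ≤ R := by
    intro T hT
    have h2 := ((hg.tendsto_integral_kernO_zero hpq hf hr hfin).const_sub
      (∫ x, kext (kernO T) f x * g x)).enorm
    refine le_of_tendsto h2 ?_
    filter_upwards [Ioo_mem_nhdsGT hT] with ε hε
    exact hg.enorm_integral_kernO_sub_le hq hf hε.1 hε.2.le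
  have h3 : ‖(0 : ℂ) - ∫ x, (-kernMass n) • (f x * g x)‖ₑ ≤ R := by
    have h4 := ((hg.tendsto_integral_kernO_atTop hq hf hr).sub_const
      (∫ x, (-kernMass n) • (f x * g x))).enorm
    refine le_of_tendsto h4 ?_
    filter_upwards [eventually_gt_atTop 0] with T hT
    exact h1 T hT
  rw [integral_smul, zero_sub, neg_smul, neg_neg, enorm_smul, Real.enorm_of_nonneg hZ.le] at h3
  have hZ0 : ENNReal.ofReal (kernMass n) ≠ 0 := by simpa using hZ
  calc ‖∫ x, f x * g x‖ₑ = ENNReal.ofReal (kernMass n)⁻¹ *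
        (ENNReal.ofReal (kernMass n) * ‖∫ x, f x * g x‖ₑ) := by
        rw [← mul_assoc, ← ENNReal.ofReal_mul (by positivity), inv_mul_cancel₀ hZ.ne',
          ENNReal.ofReal_one, one_mul]
    _ ≤ ENNReal.ofReal (kernMass n)⁻¹ * R := by gcongr
    _ = _ := by
        rw [hR, ← mul_assoc, ← ENNReal.ofReal_mul (by positivity)]
        congr 2; ring

end Reproducing

/-! ### The pairing is controlled by the square function on balls -/

section Pairing

variable {n : ℕ} {f g : Sp n → ℂ} {p q lam : ℝ} {x₀ : Sp n} {r : ℝ}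

/-- The mean zero of `g` improves the decay of its extension away from the supporting ball. -/
theorem MeanZeroIn.enorm_kext_kernT_le_far (hg : MeanZeroIn q x₀ r g) (hq : 1 ≤ q) (hr : 0 < r)
    {t R : ℝ} (ht : 0 < t) (hR : 2 * r ≤ R) {x : Sp n} (h : R ≤ hnorm t (x - x₀)) :
    ‖kext (kernT t) g x‖ₑ ≤ ENNReal.ofReal (lipC n * r * (R ^ (n + 2))⁻¹) * ∫⁻ y, ‖g y‖ₑ := by
  have hL := lipC_pos n
  have hR0 : 0 < R := by linarith
  have e : kext (kernT t) g x = ∫ y, (kernT t (x - y) - kernT t (x - x₀)) • g y := by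
    have i2 : Integrable fun y => kernT t (x - x₀) • g y :=
      (hg.integrable hq).smul (kernT t (x - x₀))
    simp only [sub_smul]
    rw [integral_sub ((hg.wInt hq).integrable_of_le (measurable_kernT_right t) ht
      (abs_kernT_le ht) x) i2, integral_smul, hg.mean, smul_zero,
      sub_zero, kext]
  rw [e, ← lintegral_const_mul' _ _ ENNReal.ofReal_ne_top]
  refine (enorm_integral_le_lintegral_enorm _).trans (lintegral_mono fun y => ?_)
  by_cases hy : y ∈ Metric.ball x₀ r
  · rw [Metric.mem_ball, dist_comm, dist_eq_norm] at hy
    rw [enorm_smul, ← ofReal_norm (kernT _ _ - _), Real.norm_eq_abs]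
    gcongr
    have e2 : (x - y) - (x - x₀) = x₀ - y := by abel
    have h1 := abs_kernT_sub_le ht (a := x - y) (b := x - x₀) (by rw [e2]; linarith)
    rw [e2] at h1
    have h2 := hnorm_pos ht (x - x₀)
    refine h1.trans ?_
    rw [mul_assoc]
    gcongr
  · simp [hg.supp _ hy]

theorem lintegral_Ioo_ofReal_le (R : ℝ) :
    ∫⁻ t in Ioo 0 R, ENNReal.ofReal t ≤ ENNReal.ofReal R ^ 2 := by
  calc ∫⁻ t in Ioo 0 R, ENNReal.ofReal t ≤ ∫⁻ _ in Ioo 0 R, ENNReal.ofReal R :=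
        setLIntegral_mono' measurableSet_Ioo fun t ht => ENNReal.ofReal_le_ofReal ht.2.le
    _ = _ := by rw [setLIntegral_const, Real.volume_Ioo, sub_zero, sq]

theorem le_rpow_half_of_sq_le {a b : ℝ≥0∞} (h : a ^ 2 ≤ b) : a ≤ b ^ (1 / 2 : ℝ) := by
  have := ENNReal.rpow_le_rpow h (by norm_num : (0 : ℝ) ≤ 1 / 2)
  rwa [← ENNReal.rpow_two, ← ENNReal.rpow_mul, mul_one_div_cancel (by norm_num),
    ENNReal.rpow_one] at this

theorem measurable_enorm_kext_kernT (hf : AEStronglyMeasurable f volume) (x : Sp n) :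
    Measurable fun t => ‖kext (kernT t) f x‖ₑ :=
  ((stronglyMeasurable_kext hf measurable_kernT).measurable.comp measurable_prodMk_right).enorm

theorem lintegral_mul_kernT_le (hf : AEStronglyMeasurable f volume) (R : ℝ)
    (x : Sp n) : ∫⁻ t in Ioo 0 R, ENNReal.ofReal t * ‖kext (kernT t) f x‖ₑ ≤
      ENNReal.ofReal R * gsq (Ioo 0 R) f x ^ (1 / 2 : ℝ) := by
  have h1 := sq_lintegral_mul_le (μ := volume.restrict (Ioo 0 R)) (w := ENNReal.ofReal)
    ENNReal.measurable_ofReal.aemeasurable (measurable_enorm_kext_kernT hf x).aemeasurable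
  have h2 := le_rpow_half_of_sq_le
    (h1.trans (mul_le_mul_left (lintegral_Ioo_ofReal_le R) _))
  rwa [ENNReal.mul_rpow_of_nonneg _ _ (by norm_num), ← ENNReal.rpow_two, ← ENNReal.rpow_mul,
    mul_one_div_cancel (by norm_num), ENNReal.rpow_one] at h2

theorem lintegral_mul_kernT_mul_le (hf : AEStronglyMeasurable f volume)
    (hg : AEStronglyMeasurable g volume) (S : Set ℝ) (x : Sp n) :
    ∫⁻ t in S, ENNReal.ofReal t * (‖kext (kernT t) f x‖ₑ * ‖kext (kernT t) g x‖ₑ) ≤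
      gsq S f x ^ (1 / 2 : ℝ) * gsq S g x ^ (1 / 2 : ℝ) := by
  have hs : ∀ c : ℝ≥0∞, c ^ (1 / 2 : ℝ) * c ^ (1 / 2 : ℝ) = c := fun c => by
    rw [← ENNReal.rpow_add_of_nonneg _ _ (by norm_num) (by norm_num)]; norm_num
  have hs2 : ∀ c : ℝ≥0∞, (c ^ (1 / 2 : ℝ)) ^ (2 : ℝ) = c := fun c => by
    rw [← ENNReal.rpow_mul]; norm_num
  have m0 : Measurable fun t : ℝ => ENNReal.ofReal t ^ (1 / 2 : ℝ) := by fun_prop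
  have h1 := ENNReal.lintegral_mul_le_Lp_mul_Lq (volume.restrict S)
    (Real.HolderConjugate.two_two)
    (f := fun t => ENNReal.ofReal t ^ (1 / 2 : ℝ) * ‖kext (kernT t) f x‖ₑ)
    (g := fun t => ENNReal.ofReal t ^ (1 / 2 : ℝ) * ‖kext (kernT t) g x‖ₑ)
    (m0.mul (measurable_enorm_kext_kernT hf x)).aemeasurable
    (m0.mul (measurable_enorm_kext_kernT hg x)).aemeasurable
  simp only [Pi.mul_apply, ENNReal.mul_rpow_of_nonneg _ _ (zero_le_two (α := ℝ)), hs2,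
    ENNReal.rpow_two] at h1
  refine le_trans (le_of_eq (lintegral_congr fun t => ?_)) h1
  rw [mul_mul_mul_comm, hs]

theorem SquareBound.lintegral_sqrt_le {C : ℝ≥0∞} (h : SquareBound p lam C f)
    (hf : AEStronglyMeasurable f volume) (hpq : p.HolderConjugate q) (x₀ : Sp n) {R : ℝ}
    (hR : 0 < R) : ∫⁻ x in Metric.ball x₀ R, gsq (Ioo 0 R) f x ^ (1 / 2 : ℝ) ≤
      (C * ENNReal.ofReal (R ^ lam)) ^ (1 / p) * volume (Metric.ball x₀ R) ^ (1 / q) := by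
  have hp := hpq.pos
  have h1 := ENNReal.lintegral_mul_le_Lp_mul_Lq (volume.restrict (Metric.ball x₀ R)) hpq
    (f := fun x => gsq (Ioo 0 R) f x ^ (1 / 2 : ℝ)) (g := fun _ => 1)
    ((measurable_gsq hf _).pow_const _).aemeasurable aemeasurable_const
  simp only [Pi.mul_apply, mul_one, ENNReal.one_rpow, lintegral_const, one_mul,
    Measure.restrict_apply_univ, ← ENNReal.rpow_mul, one_div_mul_eq_div] at h1
  refine h1.trans ?_
  gcongr
  exact h x₀ R hR

theorem MeanZeroIn.lintegral_enorm_le (hg : MeanZeroIn q x₀ r g) (hpq : p.HolderConjugate q) :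
    ∫⁻ y, ‖g y‖ₑ ≤ (∫⁻ y, ‖g y‖ₑ ^ q) ^ (1 / q) * volume (Metric.ball x₀ r) ^ (1 / p) := by
  have h1 := ENNReal.lintegral_mul_le_Lp_mul_Lq (volume.restrict (Metric.ball x₀ r)) hpq.symm
    (f := fun y => ‖g y‖ₑ) (g := fun _ => 1) hg.meas.enorm.restrict aemeasurable_const
  simp only [Pi.mul_apply, mul_one, ENNReal.one_rpow, lintegral_const, one_mul,
    Measure.restrict_apply_univ] at h1
  have e : ∫⁻ y, ‖g y‖ₑ = ∫⁻ y in Metric.ball x₀ r, ‖g y‖ₑ := by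
    rw [← lintegral_indicator measurableSet_ball]
    refine lintegral_congr fun y => ?_
    by_cases hy : y ∈ Metric.ball x₀ r
    · rw [indicator_of_mem hy]
    · rw [indicator_of_notMem hy, hg.supp _ hy, enorm_zero]
  rw [e]
  refine h1.trans ?_
  have := hpq.symm.pos
  gcongr
  exact Measure.restrict_le_self

theorem SquareBound.lintegral_local_le {C : ℝ≥0∞} (h : SquareBound p lam C f)
    (hf : AEStronglyMeasurable f volume) (hg : AEStronglyMeasurable g volume)
    (hpq : p.HolderConjugate q) {D : ℝ}
    (hD : ∫⁻ x, gsq (Ioi 0) g x ^ (q / 2) ≤ ENNReal.ofReal D * ∫⁻ x, ‖g x‖ₑ ^ q)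
    (x₀ : Sp n) {R : ℝ} (hR : 0 < R) :
    ∫⁻ x in Metric.ball x₀ R, ∫⁻ t in Ioo 0 R,
        ENNReal.ofReal t * (‖kext (kernT t) f x‖ₑ * ‖kext (kernT t) g x‖ₑ) ≤
      (C * ENNReal.ofReal (R ^ lam)) ^ (1 / p) *
        (ENNReal.ofReal D * ∫⁻ x, ‖g x‖ₑ ^ q) ^ (1 / q) := by
  have hp := hpq.pos
  have hq := hpq.symm.pos
  have h1 := ENNReal.lintegral_mul_le_Lp_mul_Lq (volume.restrict (Metric.ball x₀ R)) hpq
    (f := fun x => gsq (Ioo 0 R) f x ^ (1 / 2 : ℝ)) (g := fun x => gsq (Ioi 0) g x ^ (1 / 2 : ℝ))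
    ((measurable_gsq hf _).pow_const _).aemeasurable
    ((measurable_gsq hg _).pow_const _).aemeasurable
  simp only [Pi.mul_apply, ← ENNReal.rpow_mul, one_div_mul_eq_div] at h1
  calc _ ≤ ∫⁻ x in Metric.ball x₀ R, gsq (Ioo 0 R) f x ^ (1 / 2 : ℝ) *
        gsq (Ioi 0) g x ^ (1 / 2 : ℝ) := by
        refine lintegral_mono fun x => (lintegral_mul_kernT_mul_le hf hg _ x).trans ?_
        have := gsq_mono (Ioo_subset_Ioi_self : Ioo 0 R ⊆ Ioi 0) g x
        gcongr
    _ ≤ _ := h1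
    _ ≤ _ := by
        gcongr
        · exact h x₀ R hR
        · exact (setLIntegral_le_lintegral _ _).trans hD

theorem lintegral_box (ψ : ℝ × Sp n → ℝ≥0∞) (hψ : Measurable ψ) (x₀ : Sp n) (R : ℝ) :
    ∫⁻ z in Ioo 0 R ×ˢ Metric.ball x₀ R, ψ z ∂((volume.restrict (Ioi 0)).prod volume) =
      ∫⁻ x in Metric.ball x₀ R, ∫⁻ t in Ioo 0 R, ψ (t, x) := by
  rw [← Measure.prod_restrict, Measure.restrict_restrict measurableSet_Ioo,
    inter_eq_left.2 Ioo_subset_Ioi_self, lintegral_prod_symm _ hψ.aemeasurable]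

/-- The half space is covered by the boxes of sizes `2^{k+1} r` over `x₀`; outside such a box the
height or the distance to `x₀` is large. -/
theorem le_hnorm_of_notMem_box {t R : ℝ} (ht : 0 < t) {x : Sp n}
    (h : (t, x) ∉ Ioo 0 R ×ˢ Metric.ball x₀ R) : R ≤ hnorm t (x - x₀) := by
  by_contra! h1
  refine h ⟨⟨ht, (le_hnorm_left t _).trans_lt h1⟩, ?_⟩
  rw [Metric.mem_ball, dist_eq_norm]
  exact (norm_le_hnorm t _).trans_lt h1

theorem measurable_ofReal_mul_enorm_kext (hf : AEStronglyMeasurable f volume) :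
    Measurable fun z : ℝ × Sp n => ENNReal.ofReal z.1 * ‖kext (kernT z.1) f z.2‖ₑ := by
  have := (stronglyMeasurable_kext hf measurable_kernT).enorm
  fun_prop

/-- The half space is split into a box over the supporting ball and dyadic annular boxes. -/
theorem MeanZeroIn.pairing_le_tsum (hg : MeanZeroIn q x₀ r g) (hq : 1 ≤ q) (hr : 0 < r)
    (hf : AEStronglyMeasurable f volume) :
    pairing f g ≤ (∫⁻ x in Metric.ball x₀ (2 * r), ∫⁻ t in Ioo 0 (2 * r),
        ENNReal.ofReal t * (‖kext (kernT t) f x‖ₑ * ‖kext (kernT t) g x‖ₑ)) +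
      ∑' k : ℕ, ENNReal.ofReal (lipC n * r * ((2 ^ (k + 1) * r) ^ (n + 2))⁻¹) *
        (∫⁻ y, ‖g y‖ₑ) * ∫⁻ x in Metric.ball x₀ (2 ^ (k + 2) * r),
          ∫⁻ t in Ioo 0 (2 ^ (k + 2) * r), ENNReal.ofReal t * ‖kext (kernT t) f x‖ₑ := by
  set ν := (volume.restrict (Ioi (0 : ℝ))).prod (volume : Measure (Sp n)) with hν
  set D : ℕ → Set (ℝ × Sp n) := fun k =>
    Ioo 0 (2 ^ (k + 1) * r) ×ˢ Metric.ball x₀ (2 ^ (k + 1) * r) with hDdef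
  have hDm : ∀ k, MeasurableSet (D k) := fun k => measurableSet_Ioo.prod measurableSet_ball
  set c : ℕ → ℝ≥0∞ := fun k =>
    ENNReal.ofReal (lipC n * r * ((2 ^ (k + 1) * r) ^ (n + 2))⁻¹) * ∫⁻ y, ‖g y‖ₑ with hc
  set U : ℝ × Sp n → ℝ≥0∞ := fun z => ENNReal.ofReal z.1 * ‖kext (kernT z.1) f z.2‖ₑ with hU
  have hUm : Measurable U := measurable_ofReal_mul_enorm_kext hf
  set φ : ℝ × Sp n → ℝ≥0∞ := fun z =>
    ENNReal.ofReal z.1 * (‖kext (kernT z.1) f z.2‖ₑ * ‖kext (kernT z.1) g z.2‖ₑ) with hφ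
  have hgm := (stronglyMeasurable_kext hg.meas measurable_kernT).enorm
  have hφm : Measurable φ := by
    have : φ = fun z => U z * ‖kext (kernT z.1) g z.2‖ₑ := by
      funext z; simp only [hφ, hU, mul_assoc]
    rw [this]
    exact hUm.mul hgm
  have e1 : pairing f g = ∫⁻ z, φ z ∂ν := by
    rw [hν, lintegral_prod _ hφm.aemeasurable, pairing]
    refine lintegral_congr fun t => ?_
    simp only [hφ]
    rw [lintegral_const_mul' _ _ ENNReal.ofReal_ne_top]
  have hpt : ∀ᵐ z ∂ν, φ z ≤ (D 0).indicator φ z + ∑' k, c k * (D (k + 1)).indicator U z := by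
    have h0 : ∀ᵐ z ∂ν, z.1 ∈ Ioi (0 : ℝ) :=
      Measure.quasiMeasurePreserving_fst.ae (ae_restrict_mem measurableSet_Ioi)
    filter_upwards [h0] with z hz
    by_cases hz0 : z ∈ D 0
    · rw [indicator_of_mem hz0]
      exact le_self_add
    · have hex : ∃ k, z ∈ D k := by
        obtain ⟨k, hk⟩ := pow_unbounded_of_one_lt (max z.1 (dist z.2 x₀) / r) one_lt_two
        rw [div_lt_iff₀ hr] at hk
        have hk' : (2 : ℝ) ^ k * r ≤ 2 ^ (k + 1) * r := by
          gcongr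
          · norm_num
          · omega
        exact ⟨k, ⟨⟨hz, ((le_max_left _ _).trans_lt hk).trans_le hk'⟩,
          ((le_max_right _ _).trans_lt hk).trans_le hk'⟩⟩
      -- the first box that contains the point
      classical
      set m := Nat.find hex with hm
      have hm1 : z ∈ D m := Nat.find_spec hex
      have hm0 : m ≠ 0 := fun h => hz0 (h ▸ hm1)
      obtain ⟨k, hk⟩ := Nat.exists_eq_succ_of_ne_zero hm0
      have hm2 : z ∉ D k := Nat.find_min hex (by omega)
      have h1 : φ z ≤ c k * (D (k + 1)).indicator U z := by
        rw [indicator_of_mem (by rw [hk] at hm1; exact hm1), mul_comm]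
        simp only [hφ, hU]
        rw [← mul_assoc]
        gcongr
        refine hg.enorm_kext_kernT_le_far hq hr hz ?_ (le_hnorm_of_notMem_box hz hm2)
        gcongr
        exact le_self_pow₀ one_le_two (by omega)
      exact h1.trans ((ENNReal.le_tsum k).trans le_add_self)
  calc pairing f g = ∫⁻ z, φ z ∂ν := e1
    _ ≤ ∫⁻ z, ((D 0).indicator φ z + ∑' k, c k * (D (k + 1)).indicator U z) ∂ν :=
        lintegral_mono_ae hpt
    _ = (∫⁻ z in D 0, φ z ∂ν) + ∑' k, c k * ∫⁻ z in D (k + 1), U z ∂ν := by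
        rw [lintegral_add_left (hφm.indicator (hDm 0)), lintegral_indicator (hDm 0),
          lintegral_tsum fun k => ((hUm.indicator (hDm (k + 1))).const_mul _).aemeasurable]
        congr 2
        funext k
        rw [lintegral_const_mul _ (hUm.indicator (hDm (k + 1))), lintegral_indicator (hDm (k + 1))]
    _ = _ := by
        simp only [hDdef]
        rw [hν, lintegral_box _ hφm, zero_add, pow_one]
        congr 2
        funext k
        rw [lintegral_box _ hUm]

/-- The scaling behind the summability over the dyadic boxes. -/
theorem tail_exponent_le (n : ℕ) {r ρ : ℝ} (hr : 0 < r) (hρ : 1 ≤ ρ) (hpq : p.HolderConjugate q)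
    (hlam : lam < n) :
    r * ((ρ * r / 2) ^ (n + 2))⁻¹ * (ρ * r) * (ρ * r) ^ (lam / p) * (ρ * r) ^ ((n : ℝ) / q) *
      r ^ ((n : ℝ) / p) ≤ 2 ^ (n + 2) * r ^ (lam / p) * ρ⁻¹ := by
  have hρ0 : 0 < ρ := by linarith
  have hR : 0 < ρ * r := by positivity
  have hp := hpq.pos
  have hq := hpq.symm.pos
  have hinv : (n : ℝ) / p + n / q = n := by
    have := hpq.inv_add_inv_eq_one
    rw [div_eq_mul_inv, div_eq_mul_inv, ← mul_add, this, mul_one]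
  set e : ℝ := -((n : ℝ) + 2) + 1 + lam / p + n / q with he
  have h1 : ((ρ * r / 2) ^ (n + 2))⁻¹ = 2 ^ (n + 2) * (ρ * r) ^ (-((n : ℝ) + 2)) := by
    rw [div_pow, inv_div, Real.rpow_neg hR.le, div_eq_mul_inv]
    congr 2
    have : (n : ℝ) + 2 = ((n + 2 : ℕ) : ℝ) := by push_cast; ring
    rw [this, Real.rpow_natCast]
  have h2 : (ρ * r) ^ (-((n : ℝ) + 2)) * (ρ * r) * (ρ * r) ^ (lam / p) *
      (ρ * r) ^ ((n : ℝ) / q) = ρ ^ e * r ^ e := by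
    rw [← Real.mul_rpow hρ0.le hr.le, he, Real.rpow_add hR, Real.rpow_add hR, Real.rpow_add hR,
      Real.rpow_one]
  have h3 : r * r ^ e * r ^ ((n : ℝ) / p) = r ^ (lam / p) := by
    nth_rewrite 1 [← Real.rpow_one r]
    rw [← Real.rpow_add hr, ← Real.rpow_add hr]
    congr 1
    rw [he]; linarith
  have h4 : ρ ^ e ≤ ρ⁻¹ := by
    rw [← Real.rpow_neg_one]
    refine Real.rpow_le_rpow_of_exponent_le hρ ?_
    have : lam / p ≤ n / p := by gcongr
    rw [he]; linarith
  calc _ = 2 ^ (n + 2) * (r * ((ρ * r) ^ (-((n : ℝ) + 2)) * (ρ * r) * (ρ * r) ^ (lam / p) *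
        (ρ * r) ^ ((n : ℝ) / q)) * r ^ ((n : ℝ) / p)) := by rw [h1]; ring
    _ = 2 ^ (n + 2) * r ^ (lam / p) * ρ ^ e := by rw [h2, ← h3]; ring
    _ ≤ _ := by gcongr

theorem ofReal_pow_rpow_div {R s : ℝ} (hR : 0 < R) (n : ℕ) (hs : 0 < s) :
    ENNReal.ofReal (R ^ n) ^ (1 / s) = ENNReal.ofReal (R ^ ((n : ℝ) / s)) := by
  rw [ENNReal.ofReal_rpow_of_nonneg (by positivity) (by positivity), ← Real.rpow_natCast,
    ← Real.rpow_mul hR.le]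
  congr 2; ring

/-- Under the square function condition, the pairing with a mean-zero function is bounded by its
`L^q` norm. The box over the ball uses the bound of the square function of `g` on `L^q`. On the
dyadic boxes the decay of the extension of `g` beats the growth `R^(λ/p)` because `λ < n`. -/
theorem SquareBound.exists_pairing_le [NeZero n] {C : ℝ≥0∞} (h : SquareBound p lam C f)
    (hC : C ≠ ∞) (hf : WInt f) (hpq : p.HolderConjugate q) (hlam : lam < n) :
    ∃ C' : ℝ≥0∞, C' ≠ ∞ ∧ ∀ (x₀ : Sp n) (r : ℝ) (g : Sp n → ℂ), 0 < r → MeanZeroIn q x₀ r g →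
      pairing f g ≤ C' * ENNReal.ofReal (r ^ (lam / p)) * (∫⁻ x, ‖g x‖ₑ ^ q) ^ (1 / q) := by
  obtain ⟨D, hD, hL⟩ := exists_lintegral_gsq_rpow_le n hpq.symm.lt
  have hp := hpq.pos
  have hq := hpq.symm.pos
  have hp' : 0 ≤ 1 / p := by positivity
  have hq' : 0 ≤ 1 / q := by positivity
  have hLip := lipC_pos n
  set v := volume (Metric.ball (0 : Sp n) 1) with hv
  have hvt : v ≠ ∞ := (volume_ball_lt_top _ _).ne
  -- twice `A` bounds the sum over the dyadic boxes
  set A : ℝ≥0∞ := C ^ (1 / p) * v ^ (1 / q) * v ^ (1 / p) * ENNReal.ofReal (lipC n * 2 ^ (n + 2))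
    with hA
  refine ⟨C ^ (1 / p) * ENNReal.ofReal (2 ^ (lam / p)) * ENNReal.ofReal D ^ (1 / q) + A * 2,
    ?_, fun x₀ r g hr hg => ?_⟩
  · have h1 := ENNReal.rpow_ne_top_of_nonneg hp' hC
    have h2 := ENNReal.rpow_ne_top_of_nonneg hp' hvt
    have h3 := ENNReal.rpow_ne_top_of_nonneg hq' hvt
    have h4 := ENNReal.rpow_ne_top_of_nonneg hq' (ENNReal.ofReal_ne_top (r := D))
    finiteness
  set G := (∫⁻ x, ‖g x‖ₑ ^ q) ^ (1 / q) with hG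
  have hfm := hf.aestronglyMeasurable
  have hlamR : ∀ R : ℝ, 0 < R → (C * ENNReal.ofReal (R ^ lam)) ^ (1 / p) =
      C ^ (1 / p) * ENNReal.ofReal (R ^ (lam / p)) := by
    intro R hR
    rw [ENNReal.mul_rpow_of_nonneg _ _ hp', ENNReal.ofReal_rpow_of_nonneg (by positivity) hp',
      ← Real.rpow_mul hR.le, mul_one_div]
  refine (hg.pairing_le_tsum hpq.symm.lt.le hr hfm).trans ?_
  rw [add_mul, add_mul]
  refine add_le_add ?_ ?_
  · refine (h.lintegral_local_le hfm hg.meas hpq (hL g hg.meas hg.fin) x₀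
      (by positivity : 0 < 2 * r)).trans (le_of_eq ?_)
    rw [hlamR _ (by positivity), ENNReal.mul_rpow_of_nonneg _ _ hq',
      Real.mul_rpow (by norm_num) hr.le, ENNReal.ofReal_mul (by positivity), ← hG]
    ring
  · have hk : ∀ k : ℕ, ENNReal.ofReal (lipC n * r * ((2 ^ (k + 1) * r) ^ (n + 2))⁻¹) *
        (∫⁻ y, ‖g y‖ₑ) * ∫⁻ x in Metric.ball x₀ (2 ^ (k + 2) * r),
          ∫⁻ t in Ioo 0 (2 ^ (k + 2) * r), ENNReal.ofReal t * ‖kext (kernT t) f x‖ₑ ≤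
        A * ENNReal.ofReal (r ^ (lam / p)) * G * ENNReal.ofReal ((1 / 2) ^ k) := by
      intro k
      set ρ : ℝ := 2 ^ (k + 2) with hρ
      have hρ1 : 1 ≤ ρ := one_le_pow₀ one_le_two
      have hρ0 : 0 < ρ := by linarith
      set R : ℝ := ρ * r with hR
      have hR0 : 0 < R := by positivity
      have e1 : (2 : ℝ) ^ (k + 1) * r = R / 2 := by rw [hR, hρ, pow_succ 2 (k + 1)]; ring
      have hu : ∫⁻ x in Metric.ball x₀ R, ∫⁻ t in Ioo 0 R,
          ENNReal.ofReal t * ‖kext (kernT t) f x‖ₑ ≤ ENNReal.ofReal R * (C ^ (1 / p) *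
            ENNReal.ofReal (R ^ (lam / p)) *
              (ENNReal.ofReal (R ^ ((n : ℝ) / q)) * v ^ (1 / q))) := by
        calc _ ≤ ∫⁻ x in Metric.ball x₀ R, ENNReal.ofReal R * gsq (Ioo 0 R) f x ^ (1 / 2 : ℝ) :=
              lintegral_mono fun x => lintegral_mul_kernT_le hfm R x
          _ = ENNReal.ofReal R * ∫⁻ x in Metric.ball x₀ R, gsq (Ioo 0 R) f x ^ (1 / 2 : ℝ) :=
              lintegral_const_mul' _ _ ENNReal.ofReal_ne_top
          _ ≤ _ := by
              gcongr
              refine (h.lintegral_sqrt_le hfm hpq x₀ hR0).trans (le_of_eq ?_)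
              rw [hlamR R hR0, volume_ball_eq x₀ hR0, ENNReal.mul_rpow_of_nonneg _ _ hq',
                ofReal_pow_rpow_div hR0 n hq]
      have hg1 : ∫⁻ y, ‖g y‖ₑ ≤ G * (ENNReal.ofReal (r ^ ((n : ℝ) / p)) * v ^ (1 / p)) := by
        refine (hg.lintegral_enorm_le hpq).trans (le_of_eq ?_)
        rw [volume_ball_eq x₀ hr, ENNReal.mul_rpow_of_nonneg _ _ hp', ofReal_pow_rpow_div hr n hp]
      rw [e1]
      calc _ ≤ ENNReal.ofReal (lipC n * r * ((R / 2) ^ (n + 2))⁻¹) *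
            (G * (ENNReal.ofReal (r ^ ((n : ℝ) / p)) * v ^ (1 / p))) *
            (ENNReal.ofReal R * (C ^ (1 / p) * ENNReal.ofReal (R ^ (lam / p)) *
              (ENNReal.ofReal (R ^ ((n : ℝ) / q)) * v ^ (1 / q)))) := by gcongr
        _ = C ^ (1 / p) * v ^ (1 / q) * v ^ (1 / p) * G *
            (ENNReal.ofReal (lipC n * r * ((R / 2) ^ (n + 2))⁻¹) * ENNReal.ofReal R *
              ENNReal.ofReal (R ^ (lam / p)) * ENNReal.ofReal (R ^ ((n : ℝ) / q)) *
              ENNReal.ofReal (r ^ ((n : ℝ) / p))) := by ring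
        _ = C ^ (1 / p) * v ^ (1 / q) * v ^ (1 / p) * G *
            ENNReal.ofReal (lipC n * (r * ((R / 2) ^ (n + 2))⁻¹ * R * R ^ (lam / p) *
              R ^ ((n : ℝ) / q) * r ^ ((n : ℝ) / p))) := by
            rw [← ENNReal.ofReal_mul (by positivity), ← ENNReal.ofReal_mul (by positivity),
              ← ENNReal.ofReal_mul (by positivity), ← ENNReal.ofReal_mul (by positivity)]
            congr 2; ring
        _ ≤ C ^ (1 / p) * v ^ (1 / q) * v ^ (1 / p) * G *
            ENNReal.ofReal (lipC n * (2 ^ (n + 2) * r ^ (lam / p) * (1 / 2) ^ k)) := by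
            refine mul_le_mul_right (ENNReal.ofReal_le_ofReal
              (mul_le_mul_of_nonneg_left ?_ hLip.le)) _
            refine (tail_exponent_le n hr hρ1 hpq hlam).trans ?_
            gcongr
            rw [hρ, one_div, inv_pow]
            gcongr
            · norm_num
            · omega
        _ = _ := by
            rw [hA, ← mul_assoc, ← mul_assoc, ENNReal.ofReal_mul (by positivity),
              ENNReal.ofReal_mul (by positivity)]
            ring
    refine (ENNReal.tsum_le_tsum hk).trans (le_of_eq ?_)
    rw [ENNReal.tsum_mul_left, tsum_ofReal_half_pow]
    ring

end Pairing

/-! ### The square function controls the oscillation -/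

section Backward

variable {n : ℕ} {f : Sp n → ℂ} {p q lam : ℝ}

/-- The function that is dual to `F` in the pairing of `L^p` and `L^q`. -/
def dualFn (p : ℝ) (F : Sp n → ℂ) (x : Sp n) : ℂ := ((‖F x‖ ^ (p - 2) : ℝ) : ℂ) * star (F x)

theorem norm_dualFn (hp : 1 < p) (F : Sp n → ℂ) (x : Sp n) :
    ‖dualFn p F x‖ = ‖F x‖ ^ (p - 1) := by
  rw [dualFn, norm_mul, norm_star, Complex.norm_real, Real.norm_of_nonneg (by positivity)]
  rcases eq_or_ne (F x) 0 with h | h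
  · rw [h, norm_zero, mul_zero, Real.zero_rpow (by linarith)]
  · have h0 : 0 < ‖F x‖ := norm_pos_iff.2 h
    nth_rewrite 2 [← Real.rpow_one ‖F x‖]
    rw [← Real.rpow_add h0]
    congr 1; ring

theorem mul_dualFn (hp : 1 < p) (F : Sp n → ℂ) (x : Sp n) :
    F x * dualFn p F x = ((‖F x‖ ^ p : ℝ) : ℂ) := by
  rcases eq_or_ne (F x) 0 with h | h
  · rw [h, zero_mul, norm_zero, Real.zero_rpow (by linarith), Complex.ofReal_zero]
  · have h0 : 0 < ‖F x‖ := norm_pos_iff.2 h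
    have e : ‖F x‖ ^ p = ‖F x‖ ^ (p - 2) * ‖F x‖ ^ 2 := by
      rw [← Real.rpow_two, ← Real.rpow_add h0]
      congr 1; ring
    rw [dualFn, mul_left_comm, e, Complex.ofReal_mul, Complex.star_def, Complex.mul_conj,
      Complex.normSq_eq_norm_sq]

theorem enorm_dualFn_rpow (hpq : p.HolderConjugate q) (F : Sp n → ℂ) (x : Sp n) :
    ‖dualFn p F x‖ₑ ^ q = ‖F x‖ₑ ^ p := by
  have hp1 : 0 ≤ p - 1 := by linarith [hpq.lt]
  rw [← ofReal_norm, norm_dualFn hpq.lt, ← ENNReal.ofReal_rpow_of_nonneg (norm_nonneg _) hp1,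
    ofReal_norm, ← ENNReal.rpow_mul, hpq.sub_one_mul_conj]

/-- Subtracting the mean over a ball at most multiplies the `L^q` norm over the ball by two. -/
theorem lintegral_sub_setAverage_rpow_le {g : Sp n → ℂ} (hgm : AEStronglyMeasurable g volume)
    (hq : 1 ≤ q) (x₀ : Sp n) {r : ℝ} (hr : 0 < r) :
    ∫⁻ x in Metric.ball x₀ r, ‖g x - ⨍ y in Metric.ball x₀ r, g y‖ₑ ^ q ≤
      ENNReal.ofReal (2 ^ q * 2) * ∫⁻ x in Metric.ball x₀ r, ‖g x‖ₑ ^ q := by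
  have hq0 : 0 < q := by linarith
  have h0 := (volume_ball_pos x₀ hr).ne'
  have ht := (volume_ball_lt_top x₀ r).ne
  have h1 : ‖⨍ y in Metric.ball x₀ r, g y‖ₑ ≤ avgE g x₀ r := by
    have hv : 0 < volume.real (Metric.ball x₀ r) := ENNReal.toReal_pos h0 ht
    rw [setAverage_eq, enorm_smul, avgE, ENNReal.div_eq_inv_mul,
      Real.enorm_of_nonneg (by positivity), ENNReal.ofReal_inv_of_pos hv, measureReal_def,
      ENNReal.ofReal_toReal ht]
    gcongr
    exact enorm_integral_le_lintegral_enorm _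
  have h2 : ‖⨍ y in Metric.ball x₀ r, g y‖ₑ ^ q * volume (Metric.ball x₀ r) ≤
      ∫⁻ x in Metric.ball x₀ r, ‖g x‖ₑ ^ q := by
    have h3 := h1.trans (avgE_le_rpow hgm hq x₀ hr)
    have h4 := ENNReal.rpow_le_rpow h3 hq0.le
    rw [← ENNReal.rpow_mul, one_div_mul_cancel hq0.ne', ENNReal.rpow_one] at h4
    calc _ ≤ (∫⁻ y in Metric.ball x₀ r, ‖g y‖ₑ ^ q) / volume (Metric.ball x₀ r) *
          volume (Metric.ball x₀ r) := by gcongr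
      _ = _ := ENNReal.div_mul_cancel h0 ht
  calc _ ≤ ∫⁻ x in Metric.ball x₀ r, ENNReal.ofReal (2 ^ q) *
        (‖g x‖ₑ ^ q + ‖⨍ y in Metric.ball x₀ r, g y‖ₑ ^ q) := by
        refine lintegral_mono fun x => ?_
        refine le_trans ?_ (add_rpow_le_two_rpow_mul hq0.le)
        gcongr
        exact enorm_sub_le
    _ = ENNReal.ofReal (2 ^ q) * ((∫⁻ x in Metric.ball x₀ r, ‖g x‖ₑ ^ q) +
        ‖⨍ y in Metric.ball x₀ r, g y‖ₑ ^ q * volume (Metric.ball x₀ r)) := by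
        rw [lintegral_const_mul' _ _ ENNReal.ofReal_ne_top,
          lintegral_add_right _ measurable_const, setLIntegral_const]
    _ ≤ ENNReal.ofReal (2 ^ q) * ((∫⁻ x in Metric.ball x₀ r, ‖g x‖ₑ ^ q) +
        ∫⁻ x in Metric.ball x₀ r, ‖g x‖ₑ ^ q) := by gcongr
    _ = _ := by
        rw [ENNReal.ofReal_mul (by positivity), ENNReal.ofReal_ofNat]
        ring

theorem le_rpow_of_le_mul_rpow (hpq : p.HolderConjugate q) {a K : ℝ≥0∞} (ha : a ≠ ∞)
    (h : a ≤ K * a ^ (1 / q)) : a ≤ K ^ p := by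
  have hp := hpq.pos
  rcases eq_or_ne a 0 with h0 | h0
  · rw [h0]; exact zero_le
  have hq0 : a ^ (1 / q) ≠ 0 := (ENNReal.rpow_pos (pos_iff_ne_zero.2 h0) ha).ne'
  have hqt : a ^ (1 / q) ≠ ∞ := by
    have := hpq.symm.pos
    exact ENNReal.rpow_ne_top_of_nonneg (by positivity) ha
  have e : a = a ^ (1 / p) * a ^ (1 / q) := by
    rw [← ENNReal.rpow_add _ _ h0 ha, one_div, one_div, hpq.inv_add_inv_eq_one, ENNReal.rpow_one]
  have h1 : a ^ (1 / p) ≤ K := by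
    rw [← ENNReal.mul_le_mul_iff_left hq0 hqt, ← e]
    exact h
  have h2 := ENNReal.rpow_le_rpow h1 hp.le
  rwa [← ENNReal.rpow_mul, one_div_mul_cancel hp.ne', ENNReal.rpow_one] at h2

/-- The square function condition implies the oscillation condition, by duality with mean-zero
functions supported in the ball. -/
theorem SquareBound.oscBound [NeZero n] {C : ℝ≥0∞} (h : SquareBound p lam C f) (hC : C ≠ ∞)
    (hf : WInt f) (hp : 1 < p) (hlam : lam < n)
    (hfin : ∀ (x₀ : Sp n) (r : ℝ), ∫⁻ x in Metric.ball x₀ r, ‖f x‖ₑ ^ p < ∞) :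
    ∃ C' : ℝ≥0∞, C' ≠ ∞ ∧ OscBound p lam C' f := by
  obtain ⟨q, hpq⟩ : ∃ q, p.HolderConjugate q := ⟨_, Real.HolderConjugate.conjExponent hp⟩
  obtain ⟨C', hC', hpair⟩ := h.exists_pairing_le hC hf hpq hlam
  have hp0 : 0 < p := hpq.pos
  have hq1 : 1 < q := hpq.symm.lt
  have hq0 : 0 < q := hpq.symm.pos
  have hq' : 0 ≤ 1 / q := by positivity
  set κ : ℝ≥0∞ := ENNReal.ofReal (4 * (kernMass n)⁻¹ ^ 2) * C' *
    ENNReal.ofReal (2 ^ q * 2) ^ (1 / q) with hκ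
  have hκt : κ ≠ ∞ := by
    have := ENNReal.rpow_ne_top_of_nonneg hq' (ENNReal.ofReal_ne_top (r := 2 ^ q * 2))
    finiteness
  refine ⟨κ ^ p, ENNReal.rpow_ne_top_of_nonneg hp0.le hκt, fun x₀ r hr => ?_⟩
  set B := Metric.ball x₀ r with hB
  have hBm : MeasurableSet B := measurableSet_ball
  have hB0 := (volume_ball_pos x₀ hr).ne'
  have hBt := (volume_ball_lt_top x₀ r).ne
  set c := ⨍ y in B, f y with hc
  set F : Sp n → ℂ := fun x => f x - c with hF
  have hFW : WInt F := hf.sub_const c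
  have hFm := hFW.aestronglyMeasurable
  set a := ∫⁻ x in B, ‖F x‖ₑ ^ p with ha
  have hat : a ≠ ∞ := ne_top_of_le_ne_top (ENNReal.mul_ne_top ENNReal.ofReal_ne_top
    (hfin x₀ r).ne) (lintegral_sub_setAverage_rpow_le hf.aestronglyMeasurable hp.le x₀ hr)
  -- the dual function of the oscillation, corrected to have mean zero
  set g₀ : Sp n → ℂ := dualFn p F with hg₀
  have hg₀m : AEStronglyMeasurable g₀ volume := by
    have h1 : AEStronglyMeasurable (fun x => ‖F x‖ ^ (p - 2)) volume :=
      (hFm.norm.aemeasurable.pow_const _).aestronglyMeasurable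
    exact (Complex.continuous_ofReal.comp_aestronglyMeasurable h1).mul hFm.star
  have hg₀q : ∫⁻ x in B, ‖g₀ x‖ₑ ^ q = a := by
    rw [ha]
    exact lintegral_congr fun x => enorm_dualFn_rpow hpq F x
  set b := ⨍ y in B, g₀ y with hb
  set g : Sp n → ℂ := B.indicator fun x => g₀ x - b with hg
  have hgq : ∫⁻ x, ‖g x‖ₑ ^ q ≤ ENNReal.ofReal (2 ^ q * 2) * a := by
    rw [hg, lintegral_enorm_indicator_rpow hBm _ hq0, ← hg₀q]
    exact lintegral_sub_setAverage_rpow_le hg₀m hq1.le x₀ hr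
  have iFp : IntegrableOn (fun x => ‖F x‖ ^ p) B := by
    refine ⟨(hFm.norm.aemeasurable.pow_const p).aestronglyMeasurable.restrict, ?_⟩
    rw [HasFiniteIntegral]
    refine lt_of_eq_of_lt (lintegral_congr fun y => ?_) hat.lt_top
    rw [Real.enorm_of_nonneg (by positivity),
      ← ENNReal.ofReal_rpow_of_nonneg (norm_nonneg _) hp0.le,
      ofReal_norm]
  have hloc : ∀ w : Sp n → ℂ, WInt w → IntegrableOn w B := fun w hw =>
    (hw.locallyIntegrable.integrableOn_isCompact (isCompact_closedBall x₀ r)).mono_set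
      Metric.ball_subset_closedBall
  have iF : IntegrableOn F B := hloc F hFW
  have ig₀ : IntegrableOn g₀ B := by
    have hm : AEStronglyMeasurable (B.indicator g₀) volume := hg₀m.indicator hBm
    have hw : WInt (B.indicator g₀) := by
      refine wInt_of_lintegral_rpow hq1.le hm ?_
      rw [lintegral_enorm_indicator_rpow hBm _ hq0, hg₀q]
      exact hat.lt_top
    refine (hloc _ hw).congr_fun (fun x hx => ?_) hBm
    rw [indicator_of_mem hx]
  have hzero : ∀ w : Sp n → ℂ, IntegrableOn w B → ∫ x in B, (w x - ⨍ y in B, w y) = 0 := by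
    intro w hw
    have hv : volume.real B ≠ 0 := (ENNReal.toReal_pos hB0 hBt).ne'
    rw [integral_sub hw (integrableOn_const hBt), setIntegral_const, setAverage_eq,
      smul_inv_smul₀ hv, sub_self]
  have hgZ : MeanZeroIn q x₀ r g :=
    { meas := (hg₀m.sub aestronglyMeasurable_const).indicator hBm
      supp := fun x hx => indicator_of_notMem hx _
      fin := hgq.trans_lt (ENNReal.mul_lt_top ENNReal.ofReal_lt_top hat.lt_top)
      mean := by rw [hg, integral_indicator hBm]; exact hzero g₀ ig₀ }
  have hFg : ∫ x, f x * g x = ((∫ x in B, ‖F x‖ ^ p : ℝ) : ℂ) := by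
    have iFg₀ : IntegrableOn (fun x => F x * g₀ x) B := by
      simp only [hg₀, mul_dualFn hp]
      exact iFp.ofReal
    have e1 : ∫ x, f x * g x = ∫ x, (F x * g x + c * g x) := by
      refine integral_congr_ae (ae_of_all _ fun x => ?_)
      simp only [hF]; ring
    have e2 : ∀ x, F x * g x = B.indicator (fun x => F x * g₀ x - F x * b) x := by
      intro x
      by_cases hx : x ∈ B
      · simp only [hg, indicator_of_mem hx, mul_sub]
      · simp only [hg, indicator_of_notMem hx, mul_zero]
    have iFgb : IntegrableOn (fun x => F x * g₀ x - F x * b) B := iFg₀.sub (iF.mul_const b)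
    have iFg : Integrable fun x => F x * g x := by
      simp only [e2]
      exact (integrable_indicator_iff hBm).2 iFgb
    rw [e1, integral_add iFg ((hgZ.integrable hq1.le).const_mul c), integral_const_mul, hgZ.mean,
      mul_zero, add_zero]
    simp only [e2]
    rw [integral_indicator hBm, integral_sub iFg₀ (iF.mul_const b), integral_mul_const,
      hzero f (hloc f hf), zero_mul, sub_zero]
    simp only [hg₀, mul_dualFn hp]
    exact integral_ofReal
  have hfg : ‖∫ x, f x * g x‖ₑ = a := by
    have h0 : 0 ≤ ∫ x in B, ‖F x‖ ^ p := integral_nonneg fun x => by positivity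
    rw [hFg, ← ofReal_norm, Complex.norm_real, Real.norm_of_nonneg h0,
      ofReal_integral_eq_lintegral_ofReal iFp (ae_of_all _ fun x => by positivity), ha]
    refine lintegral_congr fun x => ?_
    rw [← ENNReal.ofReal_rpow_of_nonneg (norm_nonneg _) hp0.le, ofReal_norm]
  have key : a ≤ κ * ENNReal.ofReal (r ^ (lam / p)) * a ^ (1 / q) := by
    calc a = ‖∫ x, f x * g x‖ₑ := hfg.symm
      _ ≤ ENNReal.ofReal (4 * (kernMass n)⁻¹ ^ 2) * pairing f g :=
          hgZ.enorm_integral_mul_le hpq hf hr (hfin x₀ (2 * r))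
      _ ≤ ENNReal.ofReal (4 * (kernMass n)⁻¹ ^ 2) * (C' * ENNReal.ofReal (r ^ (lam / p)) *
            (ENNReal.ofReal (2 ^ q * 2) * a) ^ (1 / q)) := by
          gcongr
          exact (hpair x₀ r g hr hgZ).trans (by gcongr)
      _ = _ := by
          rw [ENNReal.mul_rpow_of_nonneg _ _ hq', hκ]
          ring
  refine (le_rpow_of_le_mul_rpow hpq hat key).trans (le_of_eq ?_)
  rw [ENNReal.mul_rpow_of_nonneg _ _ hp0.le, ENNReal.ofReal_rpow_of_nonneg (by positivity) hp0.le,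
    ← Real.rpow_mul hr.le, div_mul_cancel₀ _ hp0.ne']

end Backward

/-! ### The normalised Poisson semigroup -/

section Link

variable {n : ℕ} {f : Sp n → ℂ} {p lam : ℝ}

/-- The normalising constant of the Poisson kernel. -/
def poissonC (n : ℕ) : ℝ :=
  Real.Gamma (((n : ℝ) + 1) / 2) / Real.pi ^ (((n : ℝ) + 1) / 2)

theorem poissonC_pos (n : ℕ) : 0 < poissonC n := by
  have := Real.Gamma_pos_of_pos (by positivity : 0 < ((n : ℝ) + 1) / 2)
  have := Real.pi_pos
  unfold poissonC; positivity

theorem poissonKernel_eq (t : ℝ) (x : Sp n) : poissonKernel t x = poissonC n * kern t x := by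
  rw [poissonKernel, kern, poissonC, Real.rpow_neg (by positivity), div_eq_mul_inv _ (_ ^ _),
    mul_assoc]

theorem poissonSemigroup_eq (t : ℝ) (f : Sp n → ℂ) (x : Sp n) :
    poissonSemigroup t f x = poissonC n • kext (kern t) f x := by
  rw [poissonSemigroup, kext, ← integral_smul]
  refine integral_congr_ae (ae_of_all _ fun y => ?_)
  simp only [poissonKernel_eq, Complex.real_smul, Complex.ofReal_mul, mul_assoc]

theorem WInt.deriv_poissonSemigroup (hf : WInt f) {t : ℝ} (ht : 0 < t) (x : Sp n) :
    deriv (fun s : ℝ => poissonSemigroup s f x) t = poissonC n • kext (kernT t) f x := by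
  simp only [poissonSemigroup_eq]
  exact ((hf.hasDerivAt_kext_kern ht x).const_smul (poissonC n)).deriv

theorem WInt.squareFunction_eq (hf : WInt f) (r : ℝ) (x : Sp n) :
    squareFunction f r x = ENNReal.ofReal (poissonC n) * gsq (Ioo 0 r) f x ^ (1 / 2 : ℝ) := by
  have hκ := poissonC_pos n
  have h1 : ∫⁻ t in Ioo (0 : ℝ) r,
      ‖(t : ℂ) * deriv (fun s : ℝ => poissonSemigroup s f x) t‖ₑ ^ 2 / ENNReal.ofReal t =
      ENNReal.ofReal (poissonC n) ^ 2 * gsq (Ioo 0 r) f x := by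
    rw [gsq, ← lintegral_const_mul' _ _ (by finiteness)]
    refine setLIntegral_congr_fun measurableSet_Ioo fun t ht => ?_
    have ht0 : 0 < t := ht.1
    have h2 : ENNReal.ofReal t ≠ 0 := by simpa using ht0
    rw [hf.deriv_poissonSemigroup ht0, enorm_mul, enorm_smul, Real.enorm_of_nonneg hκ.le,
      ← ofReal_norm (t : ℂ), Complex.norm_real, Real.norm_of_nonneg ht0.le, mul_pow, mul_pow,
      sq (ENNReal.ofReal t), mul_assoc, ENNReal.mul_div_right_comm,
      ENNReal.div_self h2 ENNReal.ofReal_ne_top, one_mul]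
    ring
  rw [squareFunction, h1, ENNReal.mul_rpow_of_nonneg _ _ (by norm_num), ← ENNReal.rpow_two,
    ← ENNReal.rpow_mul, mul_one_div_cancel (by norm_num), ENNReal.rpow_one]

theorem IsLpLoc.aestronglyMeasurable (hf : IsLpLoc p f) : AEStronglyMeasurable f volume := by
  have h := aestronglyMeasurable_iUnion_iff.2 fun k : ℕ =>
    (hf (Metric.closedBall 0 k) (isCompact_closedBall _ _)).aestronglyMeasurable
  rwa [Metric.iUnion_closedBall_nat, Measure.restrict_univ] at h

theorem IsLpLoc.lintegral_ball_lt_top (hf : IsLpLoc p f) (hp : 0 < p) (x : Sp n) (r : ℝ) :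
    ∫⁻ y in Metric.ball x r, ‖f y‖ₑ ^ p < ∞ := by
  have h := hf (Metric.closedBall x r) (isCompact_closedBall _ _)
  have h1 := lintegral_rpow_enorm_lt_top_of_eLpNorm_lt_top
    (by simpa using hp) ENNReal.ofReal_ne_top h.2
  rw [ENNReal.toReal_ofReal hp.le] at h1
  exact (lintegral_mono_set Metric.ball_subset_closedBall).trans_lt h1

theorem kern_one_le_two_mul (x : Sp n) : kern 1 x ≤ 2 * (1 + ‖x‖ ^ (n + 1))⁻¹ := by
  have h1 : 1 ≤ hnorm 1 x := le_hnorm_left 1 x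
  have h2 := norm_le_hnorm 1 x
  have h3 : 1 + ‖x‖ ^ (n + 1) ≤ 2 * hnorm 1 x ^ (n + 1) := by
    have h4 : ‖x‖ ^ (n + 1) ≤ hnorm 1 x ^ (n + 1) := by gcongr
    have h5 : 1 ≤ hnorm 1 x ^ (n + 1) := one_le_pow₀ h1
    linarith
  have h6 : 0 < hnorm 1 x := by linarith
  rw [kern_eq_hnorm, one_mul, ← div_eq_mul_inv, le_div_iff₀ (by positivity),
    inv_mul_le_iff₀ (by positivity), mul_comm]
  exact h3

theorem PoissonClass.wInt (hf : PoissonClass p f) (hp : 1 < p) : WInt f := by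
  have hm := hf.1.aestronglyMeasurable
  refine wInt_of_rpow hp.le hm ?_
  refine (hf.2.const_mul 2).mono' ((measurable_kern_right 1).aestronglyMeasurable.smul
    (hm.norm.aemeasurable.pow_const p).aestronglyMeasurable) (ae_of_all _ fun x => ?_)
  have h1 := kern_one_le_two_mul x
  have h2 : 0 ≤ ‖f x‖ ^ p := by positivity
  rw [norm_smul, Real.norm_of_nonneg (kern_pos one_pos x).le, Real.norm_of_nonneg h2]
  calc kern 1 x * ‖f x‖ ^ p ≤ 2 * (1 + ‖x‖ ^ (n + 1))⁻¹ * ‖f x‖ ^ p := by gcongr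
    _ = _ := by ring

/-- A bound of `(r^{-λ} I(x, r))^{1/p}` uniform in the ball is a bound of `I` by `r^λ`. -/
theorem iSup_ball_lt_top_iff (hp : 0 < p) (I : Sp n → ℝ → ℝ≥0∞) :
    (⨆ (x : Sp n) (r : ℝ) (_ : 0 < r), (ENNReal.ofReal (r ^ (-lam)) * I x r) ^ (1 / p)) < ∞ ↔
      ∃ C : ℝ≥0∞, C ≠ ∞ ∧ ∀ (x : Sp n) (r : ℝ), 0 < r → I x r ≤ C * ENNReal.ofReal (r ^ lam) := by
  have hinv : ∀ r : ℝ, 0 < r → ENNReal.ofReal (r ^ (-lam)) * ENNReal.ofReal (r ^ lam) = 1 := by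
    intro r hr
    rw [← ENNReal.ofReal_mul (by positivity), ← Real.rpow_add hr, neg_add_cancel, Real.rpow_zero,
      ENNReal.ofReal_one]
  constructor
  · intro h
    refine ⟨(⨆ (x : Sp n) (r : ℝ) (_ : 0 < r),
      (ENNReal.ofReal (r ^ (-lam)) * I x r) ^ (1 / p)) ^ p,
      ENNReal.rpow_ne_top_of_nonneg hp.le h.ne, fun x r hr => ?_⟩
    have h1 : (ENNReal.ofReal (r ^ (-lam)) * I x r) ^ (1 / p) ≤ ⨆ (x : Sp n) (r : ℝ) (_ : 0 < r),
        (ENNReal.ofReal (r ^ (-lam)) * I x r) ^ (1 / p) :=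
      le_iSup_of_le x (le_iSup₂_of_le r hr le_rfl)
    have h2 := ENNReal.rpow_le_rpow h1 hp.le
    rw [← ENNReal.rpow_mul, one_div_mul_cancel hp.ne', ENNReal.rpow_one] at h2
    calc I x r = ENNReal.ofReal (r ^ (-lam)) * I x r * ENNReal.ofReal (r ^ lam) := by
          rw [mul_right_comm, hinv r hr, one_mul]
      _ ≤ _ := by gcongr
  · rintro ⟨C, hC, h⟩
    have hp' : 0 ≤ 1 / p := by positivity
    refine lt_of_le_of_lt (iSup_le fun x => iSup₂_le fun r hr => ?_)
      (ENNReal.rpow_lt_top_of_nonneg hp' hC)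
    refine ENNReal.rpow_le_rpow ?_ hp'
    calc ENNReal.ofReal (r ^ (-lam)) * I x r
        ≤ ENNReal.ofReal (r ^ (-lam)) * (C * ENNReal.ofReal (r ^ lam)) := by
          gcongr
          exact h x r hr
      _ = C := by rw [mul_left_comm, hinv r hr, mul_one]

theorem morreySeminorm_lt_top_iff (hp : 0 < p) :
    morreySeminorm p lam f < ∞ ↔ ∃ C : ℝ≥0∞, C ≠ ∞ ∧ OscBound p lam C f :=
  iSup_ball_lt_top_iff hp _

theorem WInt.littlewoodPaleyMorrey_lt_top_iff (hf : WInt f) (hp : 0 < p) :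
    littlewoodPaleyMorrey p lam f < ∞ ↔ ∃ C : ℝ≥0∞, C ≠ ∞ ∧ SquareBound p lam C f := by
  have hκ : ENNReal.ofReal (poissonC n) ^ p ≠ 0 := by
    have := poissonC_pos n
    rw [ENNReal.ofReal_rpow_of_pos this]
    simpa using Real.rpow_pos_of_pos this p
  have hκt : ENNReal.ofReal (poissonC n) ^ p ≠ ∞ :=
    ENNReal.rpow_ne_top_of_nonneg hp.le ENNReal.ofReal_ne_top
  have hp' : 0 ≤ 1 / p := by positivity
  have e : littlewoodPaleyMorrey p lam f = ⨆ (x : Sp n) (r : ℝ) (_ : 0 < r),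
      (ENNReal.ofReal (r ^ (-lam)) * (ENNReal.ofReal (poissonC n) ^ p *
        ∫⁻ y in Metric.ball x r, gsq (Ioo 0 r) f y ^ (p / 2))) ^ (1 / p) := by
    refine iSup_congr fun x => iSup_congr fun r => iSup_congr fun hr => ?_
    rw [ENNReal.mul_rpow_of_nonneg _ _ hp', ENNReal.ofReal_rpow_of_nonneg (by positivity) hp',
      ← Real.rpow_mul hr.le, eLpNorm_eq_lintegral_rpow_enorm_toReal (by simpa using hp)
        ENNReal.ofReal_ne_top, ENNReal.toReal_ofReal hp.le, ← lintegral_const_mul' _ _ hκt]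
    congr 3
    · ring
    · funext y
      rw [hf.squareFunction_eq, enorm_eq_self, ENNReal.mul_rpow_of_nonneg _ _ hp.le,
        ← ENNReal.rpow_mul, one_div_mul_eq_div]
  rw [e, iSup_ball_lt_top_iff hp]
  constructor
  · rintro ⟨C, hC, h⟩
    refine ⟨C / ENNReal.ofReal (poissonC n) ^ p, ENNReal.div_ne_top hC hκ, fun x r hr => ?_⟩
    rw [← ENNReal.mul_div_right_comm, ENNReal.le_div_iff_mul_le (Or.inl hκ) (Or.inl hκt), mul_comm]
    exact h x r hr
  · rintro ⟨C, hC, h⟩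
    refine ⟨ENNReal.ofReal (poissonC n) ^ p * C, ENNReal.mul_ne_top hκt hC, fun x r hr => ?_⟩
    rw [mul_assoc]
    gcongr
    exact h x r hr

end Link

end MorreyLP

end

theorem mainTheorem5 (n : ℕ) (p lam : ℝ) (hp : 1 < p) (hlam : 0 < lam) (hlam' : lam < (n : ℝ))
    (f : EuclideanSpace ℝ (Fin n) → ℂ) (hf : MorreyLP.PoissonClass p f) :
    MorreyLP.InMorrey p lam f ↔ MorreyLP.littlewoodPaleyMorrey p lam f < ∞ := by
  have hp0 : 0 < p := by linarith
  have hn : NeZero n := ⟨by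
    rintro rfl
    rw [Nat.cast_zero] at hlam'
    linarith⟩
  have hW := hf.wInt hp
  rw [MorreyLP.InMorrey, hW.littlewoodPaleyMorrey_lt_top_iff hp0,
    MorreyLP.morreySeminorm_lt_top_iff hp0]
  constructor
  · rintro ⟨-, C, hC, h⟩
    exact h.squareBound hC hW hp hlam'
  · rintro ⟨C, hC, h⟩
    exact ⟨hf.1, h.oscBound hC hW hp hlam' fun x r => hf.1.lintegral_ball_lt_top hp0 x r⟩
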